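/- **Setting.** For $i=1,2$ let $A_i,B_i\in\mathbb C[z]$, $B_i\neq 0$, $q_i=\deg B_i$, $d_i=\deg A_i\ge q_i+1$, and suppose that every common zero of $A_i$ and $B_i$ is a simple zero of $B_i$. Put $V_i'=(A_i+B_i')/B_i$ and $\widehat V_2'=A_2/B_2$. Fix a holomorphic non-vanishing branch of each of the weights $e^{-V_1},e^{-V_2},e^{\widehat V_2}$ on an open set (the plane with cuts). An admissible contour for such a weight is a piecewise $C^1$ curve in the domain of its branch that is either a loop of finite length or has two ends, each of which tends (i) to $\infty$ inside a closed subsector of a sector where the weight decays exponentially, or (ii) to a multiple zero of $B_i$ inside a closed subsector of a sector where the weight decays exponentially (in (i), (ii) the arc length grows at most polynomially), or (iii), with finite length, to a simple zero of $B_i$ at which the weight behaves like $(z-b)^k$, $k\in\{0,1,2,\dots\}$. Let $\Gamma_{x,\mu}$ ($\mu\le d_1$), $\Gamma_{y,\nu}$ ($\nu\le d_2$), $\widehat\Gamma_{y,\nu}$ ($\nu\le d_2$) be admissible contours for $e^{-V_1},e^{-V_2},e^{\widehat V_2}$ respectively, let $\varkappa\in\mathbb C^{d_1\times d_2}$, and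 put $\iint_\varkappa=\sum_{\mu,\nu}\varkappa_{\mu\nu}\int_{\Gamma_{x,\mu}}\!\int_{\Gamma_{y,\nu}}$ (the integral over $y$ is the inner one) and $$\mathcal L(p|q)=\iint_\varkappa p(\xi)q(y)e^{-V_1(\xi)-V_2(y)+\xi y}\,d\xi\,dy .$$ If $d_1=q_1+1$ and $d_2=q_2+1$, assume that the integrals over the $\Gamma_{x,\mu}$ defining the bimoments converge absolutely (otherwise this is automatic). Assume that the principal minors of the bimoment matrices of $\mathcal L$ and of $\widehat{\mathcal L}(p|q)=\mathcal L(p|B_2q)$ do not vanish. Let $p_n,s_n$ be polynomials of degree $n$ with equal leading coefficients and $\mathcal L(p_n|s_m)=\delta_{nm}$. Let $\widehat L$ be the strictly lower triangular semi-infinite matrix with $q_2$ subdiagonals such that all entries of $(1+\widehat L^t)\mathbf s$ are divisible by $B_2$, let $\widehat A$ be the matrix with $(\partial_y-V_2')(1+\widehat L^t)\mathbf s=-\widehat A^t\mathbf s$, and put $\widehat{\mathbf p}=(1+\widehat L)^{-1}\mathbf p$. Put $$\mathcal B_2(x;y,s)=\frac{B_2(y)-B_2(s)}{y-s}\Bigl(x-\frac1{y-s}\Bigr)-\frac{A_2(y)-B_2'(s)-A_2(s)}{y-s},$$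 $$\mathcal B_2(\Gamma_{y,\nu},\widehat\Gamma_{y,\mu})=\frac1{2\pi i}\int_{\widehat\Gamma_{y,\mu}}\!ds\int_{\Gamma_{y,\nu}}\!dy\;\mathcal B_2(x;y,s)\,e^{x(y-s)-V_2(y)+\widehat V_2(s)} ,$$ $$\underline\phi^{(0)}_m(x)=e^{V_1(x)}\iint_\varkappa \frac{s_m(y)}{x-\xi}\,e^{\xi y-V_1(\xi)-V_2(y)}\,d\xi\,dy,\qquad \underline\phi^{(\nu)}_m(x)=\int_{\Gamma_{y,\nu}}e^{xy-V_2(y)}s_m(y)\,dy,$$ $$\widehat\psi^{(0)}_m(x)=\widehat p_m(x)e^{-V_1(x)},\qquad \widehat\psi^{(\nu)}_m(x)=\frac1{2\pi i}\int_{\widehat\Gamma_{y,\nu}}\!ds\iint_\varkappa d\xi\,dy\;\mathcal B_2(x;y,s)\,e^{\xi y-xs-V_2(y)+\widehat V_2(s)}\,\frac{\widehat\psi^{(0)}_m(\xi)}{x-\xi}$$ for $\nu=1,\dots,d_2$. Let $\underline{\boldsymbol\Phi}_n$ have the rows $[\underline\phi^{(\nu)}_{n-1},\dots,\underline\phi^{(\nu)}_{n+d_2-1}]$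 and $\widehat{\boldsymbol\Psi}_n$ the columns $[\widehat\psi^{(\nu)}_{n-d_2},\dots,\widehat\psi^{(\nu)}_{n}]^t$, $\nu=0,\dots,d_2$. Let $\widehat{\mathbb A}_n(x)$ be the block of $[\widehat A-x\widehat L,\Pi_n]$ with rows $n-1,\dots,n+d_2-1$ and columns $n-d_2,\dots,n$, where $\Pi_n$ is the projector on the first $n$ coordinates. **Theorem 5.1.** (1) The concomitants $\mathcal B_2(\Gamma_{y,\nu},\widehat\Gamma_{y,\mu})$ do not depend on $x\in\mathbb C$; the sequences $p_n,s_n$ exist, and the matrices $\widehat L,\widehat A$ exist and are unique; and for all $n\ge d_2$ and all $x$ in the domain of $e^{-V_1}$ that lie neither on a contour $\Gamma_{x,\mu}$ nor at an endpoint of one, $$\underline{\boldsymbol\Phi}_n(x)\,\widehat{\mathbb A}_n(x)\,\widehat{\boldsymbol\Psi}_n(x)=\begin{pmatrix}-1&0\\0&\bigl[\mathcal B_2(\Gamma_{y,\nu},\widehat\Gamma_{y,\mu})\bigr]_{\nu,\mu=1}^{d_2}\end{pmatrix}.$$ (2) For given $A_2,B_2$ there are branches of $e^{-V_2},e^{\widehat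 V_2}$ on connected open sets, normalized by $B_2e^{-V_2}e^{\widehat V_2}=1$ at one common point, and admissible contours $\Gamma'_{y,\nu}$, $\widehat\Gamma'_{y,\nu}$ ($\nu=1,\dots,d_2$) for them, with $\mathcal B_2(\Gamma'_{y,\nu},\widehat\Gamma'_{y,\mu})=c_\nu\delta_{\nu\mu}$ and $c_\nu\ne0$. Here, with $\omega_b=e^{2\pi i\,\mathrm{res}_b V_2'}$ for the zeros $b$ of $B_2$, each $c_\nu$ is $\pm$ a product of integer powers of the $\omega_b$, possibly times a factor $1-\omega_{b}\neq0$; so apart from the choice of the contours and cuts it depends only on the residues of $V_2'$ modulo $\mathbb Z$. For all other data as above there is $\varkappa'$ such that $\sum_\nu\varkappa'_{\mu\nu}\int_{\Gamma'_{y,\nu}}q(y)e^{\xi y-V_2(y)}dy=\sum_\nu\varkappa_{\mu\nu}\int_{\Gamma_{y,\nu}}q(y)e^{\xi y-V_2(y)}dy$ for all $\mu$, $\xi\in\mathbb C$ and polynomials $q$ (so $\mathcal L$ is unchanged), and if $\underline{\boldsymbol\Phi}_n,\widehat{\boldsymbol\Psi}_n$ are formed with $\Gamma'_y,\widehat\Gamma'_y,\varkappa'$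 and the columns $\nu=1,\dots,d_2$ of $\widehat{\boldsymbol\Psi}_n$ are divided by $c_\nu$, then $\underline{\boldsymbol\Phi}_n\widehat{\mathbb A}_n\widehat{\boldsymbol\Psi}_n=\mathrm{diag}(-1,1,\dots,1)$ for the same $n$ and $x$. -/

import Mathlib

open Polynomial Filter Topology MeasureTheory

noncomputable section

namespace SemiclassicalBOP

/-! ### The polynomial data -/

/-- A pair `(A, B)` of complex polynomials of type BB: `B` is nonzero, `deg A ≥ deg B + 1`, and the
pair is reduced, i.e. the common zeros of `A` and `B` are among the simple zeros of `B`. -/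
structure IsTypeBB (A B : ℂ[X]) : Prop where
  ne_zero : B ≠ 0
  degree_lt : B.natDegree + 1 ≤ A.natDegree
  reduced : ∀ b : ℂ, A.eval b = 0 → B.eval b = 0 → (derivative B).eval b ≠ 0

/-- The weight `W = e^{-V}` with `V' = (A + B') / B` satisfies `B W' = P W` for this `P`.
(The dual weight `e^{V̂}` with `V̂' = A / B` satisfies the same equation with `P = A`.) -/
abbrev directNum (A B : ℂ[X]) : ℂ[X] := -(A + derivative B)

/-! ### Branches of a weight and its admissible contours

Both the weight and the dual weight are solutions of `B W' = P W`. -/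

/-- A single-valued holomorphic nowhere vanishing branch of the weight with logarithmic derivative
`P / B` on an open set (the plane with suitable cuts). -/
structure Branch (P B : ℂ[X]) where
  dom : Set ℂ
  W : ℂ → ℂ
  isOpen_dom : IsOpen dom
  differentiableOn : DifferentiableOn ℂ W dom
  ne_zero : ∀ z ∈ dom, W z ≠ 0
  ode : ∀ z ∈ dom, B.eval z * deriv W z = P.eval z * W z

/-- A piecewise continuously differentiable curve, parametrized by the open interval `(0, 1)`. -/
structure IsPiecewiseC1 (γ : ℝ → ℂ) : Prop where
  continuousOn : ContinuousOn γ (Set.Ioo 0 1)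
  smooth : ∃ S : Set ℝ, S.Finite ∧
    ∀ t ∈ Set.Ioo (0 : ℝ) 1 \ S, DifferentiableAt ℝ γ t ∧ ContinuousAt (deriv γ) t
  locallyIntegrable : LocallyIntegrableOn (deriv γ) (Set.Ioo 0 1)

/-- The end `l` of the curve goes to infinity inside a closed subsector of a sector in which the
weight decays: `log W ∼ ρ z^(d+1) / (d+1)` at infinity, with `d = deg P - deg B` and `ρ` the
quotient of the leading coefficients. The arc length in bounded regions grows at most
polynomially. -/
def IsEndAtInfinity (P B : ℂ[X]) (γ : ℝ → ℂ) (l : Filter ℝ) : Prop :=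
  Tendsto (fun t => ‖γ t‖) l atTop ∧
  (∃ ε : ℝ, 0 < ε ∧ ∀ᶠ t in l,
    (P.leadingCoeff / B.leadingCoeff * γ t ^ (P.natDegree - B.natDegree + 1)).re
      ≤ -ε * ‖γ t‖ ^ (P.natDegree - B.natDegree + 1)) ∧
  ∃ N : ℕ, IntegrableAtFilter (fun t => ‖deriv γ t‖ / (1 + ‖γ t‖) ^ N) l

/-- The coefficient `r` in `P / B ∼ r / (z - b)^(m+1)` at a zero `b` of `B` of multiplicity
`m + 1`. -/
def polarCoeff (P B : ℂ[X]) (b : ℂ) : ℂ :=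
  P.eval b / (B /ₘ (X - C b) ^ B.rootMultiplicity b).eval b

/-- The end `l` of the curve goes to a multiple zero `b` of `B` (an essential singularity of the
weight), of multiplicity `m + 1`, inside a closed subsector of a sector in which the weight decays:
`log W ∼ -(r / m) (z - b)^(-m)`. The arc length away from `b` grows at most polynomially. -/
def IsEndAtEssential (P B : ℂ[X]) (γ : ℝ → ℂ) (l : Filter ℝ) (b : ℂ) : Prop :=
  1 < B.rootMultiplicity b ∧
  Tendsto γ l (𝓝[≠] b) ∧
  (∃ ε : ℝ, 0 < ε ∧ ∀ᶠ t in l,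
    ε / ‖γ t - b‖ ^ (B.rootMultiplicity b - 1)
      ≤ (polarCoeff P B b / (γ t - b) ^ (B.rootMultiplicity b - 1)).re) ∧
  ∃ N : ℕ, IntegrableAtFilter (fun t => ‖deriv γ t‖ * ‖γ t - b‖ ^ N) l

/-- The end `l` of the curve is a simple zero `b` of `B` at which the weight is regular, i.e. the
exponent of `W ∼ (z - b)^k` is a natural number `k` (`k = 0` at a hard edge). -/
def IsEndAtRegular (P B : ℂ[X]) (γ : ℝ → ℂ) (l : Filter ℝ) (b : ℂ) : Prop :=
  B.rootMultiplicity b = 1 ∧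
  (∃ k : ℕ, P.eval b = k * (derivative B).eval b) ∧
  Tendsto γ l (𝓝 b) ∧
  IntegrableAtFilter (deriv γ) l

/-- One of the three kinds of ends of an admissible contour. -/
def IsAdmissibleEnd (P B : ℂ[X]) (γ : ℝ → ℂ) (l : Filter ℝ) : Prop :=
  IsEndAtInfinity P B γ l ∨ ∃ b, IsEndAtEssential P B γ l b ∨ IsEndAtRegular P B γ l b

/-- The curve is a loop of finite length in `U`. -/
def IsLoopIn (U : Set ℂ) (γ : ℝ → ℂ) : Prop :=
  (∃ z ∈ U, Tendsto γ (𝓝[>] 0) (𝓝 z) ∧ Tendsto γ (𝓝[<] 1) (𝓝 z)) ∧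
  IntegrableOn (deriv γ) (Set.Ioo 0 1)

/-- An admissible contour for a branch of the weight: a curve in the domain of the branch that
either is a loop or has two admissible ends. This comprises rays and arcs from regular points,
lassoes, circles, petals and stems. -/
structure Contour {P B : ℂ[X]} (w : Branch P B) where
  curve : ℝ → ℂ
  piecewise : IsPiecewiseC1 curve
  mem_dom : ∀ t ∈ Set.Ioo (0 : ℝ) 1, curve t ∈ w.dom
  ends : (IsAdmissibleEnd P B curve (𝓝[>] 0) ∧ IsAdmissibleEnd P B curve (𝓝[<] 1)) ∨
    IsLoopIn w.dom curve

/-- The contour integral `∫_γ f(z) dz`. -/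
def Contour.integral {P B : ℂ[X]} {w : Branch P B} (γ : Contour w) (f : ℂ → ℂ) : ℂ :=
  ∫ t in Set.Ioo (0 : ℝ) 1, f (γ.curve t) * deriv γ.curve t

/-- A branch of the weight together with `d` admissible contours for it. -/
structure ContourSystem (P B : ℂ[X]) (d : ℕ) where
  branch : Branch P B
  contour : Fin d → Contour branch

variable {P₁ B₁ P₂ B₂ Q₂ : ℂ[X]} {d₁ d₂ : ℕ}

/-! ### The bimoment functional -/

/-- The inner integral `∑_ν κ_{μν} ∫_{Γ_{y,ν}} q(y) e^{ξ y} e^{-V₂(y)} dy` for a function `q`. -/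
def innerIntegral (Y : ContourSystem P₂ B₂ d₂) (κ : Matrix (Fin d₁) (Fin d₂) ℂ) (μ : Fin d₁)
    (q : ℂ → ℂ) (ξ : ℂ) : ℂ :=
  ∑ ν, κ μ ν * (Y.contour ν).integral fun y => q y * Complex.exp (ξ * y) * Y.branch.W y

/-- The double integral
`∫∫_κ F(ξ, y) e^{-V₁(ξ) - V₂(y) + ξ y} dξ dy = ∑_{μ,ν} κ_{μν} ∫_{Γ_{x,μ}} ∫_{Γ_{y,ν}} …`,
as an iterated integral, the integral over `y` and the sum over `ν` being the inner ones. -/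
def doubleIntegral (X : ContourSystem P₁ B₁ d₁) (Y : ContourSystem P₂ B₂ d₂)
    (κ : Matrix (Fin d₁) (Fin d₂) ℂ) (F : ℂ → ℂ → ℂ) : ℂ :=
  ∑ μ, (X.contour μ).integral fun ξ => X.branch.W ξ * innerIntegral Y κ μ (F ξ) ξ

/-- The bilinear moment functional `𝓛(p | q)`. -/
def functional (X : ContourSystem P₁ B₁ d₁) (Y : ContourSystem P₂ B₂ d₂)
    (κ : Matrix (Fin d₁) (Fin d₂) ℂ) (p q : ℂ[X]) : ℂ :=
  doubleIntegral X Y κ fun ξ y => p.eval ξ * q.eval y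

/-- Absolute convergence of the integrals that define the bimoments. -/
def BimomentsConverge (X : ContourSystem P₁ B₁ d₁) (Y : ContourSystem P₂ B₂ d₂)
    (κ : Matrix (Fin d₁) (Fin d₂) ℂ) : Prop :=
  ∀ (μ : Fin d₁) (i j : ℕ), IntegrableOn (fun t =>
    (X.contour μ).curve t ^ i * X.branch.W ((X.contour μ).curve t) *
      innerIntegral Y κ μ (fun y => y ^ j) ((X.contour μ).curve t) *
      deriv (X.contour μ).curve t) (Set.Ioo 0 1)

/-- The principal minor of size `n` of the matrix of bimoments of a bilinear functional. -/
def bimomentMinor (ℓ : ℂ[X] → ℂ[X] → ℂ) (n : ℕ) : ℂ :=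
  (Matrix.of fun i j : Fin n => ℓ (X ^ (i : ℕ)) (X ^ (j : ℕ))).det

/-- Genericity: the principal minors of `𝓛` and of the associated functional
`𝓛̂(p | q) = 𝓛(p | B₂ q)` do not vanish. -/
def IsGeneric (ℓ : ℂ[X] → ℂ[X] → ℂ) (B : ℂ[X]) : Prop :=
  (∀ n, bimomentMinor ℓ n ≠ 0) ∧ ∀ n, bimomentMinor (fun p q => ℓ p (B * q)) n ≠ 0

/-- The normalized biorthogonal polynomials `p_n = π_n / √h_n`, `s_n = σ_n / √h_n`, with `π_n`,
`σ_n` monic of degree `n` and `𝓛(π_n | σ_m) = h_n δ_{nm}`. -/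
structure IsBiorthonormal (ℓ : ℂ[X] → ℂ[X] → ℂ) (p s : ℕ → ℂ[X]) : Prop where
  degree_left : ∀ n : ℕ, (p n).degree = n
  degree_right : ∀ n : ℕ, (s n).degree = n
  leadingCoeff_eq : ∀ n, (p n).leadingCoeff = (s n).leadingCoeff
  pairing : ∀ n m, ℓ (p n) (s m) = if n = m then 1 else 0

/-! ### The matrices `L̂`, `Â` and the Christoffel–Darboux matrix -/

/-- The `n`-th entry of `(1 + L̂ᵗ) s`, for `L̂` strictly lower triangular with `q` subdiagonals. -/
def dressed (q : ℕ) (Lh : ℕ → ℕ → ℂ) (s : ℕ → ℂ[X]) (n : ℕ) : ℂ[X] :=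
  s n + ∑ j ∈ Finset.Icc 1 q, C (Lh (n + j) n) * s (n + j)

/-- `L̂` is the strictly lower triangular matrix with `q₂ = deg B₂` subdiagonals such that all
entries of `(1 + L̂ᵗ) s` are divisible by `B₂`. -/
structure IsHatL (B : ℂ[X]) (s : ℕ → ℂ[X]) (Lh : ℕ → ℕ → ℂ) : Prop where
  band : ∀ n k, ¬(k < n ∧ n ≤ k + B.natDegree) → Lh n k = 0
  dvd : ∀ n, B ∣ dressed B.natDegree Lh s n

/-- `Â` is the matrix with `∇_y (1 + L̂ᵗ) s = - Âᵗ s`, where `∇_y = ∂_y - V₂'(y)` and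
`V₂' = (A₂ + B₂') / B₂` (the equation is multiplied by `B₂`). The entry `Â_{kn}` is the coefficient
of `s_k`, so it is zero for `k > n + d₂` by degree. -/
structure IsHatA (A B : ℂ[X]) (s : ℕ → ℂ[X]) (Lh Ah : ℕ → ℕ → ℂ) : Prop where
  support : ∀ k n, n + A.natDegree < k → Ah k n = 0
  eqn : ∀ n, B * derivative (dressed B.natDegree Lh s n)
      - (A + derivative B) * dressed B.natDegree Lh s n
    = -(B * ∑ k ∈ Finset.range (n + A.natDegree + 1), C (Ah k n) * s k)

/-- The vector `p̂ = (1 + L̂)⁻¹ p`, for `L̂` strictly lower triangular. -/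
def hatP (Lh : ℕ → ℕ → ℂ) (p : ℕ → ℂ[X]) (n : ℕ) : ℂ[X] :=
  p n - ∑ k : Fin n, C (Lh n k) * hatP Lh p k
termination_by n
decreasing_by exact k.2

theorem hatP_spec (Lh : ℕ → ℕ → ℂ) (p : ℕ → ℂ[X]) (n : ℕ) :
    hatP Lh p n + ∑ k ∈ Finset.range n, C (Lh n k) * hatP Lh p k = p n := by
  rw [hatP, Finset.sum_range]
  ring

/-- The diagonal entries of the projector `Π_n` onto the first `n` coordinates. -/
def projDiag (n i : ℕ) : ℂ := if i < n then 1 else 0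

/-- The entries of the commutator `[M, Π_n] = M Π_n - Π_n M` of a semi-infinite matrix. -/
def commProj (M : ℕ → ℕ → ℂ) (n i k : ℕ) : ℂ := M i k * projDiag n k - projDiag n i * M i k

/-- The Christoffel–Darboux matrix `𝔸̂_n(x)`: the square block of size `d + 1` of
`[Â - x L̂, Π_n]`, with rows `n-1, …, n+d-1` and columns `n-d, …, n`. -/
def cdMatrix (d : ℕ) (Lh Ah : ℕ → ℕ → ℂ) (n : ℕ) (x : ℂ) :
    Matrix (Fin (d + 1)) (Fin (d + 1)) ℂ :=
  Matrix.of fun a b => commProj (fun i k => Ah i k - x * Lh i k) n (n - 1 + a) (n - d + b)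

/-! ### The bilinear concomitant -/

/-- The kernel `𝓑₂(x; y, s)`, a polynomial in all its variables; see `kernel_eq`. -/
def kernel (A B : ℂ[X]) (x y s : ℂ) : ℂ :=
  x * (taylor s B).divX.eval (y - s) - (taylor s B).divX.divX.eval (y - s)
    - (taylor s A).divX.eval (y - s)

theorem taylor_divX_eval (A : ℂ[X]) (y s : ℂ) :
    (taylor s A).divX.eval (y - s) * (y - s) = A.eval y - A.eval s := by
  have h := congrArg (eval (y - s)) (divX_mul_X_add (taylor s A))
  simp only [eval_add, eval_mul, eval_X, eval_C, taylor_coeff_zero, taylor_eval,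
    sub_add_cancel] at h
  rw [← h]; ring

theorem kernel_eq (A B : ℂ[X]) (x y s : ℂ) (h : y ≠ s) :
    kernel A B x y s = (B.eval y - B.eval s) / (y - s) * (x - 1 / (y - s))
      - (A.eval y - (derivative B).eval s - A.eval s) / (y - s) := by
  have hys : y - s ≠ 0 := sub_ne_zero.2 h
  have h1 := taylor_divX_eval A y s
  have h2 := taylor_divX_eval B y s
  have h3 := congrArg (eval (y - s)) (divX_mul_X_add (taylor s B).divX)
  simp only [eval_add, eval_mul, eval_X, eval_C, coeff_divX, zero_add, taylor_coeff_one] at h3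
  have e1 : (taylor s A).divX.eval (y - s) = (A.eval y - A.eval s) / (y - s) := by
    rw [eq_div_iff hys, h1]
  have e2 : (taylor s B).divX.eval (y - s) = (B.eval y - B.eval s) / (y - s) := by
    rw [eq_div_iff hys, h2]
  have e3 : (taylor s B).divX.divX.eval (y - s)
      = ((B.eval y - B.eval s) / (y - s) - (derivative B).eval s) / (y - s) := by
    rw [eq_div_iff hys, ← e2, ← h3]; ring
  rw [kernel, e1, e2, e3]
  field_simp
  ring

/-- The matrix of bilinear concomitants
`(2πi)⁻¹ ∫_{Γ̂_{y,μ}} ds ∫_{Γ_{y,ν}} dy 𝓑₂(x; y, s) e^{x(y-s) - V₂(y) + V̂₂(s)}`,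
with row index `ν` and column index `μ`. -/
def concomitant (A : ℂ[X]) (Y : ContourSystem P₂ B₂ d₂) (Z : ContourSystem Q₂ B₂ d₂) (x : ℂ) :
    Matrix (Fin d₂) (Fin d₂) ℂ :=
  Matrix.of fun ν μ => (2 * Real.pi * Complex.I)⁻¹ *
    (Z.contour μ).integral fun s => (Y.contour ν).integral fun y =>
      kernel A B₂ x y s * Complex.exp (x * (y - s)) * Y.branch.W y * Z.branch.W s

/-! ### The dual pair of fundamental systems -/

/-- The Cauchy-type transform
`e^{V₁(x)} ∫∫_κ e^{ξ y - V₁(ξ)} φ_n(y) / (x - ξ) dξ dy` with `φ_n = s_n e^{-V₂}`. -/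
def cauchyTransform (X : ContourSystem P₁ B₁ d₁) (Y : ContourSystem P₂ B₂ d₂)
    (κ : Matrix (Fin d₁) (Fin d₂) ℂ) (q : ℂ[X]) (x : ℂ) : ℂ :=
  (X.branch.W x)⁻¹ * doubleIntegral X Y κ fun ξ y => q.eval y / (x - ξ)

/-- The Fourier–Laplace transform `∫_{Γ_{y,ν}} e^{x y} φ_n(y) dy` with `φ_n = s_n e^{-V₂}`. -/
def fourierLaplace (Y : ContourSystem P₂ B₂ d₂) (ν : Fin d₂) (q : ℂ[X]) (x : ℂ) : ℂ :=
  (Y.contour ν).integral fun y => Complex.exp (x * y) * q.eval y * Y.branch.W y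

/-- The auxiliary wave function
`(2πi)⁻¹ ∫_{Γ̂_{y,ν}} ds ∫∫_κ dξ dy 𝓑₂(x; y, s) e^{ξ y - x s - V₂(y) + V̂₂(s)} ψ(ξ) / (x - ξ)`
of the quasipolynomial `ψ = p e^{-V₁}`. -/
def auxWave (A : ℂ[X]) (X : ContourSystem P₁ B₁ d₁) (Y : ContourSystem P₂ B₂ d₂)
    (Z : ContourSystem Q₂ B₂ d₂) (κ : Matrix (Fin d₁) (Fin d₂) ℂ) (ν : Fin d₂) (p : ℂ[X])
    (x : ℂ) : ℂ :=
  (2 * Real.pi * Complex.I)⁻¹ * (Z.contour ν).integral fun s =>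
    Z.branch.W s * Complex.exp (-(x * s)) *
      doubleIntegral X Y κ fun ξ y => kernel A B₂ x y s * p.eval ξ / (x - ξ)

/-- The dual fundamental system: the first row is the window (indices `n-1, …, n+d₂-1`) of the
Cauchy-type transforms, the other `d₂` rows are the windows of the Fourier–Laplace transforms. -/
def dualSystem (X : ContourSystem P₁ B₁ d₁) (Y : ContourSystem P₂ B₂ d₂)
    (κ : Matrix (Fin d₁) (Fin d₂) ℂ) (s : ℕ → ℂ[X]) (n : ℕ) (x : ℂ) :
    Matrix (Unit ⊕ Fin d₂) (Fin (d₂ + 1)) ℂ :=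
  Matrix.of fun r a => Sum.elim (fun _ => cauchyTransform X Y κ (s (n - 1 + a)) x)
    (fun ν => fourierLaplace Y ν (s (n - 1 + a)) x) r

/-- The direct system: the first column is the window (indices `n-d₂, …, n`) of the
quasipolynomials `p̂_m e^{-V₁}`, the other `d₂` columns are the windows of the auxiliary wave
functions of these quasipolynomials. -/
def directSystem (A : ℂ[X]) (X : ContourSystem P₁ B₁ d₁) (Y : ContourSystem P₂ B₂ d₂)
    (Z : ContourSystem Q₂ B₂ d₂) (κ : Matrix (Fin d₁) (Fin d₂) ℂ) (Lh : ℕ → ℕ → ℂ)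
    (p : ℕ → ℂ[X]) (n : ℕ) (x : ℂ) :
    Matrix (Fin (d₂ + 1)) (Unit ⊕ Fin d₂) ℂ :=
  Matrix.of fun b r => Sum.elim (fun _ => (hatP Lh p (n - d₂ + b)).eval x * X.branch.W x)
    (fun ν => auxWave A X Y Z κ ν (hatP Lh p (n - d₂ + b)) x) r

/-- The matrix that multiplies the column with index `ν` of the `d` auxiliary columns by `(c ν)⁻¹`
and leaves the column of the quasipolynomials as it is. -/
def rescaling {d : ℕ} (c : Fin d → ℂ) : Matrix (Unit ⊕ Fin d) (Unit ⊕ Fin d) ℂ :=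
  Matrix.fromBlocks 1 0 0 (Matrix.diagonal fun ν => (c ν)⁻¹)

/-- The points at which the fundamental systems are considered: in the domain of `e^{-V₁}`, and not
on one of the contours `Γ_{x,μ}` nor at one of their endpoints. -/
def regularPoints (X : ContourSystem P₁ B₁ d₁) : Set ℂ :=
  {x | x ∈ X.branch.dom ∧ ∀ μ, x ∉ closure ((X.contour μ).curve '' Set.Ioo 0 1)}

/-! ### Scalars that depend only on the residues -/

/-- The residue of `f` at an isolated singularity `b`. -/
def residueAt (f : ℂ → ℂ) (b : ℂ) : ℂ :=
  limUnder (𝓝[>] (0 : ℝ)) fun r => (2 * Real.pi * Complex.I)⁻¹ * ∮ z in C(b, r), f z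

/-- The multiplier `e^{2πi res_b V'}` with `V' = (A + B') / B`; it depends only on the class of the
residue modulo `ℤ`. -/
def multiplier (A B : ℂ[X]) (b : ℂ) : ℂ :=
  Complex.exp (2 * Real.pi * Complex.I *
    residueAt (fun z => (A + derivative B).eval z / B.eval z) b)

/-- The group generated by `-1` and by the multipliers at the zeros of `B`. -/
def multiplierGroup (A B : ℂ[X]) : Subgroup ℂˣ :=
  Subgroup.closure ({-1} ∪ {u | ∃ b, B.eval b = 0 ∧ (u : ℂ) = multiplier A B b})

/-- Scalars `± ∏ e^{2πi k_b res_b V'}` (contours that cross once), possibly multiplied by a nonzero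
factor `1 - e^{2πi res_b V'}` (a pair of lassoes around `b`). They depend only on the residues of
`V'` modulo `ℤ` (and on the combinatorics of the contours and cuts). -/
def IsResidueScalar (A B : ℂ[X]) (c : ℂ) : Prop :=
  ∃ u ∈ multiplierGroup A B, c = u ∨
    ∃ b, B.eval b = 0 ∧ multiplier A B b ≠ 1 ∧ c = u * (1 - multiplier A B b)

end SemiclassicalBOP

end

open SemiclassicalBOP

open Polynomial Filter Topology MeasureTheory
open scoped Real ComplexConjugate
open Set (Ioo Icc)
open Finset (range sum_congr mem_range mul_sum sum_eq_zero sum_sub_distrib sum_mul sum_add_distrib sum_subset)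
open Complex (exp log I norm_real im_ofReal_mul exp_add exp_log continuous_ofReal exp_ne_zero slitPlane slitPlane_ne_zero exp_ofReal_mul_I_re exp_ofReal_mul_I_im two_pi_I_ne_zero normSq_eq_norm_sq)
open Real (sin cos sin_pos_of_pos_of_lt_pi norm_of_nonneg sin_neg pi_pos sin_nonneg_of_nonneg_of_le_pi exp_pos)
open Metric (ball closedBall ball_mem_nhds mem_ball_self)

noncomputable section

namespace SemiclassicalBOP

/-! ### Calculus on an open interval -/

/-- The filter is one of the two ends of the parameter interval `(0, 1)`. -/
def IsEnd (l : Filter ℝ) : Prop := l = 𝓝[>] 0 ∨ l = 𝓝[<] 1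

lemma IsEnd.neBot {l : Filter ℝ} (hl : IsEnd l) : l.NeBot := by
  rcases hl with rfl | rfl <;> infer_instance

lemma IsEnd.exists_Ioo {l : Filter ℝ} (hl : IsEnd l) {p : ℝ → Prop} (hp : ∀ᶠ t in l, p t) :
    ∃ a b : ℝ, 0 ≤ a ∧ a < b ∧ b ≤ 1 ∧ Ioo a b ∈ l ∧ ∀ t ∈ Ioo a b, p t := by
  rcases hl with rfl | rfl
  · obtain ⟨u, hu, h⟩ := (mem_nhdsGT_iff_exists_Ioo_subset (a := (0 : ℝ))).1 hp
    have hu' : (0 : ℝ) < u := hu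
    refine ⟨0, min u 1, le_rfl, lt_min hu' one_pos, min_le_right _ _,
      Ioo_mem_nhdsGT (lt_min hu' one_pos), fun t ht => h ⟨ht.1, ht.2.trans_le (min_le_left _ _)⟩⟩
  · obtain ⟨u, hu, h⟩ := (mem_nhdsLT_iff_exists_Ioo_subset (a := (1 : ℝ))).1 hp
    have hu' : u < (1 : ℝ) := hu
    refine ⟨max u 0, 1, le_max_right _ _, max_lt hu' one_pos, le_rfl,
      Ioo_mem_nhdsLT (max_lt hu' one_pos), fun t ht => h ⟨(le_max_left _ _).trans_lt ht.1, ht.2⟩⟩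

lemma IsEnd.Ioo_mem {l : Filter ℝ} (hl : IsEnd l) : Ioo (0 : ℝ) 1 ∈ l := by
  rcases hl with rfl | rfl
  · exact Ioo_mem_nhdsGT one_pos
  · exact Ioo_mem_nhdsLT one_pos

lemma integral_Ioo_eq_sub {F F' : ℝ → ℂ} {a b : ℝ} (hab : a < b) {S : Set ℝ} (hS : S.Countable)
    (hc : ContinuousOn F (Ioo a b))
    (hd : ∀ t ∈ Ioo a b \ S, HasDerivAt F (F' t) t) (hi : IntegrableOn F' (Ioo a b))
    {la lb : ℂ} (ha : Tendsto F (𝓝[>] a) (𝓝 la)) (hb : Tendsto F (𝓝[<] b) (𝓝 lb)) :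
    ∫ t in Ioo a b, F' t = lb - la := by
  set G := extendFrom (Ioo a b) F
  have hG : ∀ t ∈ Ioo a b, G t = F t := fun t ht => extendFrom_extends hc t ht
  have hGc : ContinuousOn G (Icc a b) := continuousOn_Icc_extendFrom_Ioo hc ha hb
  have h := integral_eq_of_hasDerivAt_off_countable_of_le G F' hab.le hS hGc
    (fun t ht => (hd t ht).congr_of_eventuallyEq <| by
      filter_upwards [isOpen_Ioo.mem_nhds ht.1] with s hs using hG s hs)
    (by rwa [intervalIntegrable_iff_integrableOn_Ioo_of_le hab.le])
  rw [intervalIntegral.integral_of_le hab.le, integral_Ioc_eq_integral_Ioo] at h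
  rw [h, show G a = la from eq_lim_at_left_extendFrom_Ioo hab ha,
    show G b = lb from eq_lim_at_right_extendFrom_Ioo hab hb]

lemma eq_of_hasDerivAt_zero {F : ℝ → ℂ} {a b : ℝ} {S : Set ℝ} (hS : S.Countable)
    (hc : ContinuousOn F (Ioo a b)) (hd : ∀ t ∈ Ioo a b \ S, HasDerivAt F 0 t)
    {s t : ℝ} (hs : s ∈ Ioo a b) (ht : t ∈ Ioo a b) : F s = F t := by
  wlog h : s ≤ t generalizing s t
  · exact (this ht hs (le_of_not_ge h)).symm
  have := integral_eq_of_hasDerivAt_off_countable_of_le F (fun _ => 0) h hS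
    (hc.mono fun x hx => ⟨hs.1.trans_le hx.1, hx.2.trans_lt ht.2⟩)
    (fun x hx => hd x ⟨⟨hs.1.trans hx.1.1, hx.1.2.trans ht.2⟩, hx.2⟩) (by simp)
  simp only [intervalIntegral.integral_zero] at this
  exact (sub_eq_zero.1 this.symm).symm

/-! ### Decay of solutions of `w' = g(u) u' w` along a curve in a sector -/

lemma exists_bound_of_halfPlane {a b : ℝ} {S : Set ℝ} (hS : S.Countable) {v w : ℝ → ℂ}
    {h : ℂ → ℂ} {R η : ℝ} (hh : DifferentiableOn ℂ h {z | R < z.re})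
    (hη : ∀ z : ℂ, R < z.re → ‖h z + 1‖ ≤ η) (hv : ContinuousOn v (Ioo a b))
    (hvd : ∀ t ∈ Ioo a b \ S, DifferentiableAt ℝ v t) (hw : ContinuousOn w (Ioo a b))
    (hwd : ∀ t ∈ Ioo a b \ S, HasDerivAt w (h (v t) * deriv v t * w t) t)
    (hre : ∀ t ∈ Ioo a b, R < (v t).re) :
    ∃ C : ℝ, ∀ t ∈ Ioo a b, ‖w t‖ ≤ C * rexp (-(v t).re + η * ‖v t‖) := by
  have hconv : Convex ℝ {z : ℂ | R < z.re} := convex_halfSpace_re_gt R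
  have hopen : IsOpen {z : ℂ | R < z.re} := isOpen_lt continuous_const Complex.continuous_re
  obtain ⟨G, hG'⟩ := hconv.exists_forall_hasDerivWithinAt hh
  have hG : ∀ z : ℂ, R < z.re → HasDerivAt G (h z) z := fun z hz =>
    (hG' z hz).hasDerivAt (hopen.mem_nhds hz)
  rcases (Ioo a b).eq_empty_or_nonempty with he | ⟨t₀, ht₀⟩
  · exact ⟨0, fun t ht => by simp [he] at ht⟩
  set z₀ : ℂ := ((R + 1 : ℝ) : ℂ)
  have hz₀ : R < z₀.re := by simp [z₀]
  have hη0 : 0 ≤ η := (norm_nonneg _).trans (hη z₀ hz₀)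
  set d : ℝ → ℂ := fun t => w t * exp (-G (v t))
  have hGc : ContinuousOn G {z | R < z.re} := fun z hz => (hG z hz).continuousAt.continuousWithinAt
  have hd : ∀ t ∈ Ioo a b, d t = d t₀ := by
    intro t ht
    refine eq_of_hasDerivAt_zero hS ?_ ?_ ht ht₀
    · exact hw.mul ((Complex.continuous_exp.comp_continuousOn (hGc.comp hv hre).neg))
    · intro t ht
      have h1 : HasDerivAt (fun t => G (v t)) (h (v t) * deriv v t) t :=
        (hG _ (hre t ht.1)).comp t (hvd t ht).hasDerivAt
      have h2 := (hwd t ht).mul h1.neg.cexp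
      refine h2.congr_deriv ?_
      ring
  have key : ∀ z : ℂ, R < z.re → ‖(G z + z) - (G z₀ + z₀)‖ ≤ η * ‖z - z₀‖ := fun z hz =>
    hconv.norm_image_sub_le_of_norm_hasDerivWithin_le (f := fun z => G z + z)
      (f' := fun z => h z + 1)
      (fun x hx => ((hG x hx).add (hasDerivAt_id x)).hasDerivWithinAt) (fun x hx => hη x hx) hz₀ hz
  refine ⟨‖d t₀‖ * rexp (‖G z₀ + z₀‖ + η * ‖z₀‖), fun t ht => ?_⟩
  have h1 : w t = d t₀ * exp (G (v t)) := by
    rw [← hd t ht]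
    simp [d, mul_assoc, ← exp_add]
  rw [h1, norm_mul, Complex.norm_exp, mul_assoc, ← Real.exp_add]
  gcongr
  have h2 := (Complex.abs_re_le_norm _).trans (key (v t) (hre t ht))
  have h3 := (abs_le.1 h2).2
  have h4 := (abs_le.1 (Complex.abs_re_le_norm (G z₀ + z₀))).2
  have h5 : η * ‖v t - z₀‖ ≤ η * (‖v t‖ + ‖z₀‖) := by gcongr; exact norm_sub_le _ _
  simp only [Complex.sub_re, Complex.add_re] at h3 h4
  linarith

lemma exists_decay_of_sector {n : ℕ} (hn : 1 ≤ n) {ρ : ℂ} {g : ℂ → ℂ} {R : ℝ}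
    (hg : DifferentiableOn ℂ g {u | R < ‖u‖})
    (hlim : Tendsto (fun u => g u / u ^ (n - 1)) (Bornology.cobounded ℂ) (𝓝 ρ))
    {l : Filter ℝ} (hl : IsEnd l) {S : Set ℝ} (hS : S.Countable) {u w : ℝ → ℂ}
    (hsm : ∀ᶠ t in l, ContinuousAt u t ∧ ContinuousAt w t ∧
      (t ∉ S → DifferentiableAt ℝ u t ∧ HasDerivAt w (g (u t) * deriv u t * w t) t))
    (hinf : Tendsto (fun t => ‖u t‖) l atTop) {ε : ℝ} (hε : 0 < ε)
    (hsec : ∀ᶠ t in l, (ρ * u t ^ n).re ≤ -ε * ‖u t‖ ^ n) :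
    ∃ C ε' : ℝ, 0 < ε' ∧ ∀ᶠ t in l, ‖w t‖ ≤ C * rexp (-ε' * ‖u t‖ ^ n) := by
  have hlb := hl.neBot
  have hn0 : (n : ℂ) ≠ 0 := by exact_mod_cast (by omega : n ≠ 0)
  have hn0' : (0 : ℝ) < n := by exact_mod_cast hn
  have hρ : ρ ≠ 0 := by
    rintro rfl
    obtain ⟨t, h1, h2⟩ := (hsec.and (hinf.eventually_gt_atTop 0)).exists
    have : 0 < ε * ‖u t‖ ^ n := by positivity
    simp at h1
    linarith
  have hρ0 : 0 < ‖ρ‖ := norm_pos_iff.2 hρ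
  set c : ℂ := -ρ / n
  have hc : c ≠ 0 := div_ne_zero (neg_ne_zero.2 hρ) hn0
  have hcn : ‖c‖ = ‖ρ‖ / n := by simp [c]
  obtain ⟨ν, hν, hpow⟩ : ∃ ν : ℂ, ν = (1 / n : ℝ) ∧ ∀ z : ℂ, (z ^ ν) ^ n = z :=
    ⟨_, rfl, fun z => by
      push_cast
      rw [one_div]
      exact Complex.cpow_nat_inv_pow z (by omega)⟩
  have hpow0 : ∀ z : ℂ, z ≠ 0 → z ^ ν ≠ 0 := fun z hz h => hz (by
    rw [← hpow z, h, zero_pow (by omega)])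
  set v : ℝ → ℂ := fun t => c * u t ^ n
  have hvn : ∀ t, ‖v t‖ = ‖c‖ * ‖u t‖ ^ n := fun t => by simp [v]
  set ε₁ := ε / ‖ρ‖
  have hε₁ : 0 < ε₁ := by positivity
  have hsec' : ∀ᶠ t in l, ε₁ * ‖v t‖ ≤ (v t).re := by
    filter_upwards [hsec] with t ht
    have h1 : v t = ((1 / n : ℝ) : ℂ) * -(ρ * u t ^ n) := by simp only [v, c]; push_cast; field_simp
    rw [hvn, hcn, h1, Complex.re_ofReal_mul, Complex.neg_re]
    have : ε₁ * (‖ρ‖ / n * ‖u t‖ ^ n) = (1 / n) * (ε * ‖u t‖ ^ n) := by simp only [ε₁]; field_simp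
    rw [this]
    gcongr
    linarith
  -- the limit of the model
  have hmodel : ∀ κ : ℂ, κ ^ n = c⁻¹ → ∃ R' : ℝ, 0 < R' ∧ ∀ z : ℂ, R' < z.re →
      R < ‖κ * z ^ ν‖ ∧
      ‖g (κ * z ^ ν) * (κ * (ν * z ^ (ν - 1))) + 1‖
        ≤ ε₁ / 2 := by
    intro κ hκ
    have hκ0 : κ ≠ 0 := by
      rintro rfl
      rw [zero_pow (by omega)] at hκ
      exact hc (inv_eq_zero.1 hκ.symm)
    have h1 : Tendsto (fun z : ℂ => ‖κ * z ^ ν‖) (comap Complex.re atTop) atTop := by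
      have : ∀ᶠ z : ℂ in comap Complex.re atTop,
          ‖κ‖ * z.re ^ (1 / n : ℝ) ≤ ‖κ * z ^ ν‖ := by
        filter_upwards [tendsto_comap.eventually_gt_atTop 0] with z hz
        have hz0 : z ≠ 0 := by rintro rfl; simp at hz
        rw [norm_mul, hν, Complex.norm_cpow_real]
        gcongr
        exact Complex.re_le_norm z
      refine tendsto_atTop_mono' _ this ?_
      exact ((tendsto_rpow_atTop (by positivity)).comp tendsto_comap).const_mul_atTop
        (norm_pos_iff.2 hκ0)
    have h2 : Tendsto (fun z : ℂ => κ * z ^ ν) (comap Complex.re atTop)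
        (Bornology.cobounded ℂ) := tendsto_norm_atTop_iff_cobounded.1 h1
    have h3 := (hlim.comp h2).mul_const (c⁻¹ / n)
    have h4 : Tendsto (fun z : ℂ => g (κ * z ^ ν) *
        (κ * (ν * z ^ (ν - 1))) + 1) (comap Complex.re atTop)
        (𝓝 0) := by
      have h5 : ρ * (c⁻¹ / n) + 1 = 0 := by simp only [c]; field_simp; ring
      rw [← h5]
      refine (h3.add_const 1).congr' ?_
      filter_upwards [tendsto_comap.eventually_gt_atTop 0] with z hz
      have hz0 : z ≠ 0 := by rintro rfl; simp at hz
      have hzn := hpow z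
      have hy0 := hpow0 z hz0
      simp only [Function.comp_apply]
      set y := z ^ ν
      have e1 : z ^ (ν - 1) = y / z := by
        rw [Complex.cpow_sub _ _ hz0, Complex.cpow_one]
      obtain ⟨m, rfl⟩ : ∃ m, n = m + 1 := ⟨n - 1, by omega⟩
      simp only [add_tsub_cancel_right, e1, ← hκ]
      congr 1
      rw [← hzn]
      rw [hν]
      push_cast at hn0 ⊢
      field_simp
      ring
    have h5 := h4.norm
    rw [norm_zero] at h5
    have h6 := (h5.eventually_lt_const (half_pos hε₁)).and (h1.eventually_gt_atTop R)
    rw [eventually_comap] at h6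
    obtain ⟨R', hR'⟩ := eventually_atTop.1 h6
    exact ⟨max R' 1, by positivity, fun z hz => by
      have := hR' z.re ((le_max_left _ _).trans hz.le) z rfl
      exact ⟨this.2, this.1.le⟩⟩
  -- the curve stays on one branch
  have hvinf : Tendsto (fun t => ‖v t‖) l atTop := by
    simp_rw [hvn]
    exact ((tendsto_pow_atTop (by omega)).comp hinf).const_mul_atTop (norm_pos_iff.2 hc)
  obtain ⟨a, b, ha, hab, hb, hJ, hJp⟩ := hl.exists_Ioo
    (hsm.and (hsec'.and (hvinf.eventually_gt_atTop 0)))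
  have hpos : ∀ t ∈ Ioo a b, 0 < (v t).re := fun t ht =>
    (mul_pos hε₁ (hJp t ht).2.2).trans_le (hJp t ht).2.1
  have hslit : ∀ t ∈ Ioo a b, v t ∈ slitPlane := fun t ht => Or.inl (hpos t ht)
  have hvc : ContinuousOn v (Ioo a b) := fun t ht =>
    (continuousAt_const.mul ((hJp t ht).1.1.pow n)).continuousWithinAt
  have hv0 : ∀ t ∈ Ioo a b, v t ≠ 0 := fun t ht h => by
    have := hpos t ht; rw [h] at this; simp at this
  set k : ℝ → ℂ := fun t => u t / v t ^ ν
  have hkc : ContinuousOn k (Ioo a b) := by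
    exact ContinuousOn.div (fun t ht => (hJp t ht).1.1.continuousWithinAt)
      (hvc.cpow_const hslit) fun t ht => hpow0 _ (hv0 t ht)
  have hkn : ∀ t ∈ Ioo a b, k t ^ n = c⁻¹ := fun t ht => by
    have h0 := hv0 t ht
    simp only [k, div_pow, hpow]
    have hu0 : u t ^ n ≠ 0 := fun h => h0 (by simp [v, h])
    simp only [v]
    field_simp
  obtain ⟨t₀, ht₀⟩ : (Ioo a b).Nonempty := Set.nonempty_Ioo.2 hab
  have hfin : {z : ℂ | z ^ n = c⁻¹}.Finite := by
    refine (nthRoots n c⁻¹).toFinset.finite_toSet.subset fun z hz => ?_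
    simpa [mem_nthRoots (show 0 < n by omega)] using hz
  have : Finite {z : ℂ | z ^ n = c⁻¹} := hfin
  have hkconst : ∀ t ∈ Ioo a b, k t = k t₀ := fun t ht =>
    isPreconnected_Ioo.constant_of_mapsTo hfin.isDiscrete hkc (fun t ht => hkn t ht) ht ht₀
  set κ := k t₀
  have huv : ∀ t ∈ Ioo a b, u t = κ * v t ^ ν := fun t ht => by
    rw [← hkconst t ht]
    exact (div_mul_cancel₀ _ (hpow0 _ (hv0 t ht))).symm
  obtain ⟨R', hR'0, hR'⟩ := hmodel κ (hkn t₀ ht₀)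
  have hlarge : ∀ᶠ t in l, R' < (v t).re := by
    filter_upwards [hsec', hvinf.eventually_gt_atTop (R' / ε₁)] with t h1 h2
    rw [div_lt_iff₀ hε₁] at h2
    linarith
  obtain ⟨a', b', ha', hab', hb', hJ', hJp'⟩ := hl.exists_Ioo (hlarge.and (eventually_mem_set.2 hJ))
  set h : ℂ → ℂ := fun z => g (κ * z ^ ν) *
    (κ * (ν * z ^ (ν - 1)))
  have hh : DifferentiableOn ℂ h {z | R' < z.re} := by
    intro z hz
    have hz' : z ∈ slitPlane := Or.inl (hR'0.trans hz)
    have d1 : DifferentiableAt ℂ (fun z : ℂ => κ * z ^ ν) z :=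
      (differentiableAt_id.cpow_const hz').const_mul _
    have d2 : DifferentiableAt ℂ g (κ * z ^ ν) :=
      hg.differentiableAt ((isOpen_lt continuous_const continuous_norm).mem_nhds (hR' z hz).1)
    exact ((d2.comp z d1).mul (((differentiableAt_id.cpow_const hz').const_mul _).const_mul
      _)).differentiableWithinAt
  have hvd : ∀ t ∈ Ioo a b \ S, DifferentiableAt ℝ v t := fun t ht =>
    (((hJp t ht.1).1.2.2 ht.2).1.pow n).const_mul _
  obtain ⟨C, hC⟩ := exists_bound_of_halfPlane (a := a') (b := b') (w := w) (v := v) hS hh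
    (fun z hz => (hR' z hz).2)
    (hvc.mono fun t ht => (hJp' t ht).2) (fun t ht => hvd t ⟨(hJp' t ht.1).2, ht.2⟩)
    (fun t ht => (hJp t (hJp' t ht).2).1.2.1.continuousWithinAt)
    (fun t ht => by
      have htJ := (hJp' t ht.1).2
      have h1 := ((hJp t htJ).1.2.2 ht.2).2
      have h2 : deriv u t = κ * (ν * v t ^ (ν - 1)) * deriv v t := by
        have h3 : HasDerivAt (fun t => κ * v t ^ ν)
            (κ * ((ν * v t ^ (ν - 1)) * deriv v t)) t := by
            have h4 := (((hasDerivAt_id (v t)).cpow_const (c := ν) (hslit t htJ)).comp t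
              (hvd t ⟨htJ, ht.2⟩).hasDerivAt).const_mul κ
            simpa using h4
        rw [mul_assoc, ← h3.deriv]
        refine Filter.EventuallyEq.deriv_eq ?_
        filter_upwards [isOpen_Ioo.mem_nhds htJ] with s hs using huv s hs
      rw [h2, huv t htJ] at h1
      convert h1 using 1
      simp only [h]
      ring)
    (fun t ht => (hJp' t ht).1)
  refine ⟨max C 0, ε₁ / 2 * ‖c‖, by have := norm_pos_iff.2 hc; positivity, ?_⟩
  filter_upwards [hJ', hsec'] with t ht h2
  refine (hC t ht).trans ?_
  have : -(v t).re + ε₁ / 2 * ‖v t‖ ≤ -(ε₁ / 2 * ‖c‖) * ‖u t‖ ^ n := by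
    rw [hvn] at h2 ⊢
    linarith
  gcongr
  exact le_max_left _ _

/-! ### The weight along an admissible contour -/

section Ends

variable {P B : ℂ[X]} {w : Branch P B}

lemma tendsto_eval_div_pow (P : ℂ[X]) {N : ℕ} (hN : P.natDegree ≤ N) :
    Tendsto (fun u => P.eval u / u ^ N) (Bornology.cobounded ℂ) (𝓝 (P.coeff N)) := by
  have h : ∀ᶠ u : ℂ in Bornology.cobounded ℂ,
      ∑ i ∈ range (N + 1), P.coeff i * (u⁻¹) ^ (N - i) = P.eval u / u ^ N := by
    filter_upwards [(tendsto_norm_cobounded_atTop (E := ℂ)).eventually_gt_atTop 0] with u hu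
    have hu0 : u ≠ 0 := norm_pos_iff.1 hu
    rw [eval_eq_sum_range' (Nat.lt_succ_of_le hN), Finset.sum_div]
    refine sum_congr rfl fun i hi => ?_
    have hi' : i ≤ N := Nat.lt_succ_iff.1 (mem_range.1 hi)
    rw [mul_div_assoc, inv_pow, pow_sub₀ _ hu0 hi']
    field_simp
  refine Tendsto.congr' h ?_
  have h2 : P.coeff N = ∑ i ∈ range (N + 1), P.coeff i * (0 : ℂ) ^ (N - i) := by
    rw [Finset.sum_eq_single N]
    · simp
    · intro i hi hne
      have := mem_range.1 hi
      rw [zero_pow (by omega), mul_zero]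
    · simp
  rw [h2]
  exact tendsto_finsetSum _ fun i _ => ((tendsto_inv₀_cobounded (α := ℂ)).pow (N - i)).const_mul _

lemma exists_norm_bound_of_eval_eq_zero (hB : B ≠ 0) :
    ∃ R : ℝ, 0 < R ∧ ∀ z : ℂ, R < ‖z‖ → B.eval z ≠ 0 := by
  obtain ⟨R, hR⟩ := (B.roots.toFinset.finite_toSet.isBounded).exists_norm_le
  refine ⟨max R 1, by positivity, fun z hz h => ?_⟩
  have := hR z (by simp [hB, h])
  exact absurd ((le_max_left R 1).trans_lt hz) (not_lt.2 this)

lemma Branch.hasDerivAt (w : Branch P B) {z : ℂ} (hz : z ∈ w.dom) :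
    HasDerivAt w.W (deriv w.W z) z :=
  (w.differentiableOn.differentiableAt (w.isOpen_dom.mem_nhds hz)).hasDerivAt

lemma Branch.deriv_eq (w : Branch P B) {z : ℂ} (hz : z ∈ w.dom) (hB : B.eval z ≠ 0) :
    deriv w.W z = P.eval z / B.eval z * w.W z := by
  have := w.ode z hz
  field_simp
  linear_combination this

lemma Contour.exists_smooth (γ : Contour w) : ∃ S : Set ℝ, S.Finite ∧ ∀ t ∈ Ioo (0 : ℝ) 1,
    ContinuousAt γ.curve t ∧ ContinuousAt (fun t => w.W (γ.curve t)) t ∧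
    (t ∉ S → HasDerivAt γ.curve (deriv γ.curve t) t ∧
      HasDerivAt (fun t => w.W (γ.curve t)) (deriv w.W (γ.curve t) * deriv γ.curve t) t) := by
  obtain ⟨S, hS, h⟩ := γ.piecewise.smooth
  refine ⟨S, hS, fun t ht => ?_⟩
  have hc : ContinuousAt γ.curve t := γ.piecewise.continuousOn.continuousAt (isOpen_Ioo.mem_nhds ht)
  have hw := w.hasDerivAt (γ.mem_dom t ht)
  refine ⟨hc, ContinuousAt.comp (f := γ.curve) hw.continuousAt hc, fun htS => ?_⟩
  have h1 := (h t ⟨ht, htS⟩).1.hasDerivAt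
  exact ⟨h1, hw.comp t h1⟩

lemma Contour.norm_le_of_isEndAtInfinity (γ : Contour w) (hB : B ≠ 0)
    (hdeg : B.natDegree + 1 ≤ P.natDegree) {l : Filter ℝ} (hl : IsEnd l)
    (h : IsEndAtInfinity P B γ.curve l) :
    ∃ C ε : ℝ, 0 < ε ∧ ∀ᶠ t in l, ‖w.W (γ.curve t)‖ ≤
      C * rexp (-ε * ‖γ.curve t‖ ^ (P.natDegree - B.natDegree + 1)) := by
  obtain ⟨hinf, ⟨ε, hε, hsec⟩, -⟩ := h
  obtain ⟨R, hR0, hR⟩ := exists_norm_bound_of_eval_eq_zero hB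
  obtain ⟨S, hS, hsm⟩ := γ.exists_smooth
  have hlim : Tendsto (fun u => P.eval u / B.eval u / u ^ (P.natDegree - B.natDegree + 1 - 1))
      (Bornology.cobounded ℂ) (𝓝 (P.leadingCoeff / B.leadingCoeff)) := by
    have h1 := (tendsto_eval_div_pow P le_rfl).div (tendsto_eval_div_pow B le_rfl)
      (leadingCoeff_ne_zero.2 hB)
    refine h1.congr' ?_
    filter_upwards [(tendsto_norm_cobounded_atTop (E := ℂ)).eventually_gt_atTop R] with u hu
    have hu0 : u ≠ 0 := norm_pos_iff.1 (hR0.trans hu)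
    have hBu := hR u hu
    have : P.natDegree = (P.natDegree - B.natDegree + 1 - 1) + B.natDegree := by omega
    set k := P.natDegree - B.natDegree + 1 - 1
    simp only [Pi.div_apply]
    rw [this, pow_add]
    field_simp
  refine exists_decay_of_sector (n := P.natDegree - B.natDegree + 1) (by omega) (R := R)
    (g := fun u => P.eval u / B.eval u) ?_ hlim hl hS.countable
    (u := γ.curve) (w := fun t => w.W (γ.curve t)) ?_ hinf hε hsec
  · intro u hu
    exact (P.differentiableAt.div B.differentiableAt (hR u hu)).differentiableWithinAt
  · filter_upwards [hl.Ioo_mem, hinf.eventually_gt_atTop R] with t ht h2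
    refine ⟨(hsm t ht).1, (hsm t ht).2.1, fun htS => ⟨((hsm t ht).2.2 htS).1.differentiableAt, ?_⟩⟩
    refine ((hsm t ht).2.2 htS).2.congr_deriv ?_
    rw [w.deriv_eq (γ.mem_dom t ht) (hR _ h2)]
    ring

/-- The cofactor `B / (X - b)^(m+1)` of a zero `b` of `B` of multiplicity `m + 1`. -/
abbrev cofactor (B : ℂ[X]) (b : ℂ) : ℂ[X] := B /ₘ (X - C b) ^ B.rootMultiplicity b

lemma eval_eq_pow_mul_cofactor (B : ℂ[X]) (b z : ℂ) :
    B.eval z = (z - b) ^ B.rootMultiplicity b * (cofactor B b).eval z := by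
  conv_lhs => rw [← pow_mul_divByMonic_rootMultiplicity_eq B b]
  simp

lemma exists_ball_cofactor_ne_zero (hB : B ≠ 0) (b : ℂ) :
    ∃ r : ℝ, 0 < r ∧ ∀ z ∈ ball b r, (cofactor B b).eval z ≠ 0 := by
  have h : (cofactor B b).eval b ≠ 0 := eval_divByMonic_pow_rootMultiplicity_ne_zero b hB
  have := (cofactor B b).continuous.continuousAt.eventually_ne h
  exact Metric.mem_nhds_iff.1 this

lemma Contour.norm_le_of_isEndAtEssential (γ : Contour w) (hB : B ≠ 0) {l : Filter ℝ}
    (hl : IsEnd l) {b : ℂ} (h : IsEndAtEssential P B γ.curve l b) :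
    ∃ C ε : ℝ, 0 < ε ∧ ∀ᶠ t in l, ‖w.W (γ.curve t)‖ ≤
      C * rexp (-ε * (‖γ.curve t - b‖⁻¹) ^ (B.rootMultiplicity b - 1)) := by
  obtain ⟨hmult, hlim, ⟨ε, hε, hsec⟩, -⟩ := h
  obtain ⟨r, hr0, hr⟩ := exists_ball_cofactor_ne_zero hB b
  obtain ⟨S, hS, hsm⟩ := γ.exists_smooth
  obtain ⟨m, hm⟩ : ∃ m, B.rootMultiplicity b = m + 1 := ⟨B.rootMultiplicity b - 1, by omega⟩
  have hm1 : 1 ≤ m := by omega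
  have hBz : ∀ z ∈ ball b r, z ≠ b → B.eval z ≠ 0 := fun z hz hzb => by
    rw [eval_eq_pow_mul_cofactor B b]
    exact mul_ne_zero (pow_ne_zero _ (sub_ne_zero.2 hzb)) (hr z hz)
  set Z : ℂ → ℂ := fun u => b + u⁻¹
  have hZmem : ∀ u : ℂ, r⁻¹ < ‖u‖ → Z u ∈ ball b r := fun u hu => by
    have hu0 : 0 < ‖u‖ := (inv_pos.2 hr0).trans hu
    simp only [Z, Metric.mem_ball, dist_self_add_left, norm_inv]
    exact inv_lt_of_inv_lt₀ hr0 hu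
  have hZne : ∀ u : ℂ, r⁻¹ < ‖u‖ → u ≠ 0 := fun u hu => norm_pos_iff.1 ((inv_pos.2 hr0).trans hu)
  set g : ℂ → ℂ := fun u => P.eval (Z u) / B.eval (Z u) * (-(u ^ 2)⁻¹)
  have hlimg : Tendsto (fun u => g u / u ^ (m - 1)) (Bornology.cobounded ℂ)
      (𝓝 (-polarCoeff P B b)) := by
    have hZ : Tendsto Z (Bornology.cobounded ℂ) (𝓝 b) := by
      have := (tendsto_inv₀_cobounded (α := ℂ)).const_add b
      rwa [add_zero] at this
    have h1 := (((P.continuous.tendsto b).comp hZ).div (((cofactor B b).continuous.tendsto b).comp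
      hZ) (hr b (mem_ball_self hr0))).neg
    refine h1.congr' ?_
    filter_upwards [(tendsto_norm_cobounded_atTop (E := ℂ)).eventually_gt_atTop r⁻¹] with u hu
    have hu0 := hZne u hu
    have hc := hr _ (hZmem u hu)
    obtain ⟨k, rfl⟩ : ∃ k, m = k + 1 := ⟨m - 1, by omega⟩
    simp only [g, Pi.div_apply, Function.comp_apply]
    rw [eval_eq_pow_mul_cofactor B b, hm]
    simp only [Z, add_sub_cancel_left, add_tsub_cancel_right] at hc ⊢
    generalize (cofactor B b).eval (b + u⁻¹) = x at hc ⊢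
    generalize P.eval (b + u⁻¹) = y
    rw [inv_pow]
    field_simp
    ring
  have hnb : ∀ᶠ t in l, γ.curve t ≠ b := (tendsto_nhdsWithin_iff.1 hlim).2
  have hlim' : Tendsto γ.curve l (𝓝 b) := (tendsto_nhdsWithin_iff.1 hlim).1
  have hball : ∀ᶠ t in l, γ.curve t ∈ ball b r := hlim' (ball_mem_nhds b hr0)
  have hn : ∀ t, ‖(γ.curve t - b)⁻¹‖ = ‖γ.curve t - b‖⁻¹ := fun t => norm_inv _
  have := exists_decay_of_sector hm1 (R := r⁻¹) (g := g) (ρ := -polarCoeff P B b) ?_ hlimg hl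
    hS.countable (u := fun t => (γ.curve t - b)⁻¹) (w := fun t => w.W (γ.curve t)) ?_ ?_ hε ?_
  · simp only [hn] at this
    rw [hm]
    exact this
  · intro u hu
    have hu0 := hZne u hu
    have hZd : DifferentiableAt ℂ Z u := (differentiableAt_inv hu0).const_add b
    have hne : B.eval (Z u) ≠ 0 := hBz _ (hZmem u hu) (by simp [Z, hu0])
    refine (((P.differentiableAt.comp u hZd).div (B.differentiableAt.comp u hZd) hne).mul
      ((differentiableAt_id.pow 2).inv (pow_ne_zero 2 hu0)).neg).differentiableWithinAt
  · filter_upwards [hl.Ioo_mem, hnb, hball] with t ht h1 h2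
    have h0 : γ.curve t - b ≠ 0 := sub_ne_zero.2 h1
    refine ⟨((hsm t ht).1.sub continuousAt_const).inv₀ h0, (hsm t ht).2.1, fun htS => ?_⟩
    have hd := ((hsm t ht).2.2 htS).1
    have hd2 := (hd.sub_const b).inv h0
    refine ⟨hd2.differentiableAt, ((hsm t ht).2.2 htS).2.congr_deriv ?_⟩
    have hd3 : deriv (fun t => (γ.curve t - b)⁻¹) t = _ := hd2.deriv
    rw [hd3, w.deriv_eq (γ.mem_dom t ht) (hBz _ h2 h1)]
    simp only [g, Z, inv_inv, add_sub_cancel]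
    field_simp
  · simp only [hn]
    have h1 : Tendsto (fun t => γ.curve t - b) l (𝓝[≠] 0) := by
      rw [tendsto_nhdsWithin_iff]
      refine ⟨by simpa using hlim'.sub_const b, ?_⟩
      filter_upwards [hnb] with t ht using sub_ne_zero.2 ht
    exact (tendsto_norm_nhdsNE_zero.comp h1).inv_tendsto_nhdsGT_zero
  · filter_upwards [hsec, hnb] with t ht h1
    have h0 : γ.curve t - b ≠ 0 := sub_ne_zero.2 h1
    rw [hm] at ht
    simp only [add_tsub_cancel_right] at ht
    have e : -polarCoeff P B b * (γ.curve t - b)⁻¹ ^ m = -(polarCoeff P B b / (γ.curve t - b) ^ m) := by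
      rw [inv_pow]; ring
    rw [e, Complex.neg_re, hn, inv_pow]
    rw [div_eq_mul_inv] at ht
    linarith

lemma Contour.bounded_of_isEndAtRegular (γ : Contour w) (hB : B ≠ 0) {l : Filter ℝ}
    (hl : IsEnd l) {b : ℂ} (h : IsEndAtRegular P B γ.curve l b) :
    ∃ C : ℝ, ∀ᶠ t in l, ‖w.W (γ.curve t)‖ ≤ C := by
  obtain ⟨hmult, ⟨k, hk⟩, hlim, -⟩ := h
  suffices ∃ c, Tendsto (fun t => w.W (γ.curve t)) l (𝓝 c) by
    obtain ⟨c, hc⟩ := this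
    obtain ⟨C, hC⟩ := hc.norm.isBoundedUnder_le
    exact ⟨C, by simpa using hC⟩
  by_cases hbd : b ∈ w.dom
  · exact ⟨_, (w.hasDerivAt hbd).continuousAt.tendsto.comp hlim⟩
  have hne : ∀ z ∈ w.dom, z - b ≠ 0 := fun z hz h => hbd (sub_eq_zero.1 h ▸ hz)
  obtain ⟨r, hr0, hr⟩ := exists_ball_cofactor_ne_zero hB b
  obtain ⟨S, hS, hsm⟩ := γ.exists_smooth
  set Bt := cofactor B b with hBt
  have hBe : ∀ z, B.eval z = (z - b) * Bt.eval z := fun z => by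
    have := eval_eq_pow_mul_cofactor B b z
    rwa [hmult, pow_one] at this
  have hBp : B = (X - C b) * Bt := by
    have := pow_mul_divByMonic_rootMultiplicity_eq B b
    rw [hmult, pow_one] at this
    rw [hBt, cofactor, hmult, pow_one]
    exact this.symm
  have hBd : (derivative B).eval b = Bt.eval b := by
    conv_lhs => rw [hBp]
    simp
  rw [hBd] at hk
  obtain ⟨Q, hQ⟩ : (X - C b) ∣ P - C (k : ℂ) * Bt := by rw [dvd_iff_isRoot]; simp [hk]
  have hPe : ∀ z, P.eval z = k * Bt.eval z + (z - b) * Q.eval z := fun z => by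
    have := congrArg (eval z) hQ
    simp at this
    linear_combination this
  have hf : DifferentiableOn ℂ (fun z => Q.eval z / Bt.eval z) (ball b r) := fun z hz =>
    (Q.differentiableAt.div Bt.differentiableAt (hr z hz)).differentiableWithinAt
  obtain ⟨G, hG⟩ := hf.isExactOn_ball
  set Φ : ℂ → ℂ := fun z => w.W z * exp (-G z) / (z - b) ^ k
  have hΦ : ∀ z ∈ w.dom ∩ ball b r, HasDerivAt Φ 0 z := fun z hz => by
    have h0 := hne z hz.1
    have hBtne := hr z hz.2
    refine (((w.hasDerivAt hz.1).mul (hG z hz.2).neg.cexp).div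
      (((hasDerivAt_id z).sub_const b).pow k) (pow_ne_zero k h0)).congr_deriv ?_
    rw [w.deriv_eq hz.1 (by rw [hBe]; exact mul_ne_zero h0 hBtne), hPe, hBe, div_eq_zero_iff]
    simp only [Pi.mul_apply, Pi.pow_apply, id]
    left
    rcases k with _ | k
    · simp
      field_simp
      ring
    · simp only [add_tsub_cancel_right]
      push_cast
      field_simp
      ring
  obtain ⟨a, c, ha, hac, hc, hJ, hJp⟩ := hl.exists_Ioo
    (hlim (ball_mem_nhds b hr0) : ∀ᶠ t in l, γ.curve t ∈ ball b r)
  have hin : ∀ t ∈ Ioo a c, t ∈ Ioo (0 : ℝ) 1 := fun t ht => ⟨ha.trans_lt ht.1, ht.2.trans_le hc⟩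
  obtain ⟨t₀, ht₀⟩ : (Ioo a c).Nonempty := Set.nonempty_Ioo.2 hac
  have hconst : ∀ t ∈ Ioo a c, Φ (γ.curve t) = Φ (γ.curve t₀) := fun t ht =>
    eq_of_hasDerivAt_zero (F := fun t => Φ (γ.curve t)) hS.countable
      (fun s hs => (ContinuousAt.comp (f := γ.curve)
        (hΦ _ ⟨γ.mem_dom s (hin s hs), hJp s hs⟩).continuousAt
        (hsm s (hin s hs)).1).continuousWithinAt)
      (fun s hs => by
        have := (hΦ _ ⟨γ.mem_dom s (hin s hs.1), hJp s hs.1⟩).comp s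
          ((hsm s (hin s hs.1)).2.2 hs.2).1
        simpa [Function.comp_def] using this) ht ht₀
  refine ⟨Φ (γ.curve t₀) * exp (G b) * (b - b) ^ k, ((((hG b
    (mem_ball_self hr0)).continuousAt.tendsto.comp hlim).cexp.const_mul _).mul
    ((hlim.sub_const b).pow k)).congr' ?_⟩
  filter_upwards [hJ] with t ht
  have := hne _ (γ.mem_dom t (hin t ht))
  rw [← hconst t ht]
  simp only [Φ, Complex.exp_neg, Function.comp_apply]
  have := exp_ne_zero (G (γ.curve t))
  field_simp

end Ends

/-! ### Integrals over admissible contours -/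

section Integrals

variable {P B : ℂ[X]} {w : Branch P B}

lemma integrableAtFilter_of_le {f : ℝ → ℂ} {g : ℝ → ℝ} {l : Filter ℝ} (hl : IsEnd l)
    (hg : IntegrableAtFilter g l) (hf : AEStronglyMeasurable f (volume.restrict (Ioo 0 1)))
    (h : ∀ᶠ t in l, ‖f t‖ ≤ g t) : IntegrableAtFilter f l := by
  obtain ⟨s, hs, hgs⟩ := hg
  obtain ⟨a, b, ha, hab, hb, hJ, hp⟩ := hl.exists_Ioo ((eventually_mem_set.2 hs).and h)
  have hsub : Ioo a b ⊆ Ioo (0 : ℝ) 1 := Set.Ioo_subset_Ioo ha hb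
  refine ⟨Ioo a b, hJ, ?_⟩
  refine Integrable.mono' (hgs.mono_set fun t ht => (hp t ht).1)
    (hf.mono_measure (Measure.restrict_mono hsub le_rfl)) ?_
  exact (ae_restrict_iff' measurableSet_Ioo).2 (ae_of_all _ fun t ht => (hp t ht).2)

lemma integrableOn_Ioo_of_ends {f : ℝ → ℂ} (h0 : IntegrableAtFilter f (𝓝[>] 0))
    (h1 : IntegrableAtFilter f (𝓝[<] 1)) (hf : LocallyIntegrableOn f (Ioo 0 1)) :
    IntegrableOn f (Ioo 0 1) := by
  obtain ⟨s, hs, hfs⟩ := h0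
  obtain ⟨s', hs', hfs'⟩ := h1
  obtain ⟨a, ha, hsa⟩ := (mem_nhdsGT_iff_exists_Ioo_subset (a := (0 : ℝ))).1 hs
  obtain ⟨b, hb, hsb⟩ := (mem_nhdsLT_iff_exists_Ioo_subset (a := (1 : ℝ))).1 hs'
  have ha' : (0 : ℝ) < a := ha
  have hb' : b < (1 : ℝ) := hb
  have hmid : IntegrableOn f (Icc (min (a / 2) (1 / 2)) (max b (1 / 2))) :=
    hf.integrableOn_compact_subset (fun t ht => ⟨lt_of_lt_of_le (by positivity) ht.1,
      ht.2.trans_lt (max_lt hb' (by norm_num))⟩) isCompact_Icc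
  refine ((hfs.mono_set hsa).union (hmid.union (hfs'.mono_set hsb))).mono_set fun t ht => ?_
  by_cases h1 : t < a
  · exact Or.inl ⟨ht.1, h1⟩
  · by_cases h2 : b < t
    · exact Or.inr (Or.inr ⟨h2, ht.2⟩)
    · refine Or.inr (Or.inl ⟨(min_le_left _ _).trans (by linarith), (not_lt.1 h2).trans
        (le_max_left _ _)⟩)

lemma Contour.aestronglyMeasurable_comp (γ : Contour w) {f : ℂ → ℂ}
    (hf : ContinuousOn (fun t => f (γ.curve t)) (Ioo 0 1)) :
    AEStronglyMeasurable (fun t => f (γ.curve t)) (volume.restrict (Ioo 0 1)) :=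
  hf.aestronglyMeasurable measurableSet_Ioo

lemma Contour.continuousOn_weight (γ : Contour w) :
    ContinuousOn (fun t => w.W (γ.curve t)) (Ioo 0 1) :=
  w.differentiableOn.continuousOn.comp γ.piecewise.continuousOn γ.mem_dom

lemma Contour.locallyIntegrableOn (γ : Contour w) {f : ℝ → ℂ} (hf : ContinuousOn f (Ioo 0 1)) :
    LocallyIntegrableOn (fun t => f t * deriv γ.curve t) (Ioo 0 1) :=
  γ.piecewise.locallyIntegrable.continuousOn_mul hf isOpen_Ioo.isLocallyClosed

lemma eventually_bound_exp_sub_pow {c ε : ℝ} (hε : 0 < ε) {n : ℕ} (hn : 2 ≤ n)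
    (h : c ≤ ε / 2 ∨ 3 ≤ n) (N : ℕ) :
    ∀ᶠ x : ℝ in atTop, rexp (c * x ^ 2) * rexp (-ε * x ^ n) ≤ ((1 + x) ^ N)⁻¹ := by
  have h1 : ∀ᶠ x : ℝ in atTop, c * x ^ 2 - ε * x ^ n ≤ -(ε / 2) * x := by
    rcases h with h | h
    · filter_upwards [eventually_ge_atTop 1] with x hx
      have h2 : x ^ 2 ≤ x ^ n := pow_le_pow_right₀ hx hn
      have h3 : x ≤ x ^ 2 := by nlinarith
      have h4 : c * x ^ 2 ≤ ε / 2 * x ^ 2 := by gcongr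
      nlinarith
    · filter_upwards [eventually_ge_atTop 1, eventually_ge_atTop ((|c| + ε) / ε)] with x hx hx2
      have h2 : x ^ 3 ≤ x ^ n := pow_le_pow_right₀ hx h
      rw [div_le_iff₀ hε] at hx2
      have h3 : x ≤ x ^ 2 := by nlinarith
      have h4 : c * x ^ 2 ≤ |c| * x ^ 2 := by gcongr; exact le_abs_self c
      have h5 : (|c| + ε) * x ^ 2 ≤ ε * x ^ 3 := by nlinarith [sq_nonneg x]
      nlinarith
  have h2 : Tendsto (fun x : ℝ => (1 + x) ^ N * rexp (-(ε / 2) * (1 + x))) atTop (𝓝 0) := by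
    have := (Real.tendsto_pow_mul_exp_neg_atTop_nhds_zero N).comp
      ((tendsto_atTop_add_const_left atTop (1 : ℝ) tendsto_id).const_mul_atTop (half_pos hε))
    have h3 := this.const_mul ((ε / 2) ^ N)⁻¹
    rw [mul_zero] at h3
    refine h3.congr fun x => ?_
    simp only [Function.comp, id, mul_pow]
    have : (ε / 2) ^ N ≠ 0 := by positivity
    field_simp
  filter_upwards [h1, h2.eventually_lt_const (exp_pos (-(ε / 2))), eventually_ge_atTop 0]
    with x h1 h2 hx
  rw [← Real.exp_add, le_inv_comm₀ (exp_pos _) (by positivity), ← Real.exp_neg]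
  have h3 : (1 + x) ^ N * rexp (-(ε / 2) * (1 + x)) =
      (1 + x) ^ N * rexp (-(ε / 2) * x) * rexp (-(ε / 2)) := by
    rw [mul_assoc, ← Real.exp_add]; ring_nf
  rw [h3] at h2
  have h4 : (1 + x) ^ N * rexp (-(ε / 2) * x) < 1 := by
    by_contra! h
    nlinarith [exp_pos (-(ε / 2))]
  have h5 : (1 + x) ^ N < rexp (ε / 2 * x) := by
    rw [neg_mul, Real.exp_neg] at h4
    rwa [← div_eq_mul_inv, div_lt_one (exp_pos _)] at h4
  refine h5.le.trans (Real.exp_le_exp.2 ?_)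
  linarith

lemma tendsto_pow_mul_exp_neg_pow {ε : ℝ} (hε : 0 < ε) {m : ℕ} (hm : 1 ≤ m) (N : ℕ) :
    Tendsto (fun x : ℝ => x ^ N * rexp (-ε * x ^ m)) atTop (𝓝 0) := by
  have h := (Real.tendsto_pow_mul_exp_neg_atTop_nhds_zero N).comp
    (tendsto_id.const_mul_atTop hε : Tendsto (fun x : ℝ => ε * x) atTop atTop)
  have h3 := h.const_mul (ε ^ N)⁻¹
  rw [mul_zero] at h3
  refine squeeze_zero' ?_ ?_ h3
  · filter_upwards [eventually_ge_atTop 0] with x hx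
    positivity
  · filter_upwards [eventually_ge_atTop 1] with x hx
    have h1 : x ≤ x ^ m := le_self_pow₀ hx (by omega)
    have h0 : (0 : ℝ) ≤ x := by linarith
    have h2 : ε ^ N ≠ 0 := by positivity
    calc x ^ N * rexp (-ε * x ^ m) ≤ x ^ N * rexp (-(ε * x)) := by gcongr; nlinarith
      _ = _ := by simp only [Function.comp, mul_pow]; field_simp

lemma exp_mul_norm_le {c : ℝ} {ε : ℝ} (hε : 0 < ε) (x : ℝ) :
    rexp (c * x) ≤ rexp (c ^ 2 / (4 * ε)) * rexp (ε * x ^ 2) := by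
  rw [← Real.exp_add]
  gcongr
  have h : 0 ≤ (c - 2 * ε * x) ^ 2 / (4 * ε) := by positivity
  have h2 : (c - 2 * ε * x) ^ 2 / (4 * ε) = c ^ 2 / (4 * ε) + ε * x ^ 2 - c * x := by
    field_simp; ring
  linarith

variable (γ : Contour w) (hB : B ≠ 0) (hdeg : B.natDegree + 1 ≤ P.natDegree)
include hB hdeg

/-- Near an admissible end the weight dominates Gaussian growth (any Gaussian if the degree is
large). -/
lemma Contour.exists_integrableAtFilter {l : Filter ℝ} (hl : IsEnd l)
    (h : IsAdmissibleEnd P B γ.curve l) :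
    ∃ ε : ℝ, 0 < ε ∧ ∀ c : ℝ, (c ≤ ε ∨ B.natDegree + 2 ≤ P.natDegree) →
      IntegrableAtFilter (fun t => ((rexp (c * ‖γ.curve t‖ ^ 2) : ℝ) : ℂ) *
        w.W (γ.curve t) * deriv γ.curve t) l := by
  have hmeas : ∀ c : ℝ, AEStronglyMeasurable (fun t => ((rexp (c * ‖γ.curve t‖ ^ 2) : ℝ) : ℂ) *
        w.W (γ.curve t) * deriv γ.curve t) (volume.restrict (Ioo 0 1)) := fun c => by
    refine (γ.locallyIntegrableOn ?_).aestronglyMeasurable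
    have hg := γ.piecewise.continuousOn
    have hw := γ.continuousOn_weight
    fun_prop
  have hnorm : ∀ (c t : ℝ), ‖((rexp (c * ‖γ.curve t‖ ^ 2) : ℝ) : ℂ) *
        w.W (γ.curve t) * deriv γ.curve t‖ =
        rexp (c * ‖γ.curve t‖ ^ 2) * ‖w.W (γ.curve t)‖ * ‖deriv γ.curve t‖ := fun c t => by
    rw [norm_mul, norm_mul, norm_real, norm_of_nonneg (exp_pos _).le]
  rcases h with h | ⟨b, h | h⟩
  · obtain ⟨C, ε, hε, hC⟩ := γ.norm_le_of_isEndAtInfinity hB hdeg hl h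
    obtain ⟨hinf, -, N, hN⟩ := h
    refine ⟨ε / 2, half_pos hε, fun c hc => ?_⟩
    refine integrableAtFilter_of_le hl (hN.smul (max C 0)) (hmeas c) ?_
    have := hinf.eventually (eventually_bound_exp_sub_pow (c := c) hε
      (n := P.natDegree - B.natDegree + 1) (by omega) (hc.imp_right fun _ => by omega) N)
    filter_upwards [this, hC] with t h1 h2
    rw [hnorm]
    simp only [Pi.smul_apply, smul_eq_mul]
    calc _ ≤ rexp (c * ‖γ.curve t‖ ^ 2) * (max C 0 *
          rexp (-ε * ‖γ.curve t‖ ^ (P.natDegree - B.natDegree + 1))) * ‖deriv γ.curve t‖ := by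
          gcongr
          refine h2.trans ?_
          gcongr
          exact le_max_left _ _
      _ = max C 0 * (rexp (c * ‖γ.curve t‖ ^ 2) *
          rexp (-ε * ‖γ.curve t‖ ^ (P.natDegree - B.natDegree + 1))) * ‖deriv γ.curve t‖ := by ring
      _ ≤ max C 0 * ((1 + ‖γ.curve t‖) ^ N)⁻¹ * ‖deriv γ.curve t‖ := by gcongr
      _ = _ := by ring
  · obtain ⟨C, ε, hε, hC⟩ := γ.norm_le_of_isEndAtEssential hB hl h
    obtain ⟨hmult, hlim, -, N, hN⟩ := h
    refine ⟨1, one_pos, fun c _ => ?_⟩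
    have hlim' := (tendsto_nhdsWithin_iff.1 hlim).1
    have hinv : Tendsto (fun t => ‖γ.curve t - b‖⁻¹) l atTop := by
      have h1 : Tendsto (fun t => γ.curve t - b) l (𝓝[≠] 0) := by
        rw [tendsto_nhdsWithin_iff]
        refine ⟨by simpa using hlim'.sub_const b, ?_⟩
        filter_upwards [(tendsto_nhdsWithin_iff.1 hlim).2] with t ht using sub_ne_zero.2 ht
      exact (tendsto_norm_nhdsNE_zero.comp h1).inv_tendsto_nhdsGT_zero
    have h2 := (tendsto_pow_mul_exp_neg_pow hε (m := B.rootMultiplicity b - 1) (by omega) N).comp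
      hinv
    have h3 : Tendsto (fun t => rexp (c * ‖γ.curve t‖ ^ 2)) l
        (𝓝 (rexp (c * ‖b‖ ^ 2))) := ((hlim'.norm.pow 2).const_mul c).rexp
    refine integrableAtFilter_of_le hl (hN.smul ((rexp (c * ‖b‖ ^ 2) + 1) * max C 0)) (hmeas c) ?_
    filter_upwards [hC, h2.eventually_le_const one_pos, h3.eventually_le_const (lt_add_one _),
      hinv.eventually_gt_atTop 0] with t h4 h5 h6 h7
    have h7' : 0 < ‖γ.curve t - b‖ := inv_pos.1 h7
    simp only [Function.comp] at h5
    rw [hnorm]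
    simp only [Pi.smul_apply, smul_eq_mul]
    have h8 : rexp (-ε * ‖γ.curve t - b‖⁻¹ ^ (rootMultiplicity b B - 1)) ≤ ‖γ.curve t - b‖ ^ N := by
      rw [inv_pow, inv_mul_le_iff₀ (by positivity), mul_one] at h5
      exact h5
    calc _ ≤ (rexp (c * ‖b‖ ^ 2) + 1) * (max C 0 * ‖γ.curve t - b‖ ^ N) * ‖deriv γ.curve t‖ := by
          gcongr
          refine h4.trans ?_
          gcongr
          exact le_max_left _ _
      _ = _ := by ring
  · obtain ⟨C, hC⟩ := γ.bounded_of_isEndAtRegular hB hl h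
    obtain ⟨-, -, hlim, hN⟩ := h
    refine ⟨1, one_pos, fun c _ => ?_⟩
    have h3 : Tendsto (fun t => rexp (c * ‖γ.curve t‖ ^ 2)) l
        (𝓝 (rexp (c * ‖b‖ ^ 2))) := ((hlim.norm.pow 2).const_mul c).rexp
    refine integrableAtFilter_of_le hl (hN.norm.smul ((rexp (c * ‖b‖ ^ 2) + 1) * max C 0))
      (hmeas c) ?_
    filter_upwards [hC, h3.eventually_le_const (lt_add_one _)] with t h4 h6
    rw [hnorm]
    simp only [Pi.smul_apply, smul_eq_mul]
    gcongr
    exact h4.trans (le_max_left _ _)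

lemma Contour.exists_integrableOn :
    ∃ ε : ℝ, 0 < ε ∧ ∀ c : ℝ, (c ≤ ε ∨ B.natDegree + 2 ≤ P.natDegree) →
      IntegrableOn (fun t => ((rexp (c * ‖γ.curve t‖ ^ 2) : ℝ) : ℂ) *
        w.W (γ.curve t) * deriv γ.curve t) (Ioo 0 1) := by
  have hcont : ∀ c : ℝ, ContinuousOn (fun t => ((rexp (c * ‖γ.curve t‖ ^ 2) : ℝ) : ℂ) *
        w.W (γ.curve t)) (Ioo 0 1) := fun c => by
    have hg := γ.piecewise.continuousOn
    have hw := γ.continuousOn_weight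
    fun_prop
  rcases γ.ends with ⟨h0, h1⟩ | ⟨⟨z, hz, hz0, hz1⟩, hint⟩
  · obtain ⟨ε₀, hε₀, H₀⟩ := γ.exists_integrableAtFilter hB hdeg (Or.inl rfl) h0
    obtain ⟨ε₁, hε₁, H₁⟩ := γ.exists_integrableAtFilter hB hdeg (Or.inr rfl) h1
    refine ⟨min ε₀ ε₁, lt_min hε₀ hε₁, fun c hc => integrableOn_Ioo_of_ends
      (H₀ c (hc.imp_left fun h => h.trans (min_le_left _ _)))
      (H₁ c (hc.imp_left fun h => h.trans (min_le_right _ _)))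
      (γ.locallyIntegrableOn (hcont c))⟩
  · refine ⟨1, one_pos, fun c _ => ?_⟩
    have hWz : ContinuousAt w.W z := (w.hasDerivAt hz).continuousAt
    have key : ∀ l : Filter ℝ, IsEnd l → Tendsto γ.curve l (𝓝 z) →
        IntegrableAtFilter (fun t => ((rexp (c * ‖γ.curve t‖ ^ 2) : ℝ) : ℂ) *
        w.W (γ.curve t) * deriv γ.curve t) l := fun l hl hlz => by
      have h3 : Tendsto (fun t => ((rexp (c * ‖γ.curve t‖ ^ 2) : ℝ) : ℂ) *
          w.W (γ.curve t)) l (𝓝 (((rexp (c * ‖z‖ ^ 2) : ℝ) : ℂ) * w.W z)) :=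
        ((Complex.continuous_ofReal.tendsto _).comp ((hlz.norm.pow 2).const_mul c).rexp).mul
          (hWz.tendsto.comp hlz)
      refine integrableAtFilter_of_le hl (IntegrableAtFilter.smul
        ⟨_, hl.Ioo_mem, hint.norm⟩ (‖((rexp (c * ‖z‖ ^ 2) : ℝ) : ℂ) * w.W z‖ + 1))
        (γ.locallyIntegrableOn (hcont c)).aestronglyMeasurable ?_
      filter_upwards [h3.norm.eventually_le_const (lt_add_one _)] with t ht
      rw [norm_mul]
      simp only [Pi.smul_apply, smul_eq_mul]
      gcongr
    exact integrableOn_Ioo_of_ends (key _ (Or.inl rfl) hz0) (key _ (Or.inr rfl) hz1)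
      (γ.locallyIntegrableOn (hcont c))

/-- Functions of at most exponential growth are integrable against the weight. -/
lemma Contour.integrableOn {f : ℝ → ℂ}
    (hf : AEStronglyMeasurable f (volume.restrict (Ioo 0 1))) {C c : ℝ}
    (hb : ∀ t ∈ Ioo (0 : ℝ) 1, ‖f t‖ ≤ C * rexp (c * ‖γ.curve t‖)) :
    IntegrableOn (fun t => f t * w.W (γ.curve t) * deriv γ.curve t) (Ioo 0 1) := by
  obtain ⟨ε, hε, H⟩ := γ.exists_integrableOn hB hdeg
  have h1 := (H ε (Or.inl le_rfl)).norm.const_mul (|C| * rexp (c ^ 2 / (4 * ε)))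
  refine Integrable.mono' h1 ?_ ?_
  · exact (hf.mul (γ.continuousOn_weight.aestronglyMeasurable measurableSet_Ioo)).mul
      γ.piecewise.locallyIntegrable.aestronglyMeasurable
  · refine (ae_restrict_iff' measurableSet_Ioo).2 (ae_of_all _ fun t ht => ?_)
    simp only [norm_mul, norm_real, norm_of_nonneg (exp_pos _).le]
    calc _ ≤ (|C| * (rexp (c ^ 2 / (4 * ε)) * rexp (ε * ‖γ.curve t‖ ^ 2))) *
          ‖w.W (γ.curve t)‖ * ‖deriv γ.curve t‖ := by
          gcongr
          refine (hb t ht).trans ?_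
          gcongr
          · exact le_abs_self C
          · exact exp_mul_norm_le hε _
      _ = _ := by ring

/-- The boundary terms vanish at an admissible end. -/
lemma Contour.tendsto_boundary {l : Filter ℝ} (hl : IsEnd l)
    (h : IsAdmissibleEnd P B γ.curve l) {F : ℝ → ℂ} {C c : ℝ}
    (hF : ∀ᶠ t in l, ‖F t‖ ≤ C * rexp (c * ‖γ.curve t‖)) :
    Tendsto (fun t => B.eval (γ.curve t) * w.W (γ.curve t) * F t) l (𝓝 0) := by
  rcases h with h | ⟨b, h⟩
  · obtain ⟨C', ε, hε, hC⟩ := γ.norm_le_of_isEndAtInfinity hB hdeg hl h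
    obtain ⟨hinf, -⟩ := h
    have hcob : Tendsto γ.curve l (Bornology.cobounded ℂ) := tendsto_norm_atTop_iff_cobounded.1 hinf
    have hBb := (((tendsto_eval_div_pow B le_rfl).comp hcob).norm).eventually_le_const (lt_add_one _)
    set K := ‖B.coeff B.natDegree‖ + 1
    have hexp := hinf.eventually (eventually_bound_exp_sub_pow (c := ε / 4) hε
      (n := P.natDegree - B.natDegree + 1) (by omega) (Or.inl (by linarith)) (B.natDegree + 1))
    have hg : Tendsto (fun t => |C| * rexp (c ^ 2 / (4 * (ε / 4))) * |C'| * K *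
        ‖γ.curve t‖⁻¹) l (𝓝 0) := by
      have := (tendsto_inv_atTop_zero.comp hinf).const_mul
        (|C| * rexp (c ^ 2 / (4 * (ε / 4))) * |C'| * K)
      rwa [mul_zero] at this
    refine squeeze_zero_norm' ?_ hg
    filter_upwards [hF, hC, hBb, hexp, hinf.eventually_gt_atTop 0] with t h1 h2 h3 h4 h5
    simp only [Function.comp, norm_div, norm_pow] at h3
    rw [div_le_iff₀ (by positivity)] at h3
    rw [norm_mul, norm_mul]
    have hK : 0 ≤ K := by positivity
    calc _ ≤ (K * ‖γ.curve t‖ ^ B.natDegree) * (|C'| *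
          rexp (-ε * ‖γ.curve t‖ ^ (P.natDegree - B.natDegree + 1))) *
          (|C| * (rexp (c ^ 2 / (4 * (ε / 4))) * rexp (ε / 4 * ‖γ.curve t‖ ^ 2))) := by
          gcongr
          · refine h2.trans ?_
            gcongr
            exact le_abs_self _
          · refine h1.trans ?_
            gcongr
            · exact le_abs_self _
            · exact exp_mul_norm_le (by positivity) _
      _ = |C| * rexp (c ^ 2 / (4 * (ε / 4))) * |C'| * K * (‖γ.curve t‖ ^ B.natDegree *
          (rexp (ε / 4 * ‖γ.curve t‖ ^ 2) *
          rexp (-ε * ‖γ.curve t‖ ^ (P.natDegree - B.natDegree + 1)))) := by ring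
      _ ≤ _ := by
          gcongr
          calc _ ≤ ‖γ.curve t‖ ^ B.natDegree * ((1 + ‖γ.curve t‖) ^ (B.natDegree + 1))⁻¹ := by
                gcongr
            _ ≤ ‖γ.curve t‖ ^ B.natDegree * (‖γ.curve t‖ ^ (B.natDegree + 1))⁻¹ := by
                gcongr; linarith
            _ = _ := by rw [pow_succ]; field_simp
  · have hlim : Tendsto γ.curve l (𝓝 b) := by
      rcases h with h | h
      · exact (tendsto_nhdsWithin_iff.1 h.2.1).1
      · exact h.2.2.1
    have hBb : B.eval b = 0 := by
      have : 0 < B.rootMultiplicity b := by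
        rcases h with h | h
        · exact (zero_lt_one).trans h.1
        · rw [h.1]; exact one_pos
      exact (rootMultiplicity_pos hB).1 this
    have hW : ∃ C : ℝ, ∀ᶠ t in l, ‖w.W (γ.curve t)‖ ≤ C := by
      rcases h with h | h
      · obtain ⟨C', ε, hε, hC⟩ := γ.norm_le_of_isEndAtEssential hB hl h
        refine ⟨|C'|, ?_⟩
        filter_upwards [hC] with t ht
        refine ht.trans ?_
        have : rexp (-ε * ‖γ.curve t - b‖⁻¹ ^ (rootMultiplicity b B - 1)) ≤ 1 := by
          rw [Real.exp_le_one_iff]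
          have : 0 ≤ ‖γ.curve t - b‖⁻¹ ^ (rootMultiplicity b B - 1) := by positivity
          nlinarith
        exact (mul_le_mul (le_abs_self _) this (exp_pos _).le (abs_nonneg _)).trans_eq (mul_one _)
      · exact γ.bounded_of_isEndAtRegular hB hl h
    obtain ⟨C', hC'⟩ := hW
    have h1 : Tendsto (fun t => B.eval (γ.curve t)) l (𝓝 0) := by
      rw [← hBb]; exact (B.continuous.tendsto b).comp hlim
    have h3 : Tendsto (fun t => rexp (c * ‖γ.curve t‖)) l (𝓝 (rexp (c * ‖b‖))) :=
      (hlim.norm.const_mul c).rexp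
    have hbd : ∃ K : ℝ, ∀ᶠ t in l, ‖w.W (γ.curve t) * F t‖ ≤ K := by
      refine ⟨|C'| * (|C| * (rexp (c * ‖b‖) + 1)), ?_⟩
      filter_upwards [hC', hF, h3.eventually_le_const (lt_add_one _)] with t h4 h5 h6
      rw [norm_mul]
      gcongr
      · exact h4.trans (le_abs_self _)
      · refine h5.trans ?_
        gcongr
        exact le_abs_self _
    obtain ⟨K, hK⟩ := hbd
    have := h1.zero_mul_isBoundedUnder_le (g := fun t => w.W (γ.curve t) * F t)
      ⟨K, by simpa using hK⟩
    simpa only [mul_assoc] using this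

/-- Integration by parts: the integral of the derivative of `B f W` over an admissible contour
vanishes. -/
lemma Contour.integral_deriv_eq_zero {f : ℂ → ℂ} 
    (hf : ∀ z ∈ closure (γ.curve '' Ioo 0 1), DifferentiableAt ℂ f z) {C c : ℝ}
    (hb : ∀ t ∈ Ioo (0 : ℝ) 1, ‖f (γ.curve t)‖ ≤ C * rexp (c * ‖γ.curve t‖))
    (hi : IntegrableOn (fun t => (B.eval (γ.curve t) * deriv f (γ.curve t) +
        (P + derivative B).eval (γ.curve t) * f (γ.curve t)) * w.W (γ.curve t) *
        deriv γ.curve t) (Ioo 0 1)) :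
    γ.integral (fun z => (B.eval z * deriv f z + (P + derivative B).eval z * f z) * w.W z) = 0 := by
  obtain ⟨S, hS, hsm⟩ := γ.exists_smooth
  have hmem : ∀ t ∈ Ioo (0 : ℝ) 1, DifferentiableAt ℂ f (γ.curve t) := fun t ht =>
    hf _ (subset_closure (Set.mem_image_of_mem _ ht))
  have hcont : ContinuousOn (fun t => B.eval (γ.curve t) * w.W (γ.curve t) * f (γ.curve t))
      (Ioo 0 1) := by
    have hg := γ.piecewise.continuousOn
    have hw := γ.continuousOn_weight
    have hfc : ContinuousOn (fun t => f (γ.curve t)) (Ioo 0 1) := fun t ht =>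
      (hmem t ht).continuousAt.comp_continuousWithinAt (hg t ht)
    exact ((B.continuous.comp_continuousOn hg).mul hw).mul hfc
  have hder : ∀ t ∈ Ioo (0 : ℝ) 1 \ S,
      HasDerivAt (fun t => B.eval (γ.curve t) * w.W (γ.curve t) * f (γ.curve t))
      ((B.eval (γ.curve t) * deriv f (γ.curve t) +
        (P + derivative B).eval (γ.curve t) * f (γ.curve t)) * w.W (γ.curve t) *
        deriv γ.curve t) t := fun t ht => by
    have h0 := (hsm t ht.1).2.2 ht.2
    have h1 : HasDerivAt (fun t => B.eval (γ.curve t))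
        ((derivative B).eval (γ.curve t) * deriv γ.curve t) t :=
      (B.hasDerivAt (γ.curve t)).comp t h0.1
    have h2 : HasDerivAt (fun t => f (γ.curve t)) (deriv f (γ.curve t) * deriv γ.curve t) t :=
      (hmem t ht.1).hasDerivAt.comp t h0.1
    refine ((h1.mul h0.2).mul h2).congr_deriv ?_
    have := w.ode _ (γ.mem_dom t ht.1)
    simp only [eval_add, Pi.mul_apply]
    linear_combination f (γ.curve t) * deriv γ.curve t * this
  rcases γ.ends with ⟨h0, h1⟩ | ⟨⟨z, hz, hz0, hz1⟩, -⟩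
  · have := integral_Ioo_eq_sub one_pos hS.countable hcont hder hi
      (γ.tendsto_boundary hB hdeg (Or.inl rfl) h0
        (eventually_of_mem (IsEnd.Ioo_mem (Or.inl rfl)) hb))
      (γ.tendsto_boundary hB hdeg (Or.inr rfl) h1
        (eventually_of_mem (IsEnd.Ioo_mem (Or.inr rfl)) hb))
    rwa [sub_zero] at this
  · have hzc : z ∈ closure (γ.curve '' Ioo 0 1) :=
      mem_closure_of_tendsto hz0 (eventually_of_mem (IsEnd.Ioo_mem (Or.inl rfl))
        fun t ht => Set.mem_image_of_mem _ ht)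
    have hWz : ContinuousAt (fun z => B.eval z * w.W z * f z) z :=
      (B.continuous.continuousAt.mul (w.hasDerivAt hz).continuousAt).mul (hf z hzc).continuousAt
    have := integral_Ioo_eq_sub one_pos hS.countable hcont hder hi
      (hWz.tendsto.comp hz0) (hWz.tendsto.comp hz1)
    rwa [sub_self] at this

end Integrals

/-! ### Functions of exponential growth and the moments of a contour -/

/-- A continuous function of at most exponential growth. -/
structure ExpGrowth (f : ℂ → ℂ) : Prop where
  continuous : Continuous f
  bound : ∃ C c : ℝ, 0 ≤ C ∧ 0 ≤ c ∧ ∀ z, ‖f z‖ ≤ C * rexp (c * ‖z‖)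

namespace ExpGrowth

lemma const (a : ℂ) : ExpGrowth fun _ => a :=
  ⟨continuous_const, ‖a‖, 0, norm_nonneg _, le_rfl, fun z => by simp⟩

lemma id : ExpGrowth fun z => z := ⟨continuous_id, 1, 1, zero_le_one, zero_le_one, fun z => by
    have := Real.add_one_le_exp ‖z‖
    simp; linarith⟩

lemma add {f g : ℂ → ℂ} (hf : ExpGrowth f) (hg : ExpGrowth g) : ExpGrowth fun z => f z + g z := by
  obtain ⟨C, c, hC, hc, h⟩ := hf.bound
  obtain ⟨C', c', hC', hc', h'⟩ := hg.bound
  refine ⟨hf.continuous.add hg.continuous, C + C', max c c', by positivity, by positivity,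
    fun z => ?_⟩
  calc _ ≤ ‖f z‖ + ‖g z‖ := norm_add_le _ _
    _ ≤ C * rexp (max c c' * ‖z‖) + C' * rexp (max c c' * ‖z‖) := by
        gcongr
        · refine (h z).trans ?_
          gcongr
          exact le_max_left _ _
        · refine (h' z).trans ?_
          gcongr
          exact le_max_right _ _
    _ = _ := by ring

lemma mul {f g : ℂ → ℂ} (hf : ExpGrowth f) (hg : ExpGrowth g) : ExpGrowth fun z => f z * g z := by
  obtain ⟨C, c, hC, hc, h⟩ := hf.bound
  obtain ⟨C', c', hC', hc', h'⟩ := hg.bound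
  refine ⟨hf.continuous.mul hg.continuous, C * C', c + c', by positivity, by positivity,
    fun z => ?_⟩
  rw [norm_mul, add_mul, Real.exp_add, mul_mul_mul_comm]
  exact mul_le_mul (h z) (h' z) (norm_nonneg _) (by positivity)

lemma sub {f g : ℂ → ℂ} (hf : ExpGrowth f) (hg : ExpGrowth g) : ExpGrowth fun z => f z - g z := by
  have := hf.add ((const (-1)).mul hg)
  simpa [sub_eq_add_neg] using this

lemma sum {ι : Type*} {f : ι → ℂ → ℂ} (s : Finset ι) (hf : ∀ i ∈ s, ExpGrowth (f i)) :
    ExpGrowth fun z => ∑ i ∈ s, f i z := by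
  classical
  induction s using Finset.induction_on with
  | empty => simpa using const 0
  | insert a s ha ih =>
    simp only [Finset.sum_insert ha]
    exact (hf a (by simp)).add (ih fun i hi => hf i (by simp [hi]))

lemma eval (p : ℂ[X]) : ExpGrowth fun z => p.eval z := by
  induction p using Polynomial.induction_on' with
  | add p q hp hq => simpa using hp.add hq
  | monomial n a =>
    have : ∀ n : ℕ, ExpGrowth fun z : ℂ => z ^ n := fun n => by
      induction n with
      | zero => simpa using const 1
      | succ n ih => simpa [pow_succ] using ih.mul id
    simpa using (const a).mul (this n)

lemma exp (ξ : ℂ) : ExpGrowth fun z => exp (ξ * z) :=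
  ⟨by fun_prop, 1, ‖ξ‖, zero_le_one, norm_nonneg _, fun z => by
    rw [Complex.norm_exp, one_mul, ← norm_mul]
    exact Real.exp_le_exp.2 (Complex.re_le_norm _)⟩

end ExpGrowth

section Moments

variable {P B : ℂ[X]} {w : Branch P B}

/-- The integral `∫_γ f W dz` of a function against the weight. -/
def Contour.moment (γ : Contour w) (f : ℂ → ℂ) : ℂ := γ.integral fun z => f z * w.W z

lemma Contour.moment_const_mul (γ : Contour w) (a : ℂ) (f : ℂ → ℂ) :
    γ.moment (fun z => a * f z) = a * γ.moment f := by
  simp only [Contour.moment, Contour.integral]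
  rw [← integral_const_mul]
  congr 1; ext t; ring

variable (γ : Contour w) (hB : B ≠ 0) (hdeg : B.natDegree + 1 ≤ P.natDegree)
include hB hdeg

lemma Contour.integrableOn_expGrowth {f : ℂ → ℂ} (hf : ExpGrowth f) :
    IntegrableOn (fun t => f (γ.curve t) * w.W (γ.curve t) * deriv γ.curve t) (Ioo 0 1) := by
  obtain ⟨C, c, -, -, h⟩ := hf.bound
  exact γ.integrableOn hB hdeg (f := fun t => f (γ.curve t))
    (γ.aestronglyMeasurable_comp (hf.continuous.comp_continuousOn γ.piecewise.continuousOn))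
    (fun t _ => h _)

lemma Contour.moment_add {f g : ℂ → ℂ} (hf : ExpGrowth f) (hg : ExpGrowth g) :
    γ.moment (fun z => f z + g z) = γ.moment f + γ.moment g := by
  simp only [Contour.moment, Contour.integral]
  rw [← integral_add (γ.integrableOn_expGrowth hB hdeg hf) (γ.integrableOn_expGrowth hB hdeg hg)]
  congr 1; ext t; ring

lemma Contour.moment_sum {ι : Type*} (s : Finset ι) {f : ι → ℂ → ℂ}
    (hf : ∀ i ∈ s, ExpGrowth (f i)) :
    γ.moment (fun z => ∑ i ∈ s, f i z) = ∑ i ∈ s, γ.moment (f i) := by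
  classical
  induction s using Finset.induction_on with
  | empty => simp [Contour.moment, Contour.integral]
  | insert a s ha ih =>
    simp only [Finset.sum_insert ha]
    rw [γ.moment_add hB hdeg (hf a (by simp)) (ExpGrowth.sum s fun i hi => hf i (by simp [hi])),
      ih fun i hi => hf i (by simp [hi])]

/-- Integration by parts against `g(z) e^{ξ z}`. -/
lemma Contour.moment_deriv_eq_zero (g : ℂ[X]) (ξ : ℂ) :
    γ.moment (fun z => (B * (derivative g + C ξ * g) + (P + derivative B) * g).eval z *
      exp (ξ * z)) = 0 := by
  have hgr : ExpGrowth fun z => g.eval z * exp (ξ * z) := (ExpGrowth.eval g).mul (ExpGrowth.exp ξ)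
  obtain ⟨C, c, -, -, hb⟩ := hgr.bound
  have hd : ∀ z, HasDerivAt (fun z => g.eval z * exp (ξ * z))
      ((derivative g).eval z * exp (ξ * z) + g.eval z * (exp (ξ * z) * ξ)) z :=
    fun z => (g.hasDerivAt z).mul (by simpa using ((hasDerivAt_id z).const_mul ξ).cexp)
  have key : ∀ z, B.eval z * deriv (fun z => g.eval z * exp (ξ * z)) z +
      (P + derivative B).eval z * (g.eval z * exp (ξ * z)) =
      (B * (derivative g + Polynomial.C ξ * g) + (P + derivative B) * g).eval z *
        exp (ξ * z) := fun z => by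
    rw [(hd z).deriv]
    simp only [eval_add, eval_mul, eval_C]
    ring
  have hint := γ.integrableOn_expGrowth hB hdeg
    ((ExpGrowth.eval (B * (derivative g + Polynomial.C ξ * g) + (P + derivative B) * g)).mul
      (ExpGrowth.exp ξ))
  have := γ.integral_deriv_eq_zero hB hdeg (f := fun z => g.eval z * exp (ξ * z))
    (fun z _ => (hd z).differentiableAt) (fun t _ => hb _) (by simpa only [key] using hint)
  simp only [key] at this
  exact this

/-- Differentiation of the Fourier–Laplace transform under the integral sign. -/
lemma Contour.hasDerivAt_moment {f : ℂ → ℂ} (hf : ExpGrowth f) (ξ : ℂ) :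
    HasDerivAt (fun ξ => γ.moment fun z => f z * exp (ξ * z))
      (γ.moment fun z => z * f z * exp (ξ * z)) ξ := by
  obtain ⟨C, c, hC, hc, h⟩ := hf.bound
  have hF : ∀ ξ, IntegrableOn (fun t => f (γ.curve t) * exp (ξ * γ.curve t) *
      w.W (γ.curve t) * deriv γ.curve t) (Ioo 0 1) := fun ξ => by
    have h := γ.integrableOn_expGrowth hB hdeg (hf.mul (ExpGrowth.exp ξ))
    exact h
  have hF' : ∀ ξ, IntegrableOn (fun t => γ.curve t * f (γ.curve t) *
      exp (ξ * γ.curve t) * w.W (γ.curve t) * deriv γ.curve t) (Ioo 0 1) := fun ξ => by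
    have h := γ.integrableOn_expGrowth hB hdeg ((ExpGrowth.id.mul hf).mul (ExpGrowth.exp ξ))
    exact h
  have hdom := (γ.integrableOn hB hdeg
    (f := fun t => ((rexp ((‖ξ‖ + 1) * ‖γ.curve t‖) * ‖γ.curve t * f (γ.curve t)‖ : ℝ) : ℂ))
    (C := C) (c := (‖ξ‖ + 1) + (1 + c)) (by
      refine ContinuousOn.aestronglyMeasurable ?_ measurableSet_Ioo
      have h1 := γ.piecewise.continuousOn
      have h2 : ContinuousOn (fun t => f (γ.curve t)) (Ioo 0 1) :=
        hf.continuous.comp_continuousOn h1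
      exact Complex.continuous_ofReal.comp_continuousOn
        (((continuousOn_const.mul h1.norm).rexp).mul (h1.mul h2).norm)) (fun t _ => by
      rw [norm_real, norm_of_nonneg (by positivity), norm_mul,
        add_mul (‖ξ‖ + 1) (1 + c), Real.exp_add, add_mul 1 c, Real.exp_add, one_mul]
      have h1 : ‖γ.curve t‖ ≤ rexp ‖γ.curve t‖ := by
        have := Real.add_one_le_exp ‖γ.curve t‖; linarith
      calc _ ≤ rexp ((‖ξ‖ + 1) * ‖γ.curve t‖) * (rexp ‖γ.curve t‖ *
            (C * rexp (c * ‖γ.curve t‖))) := by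
            gcongr
            exact h _
        _ = _ := by ring)).norm
  refine (hasDerivAt_integral_of_dominated_loc_of_deriv_le
    (F := fun ξ t => f (γ.curve t) * exp (ξ * γ.curve t) * w.W (γ.curve t) * deriv γ.curve t)
    (F' := fun ξ t => γ.curve t * f (γ.curve t) * exp (ξ * γ.curve t) *
      w.W (γ.curve t) * deriv γ.curve t) (ball_mem_nhds ξ one_pos)
    (Eventually.of_forall fun ξ => (hF ξ).aestronglyMeasurable) (hF ξ)
    (hF' ξ).aestronglyMeasurable (ae_of_all _ fun t η hη => ?_) hdom
    (ae_of_all _ fun t η _ => ?_)).2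
  · simp only [norm_mul, norm_real, norm_of_nonneg (exp_pos _).le, norm_norm]
    have h1 : ‖exp (η * γ.curve t)‖ ≤ rexp ((‖ξ‖ + 1) * ‖γ.curve t‖) := by
      rw [Complex.norm_exp]
      refine Real.exp_le_exp.2 ((Complex.re_le_norm _).trans ?_)
      rw [norm_mul]
      gcongr
      have := norm_sub_norm_le η ξ
      rw [Metric.mem_ball, dist_eq_norm] at hη
      linarith
    calc _ ≤ ‖γ.curve t‖ * ‖f (γ.curve t)‖ * rexp ((‖ξ‖ + 1) * ‖γ.curve t‖) *
          ‖w.W (γ.curve t)‖ * ‖deriv γ.curve t‖ := by gcongr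
      _ = _ := by ring
  · have h1 : HasDerivAt (fun η : ℂ => exp (η * γ.curve t))
        (exp (η * γ.curve t) * γ.curve t) η := by
      simpa using ((hasDerivAt_id η).mul_const (γ.curve t)).cexp
    refine (((h1.const_mul (f (γ.curve t))).mul_const (w.W (γ.curve t))).mul_const
      (deriv γ.curve t)).congr_deriv ?_
    ring

/-- Gaussian bounds for the Fourier–Laplace transform. -/
lemma Contour.exists_moment_le {f : ℂ → ℂ} (hf : ExpGrowth f) :
    ∃ δ₀ : ℝ, 0 < δ₀ ∧ ∀ δ : ℝ, 0 < δ → (δ₀ ≤ δ ∨ B.natDegree + 2 ≤ P.natDegree) →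
      ∃ K : ℝ, ∀ ξ, ‖γ.moment fun z => f z * exp (ξ * z)‖ ≤ K * rexp (δ * ‖ξ‖ ^ 2) := by
  obtain ⟨C, c, hC, hc, h⟩ := hf.bound
  obtain ⟨ε, hε, H⟩ := γ.exists_integrableOn hB hdeg
  refine ⟨1 / (2 * ε), by positivity, fun δ hδ0 hδ => ?_⟩
  have hI := (H (ε / 2 + 1 / (4 * δ)) (hδ.imp_left fun hle => by
    rw [div_le_iff₀ (by positivity)] at hle
    have : 1 / (4 * δ) ≤ ε / 2 := by rw [div_le_div_iff₀ (by positivity) two_pos]; linarith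
    linarith)).norm
  set K₀ := C * rexp (c ^ 2 / (4 * (ε / 2)))
  set M := ∫ t in Ioo (0 : ℝ) 1, ‖((rexp ((ε / 2 + 1 / (4 * δ)) * ‖γ.curve t‖ ^ 2) : ℝ) : ℂ) *
        w.W (γ.curve t) * deriv γ.curve t‖
  refine ⟨K₀ * M, fun ξ => ?_⟩
  have hb : ∀ t : ℝ, ‖f (γ.curve t) * exp (ξ * γ.curve t) * w.W (γ.curve t) *
      deriv γ.curve t‖ ≤ (K₀ * rexp (δ * ‖ξ‖ ^ 2)) *
      ‖((rexp ((ε / 2 + 1 / (4 * δ)) * ‖γ.curve t‖ ^ 2) : ℝ) : ℂ) *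
        w.W (γ.curve t) * deriv γ.curve t‖ := fun t => by
    simp only [norm_mul, norm_real, norm_of_nonneg (exp_pos _).le]
    have h1 : ‖exp (ξ * γ.curve t)‖ ≤
        rexp (δ * ‖ξ‖ ^ 2) * rexp (1 / (4 * δ) * ‖γ.curve t‖ ^ 2) := by
      rw [Complex.norm_exp, ← Real.exp_add]
      refine Real.exp_le_exp.2 ((Complex.re_le_norm _).trans ?_)
      rw [norm_mul]
      have h2 : 0 ≤ (2 * δ * ‖ξ‖ - ‖γ.curve t‖) ^ 2 / (4 * δ) := by positivity
      have h3 : (2 * δ * ‖ξ‖ - ‖γ.curve t‖) ^ 2 / (4 * δ) =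
        δ * ‖ξ‖ ^ 2 + 1 / (4 * δ) * ‖γ.curve t‖ ^ 2 - ‖ξ‖ * ‖γ.curve t‖ := by field_simp; ring
      linarith
    calc _ ≤ (C * (rexp (c ^ 2 / (4 * (ε / 2))) * rexp (ε / 2 * ‖γ.curve t‖ ^ 2))) *
          (rexp (δ * ‖ξ‖ ^ 2) * rexp (1 / (4 * δ) * ‖γ.curve t‖ ^ 2)) *
          ‖w.W (γ.curve t)‖ * ‖deriv γ.curve t‖ := by
          gcongr
          refine (h _).trans ?_
          gcongr
          exact exp_mul_norm_le (by positivity) _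
      _ = _ := by rw [add_mul (ε / 2), Real.exp_add]; ring
  calc _ ≤ ∫ t in Ioo (0 : ℝ) 1, ‖f (γ.curve t) * exp (ξ * γ.curve t) *
        w.W (γ.curve t) * deriv γ.curve t‖ := norm_integral_le_integral_norm _
    _ ≤ ∫ t in Ioo (0 : ℝ) 1, (K₀ * rexp (δ * ‖ξ‖ ^ 2)) *
      ‖((rexp ((ε / 2 + 1 / (4 * δ)) * ‖γ.curve t‖ ^ 2) : ℝ) : ℂ) *
        w.W (γ.curve t) * deriv γ.curve t‖ :=
        integral_mono (γ.integrableOn_expGrowth hB hdeg (hf.mul (ExpGrowth.exp ξ))).norm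
          (hI.const_mul _) hb
    _ = _ := by rw [integral_const_mul]; ring

end Moments

/-! ### Biorthogonal polynomials of a bilinear functional -/

lemma exists_sum_C_mul_eq {s : ℕ → ℂ[X]} (hs : ∀ n : ℕ, (s n).degree = n) (N : ℕ) (f : ℂ[X])
    (hf : f.degree < N) : ∃ c : ℕ → ℂ, f = ∑ k ∈ range N, C (c k) * s k := by
  induction N generalizing f with
  | zero =>
    refine ⟨0, ?_⟩
    have h : f = 0 := by simpa [Nat.WithBot.lt_zero_iff] using hf
    simp [h]
  | succ N ih =>
    have hl : (s N).coeff N ≠ 0 := by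
      have h1 : (s N).natDegree = N := natDegree_eq_of_degree_eq_some (hs N)
      have h0 : s N ≠ 0 := by
        rintro h
        have := hs N
        simp [h] at this
      have := leadingCoeff_ne_zero.2 h0
      rwa [leadingCoeff, h1] at this
    obtain ⟨c, hc⟩ := ih (f - C (f.coeff N / (s N).coeff N) * s N) (by
      rw [degree_lt_iff_coeff_zero]
      intro m hm
      rcases hm.eq_or_lt with rfl | hm
      · simp [hl]
      · have e1 : f.coeff m = 0 := coeff_eq_zero_of_degree_lt (hf.trans_le (by exact_mod_cast hm))
        have e2 : (s N).coeff m = 0 := coeff_eq_zero_of_degree_lt (by rw [hs]; exact_mod_cast hm)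
        simp [e1, e2])
    refine ⟨Function.update c N (f.coeff N / (s N).coeff N), ?_⟩
    rw [Finset.sum_range_succ, Function.update_self, sum_congr rfl (fun k hk => by
      rw [Function.update_of_ne (mem_range.1 hk).ne]), ← hc]
    ring

lemma map_C_mul (Φ : ℂ[X] →ₗ[ℂ] ℂ) (a : ℂ) (f : ℂ[X]) : Φ (C a * f) = a * Φ f := by
  rw [← smul_eq_C_mul, map_smul, smul_eq_mul]

lemma map_C_mul_left (ℓ : ℂ[X] →ₗ[ℂ] ℂ[X] →ₗ[ℂ] ℂ) (a : ℂ) (f g : ℂ[X]) :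
    ℓ (C a * f) g = a * ℓ f g := by
  rw [← smul_eq_C_mul, map_smul, LinearMap.smul_apply, smul_eq_mul]

section Biorthogonal

lemma degree_X_pow_add_of_lt {f : ℂ[X]} {n : ℕ} (hf : f.degree < n) :
    (X ^ n + f).degree = (n : WithBot ℕ) := by
  rw [degree_add_eq_left_of_degree_lt (by rwa [degree_X_pow]), degree_X_pow]

variable {ℓ : ℂ[X] →ₗ[ℂ] ℂ[X] →ₗ[ℂ] ℂ} {p s : ℕ → ℂ[X]} {A B : ℂ[X]} {Lh Ah : ℕ → ℕ → ℂ}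

lemma bimomentMinor_flip (n : ℕ) :
    bimomentMinor (fun p q => ℓ.flip p q) n = bimomentMinor (fun p q => ℓ p q) n := by
  rw [bimomentMinor, bimomentMinor, ← Matrix.det_transpose]
  rfl

lemma exists_forall_eq_of_bimomentMinor_ne_zero {n : ℕ}
    (h : bimomentMinor (fun p q => ℓ p q) n ≠ 0) (v : ℕ → ℂ) :
    ∃ f : ℂ[X], f.degree < n ∧ ∀ i < n, ℓ (X ^ i) f = v i := by
  set M := Matrix.of fun i j : Fin n => ℓ (X ^ (i : ℕ)) (X ^ (j : ℕ))
  have hM : IsUnit M.det := isUnit_iff_ne_zero.2 h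
  set c := M⁻¹.mulVec fun i : Fin n => v i
  have hc : M.mulVec c = fun i : Fin n => v i := by
    rw [Matrix.mulVec_mulVec, Matrix.mul_nonsing_inv _ hM, Matrix.one_mulVec]
  refine ⟨∑ j : Fin n, C (c j) * X ^ (j : ℕ), degree_sum_fin_lt _, fun i hi => ?_⟩
  have := congrFun hc ⟨i, hi⟩
  simp only [Matrix.mulVec, dotProduct, M, Matrix.of_apply] at this
  simp only [map_sum, map_C_mul]
  rw [← this]
  exact sum_congr rfl fun j _ => mul_comm _ _

lemma eq_zero_of_bimomentMinor_ne_zero {n : ℕ}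
    (h : bimomentMinor (fun p q => ℓ p q) n ≠ 0) {f : ℂ[X]} (hf : f.degree < n)
    (h0 : ∀ i < n, ℓ (X ^ i) f = 0) : f = 0 := by
  obtain ⟨c, rfl⟩ := exists_sum_C_mul_eq (s := fun n => X ^ n) (fun n => degree_X_pow n) n f hf
  have := Matrix.eq_zero_of_mulVec_eq_zero (v := fun i : Fin n => c i) h (by
    ext i
    have h1 := h0 i i.2
    simp only [map_sum, map_C_mul] at h1
    rw [Finset.sum_range] at h1
    simp only [Matrix.mulVec, dotProduct, Matrix.of_apply, Pi.zero_apply]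
    rw [← h1]
    exact sum_congr rfl fun j _ => mul_comm _ _)
  refine sum_eq_zero fun k hk => ?_
  have h2 := congrFun this ⟨k, mem_range.1 hk⟩
  simp only [Pi.zero_apply] at h2
  rw [h2]; simp

lemma degree_lt_of_mul {B g : ℂ[X]} (hB : B ≠ 0) {n : ℕ}
    (h : (B * g).degree < (n + B.natDegree : ℕ)) : g.degree < n := by
  rw [degree_mul, degree_eq_natDegree hB] at h
  rcases eq_or_ne g 0 with rfl | hg
  · simp
  rw [degree_eq_natDegree hg] at h ⊢
  norm_cast at h ⊢
  omega

lemma degree_dressed_lt (hs : ∀ n : ℕ, (s n).degree = n) (q : ℕ) (Lh : ℕ → ℕ → ℂ) (n : ℕ) :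
    (dressed q Lh s n).degree < (n + 1 + q : ℕ) := by
  refine (degree_add_le _ _).trans_lt (max_lt ?_ ((degree_sum_le _ _).trans_lt ?_))
  · rw [hs]; exact_mod_cast (by omega)
  · rw [Finset.sup_lt_iff (WithBot.bot_lt_coe _)]
    intro j hj
    refine (degree_mul_le _ _).trans_lt ?_
    rw [hs]
    have := (Finset.mem_Icc.1 hj).2
    refine (add_le_add_left degree_C_le _).trans_lt ?_
    rw [zero_add]
    exact_mod_cast (by omega)

lemma hatA_eqn_iff {A B D S : ℂ[X]} (hB : B ≠ 0) {g : ℂ[X]} (hg : D = B * g) :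
    B * derivative D - (A + derivative B) * D = -(B * S) ↔ S = A * g - B * derivative g := by
  have : B * derivative D - (A + derivative B) * D = -(B * (A * g - B * derivative g)) := by
    rw [hg, derivative_mul]; ring
  rw [this, neg_inj, mul_right_inj' hB, eq_comm]

lemma degree_sub_derivative_lt {g : ℂ[X]} {n : ℕ} (hdeg : B.natDegree + 1 ≤ A.natDegree)
    (hg : g.degree < (n + 1 : ℕ)) :
    (A * g - B * derivative g).degree < (n + A.natDegree + 1 : ℕ) := by
  rcases eq_or_ne g 0 with rfl | h0
  · simp
  have hg' : g.natDegree < n + 1 := by rw [degree_eq_natDegree h0] at hg; exact_mod_cast hg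
  have h1 : (A * g - B * derivative g).natDegree ≤ n + A.natDegree := by
    refine (natDegree_sub_le _ _).trans (max_le ?_ ?_)
    · exact natDegree_mul_le.trans (by omega)
    · have := natDegree_derivative_le g
      exact natDegree_mul_le.trans (by omega)
  exact (degree_le_natDegree).trans_lt (by exact_mod_cast Nat.lt_succ_of_le h1)

lemma IsHatL.exists_quotient (hs : ∀ n : ℕ, (s n).degree = n) (hB : B ≠ 0) (hL : IsHatL B s Lh)
    (n : ℕ) : ∃ g : ℂ[X], dressed B.natDegree Lh s n = B * g ∧ g.degree < (n + 1 : ℕ) := by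
  obtain ⟨g, hg⟩ := hL.dvd n
  exact ⟨g, hg, degree_lt_of_mul hB (by rw [← hg]; exact degree_dressed_lt hs _ _ _)⟩

lemma exists_orthogonal (h : ∀ n, bimomentMinor (fun p q => ℓ p q) n ≠ 0) :
    ∃ g : ℕ → ℂ[X], (∀ n : ℕ, (g n).degree < n) ∧
      ∀ n : ℕ, ∀ q : ℂ[X], q.degree < n → ℓ q (X ^ n + g n) = 0 := by
  choose g hg hgv using fun n => exists_forall_eq_of_bimomentMinor_ne_zero (ℓ := ℓ) (n := n)
    (h n) fun i => -ℓ (X ^ i) (X ^ n)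
  refine ⟨g, hg, fun n q hq => ?_⟩
  obtain ⟨c, rfl⟩ := exists_sum_C_mul_eq (s := fun n => X ^ n) (fun n => degree_X_pow n) n q hq
  rw [map_sum, LinearMap.sum_apply]
  refine sum_eq_zero fun k hk => ?_
  rw [map_C_mul_left, map_add, hgv n k (mem_range.1 hk), add_neg_cancel, mul_zero]

lemma exists_isBiorthonormal (h : ∀ n, bimomentMinor (fun p q => ℓ p q) n ≠ 0) :
    ∃ p s : ℕ → ℂ[X], IsBiorthonormal (fun p q => ℓ p q) p s := by
  obtain ⟨f, hf, hπ⟩ := exists_orthogonal (ℓ := ℓ.flip) fun n => by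
    rw [bimomentMinor_flip]; exact h n
  obtain ⟨g, hg, hσ⟩ := exists_orthogonal h
  simp only [LinearMap.flip_apply] at hπ
  have hn : ∀ n, ℓ (X ^ n + f n) (X ^ n + g n) ≠ 0 := fun n h0 => by
    rw [map_add, hπ n _ (hg n), add_zero] at h0
    have h1 := eq_zero_of_bimomentMinor_ne_zero (ℓ := ℓ.flip) (n := n + 1)
      (by rw [bimomentMinor_flip]; exact h _) (f := X ^ n + f n)
      (by rw [degree_X_pow_add_of_lt (hf n)]; exact_mod_cast n.lt_succ_self) fun i hi => by
        rw [LinearMap.flip_apply]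
        rcases (Nat.lt_succ_iff.1 hi).eq_or_lt with rfl | hi
        · exact h0
        · exact hπ n _ (by rw [degree_X_pow]; exact_mod_cast hi)
    exact (monic_X_pow_add (hf n)).ne_zero h1
  choose r hr using fun n => IsAlgClosed.exists_pow_nat_eq (ℓ (X ^ n + f n) (X ^ n + g n)) two_pos
  have hr0 : ∀ n, r n ≠ 0 := fun n h0 => hn n (by rw [← hr, h0]; simp)
  have hr0' : ∀ n, (r n)⁻¹ ≠ 0 := fun n => inv_ne_zero (hr0 n)
  have hdeg : ∀ n : ℕ, (C (r n)⁻¹ * (X ^ n + f n) : ℂ[X]).degree = (n : WithBot ℕ) := fun n => by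
    rw [degree_C_mul (hr0' n), degree_X_pow_add_of_lt (hf n)]
  have hdeg' : ∀ n : ℕ, (C (r n)⁻¹ * (X ^ n + g n) : ℂ[X]).degree = (n : WithBot ℕ) := fun n => by
    rw [degree_C_mul (hr0' n), degree_X_pow_add_of_lt (hg n)]
  refine ⟨fun n => C (r n)⁻¹ * (X ^ n + f n), fun n => C (r n)⁻¹ * (X ^ n + g n), hdeg, hdeg',
    fun n => ?_, fun n m => ?_⟩
  · simp only [leadingCoeff_mul, (monic_X_pow_add (hf n)).leadingCoeff,
      (monic_X_pow_add (hg n)).leadingCoeff]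
  · have e : ∀ (n m : ℕ), ℓ (C (r n)⁻¹ * (X ^ n + f n)) (C (r m)⁻¹ * (X ^ m + g m)) =
        (r n)⁻¹ * (r m)⁻¹ * ℓ (X ^ n + f n) (X ^ m + g m) := fun n m => by
      rw [map_C_mul_left, map_C_mul, mul_assoc]
    simp only [e]
    rcases lt_trichotomy n m with hlt | rfl | hlt
    · rw [hσ m _ (by rw [degree_X_pow_add_of_lt (hf n)]; exact_mod_cast hlt), if_neg hlt.ne, mul_zero]
    · rw [if_pos rfl, ← hr, ← mul_inv, ← sq, inv_mul_cancel₀ (pow_ne_zero 2 (hr0 n))]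
    · rw [hπ n _ (by rw [degree_X_pow_add_of_lt (hg m)]; exact_mod_cast hlt), if_neg hlt.ne', mul_zero]

lemma sum_window {d m N : ℕ} (hN : m + d + 1 ≤ N) (F : ℕ → ℂ)
    (hF : ∀ k, ¬(m ≤ k ∧ k ≤ m + d) → F k = 0) :
    ∑ a : Fin (d + 1), F (m + a) = ∑ k ∈ range N, F k := by
  rw [Fin.sum_univ_eq_sum_range (fun a => F (m + a)) (d + 1),
    ← sum_subset (s₁ := Finset.Ico m (m + d + 1)) (fun k hk => by
      rw [Finset.mem_Ico] at hk; rw [mem_range]; omega) (fun k _ hk => hF k (by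
      rw [Finset.mem_Ico] at hk; omega)), Finset.sum_Ico_eq_sum_range]
  congr 2
  omega

variable (h : IsBiorthonormal (fun p q => ℓ p q) p s)
include h

lemma IsBiorthonormal.flip :
    IsBiorthonormal (fun p q => ℓ.flip p q) s p :=
  ⟨h.degree_right, h.degree_left, fun n => (h.leadingCoeff_eq n).symm, fun n m => by
    have := h.pairing m n
    simpa [eq_comm] using this⟩

lemma IsBiorthonormal.pair (n m : ℕ) :
    ℓ (p n) (s m) = if n = m then 1 else 0 := h.pairing n m

lemma IsBiorthonormal.expand_right {N : ℕ}
    {f : ℂ[X]} (hf : f.degree < N) :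
    f = ∑ k ∈ range N, C (ℓ (p k) f) * s k := by
  obtain ⟨c, hc⟩ := exists_sum_C_mul_eq h.degree_right N f hf
  have h1 : ∀ k ∈ range N, ℓ (p k) f = c k := fun k hk => by
    rw [hc, map_sum, sum_congr rfl fun j _ => by rw [map_C_mul, h.pair]]
    simp [mem_range.1 hk]
  conv_lhs => rw [hc]
  exact sum_congr rfl fun k hk => by rw [h1 k hk]

lemma IsBiorthonormal.expand_left {N : ℕ}
    {f : ℂ[X]} (hf : f.degree < N) :
    f = ∑ k ∈ range N, C (ℓ f (s k)) * p k := h.flip.expand_right hf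

lemma IsBiorthonormal.pair_eq_zero_right {N : ℕ}
    {f : ℂ[X]} (hf : f.degree < N) : ℓ (p N) f = 0 := by
  rw [h.expand_right hf, map_sum]
  refine sum_eq_zero fun k hk => ?_
  rw [map_C_mul, h.pair, if_neg (mem_range.1 hk).ne', mul_zero]

/-! ### The matrices `L̂` and `Â` -/

lemma IsBiorthonormal.pair_dressed {B : ℂ[X]}
    {Lh : ℕ → ℕ → ℂ} (hL : ∀ n k, ¬(k < n ∧ n ≤ k + B.natDegree) → Lh n k = 0) (i n : ℕ) :
    ℓ (p i) (dressed B.natDegree Lh s n) = (if i = n then 1 else 0) + Lh i n := by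
  rw [dressed, map_add, h.pair, map_sum]
  congr 1
  rw [sum_congr rfl fun j _ => by rw [map_C_mul, h.pair]]
  by_cases hi : n < i ∧ i ≤ n + B.natDegree
  · rw [Finset.sum_eq_single (i - n)]
    · rw [Nat.add_sub_cancel' hi.1.le]; simp
    · intro j _ hj
      rw [if_neg (by omega), mul_zero]
    · intro hj
      exact absurd (Finset.mem_Icc.2 ⟨by omega, by omega⟩) hj
  · rw [hL _ _ hi]
    refine sum_eq_zero fun j hj => ?_
    have := Finset.mem_Icc.1 hj
    rw [if_neg (by omega), mul_zero]

lemma IsBiorthonormal.existsUnique_isHatL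
    {B : ℂ[X]} (hB : B ≠ 0) (hm : ∀ n, bimomentMinor (fun p q => ℓ p (B * q)) n ≠ 0) :
    ∃! Lh : ℕ → ℕ → ℂ, IsHatL B s Lh := by
  have hm' : ∀ n, bimomentMinor (fun p q => ℓ.compl₂ (LinearMap.mulLeft ℂ B) p q) n ≠ 0 := hm
  have hX : ∀ n (i : ℕ), i < n → ∀ f : ℂ[X], (∀ k < n, ℓ (p k) f = 0) → ℓ (X ^ i) f = 0 :=
    fun n i hi f hf => by
      rw [h.expand_left (f := X ^ i) (N := n) (by rw [degree_X_pow]; exact_mod_cast hi), map_sum,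
        LinearMap.sum_apply]
      refine sum_eq_zero fun k hk => ?_
      rw [map_C_mul_left, hf k (mem_range.1 hk), mul_zero]
  refine existsUnique_of_exists_of_unique ?_ fun L L' hL hL' => ?_
  · choose g hg hgv using fun n => exists_forall_eq_of_bimomentMinor_ne_zero (hm' (n + 1))
      fun i => ℓ (X ^ i) (s n)
    have hgp : ∀ n k, k ≤ n → ℓ (p k) (B * g n - s n) = 0 := fun n k hk => by
      rw [exists_sum_C_mul_eq (s := fun n => X ^ n) (fun n => degree_X_pow n) (n + 1) (p k)
        (by rw [h.degree_left]; exact_mod_cast (by omega)) |>.choose_spec, map_sum,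
        LinearMap.sum_apply]
      refine sum_eq_zero fun i hi => ?_
      have := hgv n i (mem_range.1 hi)
      rw [LinearMap.compl₂_apply, LinearMap.mulLeft_apply] at this
      rw [map_C_mul_left, map_sub, this, sub_self, mul_zero]
    refine ⟨fun n k => if k < n ∧ n ≤ k + B.natDegree then ℓ (p n) (B * g k - s k) else 0,
      fun n k hnk => if_neg hnk, fun n => ⟨g n, ?_⟩⟩
    have hd : (B * g n - s n).degree < (n + 1 + B.natDegree : ℕ) := by
      refine (degree_sub_le _ _).trans_lt (max_lt ?_ ?_)
      · rw [degree_mul, degree_eq_natDegree hB]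
        rcases eq_or_ne (g n) 0 with h0 | h0
        · rw [h0]; simp
        · have h1 := hg n
          rw [degree_eq_natDegree h0] at h1 ⊢
          norm_cast at h1 ⊢
          omega
      · rw [h.degree_right]; exact_mod_cast (by omega)
    have he := h.expand_right hd
    rw [Finset.sum_range_add, sum_eq_zero (fun k hk => by
      rw [hgp n k (Nat.lt_succ_iff.1 (mem_range.1 hk)), C_0, zero_mul]), zero_add] at he
    rw [dressed, eq_comm, ← sub_eq_iff_eq_add']
    refine he.trans ?_
    rw [show Finset.Icc 1 B.natDegree = Finset.Ico 1 (B.natDegree + 1) from rfl,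
      Finset.sum_Ico_eq_sum_range, Nat.add_sub_cancel]
    refine sum_congr rfl fun j hj => ?_
    have := mem_range.1 hj
    rw [if_pos (by omega), add_assoc]
  · have key : ∀ n, dressed B.natDegree L s n = dressed B.natDegree L' s n := fun n => by
      obtain ⟨g, hg⟩ := (hL.dvd n).sub (hL'.dvd n)
      have h1 : g.degree < (n + 1 : ℕ) := degree_lt_of_mul hB (by
        rw [← hg]
        exact (degree_sub_le _ _).trans_lt (max_lt (degree_dressed_lt h.degree_right _ _ _)
          (degree_dressed_lt h.degree_right _ _ _)))
      have h2 := eq_zero_of_bimomentMinor_ne_zero (hm' (n + 1)) h1 fun i hi => by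
        rw [LinearMap.compl₂_apply, LinearMap.mulLeft_apply, ← hg]
        refine hX (n + 1) i hi _ fun k hk => ?_
        rw [map_sub, h.pair_dressed hL.band, h.pair_dressed hL'.band, hL.band k n (by omega),
          hL'.band k n (by omega), sub_self]
      rw [h2, mul_zero, sub_eq_zero] at hg
      exact hg
    ext i n
    have := congrArg (ℓ (p i)) (key n)
    rwa [h.pair_dressed hL.band, h.pair_dressed hL'.band, add_right_inj] at this

lemma IsBiorthonormal.existsUnique_isHatA
    (hB : B ≠ 0) (hdeg : B.natDegree + 1 ≤ A.natDegree) (hL : IsHatL B s Lh) :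
    ∃! Ah : ℕ → ℕ → ℂ, IsHatA A B s Lh Ah := by
  choose g hg hgd using hL.exists_quotient h.degree_right hB
  refine ⟨fun k n => ℓ (p k) (A * g n - B * derivative (g n)), ⟨fun k n hk => ?_, fun n => ?_⟩,
    fun Ah hA => ?_⟩
  · exact h.pair_eq_zero_right ((degree_sub_derivative_lt hdeg (hgd n)).trans_le
      (by exact_mod_cast (by omega)))
  · rw [hatA_eqn_iff hB (hg n)]
    exact (h.expand_right (degree_sub_derivative_lt hdeg (hgd n))).symm
  · ext k n
    have := hA.eqn n
    rw [hatA_eqn_iff hB (hg n)] at this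
    rw [← this, map_sum, sum_congr rfl fun j _ => by rw [map_C_mul, h.pair]]
    by_cases hk : k < n + A.natDegree + 1
    · simp [hk]
    · simp [hk, hA.support k n (by omega)]

lemma IsBiorthonormal.hatA_eq
    (hB : B ≠ 0) (hA : IsHatA A B s Lh Ah)
    (hℓ : ∀ q g : ℂ[X], ℓ q (A * g - B * derivative g) = ℓ (X * q) (B * g)) {n : ℕ} {g : ℂ[X]}
    (hg : dressed B.natDegree Lh s n = B * g) (k : ℕ) :
    Ah k n = ℓ (X * p k) (dressed B.natDegree Lh s n) := by
  have := hA.eqn n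
  rw [hatA_eqn_iff hB hg] at this
  rw [hg, ← hℓ, ← this, map_sum, sum_congr rfl fun j _ => by rw [map_C_mul, h.pair]]
  by_cases hk : k < n + A.natDegree + 1
  · simp [hk]
  · simp [hk, hA.support k n (by omega)]

lemma IsBiorthonormal.expand_hatP
    (hL : IsHatL B s Lh) {N : ℕ} {f : ℂ[X]} (hf : f.degree < N) :
    f = ∑ k ∈ range N, C (ℓ f (dressed B.natDegree Lh s k)) * hatP Lh p k := by
  have hp : ∀ i < N, p i = ∑ k ∈ range N,
      C (ℓ (p i) (dressed B.natDegree Lh s k)) * hatP Lh p k := fun i hi => by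
    rw [sum_congr rfl fun k _ => by rw [h.pair_dressed hL.band]]
    simp only [C_add, add_mul, sum_add_distrib]
    rw [Finset.sum_eq_single i (fun k _ hk => by rw [if_neg hk.symm]; simp)
      (fun hi' => absurd (mem_range.2 hi) hi')]
    conv_lhs => rw [← hatP_spec Lh p i]
    simp only [if_true, C_1, one_mul]
    congr 1
    refine sum_subset (Finset.range_mono hi.le) fun k _ hk => ?_
    rw [hL.band i k (by rw [mem_range] at hk; omega), C_0, zero_mul]
  have he := h.expand_left hf
  conv_lhs => rw [he, sum_congr rfl fun i hi => by rw [hp i (mem_range.1 hi)]]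
  simp only [mul_sum]
  rw [Finset.sum_comm]
  refine sum_congr rfl fun k _ => ?_
  conv_rhs => rw [he]
  rw [map_sum, LinearMap.sum_apply, map_sum, sum_mul]
  refine sum_congr rfl fun i _ => ?_
  rw [← mul_assoc, ← C_mul, map_C_mul_left]

/-! ### The Christoffel–Darboux pairing -/

lemma IsBiorthonormal.sum_cdMatrix (hB : B ≠ 0)
    (hdeg : B.natDegree + 1 ≤ A.natDegree)
    (hℓ : ∀ q g : ℂ[X], ℓ q (A * g - B * derivative g) = ℓ (X * q) (B * g))
    (hL : IsHatL B s Lh) (hA : IsHatA A B s Lh Ah) {n : ℕ} (hn : A.natDegree ≤ n) (x lam : ℂ)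
    (Φ Ψ : ℂ[X] →ₗ[ℂ] ℂ)
    (hΦ : ∀ g : ℂ[X], Φ (A * g - B * derivative g) = x * Φ (B * g) - lam * ℓ 1 (B * g))
    {K : ℂ[X]} (hK : K.degree < A.natDegree)
    (hΨ : ∀ q : ℂ[X], Ψ ((X - C x) * q) = -ℓ q K) :
    ∑ b : Fin (A.natDegree + 1), (∑ a : Fin (A.natDegree + 1), Φ (s (n - 1 + a)) *
        cdMatrix A.natDegree Lh Ah n x a b) * Ψ (hatP Lh p (n - A.natDegree + b))
      = -lam * Ψ 1 + Φ K := by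
  choose g hg hgd using hL.exists_quotient h.degree_right hB
  set d := A.natDegree with hd
  set M : ℕ → ℕ → ℂ := fun i k => Ah i k - x * Lh i k with hM
  have hAh := fun n k => h.hatA_eq hB hA hℓ (hg n) k
  have hXd : ∀ k : ℕ, (X * p k : ℂ[X]).degree < ((k + 2 : ℕ) : WithBot ℕ) := fun k => by
    rw [degree_mul, degree_X, h.degree_left]
    exact_mod_cast (by omega)
  have hband : ∀ m k, ¬(k ≤ m + 1 ∧ m ≤ k + d) → M m k = 0 := fun m k hmk => by
    have h1 : Ah m k = 0 := by
      by_cases h2 : k ≤ m + 1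
      · exact hA.support m k (by omega)
      · rw [hAh, h.expand_left (hXd m), map_sum, LinearMap.sum_apply]
        refine sum_eq_zero fun i hi => ?_
        have := mem_range.1 hi
        rw [map_C_mul_left, h.pair_dressed hL.band, if_neg (by omega), hL.band i k (by omega)]
        simp
    simp only [hM, h1, hL.band m k (by omega), mul_zero, sub_zero]
  have hcomm : ∀ m k, ¬((n - 1 ≤ m ∧ m ≤ n - 1 + d) ∧ n - d ≤ k ∧ k ≤ n - d + d) →
      commProj M n m k = 0 := fun m k hmk => by
    by_cases hb : k ≤ m + 1 ∧ m ≤ k + d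
    · have : k < n ↔ m < n := by omega
      simp only [commProj, projDiag, this]
      ring
    · simp [commProj, hband m k hb]
  set N := n + d with hN
  have hcol : ∀ k < n, ∑ m ∈ range N, Φ (s m) * M m k =
      x * Φ (s k) - lam * ℓ 1 (dressed B.natDegree Lh s k) := fun k hk => by
    have h1 : ∑ m ∈ range N, Φ (s m) * Ah m k = Φ (A * g k - B * derivative (g k)) := by
      have := hA.eqn k
      rw [hatA_eqn_iff hB (hg k)] at this
      rw [← this, map_sum]
      rw [← sum_subset (Finset.range_mono (show k + d + 1 ≤ N by omega)) (fun m _ hm => by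
        rw [hA.support m k (by rw [mem_range] at hm; omega), mul_zero])]
      exact sum_congr rfl fun m _ => by rw [map_C_mul, mul_comm]
    have h2 : ∑ m ∈ range N, Φ (s m) * Lh m k = Φ (B * g k) - Φ (s k) := by
      have hd' : (B * g k - s k).degree < N := by
        refine (degree_sub_le _ _).trans_lt (max_lt ?_ ?_)
        · rw [← hg]
          exact (degree_dressed_lt h.degree_right _ _ _).trans_le (by exact_mod_cast (by omega))
        · rw [h.degree_right]; exact_mod_cast (by omega)
      rw [← map_sub, h.expand_right hd', map_sum]
      refine sum_congr rfl fun m _ => ?_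
      rw [map_C_mul, map_sub, ← hg, h.pair_dressed hL.band, h.pair]
      ring
    simp only [hM, mul_sub, sum_sub_distrib, h1, hΦ]
    have h3 : ∑ m ∈ range N, Φ (s m) * (x * Lh m k) = x * ∑ m ∈ range N, Φ (s m) * Lh m k := by
      rw [mul_sum]; exact sum_congr rfl fun _ _ => by ring
    rw [h3, h2, hg]
    ring
  have hrow : ∀ m < n, ∑ k ∈ range N, M m k * Ψ (hatP Lh p k) =
      x * Ψ (hatP Lh p m) - ℓ (p m) K := fun m hm => by
    have h1 : ∑ k ∈ range N, C (Ah m k) * hatP Lh p k = X * p m := by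
      rw [sum_congr rfl fun k _ => by rw [hAh]]
      exact (h.expand_hatP hL ((hXd m).trans_le (by exact_mod_cast (by omega)))).symm
    have h2 : ∑ k ∈ range N, C (Lh m k) * hatP Lh p k = p m - hatP Lh p m := by
      rw [eq_sub_iff_add_eq', ← hatP_spec Lh p m]
      congr 1
      exact (sum_subset (Finset.range_mono (show m ≤ N by omega)) fun k _ hk => by
        rw [hL.band m k (by rw [mem_range] at hk; omega), C_0, zero_mul]).symm
    have h3 : ∑ k ∈ range N, M m k * Ψ (hatP Lh p k) = Ψ ((X - C x) * p m + C x * hatP Lh p m) := by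
      have : (X - C x) * p m + C x * hatP Lh p m = ∑ k ∈ range N, C (M m k) * hatP Lh p k := by
        simp only [hM, C_sub, C_mul, sub_mul, sum_sub_distrib, mul_assoc, ← mul_sum, h1, h2]
        ring
      rw [this, map_sum]
      exact sum_congr rfl fun k _ => (map_C_mul _ _ _).symm
    rw [h3, map_add, hΨ, map_C_mul]
    ring
  have hS : ∑ b : Fin (d + 1), (∑ a : Fin (d + 1), Φ (s (n - 1 + a)) *
        cdMatrix d Lh Ah n x a b) * Ψ (hatP Lh p (n - d + b)) =
      ∑ k ∈ range N, (∑ m ∈ range N, Φ (s m) * commProj M n m k) * Ψ (hatP Lh p k) := by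
    rw [← sum_window (d := d) (m := n - d) (by omega) (fun k =>
      (∑ m ∈ range N, Φ (s m) * commProj M n m k) * Ψ (hatP Lh p k)) (fun k hk => by
        rw [sum_eq_zero (fun m _ => by rw [hcomm m k (by tauto), mul_zero]), zero_mul])]
    refine sum_congr rfl fun b _ => ?_
    rw [← sum_window (d := d) (m := n - 1) (by omega) (fun m =>
      Φ (s m) * commProj M n m (n - d + b)) (fun m hm => by rw [hcomm m _ (by tauto), mul_zero])]
    rfl
  have hsplit : ∀ F : ℕ → ℂ, ∑ k ∈ range N, projDiag n k * F k = ∑ k ∈ range n, F k := fun F => by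
    rw [← sum_subset (Finset.range_mono (show n ≤ N by omega)) (fun k _ hk => by
      rw [projDiag, if_neg (by rwa [mem_range] at hk), zero_mul])]
    exact sum_congr rfl fun k hk => by rw [projDiag, if_pos (mem_range.1 hk), one_mul]
  have h1 : ∑ k ∈ range N, (∑ m ∈ range N, Φ (s m) * commProj M n m k) * Ψ (hatP Lh p k) =
      ∑ k ∈ range n, (∑ m ∈ range N, Φ (s m) * M m k) * Ψ (hatP Lh p k) -
      ∑ m ∈ range n, Φ (s m) * ∑ k ∈ range N, M m k * Ψ (hatP Lh p k) := by
    rw [← hsplit, ← hsplit]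
    have e2 : ∑ m ∈ range N, projDiag n m * (Φ (s m) * ∑ k ∈ range N,
        M m k * Ψ (hatP Lh p k)) = ∑ k ∈ range N, ∑ m ∈ range N,
        projDiag n m * (Φ (s m) * (M m k * Ψ (hatP Lh p k))) := by
      rw [Finset.sum_comm]
      exact sum_congr rfl fun m _ => by simp only [mul_sum]
    rw [e2, ← sum_sub_distrib]
    refine sum_congr rfl fun k _ => ?_
    rw [sum_mul, sum_mul, mul_sum, ← sum_sub_distrib]
    exact sum_congr rfl fun m _ => by simp only [commProj]; ring
  have hone := h.expand_hatP hL (N := n) (f := 1) (by rw [degree_one]; exact_mod_cast (by omega))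
  have e1 : ∑ m ∈ range n, Φ (s m) * ∑ k ∈ range N, M m k * Ψ (hatP Lh p k) =
      ∑ m ∈ range n, Φ (s m) * (x * Ψ (hatP Lh p m) - ℓ (p m) K) :=
    sum_congr rfl fun m hm => by rw [hrow m (mem_range.1 hm)]
  rw [hS, h1, e1, sum_congr rfl fun k hk => by rw [hcol k (mem_range.1 hk)]]
  have e3 : Ψ 1 = ∑ k ∈ range n, ℓ 1 (dressed B.natDegree Lh s k) * Ψ (hatP Lh p k) := by
    conv_lhs => rw [hone, map_sum]
    exact sum_congr rfl fun k _ => map_C_mul _ _ _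
  have e4 : Φ K = ∑ m ∈ range n, ℓ (p m) K * Φ (s m) := by
    conv_lhs => rw [h.expand_right (hK.trans_le (by exact_mod_cast hn)), map_sum]
    exact sum_congr rfl fun k _ => map_C_mul _ _ _
  rw [e3, e4, ← sum_sub_distrib, mul_sum, ← sum_add_distrib]
  exact sum_congr rfl fun k _ => by ring

end Biorthogonal

/-! ### The bimoment functional as a bilinear form -/

lemma natDegree_directNum {A B : ℂ[X]} (h : IsTypeBB A B) :
    (directNum A B).natDegree = A.natDegree := by
  have h1 := h.degree_lt
  have h2 := natDegree_derivative_le B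
  rw [natDegree_neg, natDegree_add_eq_left_of_natDegree_lt (by omega)]

lemma IsTypeBB.le_directNum {A B : ℂ[X]} (h : IsTypeBB A B) :
    B.natDegree + 1 ≤ (directNum A B).natDegree := by rw [natDegree_directNum h]; exact h.degree_lt

section Laplace

variable {P B : ℂ[X]} {w : Branch P B}

/-- The Fourier–Laplace transform as a linear functional of the polynomial. -/
def Contour.laplace (γ : Contour w) (hB : B ≠ 0) (hdeg : B.natDegree + 1 ≤ P.natDegree) (ξ : ℂ) :
    ℂ[X] →ₗ[ℂ] ℂ where
  toFun q := γ.moment fun y => q.eval y * exp (ξ * y)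
  map_add' p q := by
    simp only [eval_add, add_mul]
    exact γ.moment_add hB hdeg ((ExpGrowth.eval p).mul (ExpGrowth.exp ξ))
      ((ExpGrowth.eval q).mul (ExpGrowth.exp ξ))
  map_smul' a q := by
    simp only [eval_smul, smul_eq_mul, mul_assoc, RingHom.id_apply]
    exact γ.moment_const_mul a _

lemma Contour.laplace_apply (γ : Contour w) (hB : B ≠ 0)
    (hdeg : B.natDegree + 1 ≤ P.natDegree) (ξ : ℂ) (q : ℂ[X]) :
    γ.laplace hB hdeg ξ q = γ.moment fun y => q.eval y * exp (ξ * y) := rfl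

lemma Contour.hasDerivAt_laplace (γ : Contour w) (hB : B ≠ 0)
    (hdeg : B.natDegree + 1 ≤ P.natDegree) (ξ : ℂ) (q : ℂ[X]) :
    HasDerivAt (fun ξ => γ.laplace hB hdeg ξ q) (γ.laplace hB hdeg ξ (X * q)) ξ := by
  have := γ.hasDerivAt_moment hB hdeg (ExpGrowth.eval q) ξ
  simp only [Contour.laplace_apply, eval_mul, eval_X]
  exact this

lemma Contour.laplace_ibp {A : ℂ[X]} {w : Branch (directNum A B) B} (γ : Contour w)
    (hB : B ≠ 0) (hdeg : B.natDegree + 1 ≤ (directNum A B).natDegree) (ξ : ℂ) (g : ℂ[X]) :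
    γ.laplace hB hdeg ξ (A * g - B * derivative g) = ξ * γ.laplace hB hdeg ξ (B * g) := by
  have h := γ.moment_deriv_eq_zero hB hdeg g ξ
  rw [← Contour.laplace_apply γ hB hdeg] at h
  rw [← map_C_mul, ← sub_eq_zero, ← map_sub, ← neg_eq_zero, ← map_neg, ← h]
  congr 1
  ring

end Laplace

section Functional

variable {P₁ B₁ A₂ B₂ : ℂ[X]} {d₁ d₂ : ℕ} (X' : ContourSystem P₁ B₁ d₁)
  (Y : ContourSystem (directNum A₂ B₂) B₂ d₂) (h₂ : IsTypeBB A₂ B₂)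
  (κ : Matrix (Fin d₁) (Fin d₂) ℂ)

/-- The inner integral as a linear functional. -/
def innerFunctional (μ : Fin d₁) (ξ : ℂ) : ℂ[X] →ₗ[ℂ] ℂ :=
  ∑ ν, κ μ ν • (Y.contour ν).laplace h₂.ne_zero h₂.le_directNum ξ

lemma innerIntegral_eq (μ : Fin d₁) (ξ a : ℂ) (q : ℂ[X]) :
    innerIntegral Y κ μ (fun y => a * q.eval y) ξ = a * innerFunctional Y h₂ κ μ ξ q := by
  simp only [innerIntegral, innerFunctional, LinearMap.sum_apply, LinearMap.smul_apply,
    smul_eq_mul, mul_sum, Contour.laplace_apply]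
  refine sum_congr rfl fun ν _ => ?_
  rw [mul_left_comm, ← Contour.moment_const_mul]
  simp only [Contour.moment, mul_assoc]

lemma innerIntegral_eval (μ : Fin d₁) (ξ : ℂ) (q : ℂ[X]) :
    innerIntegral Y κ μ (fun y => q.eval y) ξ = innerFunctional Y h₂ κ μ ξ q := by
  have := innerIntegral_eq Y h₂ κ μ ξ 1 q
  simpa only [one_mul] using this

lemma innerFunctional_ibp (μ : Fin d₁) (ξ : ℂ) (g : ℂ[X]) :
    innerFunctional Y h₂ κ μ ξ (A₂ * g - B₂ * derivative g) =
      ξ * innerFunctional Y h₂ κ μ ξ (B₂ * g) := by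
  simp only [innerFunctional, LinearMap.sum_apply, LinearMap.smul_apply, smul_eq_mul,
    mul_sum, Contour.laplace_ibp]
  exact sum_congr rfl fun ν _ => mul_left_comm _ _ _

lemma continuous_innerFunctional (μ : Fin d₁) (q : ℂ[X]) :
    Continuous fun ξ => innerFunctional Y h₂ κ μ ξ q := by
  simp only [innerFunctional, LinearMap.sum_apply, LinearMap.smul_apply, smul_eq_mul]
  refine continuous_finsetSum _ fun ν _ => continuous_const.mul ?_
  exact continuous_iff_continuousAt.2 fun ξ =>
    ((Y.contour ν).hasDerivAt_laplace h₂.ne_zero h₂.le_directNum ξ q).continuousAt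

/-- Functions of polynomial growth on the contours `Γ_{x,μ}`. -/
structure PolyAmp (a : ℂ → ℂ) : Prop where
  continuousOn : ∀ μ, ContinuousOn (fun t => a ((X'.contour μ).curve t)) (Ioo 0 1)
  bound : ∃ C : ℝ, ∃ N : ℕ, ∀ μ, ∀ t ∈ Ioo (0 : ℝ) 1,
    ‖a ((X'.contour μ).curve t)‖ ≤ C * (1 + ‖(X'.contour μ).curve t‖) ^ N

variable {X'}

lemma exists_norm_eval_le (p : ℂ[X]) : ∃ C : ℝ, 0 ≤ C ∧ ∃ N : ℕ, ∀ z : ℂ,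
    ‖p.eval z‖ ≤ C * (1 + ‖z‖) ^ N := by
  induction p using Polynomial.induction_on' with
  | add p q hp hq =>
    obtain ⟨C, hC, N, h⟩ := hp
    obtain ⟨C', hC', N', h'⟩ := hq
    refine ⟨C + C', by positivity, max N N', fun z => ?_⟩
    have h1 : 1 ≤ 1 + ‖z‖ := by linarith [norm_nonneg z]
    rw [eval_add, add_mul]
    refine (norm_add_le _ _).trans (add_le_add ((h z).trans ?_) ((h' z).trans ?_))
    · gcongr
      exact le_max_left _ _
    · gcongr
      exact le_max_right _ _
  | monomial n a =>
    refine ⟨‖a‖, norm_nonneg _, n, fun z => ?_⟩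
    rw [eval_monomial, norm_mul, norm_pow]
    gcongr
    linarith

lemma PolyAmp.eval (p : ℂ[X]) : PolyAmp X' fun ξ => p.eval ξ := by
  obtain ⟨C, -, N, h⟩ := exists_norm_eval_le p
  exact ⟨fun μ => p.continuous.comp_continuousOn (X'.contour μ).piecewise.continuousOn,
    C, N, fun μ t _ => h _⟩

lemma PolyAmp.mul {a b : ℂ → ℂ} (ha : PolyAmp X' a) (hb : PolyAmp X' b) :
    PolyAmp X' fun ξ => a ξ * b ξ := by
  obtain ⟨C, N, h⟩ := ha.bound
  obtain ⟨C', N', h'⟩ := hb.bound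
  refine ⟨fun μ => (ha.continuousOn μ).mul (hb.continuousOn μ), C * C', N + N', fun μ t ht => ?_⟩
  rw [norm_mul]
  calc _ ≤ (C * (1 + ‖(X'.contour μ).curve t‖) ^ N) * (C' * (1 + ‖(X'.contour μ).curve t‖) ^ N') :=
        mul_le_mul (h μ t ht) (h' μ t ht) (norm_nonneg _) ((norm_nonneg _).trans (h μ t ht))
    _ = _ := by ring

lemma regularPoints.exists_dist {x : ℂ} (hx : x ∈ regularPoints X') :
    ∃ δ : ℝ, 0 < δ ∧ ∀ μ, ∀ t ∈ Ioo (0 : ℝ) 1, δ ≤ ‖x - (X'.contour μ).curve t‖ := by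
  have h1 : ∀ μ, ∃ δ : ℝ, 0 < δ ∧ ∀ t ∈ Ioo (0 : ℝ) 1, δ ≤ ‖x - (X'.contour μ).curve t‖ :=
    fun μ => by
      have := hx.2 μ
      rw [Metric.mem_closure_iff] at this
      push Not at this
      obtain ⟨δ, hδ, h⟩ := this
      exact ⟨δ, hδ, fun t ht => by rw [← dist_eq_norm]; exact h _ (Set.mem_image_of_mem _ ht)⟩
  choose δ hδ h using h1
  rcases isEmpty_or_nonempty (Fin d₁) with he | he
  · exact ⟨1, one_pos, fun μ => he.elim μ⟩
  · refine ⟨Finset.univ.inf' Finset.univ_nonempty δ, ?_, fun μ t ht =>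
      (Finset.inf'_le _ (Finset.mem_univ μ)).trans (h μ t ht)⟩
    rw [Finset.lt_inf'_iff]
    exact fun μ _ => hδ μ

lemma PolyAmp.inv_sub {x : ℂ} (hx : x ∈ regularPoints X') : PolyAmp X' fun ξ => (x - ξ)⁻¹ := by
  obtain ⟨δ, hδ, h⟩ := regularPoints.exists_dist hx
  refine ⟨fun μ => (continuousOn_const.sub (X'.contour μ).piecewise.continuousOn).inv₀
    fun t ht => ?_, δ⁻¹, 0, fun μ t ht => ?_⟩
  · rw [← norm_pos_iff]; exact hδ.trans_le (h μ t ht)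
  · rw [norm_inv, pow_zero, mul_one]
    exact inv_anti₀ hδ (h μ t ht)

variable (hconv : BimomentsConverge X' Y κ)

include hconv in
lemma PolyAmp.integrableOn {a : ℂ → ℂ} (ha : PolyAmp X' a) (μ : Fin d₁) (q : ℂ[X]) :
    IntegrableOn (fun t => X'.branch.W ((X'.contour μ).curve t) *
      (a ((X'.contour μ).curve t) * innerFunctional Y h₂ κ μ ((X'.contour μ).curve t) q) *
      deriv (X'.contour μ).curve t) (Ioo 0 1) := by
  have hpow : ∀ i : ℕ, IntegrableOn (fun t => (X'.contour μ).curve t ^ i *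
      X'.branch.W ((X'.contour μ).curve t) * innerFunctional Y h₂ κ μ ((X'.contour μ).curve t) q *
      deriv (X'.contour μ).curve t) (Ioo 0 1) := fun i => by
    induction q using Polynomial.induction_on' with
    | add p q hp hq =>
      refine (hp.add hq).congr_fun (fun t _ => ?_) measurableSet_Ioo
      simp only [map_add, Pi.add_apply]
      ring
    | monomial n c =>
      have h := hconv μ i n
      have e : ∀ ξ, innerIntegral Y κ μ (fun y => y ^ n) ξ =
          innerFunctional Y h₂ κ μ ξ (X ^ n) := fun ξ => by rw [← innerIntegral_eval]; simp
      simp only [e] at h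
      refine (Integrable.const_mul h c).congr (ae_of_all _ fun t => ?_)
      simp only [← C_mul_X_pow_eq_monomial, map_C_mul]
      ring
  obtain ⟨C, N, hC⟩ := ha.bound
  have hdom : IntegrableOn (fun t => |C| * ∑ i ∈ range (N + 1), (N.choose i : ℝ) *
      ‖(X'.contour μ).curve t ^ i * X'.branch.W ((X'.contour μ).curve t) *
      innerFunctional Y h₂ κ μ ((X'.contour μ).curve t) q *
      deriv (X'.contour μ).curve t‖) (Ioo 0 1) :=
    Integrable.const_mul (integrable_finsetSum _ fun i _ => Integrable.const_mul (hpow i).norm _) _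
  refine Integrable.mono' hdom ?_ ?_
  · refine AEStronglyMeasurable.mul (ContinuousOn.aestronglyMeasurable ?_ measurableSet_Ioo)
      (X'.contour μ).piecewise.locallyIntegrable.aestronglyMeasurable
    exact (X'.contour μ).continuousOn_weight.mul ((ha.continuousOn μ).mul
      ((continuous_innerFunctional Y h₂ κ μ q).comp_continuousOn
        (X'.contour μ).piecewise.continuousOn))
  · refine (ae_restrict_iff' measurableSet_Ioo).2 (ae_of_all _ fun t ht => ?_)
    have h1 : ‖a ((X'.contour μ).curve t)‖ ≤ |C| * ∑ i ∈ range (N + 1),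
        (N.choose i : ℝ) * ‖(X'.contour μ).curve t‖ ^ i := by
      refine (hC μ t ht).trans ?_
      have : (1 + ‖(X'.contour μ).curve t‖) ^ N = ∑ i ∈ range (N + 1),
        (N.choose i : ℝ) * ‖(X'.contour μ).curve t‖ ^ i := by
        rw [add_comm, add_pow]
        exact sum_congr rfl fun i _ => by ring
      rw [← this]
      gcongr
      exact le_abs_self C
    simp only [norm_mul, norm_pow]
    calc _ ≤ ‖X'.branch.W ((X'.contour μ).curve t)‖ * ((|C| * ∑ i ∈ range (N + 1),
        (N.choose i : ℝ) * ‖(X'.contour μ).curve t‖ ^ i) *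
          ‖innerFunctional Y h₂ κ μ ((X'.contour μ).curve t) q‖) *
          ‖deriv (X'.contour μ).curve t‖ := by gcongr
      _ = _ := by
        simp only [mul_sum, sum_mul]
        exact sum_congr rfl fun i _ => by ring

variable (X') in
/-- The pairing `∫∫_κ a(ξ) q(y) e^{-V₁(ξ) - V₂(y) + ξ y} dξ dy` of an amplitude and a polynomial. -/
def ampPairing (a : ℂ → ℂ) (q : ℂ[X]) : ℂ := doubleIntegral X' Y κ fun ξ y => a ξ * q.eval y

lemma ampPairing_eq (a : ℂ → ℂ) (q : ℂ[X]) : ampPairing X' Y κ a q =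
    ∑ μ, (X'.contour μ).integral fun ξ => X'.branch.W ξ * (a ξ * innerFunctional Y h₂ κ μ ξ q) := by
  simp only [ampPairing, doubleIntegral, innerIntegral_eq Y h₂]

include h₂

include hconv in
lemma ampPairing_add_left {a b : ℂ → ℂ} (ha : PolyAmp X' a) (hb : PolyAmp X' b) (q : ℂ[X]) :
    ampPairing X' Y κ (fun ξ => a ξ + b ξ) q = ampPairing X' Y κ a q + ampPairing X' Y κ b q := by
  simp only [ampPairing_eq Y h₂, Contour.integral]
  rw [← sum_add_distrib]
  refine sum_congr rfl fun μ _ => ?_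
  rw [← integral_add (ha.integrableOn Y h₂ κ hconv μ q) (hb.integrableOn Y h₂ κ hconv μ q)]
  congr 1; ext t; ring

lemma ampPairing_const_mul (c : ℂ) (a : ℂ → ℂ) (q : ℂ[X]) :
    ampPairing X' Y κ (fun ξ => c * a ξ) q = c * ampPairing X' Y κ a q := by
  simp only [ampPairing_eq Y h₂, Contour.integral]
  rw [mul_sum]
  refine sum_congr rfl fun μ _ => ?_
  rw [← integral_const_mul]
  congr 1; ext t; ring

include hconv in
lemma ampPairing_add_right {a : ℂ → ℂ} (ha : PolyAmp X' a) (p q : ℂ[X]) :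
    ampPairing X' Y κ a (p + q) = ampPairing X' Y κ a p + ampPairing X' Y κ a q := by
  simp only [ampPairing_eq Y h₂, Contour.integral]
  rw [← sum_add_distrib]
  refine sum_congr rfl fun μ _ => ?_
  rw [← integral_add (ha.integrableOn Y h₂ κ hconv μ p) (ha.integrableOn Y h₂ κ hconv μ q)]
  congr 1; ext t; rw [map_add]; ring

lemma ampPairing_smul_right (c : ℂ) (a : ℂ → ℂ) (q : ℂ[X]) :
    ampPairing X' Y κ a (c • q) = c * ampPairing X' Y κ a q := by
  rw [← ampPairing_const_mul Y h₂]
  simp only [ampPairing_eq Y h₂, map_smul, smul_eq_mul]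
  refine sum_congr rfl fun μ _ => congrArg _ (funext fun ξ => ?_)
  ring

lemma ampPairing_ibp (a : ℂ → ℂ) (g : ℂ[X]) : ampPairing X' Y κ a (A₂ * g - B₂ * derivative g) =
      ampPairing X' Y κ (fun ξ => ξ * a ξ) (B₂ * g) := by
  simp only [ampPairing_eq Y h₂, innerFunctional_ibp]
  refine sum_congr rfl fun μ _ => congrArg _ (funext fun ξ => ?_)
  ring

lemma ampPairing_congr {a b : ℂ → ℂ}
    (h : ∀ μ, ∀ t ∈ Ioo (0 : ℝ) 1, a ((X'.contour μ).curve t) = b ((X'.contour μ).curve t))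
    (q : ℂ[X]) : ampPairing X' Y κ a q = ampPairing X' Y κ b q := by
  simp only [ampPairing_eq Y h₂, Contour.integral]
  refine sum_congr rfl fun μ _ => setIntegral_congr_fun measurableSet_Ioo fun t ht => ?_
  simp only [h μ t ht]

/-- The linear functional `q ↦ ∫∫_κ a(ξ) q(y) …`. -/
def ampFunctional {a : ℂ → ℂ} (ha : PolyAmp X' a) : ℂ[X] →ₗ[ℂ] ℂ where
  toFun := ampPairing X' Y κ a
  map_add' := ampPairing_add_right Y h₂ κ hconv ha
  map_smul' c q := ampPairing_smul_right Y h₂ κ c a q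

/-- The functional `𝓛` as a bilinear map. -/
def bilinearFunctional : ℂ[X] →ₗ[ℂ] ℂ[X] →ₗ[ℂ] ℂ :=
  LinearMap.mk₂ ℂ (fun p q => ampPairing X' Y κ (fun ξ => p.eval ξ) q) (fun p p' q => by
      simp only [eval_add]
      exact ampPairing_add_left Y h₂ κ hconv (PolyAmp.eval p) (PolyAmp.eval p') q)
    (fun c p q => by
      simp only [eval_smul, smul_eq_mul]
      exact ampPairing_const_mul Y h₂ κ c _ q)
    (fun p q q' => ampPairing_add_right Y h₂ κ hconv (PolyAmp.eval p) q q')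
    (fun c p q => ampPairing_smul_right Y h₂ κ c _ q)

lemma bilinearFunctional_ibp (q g : ℂ[X]) :
    bilinearFunctional Y h₂ κ hconv q (A₂ * g - B₂ * derivative g) =
      bilinearFunctional Y h₂ κ hconv (X * q) (B₂ * g) := by
  refine (ampPairing_ibp Y h₂ κ _ g).trans ?_
  simp only [bilinearFunctional, LinearMap.mk₂_apply, eval_mul, eval_X]

end Functional

/-! ### Absolute convergence of the bimoments -/

lemma bimomentsConverge {A₁ B₁ A₂ B₂ : ℂ[X]} {d₁ d₂ : ℕ} (h₁ : IsTypeBB A₁ B₁)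
    (h₂ : IsTypeBB A₂ B₂) (X' : ContourSystem (directNum A₁ B₁) B₁ d₁)
    (Y : ContourSystem (directNum A₂ B₂) B₂ d₂) (κ : Matrix (Fin d₁) (Fin d₂) ℂ)
    (h : A₁.natDegree = B₁.natDegree + 1 → A₂.natDegree = B₂.natDegree + 1 →
      BimomentsConverge X' Y κ) : BimomentsConverge X' Y κ := by
  by_cases hh : A₁.natDegree = B₁.natDegree + 1 ∧ A₂.natDegree = B₂.natDegree + 1
  · exact h hh.1 hh.2
  intro μ i j
  obtain ⟨ε, hε, hI⟩ := (X'.contour μ).exists_integrableOn h₁.ne_zero h₁.le_directNum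
  choose δ₀ hδ₀ hM using fun ν => (Y.contour ν).exists_moment_le h₂.ne_zero h₂.le_directNum
    (ExpGrowth.eval (X ^ j))
  have hcase : ∃ δ : ℝ, 0 < δ ∧ (∀ ν, δ₀ ν ≤ δ ∨ B₂.natDegree + 2 ≤ (directNum A₂ B₂).natDegree) ∧
      (2 * δ ≤ ε ∨ B₁.natDegree + 2 ≤ (directNum A₁ B₁).natDegree) := by
    have e1 := natDegree_directNum h₁
    have e2 := natDegree_directNum h₂
    have l1 := h₁.degree_lt
    have l2 := h₂.degree_lt
    by_cases h3 : A₁.natDegree = B₁.natDegree + 1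
    · exact ⟨ε / 2, by positivity, fun ν => Or.inr (by omega), Or.inl (by linarith)⟩
    · refine ⟨1 + ∑ ν, δ₀ ν, ?_, fun ν => Or.inl ?_, Or.inr (by omega)⟩
      · have := Finset.sum_nonneg fun ν (_ : ν ∈ Finset.univ) => (hδ₀ ν).le
        linarith
      · have := Finset.single_le_sum (fun ν _ => (hδ₀ ν).le) (Finset.mem_univ ν)
        linarith
  obtain ⟨δ, hδ, hδY, hδX⟩ := hcase
  choose K hK using fun ν => hM ν δ hδ (hδY ν)
  have hin : ∀ ξ, ‖innerIntegral Y κ μ (fun y => y ^ j) ξ‖ ≤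
      (∑ ν, ‖κ μ ν‖ * K ν) * rexp (δ * ‖ξ‖ ^ 2) := fun ξ => by
    rw [innerIntegral, sum_mul]
    refine (norm_sum_le _ _).trans (Finset.sum_le_sum fun ν _ => ?_)
    rw [norm_mul, mul_assoc]
    gcongr
    have := hK ν ξ
    simp only [eval_pow, eval_X] at this
    exact this
  have hpow : ∀ r : ℝ, 0 ≤ r → r ^ i ≤ i.factorial * rexp (1 / (4 * δ)) *
      rexp (δ * r ^ 2) := fun r hr => by
    have h1 := Real.pow_div_factorial_le_exp r hr i
    rw [div_le_iff₀ (by positivity)] at h1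
    have h2 : r ≤ 1 / (4 * δ) + δ * r ^ 2 := by
      have : 0 ≤ (2 * δ * r - 1) ^ 2 / (4 * δ) := by positivity
      have e : (2 * δ * r - 1) ^ 2 / (4 * δ) = 1 / (4 * δ) + δ * r ^ 2 - r := by field_simp; ring
      linarith
    calc r ^ i ≤ rexp r * i.factorial := h1
      _ ≤ rexp (1 / (4 * δ) + δ * r ^ 2) * i.factorial := by gcongr
      _ = _ := by rw [Real.exp_add]; ring
  set S := ∑ ν, ‖κ μ ν‖ * K ν with hS
  refine Integrable.mono' ((hI (2 * δ) hδX).norm.const_mul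
    (i.factorial * rexp (1 / (4 * δ)) * |S|)) ?_ ?_
  · refine AEStronglyMeasurable.mul (ContinuousOn.aestronglyMeasurable ?_ measurableSet_Ioo)
      (X'.contour μ).piecewise.locallyIntegrable.aestronglyMeasurable
    have hg := (X'.contour μ).piecewise.continuousOn
    have e : (fun ξ => innerIntegral Y κ μ (fun y => y ^ j) ξ) =
        fun ξ => innerFunctional Y h₂ κ μ ξ (X ^ j) := by ext ξ; rw [← innerIntegral_eval]; simp
    have hc : Continuous fun ξ => innerIntegral Y κ μ (fun y => y ^ j) ξ := by
      rw [e]; exact continuous_innerFunctional Y h₂ κ μ _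
    exact ((hg.pow i).mul (X'.contour μ).continuousOn_weight).mul (hc.comp_continuousOn hg)
  · refine ae_of_all _ fun t => ?_
    simp only [norm_mul, norm_pow, norm_real, norm_of_nonneg (exp_pos _).le]
    set r := ‖(X'.contour μ).curve t‖
    calc _ ≤ (i.factorial * rexp (1 / (4 * δ)) * rexp (δ * r ^ 2)) *
          ‖X'.branch.W ((X'.contour μ).curve t)‖ * (|S| * rexp (δ * r ^ 2)) *
          ‖deriv (X'.contour μ).curve t‖ := by
          gcongr
          · exact hpow r (norm_nonneg _)
          · refine (hin _).trans ?_
            gcongr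
            exact le_abs_self S
      _ = _ := by rw [mul_assoc 2 δ, two_mul, Real.exp_add]; ring

/-! ### The kernel as a polynomial in `y` -/

/-- `f(y, s)` is a polynomial in `y` of degree less than `N` whose coefficients are polynomials
in `s`. -/
def IsPolyKernel (N : ℕ) (f : ℂ → ℂ → ℂ) : Prop :=
  ∃ K : ℕ → ℂ[X], ∀ y s, f y s = ∑ k ∈ range N, (K k).eval s * y ^ k

namespace IsPolyKernel

variable {N : ℕ} {f g : ℂ → ℂ → ℂ}

lemma zero : IsPolyKernel N fun _ _ => 0 := ⟨0, by simp⟩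

lemma add (hf : IsPolyKernel N f) (hg : IsPolyKernel N g) :
    IsPolyKernel N fun y s => f y s + g y s := by
  obtain ⟨K, hK⟩ := hf
  obtain ⟨K', hK'⟩ := hg
  refine ⟨fun k => K k + K' k, fun y s => ?_⟩
  simp only [hK, hK', eval_add, add_mul, sum_add_distrib]

lemma mul_left (hf : IsPolyKernel N f) (p : ℂ[X]) :
    IsPolyKernel N fun y s => p.eval s * f y s := by
  obtain ⟨K, hK⟩ := hf
  refine ⟨fun k => p * K k, fun y s => ?_⟩
  simp only [hK, eval_mul, mul_sum, mul_assoc]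

lemma mono {M : ℕ} (hf : IsPolyKernel N f) (h : N ≤ M) : IsPolyKernel M f := by
  obtain ⟨K, hK⟩ := hf
  refine ⟨fun k => if k < N then K k else 0, fun y s => ?_⟩
  rw [hK, ← sum_subset (Finset.range_mono h) (fun k _ hk => by
    beta_reduce
    rw [if_neg (by simpa using hk), eval_zero, zero_mul])]
  refine sum_congr rfl fun k hk => ?_
  beta_reduce
  rw [if_pos (mem_range.1 hk)]

lemma eval_left (p : ℂ[X]) (hp : p.natDegree < N) : IsPolyKernel N fun y _ => p.eval y :=
  ⟨fun k => C (p.coeff k), fun y s => by simp [eval_eq_sum_range' hp]⟩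

lemma eval_right (p : ℂ[X]) (hN : 0 < N) : IsPolyKernel N fun _ s => p.eval s :=
  mono (N := 1) ⟨fun _ => p, fun y s => by simp⟩ hN

lemma sub (hf : IsPolyKernel N f) (hg : IsPolyKernel N g) :
    IsPolyKernel N fun y s => f y s - g y s := by
  have := hf.add (hg.mul_left (C (-1)))
  simpa [sub_eq_add_neg] using this

lemma mul_sub (hf : IsPolyKernel N f) : IsPolyKernel (N + 1) fun y s => (y - s) * f y s := by
  have h1 : IsPolyKernel (N + 1) fun y s => y * f y s := by
    obtain ⟨K, hK⟩ := hf
    refine ⟨fun k => if k = 0 then 0 else K (k - 1), fun y s => ?_⟩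
    beta_reduce
    rw [Finset.sum_range_succ', hK, mul_sum]
    simp only [Nat.add_eq_zero_iff, one_ne_zero, and_false, if_false, if_true, eval_zero, zero_mul,
      add_zero, Nat.add_sub_cancel]
    exact sum_congr rfl fun k _ => by ring
  have := h1.sub ((hf.mono N.le_succ).mul_left X)
  simpa only [eval_X, sub_mul] using this

end IsPolyKernel

lemma taylor_X_mul (Q : ℂ[X]) (s : ℂ) : taylor s (Q * X) = taylor s Q * X + C s * taylor s Q := by
  simp only [taylor_mul, taylor_X]
  ring

lemma divX_mul_X_self (Q : ℂ[X]) : (Q * X).divX = Q := by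
  ext n
  rw [coeff_divX, coeff_mul_X]

lemma taylor_divX_step (Q : ℂ[X]) (s y : ℂ) : (taylor s Q).divX.eval (y - s) =
      Q.divX.eval y + s * (taylor s Q.divX).divX.eval (y - s) := by
  conv_lhs => rw [← divX_mul_X_add Q, map_add, taylor_X_mul, taylor_C]
  rw [divX_add, divX_add, divX_mul_X_self, divX_C_mul, divX_C, add_zero, eval_add, eval_C_mul,
    taylor_eval, sub_add_cancel]

lemma taylor_divX_divX_step (Q : ℂ[X]) (s y : ℂ) : (taylor s Q).divX.divX.eval (y - s) =
      (taylor s Q.divX).divX.eval (y - s) + s * (taylor s Q.divX).divX.divX.eval (y - s) := by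
  conv_lhs => rw [← divX_mul_X_add Q, map_add, taylor_X_mul, taylor_C]
  rw [divX_add, divX_C, add_zero, divX_add, divX_mul_X_self, divX_C_mul, divX_add, divX_C_mul,
    eval_add, eval_C_mul]

lemma isPolyKernel_taylor_divX (Q : ℂ[X]) {N : ℕ} (hQ : Q.natDegree ≤ N) :
    IsPolyKernel N (fun y s => (taylor s Q).divX.eval (y - s)) ∧
      IsPolyKernel N (fun y s => (taylor s Q).divX.divX.eval (y - s)) := by
  induction N generalizing Q with
  | zero =>
    rw [eq_C_of_natDegree_eq_zero (Nat.le_zero.1 hQ)]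
    simp only [taylor_C, divX_C, eval_zero]
    exact ⟨IsPolyKernel.zero, by simpa using IsPolyKernel.zero⟩
  | succ N ih =>
    have hd : Q.divX.natDegree ≤ N := by rw [natDegree_divX_eq_natDegree_tsub_one]; omega
    obtain ⟨h1, h2⟩ := ih _ hd
    have h1 := h1.mono N.le_succ
    have h2 := h2.mono N.le_succ
    constructor
    · rw [funext fun y => funext fun s => taylor_divX_step Q s y]
      exact (IsPolyKernel.eval_left _ (by omega)).add (by simpa using h1.mul_left X)
    · rw [funext fun y => funext fun s => taylor_divX_divX_step Q s y]
      exact h1.add (by simpa using h2.mul_left X)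

lemma isPolyKernel_kernel {A B : ℂ[X]} (hdeg : B.natDegree + 1 ≤ A.natDegree) (x : ℂ) :
    IsPolyKernel A.natDegree (kernel A B x) := by
  obtain ⟨h1, h2⟩ := isPolyKernel_taylor_divX B (N := A.natDegree) (by omega)
  have h3 := (isPolyKernel_taylor_divX A le_rfl).1
  have := ((h1.mul_left (C x)).sub h2).sub h3
  simp only [eval_C] at this
  exact this

/-! ### Double integrals of polynomial kernels -/

section Double

variable {P B Q D : ℂ[X]} {w : Branch P B} {v : Branch Q D}

/-- The double integral `∫_γ̂ ds ∫_γ dy f(y, s) e^{x (y - s)} W(y) Ŵ(s)`. -/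
def Contour.double (γ : Contour w) (γ' : Contour v) (x : ℂ) (f : ℂ → ℂ → ℂ) : ℂ :=
  γ'.integral fun s => γ.integral fun y => f y s * exp (x * (y - s)) * w.W y * v.W s

lemma Contour.integral_congr (γ : Contour w) {f g : ℂ → ℂ} (h : ∀ z, f z = g z) :
    γ.integral f = γ.integral g := by rw [funext h]

lemma Contour.integral_const_mul (γ : Contour w) (a : ℂ) (f : ℂ → ℂ) :
    γ.integral (fun z => a * f z) = a * γ.integral f := by
  simp only [Contour.integral, mul_assoc, MeasureTheory.integral_const_mul]

variable (γ : Contour w) (γ' : Contour v) (hB : B ≠ 0) (hdeg : B.natDegree + 1 ≤ P.natDegree)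
  (hD : D ≠ 0) (hdeg' : D.natDegree + 1 ≤ Q.natDegree)

include hB hdeg in
lemma Contour.inner_eq_sum {N : ℕ} {f : ℂ → ℂ → ℂ} {K : ℕ → ℂ[X]}
    (hK : ∀ y s, f y s = ∑ k ∈ range N, (K k).eval s * y ^ k) (x s c : ℂ) :
    (γ.integral fun y => f y s * exp (x * (y - s)) * w.W y * c) =
      c * ∑ k ∈ range N, ((K k).eval s * exp (-x * s)) * γ.laplace hB hdeg x (X ^ k) := by
  have h1 : ∀ y, f y s * exp (x * (y - s)) * w.W y * c =
      c * ((∑ k ∈ range N, (((K k).eval s * exp (-x * s)) *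
        ((X ^ k : ℂ[X]).eval y * exp (x * y)))) * w.W y) := fun y => by
    rw [hK, show x * (y - s) = -x * s + x * y by ring, exp_add]
    simp only [eval_pow, eval_X, sum_mul, mul_sum]
    exact sum_congr rfl fun k _ => by ring
  rw [γ.integral_congr h1, γ.integral_const_mul]
  congr 1
  change γ.moment _ = _
  rw [γ.moment_sum hB hdeg _ fun k _ => (ExpGrowth.const _).mul
    ((ExpGrowth.eval (X ^ k)).mul (ExpGrowth.exp x))]
  exact sum_congr rfl fun k _ => γ.moment_const_mul _ _

include hB hdeg hD hdeg' in
lemma Contour.double_eq_sum {N : ℕ} {f : ℂ → ℂ → ℂ} {K : ℕ → ℂ[X]}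
    (hK : ∀ y s, f y s = ∑ k ∈ range N, (K k).eval s * y ^ k) (x : ℂ) :
    γ.double γ' x f = ∑ k ∈ range N,
      γ'.laplace hD hdeg' (-x) (K k) * γ.laplace hB hdeg x (X ^ k) := by
  have h1 : ∀ s, (γ.integral fun y => f y s * exp (x * (y - s)) * w.W y * v.W s) =
      (∑ k ∈ range N, γ.laplace hB hdeg x (X ^ k) *
        ((K k).eval s * exp (-x * s))) * v.W s := fun s => by
    rw [γ.inner_eq_sum hB hdeg hK, mul_comm]
    simp only [mul_comm]
  rw [Contour.double, γ'.integral_congr h1]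
  change γ'.moment _ = _
  rw [γ'.moment_sum hD hdeg' _ fun k _ => (ExpGrowth.const _).mul
    ((ExpGrowth.eval (K k)).mul (ExpGrowth.exp (-x)))]
  refine sum_congr rfl fun k _ => ?_
  rw [γ'.moment_const_mul, mul_comm]
  rfl

include hB hdeg hD hdeg' in
lemma Contour.double_add {N : ℕ} {f g : ℂ → ℂ → ℂ} (hf : IsPolyKernel N f)
    (hg : IsPolyKernel N g) (x : ℂ) :
    γ.double γ' x (fun y s => f y s + g y s) = γ.double γ' x f + γ.double γ' x g := by
  obtain ⟨K, hK⟩ := hf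
  obtain ⟨K', hK'⟩ := hg
  rw [γ.double_eq_sum γ' hB hdeg hD hdeg' hK, γ.double_eq_sum γ' hB hdeg hD hdeg' hK',
    γ.double_eq_sum γ' hB hdeg hD hdeg' (N := N) (K := fun k => K k + K' k) (fun y s => by
      simp only [hK, hK', eval_add, add_mul, sum_add_distrib]), ← sum_add_distrib]
  simp only [map_add, add_mul]

lemma Contour.double_const_mul (c : ℂ) (f : ℂ → ℂ → ℂ) (x : ℂ) :
    γ.double γ' x (fun y s => c * f y s) = c * γ.double γ' x f := by
  simp only [Contour.double, mul_assoc, Contour.integral_const_mul]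

include hB hdeg hD hdeg' in
lemma Contour.double_sub {N : ℕ} {f g : ℂ → ℂ → ℂ} (hf : IsPolyKernel N f)
    (hg : IsPolyKernel N g) (x : ℂ) :
    γ.double γ' x (fun y s => f y s - g y s) = γ.double γ' x f - γ.double γ' x g := by
  have h := γ.double_add γ' hB hdeg hD hdeg' hf (hg.mul_left (C (-1))) x
  simp only [eval_C] at h
  rw [γ.double_const_mul γ'] at h
  simp only [neg_mul, one_mul, ← sub_eq_add_neg] at h
  exact h

include hB hdeg hD hdeg' in
lemma Contour.hasDerivAt_double {N : ℕ} {f : ℂ → ℂ → ℂ} (hf : IsPolyKernel N f) (x : ℂ) :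
    HasDerivAt (fun x => γ.double γ' x f) (γ.double γ' x fun y s => (y - s) * f y s) x := by
  obtain ⟨K, hK⟩ := hf
  have h1 : ∀ y s, y * f y s = ∑ k ∈ range (N + 1),
      (if k = 0 then 0 else K (k - 1)).eval s * y ^ k := fun y s => by
    rw [Finset.sum_range_succ', hK, mul_sum]
    simp only [Nat.add_eq_zero_iff, one_ne_zero, and_false, if_false, if_true, eval_zero, zero_mul,
      add_zero, Nat.add_sub_cancel]
    exact sum_congr rfl fun k _ => by ring
  have h2 : ∀ y s, s * f y s = ∑ k ∈ range N, (X * K k).eval s * y ^ k := fun y s => by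
    rw [hK, mul_sum]
    exact sum_congr rfl fun k _ => by simp [mul_assoc]
  have e : γ.double γ' x (fun y s => (y - s) * f y s) =
      ∑ k ∈ range N, (γ'.laplace hD hdeg' (-x) (K k) * γ.laplace hB hdeg x (X * X ^ k) -
        γ'.laplace hD hdeg' (-x) (X * K k) * γ.laplace hB hdeg x (X ^ k)) := by
    simp only [sub_mul]
    rw [γ.double_sub γ' hB hdeg hD hdeg' ⟨_, h1⟩ (IsPolyKernel.mono ⟨_, h2⟩ N.le_succ),
      γ.double_eq_sum γ' hB hdeg hD hdeg' h1, γ.double_eq_sum γ' hB hdeg hD hdeg' h2,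
      Finset.sum_range_succ', sum_sub_distrib]
    simp [pow_succ']
  rw [e, funext fun x => γ.double_eq_sum γ' hB hdeg hD hdeg' hK x]
  refine HasDerivAt.fun_sum fun k _ => ?_
  have d1 : HasDerivAt (fun x => γ'.laplace hD hdeg' (-x) (K k))
      (-γ'.laplace hD hdeg' (-x) (X * K k)) x := by
    have := (γ'.hasDerivAt_laplace hD hdeg' (-x) (K k)).comp x (hasDerivAt_neg x)
    exact this.congr_deriv (by ring)
  exact (d1.mul (γ.hasDerivAt_laplace hB hdeg x (X ^ k))).congr_deriv (by ring)

end Double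

/-! ### The concomitants are constant -/

section Concomitant

variable {A B : ℂ[X]} {w : Branch (directNum A B) B} {v : Branch A B}

lemma kernel_deriv_identity (A B : ℂ[X]) (x y s : ℂ) :
    (taylor s B).divX.eval (y - s) + (y - s) * kernel A B x y s =
      (C x * B - A).eval y - (C x * B - A - derivative B).eval s := by
  have h1 := taylor_divX_eval A y s
  have h2 := taylor_divX_eval B y s
  have h3 := congrArg (eval (y - s)) (divX_mul_X_add (taylor s B).divX)
  simp only [eval_add, eval_mul, eval_X, eval_C, coeff_divX, zero_add, taylor_coeff_one] at h3
  simp only [kernel, eval_sub, eval_mul, eval_C]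
  linear_combination x * h2 - h1 - h3

lemma Contour.double_kernel_const (h : IsTypeBB A B) (γ : Contour w) (γ' : Contour v)
    (x x' : ℂ) : γ.double γ' x (kernel A B x) = γ.double γ' x' (kernel A B x') := by
  have hB := h.ne_zero
  have hd := h.le_directNum
  have hd' := h.degree_lt
  set N := A.natDegree + 1
  obtain ⟨k1, k2⟩ := isPolyKernel_taylor_divX B (N := A.natDegree) (by omega)
  have k3 := (isPolyKernel_taylor_divX A le_rfl).1
  have e : ∀ x, γ.double γ' x (kernel A B x) =
      x * γ.double γ' x (fun y s => (taylor s B).divX.eval (y - s)) -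
      γ.double γ' x (fun y s => (taylor s B).divX.divX.eval (y - s)) -
      γ.double γ' x (fun y s => (taylor s A).divX.eval (y - s)) := fun x => by
    have k4 : IsPolyKernel A.natDegree fun y s => x * (taylor s B).divX.eval (y - s) := by
      simpa using k1.mul_left (C x)
    rw [← γ.double_const_mul γ', ← γ.double_sub γ' hB hd hB hd' k4 k2,
      ← γ.double_sub γ' hB hd hB hd' (k4.sub k2) k3]
    rfl
  have hder : ∀ x, HasDerivAt (fun x => γ.double γ' x (kernel A B x)) 0 x := fun x => by
    rw [funext e]
    refine ((((hasDerivAt_id x).mul (γ.hasDerivAt_double γ' hB hd hB hd' k1 x)).sub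
      (γ.hasDerivAt_double γ' hB hd hB hd' k2 x)).sub
      (γ.hasDerivAt_double γ' hB hd hB hd' k3 x)).congr_deriv ?_
    have hk := isPolyKernel_kernel hd' x
    have k5 : IsPolyKernel N fun y s => x * ((y - s) * (taylor s B).divX.eval (y - s)) := by
      simpa using k1.mul_sub.mul_left (C x)
    have e1 : γ.double γ' x (fun y s => (taylor s B).divX.eval (y - s) +
        (y - s) * kernel A B x y s) = 0 := by
      simp only [kernel_deriv_identity]
      have n1 : (C x * B - A).natDegree < N := by
        refine Nat.lt_succ_of_le ((natDegree_sub_le _ _).trans (max_le ?_ le_rfl))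
        exact (natDegree_C_mul_le _ _).trans (by omega)
      rw [γ.double_sub γ' hB hd hB hd' (IsPolyKernel.eval_left _ n1)
        (IsPolyKernel.eval_right _ (by omega : 0 < N))]
      have z1 : γ.double γ' x (fun y _ => (C x * B - A).eval y) = 0 := by
        rw [γ.double_eq_sum γ' hB hd hB hd' (N := N) (K := fun k => C ((C x * B - A).coeff k))
          (fun y s => by simp [eval_eq_sum_range' n1])]
        have := γ.laplace_ibp hB hd x 1
        have h2 : γ.laplace hB hd x (C x * B - A) = 0 := by
          simp only [mul_one, derivative_one, mul_zero, sub_zero] at this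
          rw [map_sub, map_C_mul, this, sub_self]
        rw [(C x * B - A).as_sum_range_C_mul_X_pow' n1, map_sum] at h2
        have h3 := congrArg (fun z => γ'.laplace hB hd' (-x) 1 * z) h2
        simp only [mul_sum, mul_zero, map_C_mul] at h3
        rw [← h3]
        refine sum_congr rfl fun k _ => ?_
        rw [← mul_one (C _), map_C_mul]
        ring
      have z2 : γ.double γ' x (fun _ s => (C x * B - A - derivative B).eval s) = 0 := by
        rw [γ.double_eq_sum γ' hB hd hB hd' (N := 1)
          (K := fun _ => C x * B - A - derivative B) (fun y s => by simp)]
        have h2 := γ'.moment_deriv_eq_zero hB hd' 1 (-x)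
        rw [← Contour.laplace_apply γ' hB hd'] at h2
        simp only [derivative_one, mul_one, zero_add] at h2
        have h3 : γ'.laplace hB hd' (-x) (C x * B - A - derivative B) = 0 := by
          rw [← neg_eq_zero, ← map_neg, ← h2]
          congr 1
          simp only [map_neg]
          ring
        simp [h3]
      rw [z1, z2, sub_zero]
    rw [← e1, γ.double_add γ' hB hd hB hd' (k1.mono (Nat.le_succ _)) hk.mul_sub]
    have e2 : ∀ y s, (y - s) * kernel A B x y s = x * ((y - s) * (taylor s B).divX.eval (y - s)) -
        (y - s) * (taylor s B).divX.divX.eval (y - s) -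
        (y - s) * (taylor s A).divX.eval (y - s) := fun y s => by rw [kernel]; ring
    simp only [e2]
    rw [γ.double_sub γ' hB hd hB hd' (k5.sub k2.mul_sub) k3.mul_sub,
      γ.double_sub γ' hB hd hB hd' k5 k2.mul_sub, γ.double_const_mul γ']
    simp only [id]
    ring
  exact is_const_of_deriv_eq_zero (fun x => (hder x).differentiableAt)
    (fun x => (hder x).deriv) x x'

lemma concomitant_const (h : IsTypeBB A B) {d : ℕ} (Y : ContourSystem (directNum A B) B d)
    (Z : ContourSystem A B d) (x x' : ℂ) : concomitant A Y Z x = concomitant A Y Z x' := by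
  ext ν μ
  simp only [concomitant, Matrix.of_apply]
  congr 1
  exact (Y.contour ν).double_kernel_const h (Z.contour μ) x x'

/-- The integral of the kernel over a dual contour, as a polynomial in `y`. -/
lemma exists_contracted_kernel (h : IsTypeBB A B) {d : ℕ} (Z : ContourSystem A B d) (x : ℂ)
    (μ : Fin d) : ∃ K : ℂ[X], K.degree < A.natDegree ∧
      (∀ (Y : ContourSystem (directNum A B) B d) (ν : Fin d),
        concomitant A Y Z x ν μ = (Y.contour ν).laplace h.ne_zero h.le_directNum x K) ∧
      ∀ (Y : ContourSystem (directNum A B) B d) {P₁ B₁ : ℂ[X]} {d₁ : ℕ}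
        (X' : ContourSystem P₁ B₁ d₁) (κ : Matrix (Fin d₁) (Fin d) ℂ)
        (_ : BimomentsConverge X' Y κ) {p : ℂ[X]}, x ∈ regularPoints X' →
        auxWave A X' Y Z κ μ p x = ampPairing X' Y κ (fun ξ => p.eval ξ * (x - ξ)⁻¹) K := by
  obtain ⟨K, hK⟩ := isPolyKernel_kernel h.degree_lt x
  set G := fun k => (2 * π * I : ℂ)⁻¹ *
    (Z.contour μ).laplace h.ne_zero h.degree_lt (-x) (K k) with hG
  refine ⟨∑ k : Fin A.natDegree, C (G k) * X ^ (k : ℕ), degree_sum_fin_lt _, fun Y ν => ?_,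
    fun Y P₁ B₁ d₁ X' κ hconv p hx => ?_⟩
  · rw [← Finset.sum_range fun k => C (G k) * X ^ k, map_sum]
    simp only [concomitant, Matrix.of_apply]
    refine (congrArg _ ((Y.contour ν).double_eq_sum (Z.contour μ) h.ne_zero h.le_directNum
      h.ne_zero h.degree_lt hK x)).trans ?_
    rw [mul_sum]
    refine sum_congr rfl fun k _ => ?_
    rw [map_C_mul, hG]
    ring
  · have ha : PolyAmp X' fun ξ => p.eval ξ * (x - ξ)⁻¹ := (PolyAmp.eval p).mul (PolyAmp.inv_sub hx)
    set Φ := ampFunctional Y h κ hconv ha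
    have h1 : ∀ s, doubleIntegral X' Y κ (fun ξ y => kernel A B x y s * p.eval ξ / (x - ξ)) =
        ∑ k ∈ range A.natDegree, (K k).eval s * Φ (X ^ k) := fun s => by
      have : (fun ξ y => kernel A B x y s * p.eval ξ / (x - ξ)) = fun ξ y =>
          (p.eval ξ * (x - ξ)⁻¹) *
            (∑ k ∈ range A.natDegree, C ((K k).eval s) * X ^ k : ℂ[X]).eval y := by
        ext ξ y
        rw [hK, eval_finsetSum]
        simp only [eval_mul, eval_C, eval_pow, eval_X]
        ring
      rw [this]
      change Φ _ = _
      rw [map_sum]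
      exact sum_congr rfl fun k _ => map_C_mul _ _ _
    change _ = Φ _
    rw [← Finset.sum_range fun k => C (G k) * X ^ k, map_sum, auxWave]
    have h2 : ∀ s, Z.branch.W s * exp (-(x * s)) *
        doubleIntegral X' Y κ (fun ξ y => kernel A B x y s * p.eval ξ / (x - ξ)) =
        (∑ k ∈ range A.natDegree, Φ (X ^ k) * ((K k).eval s * exp (-x * s))) *
          Z.branch.W s := fun s => by
      rw [h1, mul_sum, sum_mul, neg_mul]
      exact sum_congr rfl fun k _ => by ring
    rw [Contour.integral_congr _ h2]
    change _ * (Z.contour μ).moment _ = _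
    rw [(Z.contour μ).moment_sum h.ne_zero h.degree_lt _ fun k _ => (ExpGrowth.const _).mul
      ((ExpGrowth.eval (K k)).mul (ExpGrowth.exp (-x))), mul_sum]
    refine sum_congr rfl fun k _ => ?_
    rw [map_C_mul, (Z.contour μ).moment_const_mul, hG]
    simp only [Contour.laplace_apply]
    ring

end Concomitant

/-! ### The pairing of the fundamental systems -/

lemma pairing_eq {A₁ B₁ A₂ B₂ : ℂ[X]} {d₁ : ℕ} (h₂ : IsTypeBB A₂ B₂)
    (X' : ContourSystem (directNum A₁ B₁) B₁ d₁)
    (Y : ContourSystem (directNum A₂ B₂) B₂ A₂.natDegree)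
    (Z : ContourSystem A₂ B₂ A₂.natDegree) (κ : Matrix (Fin d₁) (Fin A₂.natDegree) ℂ)
    (hconv : BimomentsConverge X' Y κ) {p s : ℕ → ℂ[X]}
    (h : IsBiorthonormal (functional X' Y κ) p s) {Lh Ah : ℕ → ℕ → ℂ} (hL : IsHatL B₂ s Lh)
    (hA : IsHatA A₂ B₂ s Lh Ah) {n : ℕ} (hn : A₂.natDegree ≤ n) {x : ℂ}
    (hx : x ∈ regularPoints X') :
    dualSystem X' Y κ s n x * cdMatrix A₂.natDegree Lh Ah n x * directSystem A₂ X' Y Z κ Lh p n x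
      = Matrix.fromBlocks (-1) 0 0 (concomitant A₂ Y Z x) := by
  have hW : X'.branch.W x ≠ 0 := X'.branch.ne_zero x hx.1
  obtain ⟨δ, hδ, hdist⟩ := regularPoints.exists_dist hx
  have hne : ∀ μ, ∀ t ∈ Ioo (0 : ℝ) 1, x - (X'.contour μ).curve t ≠ 0 := fun μ t ht => by
    rw [← norm_pos_iff]; exact hδ.trans_le (hdist μ t ht)
  set ℓ := bilinearFunctional Y h₂ κ hconv
  have h' : IsBiorthonormal (fun p q => ℓ p q) p s := h
  have key := h'.sum_cdMatrix h₂.ne_zero h₂.degree_lt (bilinearFunctional_ibp Y h₂ κ hconv) hL hA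
    hn x
  set Φc : ℂ[X] →ₗ[ℂ] ℂ :=
    (X'.branch.W x)⁻¹ • ampFunctional Y h₂ κ hconv (PolyAmp.inv_sub hx) with hΦc
  have hΦc' : ∀ q, cauchyTransform X' Y κ q x = Φc q := fun q => by
    simp only [cauchyTransform, hΦc, LinearMap.smul_apply, smul_eq_mul, ampFunctional,
      LinearMap.coe_mk, AddHom.coe_mk, ampPairing, div_eq_mul_inv, mul_comm (q.eval _)]
  have hcΦ : ∀ g : ℂ[X], Φc (A₂ * g - B₂ * derivative g) =
      x * Φc (B₂ * g) - (X'.branch.W x)⁻¹ * ℓ 1 (B₂ * g) := fun g => by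
    have e1 : ampPairing X' Y κ (fun ξ => ξ * (x - ξ)⁻¹) (B₂ * g) =
        x * ampPairing X' Y κ (fun ξ => (x - ξ)⁻¹) (B₂ * g) - ℓ 1 (B₂ * g) := by
      rw [← ampPairing_const_mul Y h₂, eq_sub_iff_add_eq]
      refine (ampPairing_add_left Y h₂ κ hconv (b := fun ξ => (1 : ℂ[X]).eval ξ) ?_
        (PolyAmp.eval 1) _).symm.trans ?_
      · simpa only [eval_X] using (PolyAmp.eval X).mul (PolyAmp.inv_sub hx)
      · refine ampPairing_congr Y h₂ κ (fun μ t ht => ?_) _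
        have := hne μ t ht
        rw [eval_one]
        field_simp
        ring
    simp only [hΦc, LinearMap.smul_apply, smul_eq_mul, ampFunctional, LinearMap.coe_mk,
      AddHom.coe_mk]
    rw [ampPairing_ibp Y h₂, e1]
    ring
  set Φν : Fin A₂.natDegree → ℂ[X] →ₗ[ℂ] ℂ :=
    fun ν => (Y.contour ν).laplace h₂.ne_zero h₂.le_directNum x
  have hΦν' : ∀ ν q, fourierLaplace Y ν q x = Φν ν q := fun ν q => by
    rw [Contour.laplace_apply, fourierLaplace, Contour.moment]
    exact Contour.integral_congr _ fun y => by ring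
  have hνΦ : ∀ ν, ∀ g : ℂ[X], Φν ν (A₂ * g - B₂ * derivative g) =
      x * Φν ν (B₂ * g) - 0 * ℓ 1 (B₂ * g) := fun ν g => by
    rw [zero_mul, sub_zero]
    exact (Y.contour ν).laplace_ibp h₂.ne_zero h₂.le_directNum x g
  set Ψ0 : ℂ[X] →ₗ[ℂ] ℂ := X'.branch.W x • leval x with hΨ0
  have hΨ0e : ∀ q : ℂ[X], Ψ0 q = q.eval x * X'.branch.W x := fun q => by simp [hΨ0, mul_comm]
  have hΨ0' : ∀ q : ℂ[X], Ψ0 ((X - C x) * q) = -ℓ q 0 := fun q => by rw [hΨ0e]; simp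
  choose K hKd hKc hKa using fun μ => exists_contracted_kernel h₂ Z x μ
  set Ψ : Fin A₂.natDegree → ℂ[X] →ₗ[ℂ] ℂ := fun μ =>
    { toFun := fun q => ampPairing X' Y κ (fun ξ => q.eval ξ * (x - ξ)⁻¹) (K μ)
      map_add' := fun q q' => by
        simp only [eval_add, add_mul]
        exact ampPairing_add_left Y h₂ κ hconv ((PolyAmp.eval q).mul (PolyAmp.inv_sub hx))
          ((PolyAmp.eval q').mul (PolyAmp.inv_sub hx)) _
      map_smul' := fun c q => by
        simp only [eval_smul, smul_eq_mul, mul_assoc, RingHom.id_apply]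
        exact ampPairing_const_mul Y h₂ κ c _ _ }
  have hΨe : ∀ μ q, Ψ μ q = ampPairing X' Y κ (fun ξ => q.eval ξ * (x - ξ)⁻¹) (K μ) :=
    fun μ q => rfl
  have hΨ' : ∀ μ, ∀ q : ℂ[X], Ψ μ ((X - C x) * q) = -ℓ q (K μ) := fun μ q => by
    rw [hΨe, ← neg_one_mul]
    refine (ampPairing_congr Y h₂ κ (b := fun ξ => -1 * q.eval ξ) (fun μ' t ht => ?_) _).trans
      (ampPairing_const_mul Y h₂ κ (-1) _ _)
    have := hne μ' t ht
    simp only [eval_mul, eval_sub, eval_X, eval_C]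
    field_simp
    ring
  have hbot : (0 : ℂ[X]).degree < A₂.natDegree := by simp
  ext r c
  rw [Matrix.mul_apply]
  simp only [Matrix.mul_apply]
  rcases r with r | ν <;> rcases c with c | μ
  · have := key _ Φc Ψ0 hcΦ hbot hΨ0'
    rw [Matrix.fromBlocks_apply₁₁, Matrix.neg_apply, Subsingleton.elim r c, Matrix.one_apply_eq]
    simp only [dualSystem, directSystem, Matrix.of_apply, Sum.elim_inl, hΦc', ← hΨ0e]
    rw [this, hΨ0e, map_zero, eval_one, one_mul, neg_mul, inv_mul_cancel₀ hW, add_zero]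
  · have := key _ Φc (Ψ μ) hcΦ (hKd μ) (hΨ' μ)
    rw [Matrix.fromBlocks_apply₁₂, Matrix.zero_apply]
    simp only [dualSystem, directSystem, Matrix.of_apply, Sum.elim_inl, Sum.elim_inr, hΦc',
      hKa μ Y X' κ hconv hx, ← hΨe]
    rw [this, hΨe]
    simp only [eval_one, one_mul, hΦc, LinearMap.smul_apply, smul_eq_mul, ampFunctional,
      LinearMap.coe_mk, AddHom.coe_mk]
    ring
  · have := key _ (Φν ν) Ψ0 (hνΦ ν) hbot hΨ0'
    rw [Matrix.fromBlocks_apply₂₁, Matrix.zero_apply]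
    simp only [dualSystem, directSystem, Matrix.of_apply, Sum.elim_inl, Sum.elim_inr, hΦν', ← hΨ0e]
    rw [this, map_zero]
    ring
  · have := key _ (Φν ν) (Ψ μ) (hνΦ ν) (hKd μ) (hΨ' μ)
    rw [Matrix.fromBlocks_apply₂₂]
    simp only [dualSystem, directSystem, Matrix.of_apply, Sum.elim_inr, hΦν',
      hKa μ Y X' κ hconv hx, ← hΨe]
    rw [this, hKc μ Y ν]
    ring

/-! ### Change of the contours -/

lemma exists_eq_add_sub_derivative {A B : ℂ[X]} (hdeg : B.natDegree + 1 ≤ A.natDegree)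
    (q : ℂ[X]) : ∃ r g : ℂ[X], r.degree < A.natDegree ∧ q = r + (A * g - B * derivative g) := by
  have hA : A ≠ 0 := by
    rintro rfl
    simp at hdeg
  induction hN : q.natDegree using Nat.strong_induction_on generalizing q with
  | _ N ih =>
    by_cases hlt : q.degree < A.natDegree
    · exact ⟨q, 0, hlt, by simp⟩
    · have hq0 : q ≠ 0 := by
        rintro rfl
        simp at hlt
      have hle : A.natDegree ≤ N := by
        rw [← hN]
        rw [degree_eq_natDegree hq0] at hlt
        exact_mod_cast not_lt.1 hlt
      set n := N - A.natDegree with hn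
      set a := q.leadingCoeff / A.leadingCoeff with ha
      have ha0 : a ≠ 0 := div_ne_zero (leadingCoeff_ne_zero.2 hq0) (leadingCoeff_ne_zero.2 hA)
      set g := C a * X ^ n with hg
      have e1 : (A * g).degree = q.degree := by
        rw [degree_mul, hg, degree_C_mul_X_pow n ha0, degree_eq_natDegree hA,
          degree_eq_natDegree hq0]
        exact_mod_cast (by omega)
      have e2 : (A * g).leadingCoeff = q.leadingCoeff := by
        rw [leadingCoeff_mul, hg, leadingCoeff_C_mul_X_pow, ha,
          mul_div_cancel₀ _ (leadingCoeff_ne_zero.2 hA)]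
      have h1 : (q - A * g).degree < q.degree := degree_sub_lt_left e1.symm hq0 e2.symm
      have h2 : (B * derivative g).degree < q.degree := by
        rcases eq_or_ne (B * derivative g) 0 with h0 | h0
        · rw [h0, degree_zero, bot_lt_iff_ne_bot]
          exact fun h => hq0 (degree_eq_bot.1 h)
        · rw [degree_eq_natDegree h0, degree_eq_natDegree hq0]
          have h3 := natDegree_derivative_le g
          have h4 : g.natDegree = n := natDegree_C_mul_X_pow n a ha0
          have h5 := natDegree_mul_le (p := B) (q := derivative g)
          exact_mod_cast (by omega)
      have h3 : (q - A * g + B * derivative g).degree < q.degree :=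
        (degree_add_le _ _).trans_lt (max_lt h1 h2)
      rcases eq_or_ne (q - A * g + B * derivative g) 0 with h0 | h0
      · exact ⟨0, g, by simp, by linear_combination h0⟩
      · rw [degree_eq_natDegree h0, degree_eq_natDegree hq0, hN] at h3
        obtain ⟨r, g', hr, he⟩ := ih _ (by exact_mod_cast h3) _ rfl
        refine ⟨r, g' + g, hr, ?_⟩
        rw [derivative_add]
        linear_combination he

lemma eq_of_vanish_of_eq_on_monomials {A B : ℂ[X]} (hdeg : B.natDegree + 1 ≤ A.natDegree)
    {Φ Ψ : ℂ[X] →ₗ[ℂ] ℂ} (hΦ : ∀ g, Φ (A * g - B * derivative g) = 0)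
    (hΨ : ∀ g, Ψ (A * g - B * derivative g) = 0)
    (h : ∀ k < A.natDegree, Φ (X ^ k) = Ψ (X ^ k)) : Φ = Ψ := by
  refine LinearMap.ext fun q => ?_
  obtain ⟨r, g, hr, rfl⟩ := exists_eq_add_sub_derivative hdeg q
  obtain ⟨c, rfl⟩ := exists_sum_C_mul_eq (s := fun n => X ^ n) (fun n => degree_X_pow n) _ r hr
  rw [map_add, map_add, hΦ, hΨ, map_sum, map_sum]
  congr 1
  refine sum_congr rfl fun k hk => ?_
  rw [map_C_mul, map_C_mul, h k (mem_range.1 hk)]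

section Change

variable {A₂ B₂ : ℂ[X]} {d₁ d₂ : ℕ} (Y Y' : ContourSystem (directNum A₂ B₂) B₂ d₂)
  (h₂ : IsTypeBB A₂ B₂) (κ κ' : Matrix (Fin d₁) (Fin d₂) ℂ)

lemma hasDerivAt_innerFunctional (μ : Fin d₁) (ξ : ℂ) (q : ℂ[X]) :
    HasDerivAt (fun ξ => innerFunctional Y h₂ κ μ ξ q) (innerFunctional Y h₂ κ μ ξ (X * q)) ξ := by
  simp only [innerFunctional, LinearMap.sum_apply, LinearMap.smul_apply, smul_eq_mul]
  exact HasDerivAt.fun_sum fun ν _ =>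
    ((Y.contour ν).hasDerivAt_laplace h₂.ne_zero h₂.le_directNum ξ q).const_mul _

lemma innerFunctional_eq_tsum (μ : Fin d₁) (ξ : ℂ) (q : ℂ[X]) : innerFunctional Y h₂ κ μ ξ q =
      ∑' n : ℕ, (n.factorial : ℂ)⁻¹ * innerFunctional Y h₂ κ μ 0 (X ^ n * q) * ξ ^ n := by
  have hi : ∀ n, iteratedDeriv n (fun ξ => innerFunctional Y h₂ κ μ ξ q) =
      fun ξ => innerFunctional Y h₂ κ μ ξ (X ^ n * q) := fun n => by
    induction n with
    | zero => simp
    | succ n ih =>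
      rw [iteratedDeriv_succ, ih]
      ext ξ
      rw [(hasDerivAt_innerFunctional Y h₂ κ μ ξ _).deriv, pow_succ', mul_assoc]
  have := Complex.taylorSeries_eq_of_entire' 0 ξ
    (fun ξ => (hasDerivAt_innerFunctional Y h₂ κ μ ξ q).differentiableAt)
  rw [← this]
  refine tsum_congr fun n => ?_
  rw [hi, sub_zero]

lemma innerFunctional_congr (h : ∀ μ, innerFunctional Y' h₂ κ' μ 0 = innerFunctional Y h₂ κ μ 0)
    (μ : Fin d₁) (ξ : ℂ) : innerFunctional Y' h₂ κ' μ ξ = innerFunctional Y h₂ κ μ ξ := by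
  refine LinearMap.ext fun q => ?_
  rw [innerFunctional_eq_tsum Y, innerFunctional_eq_tsum Y', h]

end Change

lemma exists_coefficients {A B : ℂ[X]} (h : IsTypeBB A B)
    (Y' : ContourSystem (directNum A B) B A.natDegree) (Z' : ContourSystem A B A.natDegree)
    {c : Fin A.natDegree → ℂ} (hc : ∀ ν, c ν ≠ 0)
    (hdiag : concomitant A Y' Z' 0 = Matrix.diagonal c) {d₁ d₂ : ℕ}
    (Y : ContourSystem (directNum A B) B d₂) (κ : Matrix (Fin d₁) (Fin d₂) ℂ) :
    ∃ κ' : Matrix (Fin d₁) (Fin A.natDegree) ℂ, ∀ μ,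
      innerFunctional Y' h κ' μ 0 = innerFunctional Y h κ μ 0 := by
  set M : Matrix (Fin A.natDegree) (Fin A.natDegree) ℂ := Matrix.of fun ν k =>
    (Y'.contour ν).laplace h.ne_zero h.le_directNum 0 (X ^ (k : ℕ)) with hM
  choose K hKd hKc _ using fun μ => exists_contracted_kernel h Z' 0 μ
  have hMK : M * (Matrix.of fun (k : Fin A.natDegree) μ => (K μ).coeff (k : ℕ)) = Matrix.diagonal c := by
    rw [← hdiag]
    ext ν μ
    rw [hKc, Matrix.mul_apply]
    obtain hz | hz := Nat.eq_zero_or_pos A.natDegree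
    · exact (Fin.elim0 (hz ▸ ν))
    have hn : (K μ).natDegree < A.natDegree := by
      rcases eq_or_ne (K μ) 0 with h0 | h0
      · rwa [h0, natDegree_zero]
      · exact (natDegree_lt_iff_degree_lt h0).2 (hKd μ)
    conv_rhs => rw [(K μ).as_sum_range_C_mul_X_pow' hn, map_sum]
    rw [Finset.sum_range]
    refine sum_congr rfl fun k _ => ?_
    rw [map_C_mul]
    exact mul_comm _ _
  have hdet : IsUnit M.det := by
    rw [isUnit_iff_ne_zero]
    intro h0
    have := congrArg Matrix.det hMK
    rw [Matrix.det_mul, h0, zero_mul, Matrix.det_diagonal] at this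
    exact Finset.prod_ne_zero_iff.2 (fun ν _ => hc ν) this.symm
  refine ⟨(Matrix.of fun μ k => innerFunctional Y h κ μ 0 (X ^ ((k : Fin A.natDegree) : ℕ))) * M⁻¹,
    fun μ => eq_of_vanish_of_eq_on_monomials h.degree_lt (fun g => ?_) (fun g => ?_)
      fun k hk => ?_⟩
  · rw [innerFunctional_ibp, zero_mul]
  · rw [innerFunctional_ibp, zero_mul]
  · set N : Matrix (Fin d₁) (Fin A.natDegree) ℂ :=
      Matrix.of fun μ k => innerFunctional Y h κ μ 0 (X ^ ((k : Fin A.natDegree) : ℕ))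
    have h1 : N * M⁻¹ * M = N := by
      rw [Matrix.mul_assoc, Matrix.nonsing_inv_mul _ hdet, Matrix.mul_one]
    have h2 := congrFun (congrFun h1 μ) ⟨k, hk⟩
    rw [Matrix.mul_apply] at h2
    refine Eq.trans ?_ h2
    rw [innerFunctional, LinearMap.sum_apply]
    rfl

/-- The change of contours and the rescaled pairing, for contours whose concomitants form an
invertible diagonal matrix. -/
lemma rescaled_pairing {A₁ B₁ A₂ B₂ : ℂ[X]} (h₁ : IsTypeBB A₁ B₁) (h₂ : IsTypeBB A₂ B₂)
    (Y' : ContourSystem (directNum A₂ B₂) B₂ A₂.natDegree)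
    (Z' : ContourSystem A₂ B₂ A₂.natDegree) {c : Fin A₂.natDegree → ℂ} (hc : ∀ ν, c ν ≠ 0)
    (hdiag : ∀ x, concomitant A₂ Y' Z' x = Matrix.diagonal c) {d₁ : ℕ}
    (X' : ContourSystem (directNum A₁ B₁) B₁ d₁)
    (Y : ContourSystem (directNum A₂ B₂) B₂ A₂.natDegree)
    (κ : Matrix (Fin d₁) (Fin A₂.natDegree) ℂ)
    (hconv : A₁.natDegree = B₁.natDegree + 1 → A₂.natDegree = B₂.natDegree + 1 →
      BimomentsConverge X' Y κ) :
    ∃ κ' : Matrix (Fin d₁) (Fin A₂.natDegree) ℂ,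
      (∀ (μ : Fin d₁) (q : ℂ[X]) (ξ : ℂ), innerIntegral Y' κ' μ (fun y => q.eval y) ξ
        = innerIntegral Y κ μ (fun y => q.eval y) ξ) ∧
      ∀ p s : ℕ → ℂ[X], IsBiorthonormal (functional X' Y κ) p s →
        ∀ Lh Ah : ℕ → ℕ → ℂ, IsHatL B₂ s Lh → IsHatA A₂ B₂ s Lh Ah →
          ∀ n : ℕ, A₂.natDegree ≤ n → ∀ x ∈ regularPoints X',
            dualSystem X' Y' κ' s n x * cdMatrix A₂.natDegree Lh Ah n x *
              (directSystem A₂ X' Y' Z' κ' Lh p n x * rescaling c)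
              = Matrix.fromBlocks (-1) 0 0 1 := by
  have hconv := bimomentsConverge h₁ h₂ X' Y κ hconv
  obtain ⟨κ', hκ'⟩ := exists_coefficients h₂ Y' Z' hc (hdiag 0) Y κ
  have hI := innerFunctional_congr Y Y' h₂ κ κ' hκ'
  have hinner : ∀ (μ : Fin d₁) (q : ℂ[X]) (ξ : ℂ), innerIntegral Y' κ' μ (fun y => q.eval y) ξ
        = innerIntegral Y κ μ (fun y => q.eval y) ξ := fun μ q ξ => by
    rw [innerIntegral_eval Y' h₂, innerIntegral_eval Y h₂, hI]
  refine ⟨κ', hinner, fun p s hps Lh Ah hL hA n hn x hx => ?_⟩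
  have hconv' : BimomentsConverge X' Y' κ' := fun μ i j => by
    have := hconv μ i j
    have e : ∀ ξ, innerIntegral Y' κ' μ (fun y => y ^ j) ξ =
        innerIntegral Y κ μ (fun y => y ^ j) ξ := fun ξ => by simpa using hinner μ (X ^ j) ξ
    simpa only [e] using this
  have hfun : functional X' Y' κ' = functional X' Y κ := by
    ext p q
    change ampPairing X' Y' κ' (fun ξ => p.eval ξ) q = ampPairing X' Y κ (fun ξ => p.eval ξ) q
    simp only [ampPairing_eq Y h₂, ampPairing_eq Y' h₂, hI]
  rw [← hfun] at hps
  have := pairing_eq h₂ X' Y' Z' κ' hconv' hps hL hA hn hx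
  rw [← Matrix.mul_assoc, this, hdiag, rescaling, Matrix.fromBlocks_multiply]
  simp only [Matrix.mul_one, Matrix.mul_zero, Matrix.zero_mul, add_zero, zero_add,
    Matrix.diagonal_mul_diagonal]
  congr 1
  rw [← Matrix.diagonal_one]
  congr 1
  ext ν
  exact mul_inv_cancel₀ (hc ν)

/-! ### Concomitants from crossings -/

lemma integral_Ioo_eq_sub_jumps {F F' : ℝ → ℂ} {S : Set ℝ} (hS : S.Countable) {Lm Lp : ℝ → ℂ}
    {a : ℝ} {la : ℂ} (T : Finset ℝ) : ∀ {b : ℝ} {lb : ℂ}, a < b → (∀ t ∈ T, t ∈ Ioo a b) →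
    ContinuousOn F (Ioo a b \ T) → (∀ t ∈ (Ioo a b \ T) \ S, HasDerivAt F (F' t) t) →
    IntegrableOn F' (Ioo a b) → Tendsto F (𝓝[>] a) (𝓝 la) → Tendsto F (𝓝[<] b) (𝓝 lb) →
    (∀ t ∈ T, Tendsto F (𝓝[<] t) (𝓝 (Lm t)) ∧ Tendsto F (𝓝[>] t) (𝓝 (Lp t))) →
    ∫ t in Ioo a b, F' t = lb - la - ∑ t ∈ T, (Lp t - Lm t) := by
  induction T using Finset.induction_on_max with
  | empty =>
    intro b lb hab _ hc hd hi ha hb _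
    rw [Finset.sum_empty, sub_zero]
    exact integral_Ioo_eq_sub hab hS (by simpa using hc) (fun t ht => hd t (by simpa using ht))
      hi ha hb
  | insert m T hm ih =>
    intro b lb hab hT hc hd hi ha hb hL
    have hmT : m ∉ T := fun h => (hm m h).false
    obtain ⟨hm1, hm2⟩ := hT m (by simp)
    obtain ⟨hLm, hLp⟩ := hL m (by simp)
    have hlt : ∀ t, t < m → t ∉ (T : Set ℝ) → t ∉ ((insert m T : Finset ℝ) : Set ℝ) :=
      fun t ht h => by simpa [ht.ne] using h
    have h1 := ih (b := m) (lb := Lm m) hm1 (fun t ht => ⟨(hT t (by simp [ht])).1, hm t ht⟩)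
      (hc.mono fun t ht => ⟨⟨ht.1.1, ht.1.2.trans hm2⟩, hlt t ht.1.2 ht.2⟩)
      (fun t ht => hd t ⟨⟨⟨ht.1.1.1, ht.1.1.2.trans hm2⟩, hlt t ht.1.1.2 ht.1.2⟩, ht.2⟩)
      (hi.mono_set (Set.Ioo_subset_Ioo_right hm2.le)) ha hLm
      (fun t ht => hL t (by simp [ht]))
    have hnot : ∀ t, m < t → t ∉ ((insert m T : Finset ℝ) : Set ℝ) := fun t ht h => by
      simp only [Finset.coe_insert, Set.mem_insert_iff] at h
      rcases h with h | h
      · exact ht.ne' h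
      · exact (ht.trans (hm t h)).false
    have h2 := integral_Ioo_eq_sub hm2 hS
      (hc.mono fun t ht => ⟨⟨hm1.trans ht.1, ht.2⟩, hnot t ht.1⟩)
      (fun t ht => hd t ⟨⟨⟨hm1.trans ht.1.1, ht.1.2⟩, hnot t ht.1.1⟩, ht.2⟩)
      (hi.mono_set (Set.Ioo_subset_Ioo_left hm1.le)) hLp hb
    have h3 : ∫ t in Ioo a b, F' t = (∫ t in Ioo a m, F' t) + ∫ t in Ioo m b, F' t := by
      rw [← Set.Ioc_union_Ioo_eq_Ioo hm1.le hm2, setIntegral_union _ measurableSet_Ioo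
        (hi.mono_set fun t ht => ⟨ht.1, ht.2.trans_lt hm2⟩)
        (hi.mono_set (Set.Ioo_subset_Ioo_left hm1.le)), integral_Ioc_eq_integral_Ioo]
      exact Set.disjoint_left.2 fun t ht ht' => (ht.2.trans_lt ht'.1).false
    rw [h3, h1, h2, Finset.sum_insert hmT]
    ring

section Stieltjes

variable {P B : ℂ[X]} {w : Branch P B}

/-- The Cauchy transform `∫_γ W(y) / (y - s) dy`. -/
def Contour.stieltjes (γ : Contour w) (s : ℂ) : ℂ := γ.integral fun y => w.W y / (y - s)

lemma Contour.exists_dist_of_notMem_closure (γ : Contour w) {s : ℂ}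
    (hs : s ∉ closure (γ.curve '' Ioo 0 1)) :
    ∃ δ : ℝ, 0 < δ ∧ ∀ t ∈ Ioo (0 : ℝ) 1, δ ≤ ‖γ.curve t - s‖ := by
  rw [Metric.mem_closure_iff] at hs
  push Not at hs
  obtain ⟨δ, hδ, h⟩ := hs
  exact ⟨δ, hδ, fun t ht => by
    rw [← dist_eq_norm, dist_comm]; exact h _ (Set.mem_image_of_mem _ ht)⟩

variable (γ : Contour w) (hB : B ≠ 0) (hdeg : B.natDegree + 1 ≤ P.natDegree)

include hB hdeg

lemma Contour.integrableOn_div {f : ℂ → ℂ} (hf : ExpGrowth f) {s : ℂ} {δ : ℝ} (hδ : 0 < δ)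
    (h : ∀ t ∈ Ioo (0 : ℝ) 1, δ ≤ ‖γ.curve t - s‖) (k : ℕ) :
    IntegrableOn (fun t => f (γ.curve t) / (γ.curve t - s) ^ k * w.W (γ.curve t) *
      deriv γ.curve t) (Ioo 0 1) := by
  obtain ⟨C, c, hC, hc, hb⟩ := hf.bound
  have hg := γ.piecewise.continuousOn
  refine γ.integrableOn hB hdeg (C := C / δ ^ k) (c := c) ?_ fun t ht => ?_
  · refine ContinuousOn.aestronglyMeasurable ?_ measurableSet_Ioo
    refine (hf.continuous.comp_continuousOn hg).div ((hg.sub continuousOn_const).pow k)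
      fun t ht => pow_ne_zero _ ?_
    rw [← norm_pos_iff]
    exact hδ.trans_le (h t ht)
  · rw [norm_div, norm_pow, div_mul_eq_mul_div]
    gcongr
    · exact hb _
    · exact h t ht

lemma Contour.norm_stieltjes_le {s : ℂ} {δ : ℝ} (hδ : 0 < δ)
    (h : ∀ t ∈ Ioo (0 : ℝ) 1, δ ≤ ‖γ.curve t - s‖) :
    ‖γ.stieltjes s‖ ≤ (∫ t in Ioo (0 : ℝ) 1, ‖w.W (γ.curve t) * deriv γ.curve t‖) / δ := by
  have h1 := γ.integrableOn_expGrowth hB hdeg (ExpGrowth.const 1)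
  simp only [one_mul] at h1
  have h2 := γ.integrableOn_div hB hdeg (ExpGrowth.const 1) hδ h 1
  rw [div_eq_inv_mul, ← MeasureTheory.integral_const_mul]
  refine (norm_integral_le_integral_norm _).trans ?_
  refine setIntegral_mono_on ?_ (h1.norm.const_mul _) measurableSet_Ioo fun t ht => ?_
  · refine h2.norm.congr (ae_of_all _ fun t => ?_)
    simp only [pow_one]
    congr 1
    ring
  · rw [norm_mul, norm_div, norm_mul, div_mul_eq_mul_div, div_eq_inv_mul]
    gcongr
    exact h t ht

lemma Contour.hasDerivAt_stieltjes {s : ℂ} (hs : s ∉ closure (γ.curve '' Ioo 0 1)) :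
    HasDerivAt γ.stieltjes (γ.integral fun y => w.W y / (y - s) ^ 2) s := by
  obtain ⟨δ, hδ, h⟩ := γ.exists_dist_of_notMem_closure hs
  have hball : ∀ x ∈ ball s (δ / 2), ∀ t ∈ Ioo (0 : ℝ) 1,
      δ / 2 ≤ ‖γ.curve t - x‖ := fun x hx t ht => by
    have h1 := h t ht
    rw [Metric.mem_ball, dist_eq_norm] at hx
    have h2 := norm_sub_le_norm_sub_add_norm_sub (γ.curve t) x s
    linarith
  have hne : ∀ x ∈ ball s (δ / 2), ∀ t ∈ Ioo (0 : ℝ) 1, γ.curve t - x ≠ 0 := fun x hx t ht => by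
      rw [← norm_pos_iff]; linarith [hball x hx t ht]
  have hI := fun x (hx : x ∈ ball s (δ / 2)) k =>
    γ.integrableOn_div hB hdeg (ExpGrowth.const 1) (half_pos hδ) (hball x hx) k
  have hs0 : s ∈ ball s (δ / 2) := mem_ball_self (half_pos hδ)
  have e1 : ∀ x k, (fun t => (1 : ℂ) / (γ.curve t - x) ^ k * w.W (γ.curve t) * deriv γ.curve t) =
      fun t => w.W (γ.curve t) / (γ.curve t - x) ^ k * deriv γ.curve t := fun x k => by ext t; ring
  simp only [e1] at hI
  have hI1 : ∀ x ∈ ball s (δ / 2), IntegrableOn (fun t =>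
      w.W (γ.curve t) / (γ.curve t - x) * deriv γ.curve t) (Ioo 0 1) := fun x hx => by
    simpa using hI x hx 1
  have hb := γ.integrableOn_expGrowth hB hdeg (ExpGrowth.const 1)
  simp only [one_mul] at hb
  refine (hasDerivAt_integral_of_dominated_loc_of_deriv_le
    (F := fun x t => w.W (γ.curve t) / (γ.curve t - x) * deriv γ.curve t)
    (F' := fun x t => w.W (γ.curve t) / (γ.curve t - x) ^ 2 * deriv γ.curve t)
    (bound := fun t => ((δ / 2) ^ 2)⁻¹ * ‖w.W (γ.curve t) * deriv γ.curve t‖)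
    (ball_mem_nhds s (half_pos hδ)) ?_ (hI1 s hs0) (hI s hs0 2).aestronglyMeasurable ?_
    (hb.norm.const_mul _) ?_).2
  · filter_upwards [ball_mem_nhds s (half_pos hδ)] with x hx
    exact (hI1 x hx).aestronglyMeasurable
  · refine (ae_restrict_iff' measurableSet_Ioo).2 (ae_of_all _ fun t ht x hx => ?_)
    rw [norm_mul, norm_div, norm_mul, norm_pow, div_mul_eq_mul_div, div_eq_inv_mul]
    gcongr
    exact hball x hx t ht
  · refine (ae_restrict_iff' measurableSet_Ioo).2 (ae_of_all _ fun t ht x hx => ?_)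
    have h1 : HasDerivAt (fun x => (γ.curve t - x)⁻¹) (-(-1) / (γ.curve t - x) ^ 2) x :=
      ((hasDerivAt_id x).const_sub (γ.curve t)).inv (hne x hx t ht)
    have h2 := (h1.const_mul (w.W (γ.curve t))).mul_const (deriv γ.curve t)
    simp only [div_eq_mul_inv]
    refine h2.congr_deriv ?_
    ring

end Stieltjes

section Jump

variable {P B : ℂ[X]} {w : Branch P B}

lemma integral_inv_sub {b : ℝ} (hb : 0 < b) (τ₀ : ℝ) {ζ : ℂ} (hζ : ζ.im ≠ 0) :
    ∫ τ in Ioo (τ₀ - b) (τ₀ + b), ((((τ - τ₀ : ℝ) : ℂ)) - ζ)⁻¹ = log (b - ζ) - log (-b - ζ) := by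
  have hslit : ∀ τ : ℝ, ((τ - τ₀ : ℝ) : ℂ) - ζ ∈ slitPlane := fun τ => by
    right
    simpa using hζ
  have hd : ∀ τ : ℝ, HasDerivAt (fun τ : ℝ => log (((τ - τ₀ : ℝ) : ℂ) - ζ))
      ((((τ - τ₀ : ℝ) : ℂ)) - ζ)⁻¹ τ := fun τ => by
    have h1 : HasDerivAt (fun τ : ℝ => ((τ - τ₀ : ℝ) : ℂ) - ζ) 1 τ := by
      have := (((hasDerivAt_id τ).sub_const τ₀).ofReal_comp).sub_const ζ
      simpa using this
    simpa using h1.clog_real (hslit τ)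
  have hc : Continuous fun τ : ℝ => log (((τ - τ₀ : ℝ) : ℂ) - ζ) :=
    continuous_iff_continuousAt.2 fun τ => (hd τ).continuousAt
  have hci : Continuous fun τ : ℝ => ((((τ - τ₀ : ℝ) : ℂ)) - ζ)⁻¹ := by
    refine Continuous.inv₀ (by fun_prop) fun τ => ?_
    exact slitPlane_ne_zero (hslit τ)
  have h1 := hc.tendsto (τ₀ - b)
  have h2 := hc.tendsto (τ₀ + b)
  rw [integral_Ioo_eq_sub (by linarith) Set.countable_empty hc.continuousOn (fun τ _ => hd τ)
    ((hci.integrableOn_Icc).mono_set Set.Ioo_subset_Icc_self)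
    (h1.mono_left nhdsWithin_le_nhds) (h2.mono_left nhdsWithin_le_nhds)]
  congr 2 <;> push_cast <;> ring

lemma tendsto_log_sub_log {b : ℝ} (hb : 0 < b) :
    Tendsto (fun ζ : ℂ => log (b - ζ) - log (-b - ζ)) (𝓝[{ζ | 0 < ζ.im}] 0) (𝓝 (π * I)) ∧
    Tendsto (fun ζ : ℂ => log (b - ζ) - log (-b - ζ)) (𝓝[{ζ | ζ.im < 0}] 0) (𝓝 (-(π * I))) := by
  have h1 : Tendsto (fun ζ : ℂ => log (b - ζ)) (𝓝 0) (𝓝 (log b)) := by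
    have : ContinuousAt (fun ζ : ℂ => log (b - ζ)) 0 :=
      ContinuousAt.clog (by fun_prop) (Or.inl (by simpa using hb))
    simpa [ContinuousAt] using this
  have key : ∀ {S S' : Set ℂ} {c : ℂ}, (∀ ζ ∈ S, -(b : ℂ) - ζ ∈ S') →
      Tendsto log (𝓝[S'] (-(b : ℂ))) (𝓝 (Real.log ‖-(b : ℂ)‖ + c)) →
      Tendsto (fun ζ : ℂ => log (b - ζ) - log (-b - ζ)) (𝓝[S] 0) (𝓝 (-c)) := fun hS h => by
    have h2 : Continuous fun ζ : ℂ => -(b : ℂ) - ζ := by fun_prop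
    have h3 := (h1.mono_left nhdsWithin_le_nhds).sub (h.comp (tendsto_nhdsWithin_iff.2
      ⟨(h2.tendsto' 0 _ (sub_zero _)).mono_left nhdsWithin_le_nhds,
        eventually_mem_nhdsWithin.mono hS⟩))
    rw [norm_neg, norm_real, norm_of_nonneg hb.le, Complex.ofReal_log hb.le] at h3
    convert! h3 using 2
    ring
  have hre : (-(b : ℂ)).re < 0 := by simpa using hb
  rw [← neg_neg (π * I : ℂ), neg_neg (-(π * I : ℂ))]
  refine ⟨key (S' := {z | z.im < 0}) (fun ζ hζ => by simpa using hζ) ?_,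
    key (S' := {z | 0 ≤ z.im}) (fun ζ (hζ : ζ.im < 0) => by simpa using hζ.le) ?_⟩
  · exact Complex.tendsto_log_nhdsWithin_im_neg_of_re_neg_of_im_zero hre (by simp)
  · exact Complex.tendsto_log_nhdsWithin_im_nonneg_of_re_neg_of_im_zero hre (by simp)

/-- The contour passes through `p` exactly once, along a straight line. -/
structure Contour.PassesAt (γ : Contour w) (p d : ℂ) : Prop where
  ne_zero : d ≠ 0
  local_line : ∃ τ₀ a : ℝ, 0 < a ∧ (∀ τ ∈ Ioo (τ₀ - a) (τ₀ + a), τ ∈ Ioo (0 : ℝ) 1 ∧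
      γ.curve τ = p + (τ - τ₀ : ℝ) * d) ∧
    ∃ δ : ℝ, 0 < δ ∧ ∀ τ ∈ Ioo (0 : ℝ) 1, a ≤ |τ - τ₀| → δ ≤ ‖γ.curve τ - p‖

set_option maxHeartbeats 800000 in
/-- The jump of the Cauchy transform across the contour. -/
lemma Contour.exists_tendsto_stieltjes (γ : Contour w) (hB : B ≠ 0)
    (hdeg : B.natDegree + 1 ≤ P.natDegree) {p d : ℂ} (h : γ.PassesAt p d) : ∃ h₀ : ℂ,
    Tendsto γ.stieltjes (𝓝[{s | 0 < ((s - p) / d).im}] p) (𝓝 (h₀ + w.W p * (π * I))) ∧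
    Tendsto γ.stieltjes (𝓝[{s | ((s - p) / d).im < 0}] p) (𝓝 (h₀ + w.W p * -(π * I))) := by
  obtain ⟨hd, τ₀, a, ha, hline, δ₀, hδ₀, hfar⟩ := h
  have hdn : 0 < ‖d‖ := norm_pos_iff.2 hd
  have hτ₀ := hline τ₀ ⟨by linarith, by linarith⟩
  have hpdom : p ∈ w.dom := by
    have := γ.mem_dom τ₀ hτ₀.1
    rw [hτ₀.2] at this
    simpa using this
  obtain ⟨R, hR, hball⟩ := Metric.isOpen_iff.1 w.isOpen_dom p hpdom
  obtain ⟨r, hr, hrR⟩ : ∃ r : ℝ, 0 < r ∧ r < R := ⟨R / 2, by linarith, by linarith⟩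
  set b := min a (r / ‖d‖) with hbdef
  have hb : 0 < b := lt_min ha (by positivity)
  have hba : b ≤ a := min_le_left _ _
  have hbr : b * ‖d‖ ≤ r := by rw [← le_div_iff₀ hdn]; exact min_le_right _ _
  set I := Ioo (τ₀ - b) (τ₀ + b) with hI
  have hIsub : I ⊆ Ioo (τ₀ - a) (τ₀ + a) := Set.Ioo_subset_Ioo (by linarith) (by linarith)
  have hI01 : I ⊆ Ioo (0 : ℝ) 1 := fun τ hτ => (hline τ (hIsub hτ)).1
  have hIγ : ∀ τ ∈ I, γ.curve τ = p + (τ - τ₀ : ℝ) * d := fun τ hτ => (hline τ (hIsub hτ)).2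
  have hIabs : ∀ τ ∈ I, |τ - τ₀| < b := fun τ hτ => abs_lt.2 ⟨by linarith [hτ.1], by linarith [hτ.2]⟩
  have hIball : ∀ τ ∈ I, γ.curve τ ∈ closedBall p r := fun τ hτ => by
    rw [Metric.mem_closedBall, dist_eq_norm, hIγ τ hτ, add_sub_cancel_left, norm_mul,
      norm_real, Real.norm_eq_abs]
    refine le_trans ?_ hbr
    gcongr
    exact (hIabs τ hτ).le
  have hIderiv : ∀ τ ∈ I, deriv γ.curve τ = d := fun τ hτ => by
    have h1 : γ.curve =ᶠ[𝓝 τ] fun τ => p + (τ - τ₀ : ℝ) * d := by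
      filter_upwards [isOpen_Ioo.mem_nhds hτ] with x hx using hIγ x hx
    have h2 : HasDerivAt (fun τ : ℝ => p + (τ - τ₀ : ℝ) * d) d τ := by
      have := ((((hasDerivAt_id τ).sub_const τ₀).ofReal_comp).mul_const d).const_add p
      simpa using this
    rw [h1.deriv_eq, h2.deriv]
  -- the part away from `p`
  set δ := min δ₀ (b * ‖d‖) with hδdef
  have hδ : 0 < δ := lt_min hδ₀ (by positivity)
  have hfar' : ∀ τ ∈ Ioo (0 : ℝ) 1 \ I, δ ≤ ‖γ.curve τ - p‖ := fun τ hτ => by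
    have h1 : b ≤ |τ - τ₀| := by
      by_contra hlt
      rw [not_le, abs_lt] at hlt
      exact hτ.2 ⟨by linarith [hlt.1], by linarith [hlt.2]⟩
    rcases le_or_gt a |τ - τ₀| with h2 | h2
    · exact (min_le_left _ _).trans (hfar τ hτ.1 h2)
    · refine (min_le_right _ _).trans ?_
      rw [abs_lt] at h2
      rw [(hline τ ⟨by linarith [h2.1], by linarith [h2.2]⟩).2, add_sub_cancel_left, norm_mul,
        norm_real, Real.norm_eq_abs]
      gcongr
  have hfarb : ∀ s ∈ ball p (δ / 2), ∀ τ ∈ Ioo (0 : ℝ) 1 \ I,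
      δ / 2 ≤ ‖γ.curve τ - s‖ := fun s hs τ hτ => by
    have h1 := hfar' τ hτ
    rw [Metric.mem_ball, dist_eq_norm] at hs
    have h2 := norm_sub_le_norm_sub_add_norm_sub (γ.curve τ) s p
    linarith
  have hmeas : MeasurableSet (Ioo (0 : ℝ) 1 \ I) := measurableSet_Ioo.diff measurableSet_Ioo
  have hW := γ.integrableOn_expGrowth hB hdeg (ExpGrowth.const 1)
  simp only [one_mul] at hW
  set G₁ : ℂ → ℂ := fun s => ∫ τ in Ioo (0 : ℝ) 1 \ I,
    w.W (γ.curve τ) / (γ.curve τ - s) * deriv γ.curve τ with hG₁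
  have hint₁ : ∀ s ∈ ball p (δ / 2), IntegrableOn (fun τ =>
      w.W (γ.curve τ) / (γ.curve τ - s) * deriv γ.curve τ) (Ioo 0 1 \ I) := fun s hs => by
    refine Integrable.mono' ((hW.mono_set Set.sdiff_subset).norm.const_mul (δ / 2)⁻¹) ?_ ?_
    · refine AEStronglyMeasurable.mul (ContinuousOn.aestronglyMeasurable ?_ hmeas)
        (γ.piecewise.locallyIntegrable.aestronglyMeasurable.mono_set Set.sdiff_subset)
      refine (γ.continuousOn_weight.mono Set.sdiff_subset).div
        ((γ.piecewise.continuousOn.mono Set.sdiff_subset).sub continuousOn_const) fun τ hτ => ?_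
      rw [← norm_pos_iff]; linarith [hfarb s hs τ hτ]
    · refine (ae_restrict_iff' hmeas).2 (ae_of_all _ fun τ hτ => ?_)
      rw [norm_mul, norm_div, norm_mul, div_mul_eq_mul_div, div_eq_inv_mul]
      gcongr
      exact hfarb s hs τ hτ
  have hG₁c : ContinuousAt G₁ p := by
    refine continuousAt_of_dominated (bound := fun τ => (δ / 2)⁻¹ *
      ‖w.W (γ.curve τ) * deriv γ.curve τ‖) ?_ ?_ ((hW.mono_set Set.sdiff_subset).norm.const_mul _) ?_
    · filter_upwards [ball_mem_nhds p (half_pos hδ)] with s hs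
      exact (hint₁ s hs).aestronglyMeasurable
    · filter_upwards [ball_mem_nhds p (half_pos hδ)] with s hs
      refine (ae_restrict_iff' hmeas).2 (ae_of_all _ fun τ hτ => ?_)
      rw [norm_mul, norm_div, norm_mul, div_mul_eq_mul_div, div_eq_inv_mul]
      gcongr
      exact hfarb s hs τ hτ
    · refine (ae_restrict_iff' hmeas).2 (ae_of_all _ fun τ hτ => ?_)
      refine ContinuousAt.mul (ContinuousAt.div continuousAt_const (by fun_prop) ?_)
        continuousAt_const
      rw [← norm_pos_iff]; exact hδ.trans_le (hfar' τ hτ)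
  -- the part near `p`
  have hWd : ∀ z ∈ closedBall p r, DifferentiableAt ℂ w.W z := fun z hz =>
    (w.hasDerivAt (hball (Metric.closedBall_subset_ball hrR hz))).differentiableAt
  obtain ⟨K, hK⟩ : ∃ K, ∀ z ∈ closedBall p r, ‖deriv w.W z‖ ≤ K := by
    refine (isCompact_closedBall p r).exists_bound_of_continuousOn ?_
    exact ((w.differentiableOn.deriv w.isOpen_dom).continuousOn).mono
      ((Metric.closedBall_subset_ball hrR).trans hball)
  have hK0 : 0 ≤ K := (norm_nonneg _).trans (hK p (Metric.mem_closedBall_self hr.le))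
  have hLip : ∀ x ∈ closedBall p r, ∀ y ∈ closedBall p r,
      ‖(w.W y - w.W x) / (y - x)‖ ≤ K := fun x hx y hy => by
    rw [norm_div]
    refine div_le_of_le_mul₀ (norm_nonneg _) hK0 ?_
    exact Convex.norm_image_sub_le_of_norm_deriv_le hWd hK (convex_closedBall p r) hx hy
  set G₂ : ℂ → ℂ := fun s => ∫ τ in I, (w.W (γ.curve τ) - w.W s) / (γ.curve τ - s) * d with hG₂
  have hIfin : volume I ≠ ⊤ := by rw [hI, Real.volume_Ioo]; exact ENNReal.ofReal_ne_top
  have hγI : ContinuousOn γ.curve I := γ.piecewise.continuousOn.mono hI01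
  have hWI : ContinuousOn (fun τ => w.W (γ.curve τ)) I := γ.continuousOn_weight.mono hI01
  have hmeas₂ : ∀ s, AEStronglyMeasurable (fun τ =>
      (w.W (γ.curve τ) - w.W s) / (γ.curve τ - s) * d) (volume.restrict I) := fun s => by
    refine AEStronglyMeasurable.mul (AEStronglyMeasurable.div₀ ?_ ?_) aestronglyMeasurable_const
    · exact (hWI.sub continuousOn_const).aestronglyMeasurable measurableSet_Ioo
    · exact (hγI.sub continuousOn_const).aestronglyMeasurable measurableSet_Ioo
  have hb₂ : ∀ s ∈ closedBall p r, ∀ᵐ τ ∂volume.restrict I,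
      ‖(w.W (γ.curve τ) - w.W s) / (γ.curve τ - s) * d‖ ≤ K * ‖d‖ := fun s hs =>
    (ae_restrict_iff' measurableSet_Ioo).2 (ae_of_all _ fun τ hτ => by
      rw [norm_mul]
      gcongr
      exact hLip s hs _ (hIball τ hτ))
  have hG₂c : Tendsto G₂ (𝓝 p) (𝓝 (G₂ p)) := by
    refine tendsto_integral_filter_of_dominated_convergence (fun _ => K * ‖d‖)
      (Eventually.of_forall hmeas₂) ?_ (integrableOn_const hIfin) ?_
    · filter_upwards [Metric.closedBall_mem_nhds p hr] with s hs using hb₂ s hs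
    · have hne : ∀ᵐ τ ∂volume.restrict I, τ ≠ τ₀ :=
        ae_restrict_of_ae (by simp [ae_iff, measure_singleton])
      filter_upwards [hne, ae_restrict_mem measurableSet_Ioo] with τ hτ hτI
      have h1 : γ.curve τ - p ≠ 0 := by
        rw [hIγ τ hτI, add_sub_cancel_left]
        refine mul_ne_zero ?_ hd
        exact_mod_cast sub_ne_zero.2 hτ
      have h2 : ContinuousAt w.W p := (hWd p (Metric.mem_closedBall_self hr.le)).continuousAt
      have h3 : ContinuousAt (fun s => (w.W (γ.curve τ) - w.W s) / (γ.curve τ - s) * d) p :=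
        ((continuousAt_const.sub h2).div (continuousAt_const.sub continuousAt_id) h1).mul
          continuousAt_const
      exact h3.tendsto
  have hdecomp : ∀ s ∈ ball p (min r (δ / 2)), ((s - p) / d).im ≠ 0 → γ.stieltjes s = G₁ s + G₂ s +
        w.W s * (log (b - (s - p) / d) - log (-b - (s - p) / d)) := fun s hs him => by
    have hs1 : s ∈ ball p (δ / 2) := Metric.ball_subset_ball (min_le_right _ _) hs
    have hs2 : s ∈ closedBall p r :=
      Metric.ball_subset_closedBall (Metric.ball_subset_ball (min_le_left _ _) hs)
    have hinv : ∀ τ ∈ I, d / (γ.curve τ - s) = (((τ - τ₀ : ℝ) : ℂ) - (s - p) / d)⁻¹ :=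
      fun τ hτ => by
        rw [hIγ τ hτ, ← inv_div]
        congr 1
        field_simp
        ring
    have hne : ∀ τ ∈ I, γ.curve τ - s ≠ 0 := fun τ hτ h0 => by
      rw [hIγ τ hτ] at h0
      apply him
      have : (s - p) / d = ((τ - τ₀ : ℝ) : ℂ) := by
        rw [div_eq_iff hd]
        linear_combination -h0
      rw [this, Complex.ofReal_im]
    have hint₂ : IntegrableOn (fun τ => (w.W (γ.curve τ) - w.W s) / (γ.curve τ - s) * d) I :=
      Integrable.mono' (integrableOn_const hIfin) (hmeas₂ s) (hb₂ s hs2)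
    have hint₃ : IntegrableOn (fun τ : ℝ => w.W s * (((τ - τ₀ : ℝ) : ℂ) - (s - p) / d)⁻¹) I := by
      have hci : Continuous fun τ : ℝ => w.W s * (((τ - τ₀ : ℝ) : ℂ) - (s - p) / d)⁻¹ := by
        refine continuous_const.mul (Continuous.inv₀ (by fun_prop) fun τ h0 => him ?_)
        rw [← sub_eq_zero.1 h0, Complex.ofReal_im]
      exact (hci.integrableOn_Icc).mono_set Set.Ioo_subset_Icc_self
    have hnear : Set.EqOn (fun τ => w.W (γ.curve τ) / (γ.curve τ - s) * deriv γ.curve τ)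
        (fun τ => (w.W (γ.curve τ) - w.W s) / (γ.curve τ - s) * d +
          w.W s * (((τ - τ₀ : ℝ) : ℂ) - (s - p) / d)⁻¹) I := fun τ hτ => by
      simp only [hIderiv τ hτ, ← hinv τ hτ]
      have := hne τ hτ
      field_simp
      ring
    have hint₄ : IntegrableOn (fun τ => w.W (γ.curve τ) / (γ.curve τ - s) * deriv γ.curve τ) I :=
      IntegrableOn.congr_fun (hint₂.add hint₃) (fun τ hτ => (hnear hτ).symm) measurableSet_Ioo
    rw [Contour.stieltjes, Contour.integral, ← Set.sdiff_union_of_subset hI01,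
      setIntegral_union Set.disjoint_sdiff_left measurableSet_Ioo (hint₁ s hs1) hint₄,
      setIntegral_congr_fun measurableSet_Ioo hnear, integral_add hint₂ hint₃,
      MeasureTheory.integral_const_mul, integral_inv_sub hb τ₀ him, ← add_assoc]
  have hWp : Tendsto w.W (𝓝 p) (𝓝 (w.W p)) :=
    (hWd p (Metric.mem_closedBall_self hr.le)).continuousAt
  have hζ : Tendsto (fun s : ℂ => (s - p) / d) (𝓝 p) (𝓝 0) := by
    have : Continuous fun s : ℂ => (s - p) / d := by fun_prop
    have h := this.tendsto p
    rwa [sub_self, zero_div] at h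
  have hnhds : ball p (min r (δ / 2)) ∈ 𝓝 p := ball_mem_nhds p (lt_min hr (half_pos hδ))
  have key : ∀ {S : Set ℂ} {c : ℂ}, (∀ ζ ∈ S, ζ.im ≠ 0) →
      Tendsto (fun ζ : ℂ => log (b - ζ) - log (-b - ζ)) (𝓝[S] 0) (𝓝 c) →
      Tendsto γ.stieltjes (𝓝[(fun s => (s - p) / d) ⁻¹' S] p) (𝓝 (G₁ p + G₂ p + w.W p * c)) :=
      fun hS h => by
    refine (((hG₁c.tendsto.add hG₂c).mono_left nhdsWithin_le_nhds).add
      ((hWp.mono_left nhdsWithin_le_nhds).mul (h.comp (tendsto_nhdsWithin_iff.2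
        ⟨hζ.mono_left nhdsWithin_le_nhds, eventually_mem_nhdsWithin⟩)))).congr' ?_
    filter_upwards [mem_nhdsWithin_of_mem_nhds hnhds, self_mem_nhdsWithin] with s h1 h2
    exact (hdecomp s h1 (hS _ h2)).symm
  exact ⟨_, key (fun _ h => ne_of_gt h) (tendsto_log_sub_log hb).1,
    key (fun _ h => ne_of_lt h) (tendsto_log_sub_log hb).2⟩

end Jump

/-! ### Separation of the ends of dual contours -/

lemma exists_cone_dist (n : ℕ) (ρ : ℂ) {ε : ℝ} (hε : 0 < ε) : ∃ c : ℝ, 0 < c ∧ ∀ z z' : ℂ,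
    (ρ * z ^ n).re ≤ 0 → ε * ‖z'‖ ^ n ≤ (ρ * z' ^ n).re → c * ‖z'‖ ≤ ‖z - z'‖ := by
  have hcont : ContinuousAt (fun u : ℂ => u ^ n) 1 := by fun_prop
  obtain ⟨c, hc, h⟩ := Metric.continuousAt_iff.1 hcont (ε / (‖ρ‖ + 1)) (by positivity)
  refine ⟨c, hc, fun z z' hz hz' => ?_⟩
  rcases eq_or_ne z' 0 with h0 | h0
  · simp [h0]
  by_contra! hlt
  have hz'0 : 0 < ‖z'‖ := norm_pos_iff.2 h0
  have h1 : dist (z / z') 1 < c := by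
    rw [dist_eq_norm, div_sub_one h0, norm_div, div_lt_iff₀ hz'0]
    exact hlt
  have h2 := h h1
  rw [dist_eq_norm, one_pow, div_pow] at h2
  have h3 : ρ * z ^ n = ρ * z' ^ n + ρ * z' ^ n * (z ^ n / z' ^ n - 1) := by
    field_simp
    ring
  have h4 : ‖ρ * z' ^ n * (z ^ n / z' ^ n - 1)‖ < ε * ‖z'‖ ^ n := by
    rw [norm_mul, norm_mul, norm_pow]
    have h5 : ‖ρ‖ * ‖z ^ n / z' ^ n - 1‖ < ε := by
      rw [lt_div_iff₀ (by positivity)] at h2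
      nlinarith [norm_nonneg ρ, norm_nonneg (z ^ n / z' ^ n - 1)]
    have h6 : 0 < ‖z'‖ ^ n := by positivity
    nlinarith
  have h7 := Complex.abs_re_le_norm (ρ * z' ^ n * (z ^ n / z' ^ n - 1))
  rw [h3, Complex.add_re] at hz
  linarith [neg_abs_le (ρ * z' ^ n * (z ^ n / z' ^ n - 1)).re]

section Dual

variable {A B : ℂ[X]} {w : Branch (directNum A B) B} {v : Branch A B}

lemma eval_derivative_ne_zero_of_rootMultiplicity_eq_one {b : ℂ} (h : B.rootMultiplicity b = 1) :
    B.eval b = 0 ∧ (derivative B).eval b ≠ 0 := by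
  have hB : B ≠ 0 := by rintro rfl; simp at h
  have h1 : B.IsRoot b := (rootMultiplicity_pos hB).1 (by omega)
  refine ⟨h1, fun h2 => ?_⟩
  have := (one_lt_rootMultiplicity_iff_isRoot hB).2 ⟨h1, h2⟩
  omega

lemma eval_of_one_lt_rootMultiplicity {b : ℂ} (h : 1 < B.rootMultiplicity b) :
    B.eval b = 0 ∧ (derivative B).eval b = 0 := by
  have hB : B ≠ 0 := by rintro rfl; simp at h
  exact (one_lt_rootMultiplicity_iff_isRoot hB).1 h

lemma IsTypeBB.eval_ne_zero (h : IsTypeBB A B) {b : ℂ} (hb : 1 < B.rootMultiplicity b) :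
    A.eval b ≠ 0 := fun h0 =>
  h.reduced b h0 (eval_of_one_lt_rootMultiplicity hb).1 (eval_of_one_lt_rootMultiplicity hb).2

lemma Branch.notMem_dom {P : ℂ[X]} (u : Branch P B) {b : ℂ} (hB : B.eval b = 0)
    (hP : P.eval b ≠ 0) : b ∉ u.dom := fun hb => by
  have h1 := u.ode b hb
  rw [hB, zero_mul] at h1
  exact mul_ne_zero hP (u.ne_zero b hb) h1.symm

lemma IsEndAtEssential.notMem_dom_dual (h : IsTypeBB A B) {γ : ℝ → ℂ} {l : Filter ℝ} {b : ℂ}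
    (hb : IsEndAtEssential (directNum A B) B γ l b) : b ∉ v.dom :=
  v.notMem_dom (eval_of_one_lt_rootMultiplicity hb.1).1 (h.eval_ne_zero hb.1)

lemma IsEndAtEssential.notMem_dom_direct (h : IsTypeBB A B) {γ : ℝ → ℂ} {l : Filter ℝ} {b : ℂ}
    (hb : IsEndAtEssential A B γ l b) : b ∉ w.dom := by
  refine w.notMem_dom (eval_of_one_lt_rootMultiplicity hb.1).1 ?_
  simpa [directNum, (eval_of_one_lt_rootMultiplicity hb.1).2] using h.eval_ne_zero hb.1

lemma IsEndAtRegular.eval_dual_ne_zero {γ : ℝ → ℂ} {l : Filter ℝ} {b : ℂ}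
    (hb : IsEndAtRegular (directNum A B) B γ l b) : A.eval b ≠ 0 := fun h0 => by
  obtain ⟨h1, ⟨k, hk⟩, -⟩ := hb
  have h2 := (eval_derivative_ne_zero_of_rootMultiplicity_eq_one h1).2
  simp only [directNum, eval_neg, eval_add, h0, zero_add] at hk
  have h3 : ((k : ℂ) + 1) * (derivative B).eval b = 0 := by linear_combination -hk
  exact mul_ne_zero (by exact_mod_cast k.succ_ne_zero) h2 h3

lemma IsEndAtRegular.eval_direct_ne_zero {γ : ℝ → ℂ} {l : Filter ℝ} {b : ℂ}
    (hb : IsEndAtRegular A B γ l b) : (directNum A B).eval b ≠ 0 := fun h0 => by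
  obtain ⟨h1, ⟨k, hk⟩, -⟩ := hb
  have h2 := (eval_derivative_ne_zero_of_rootMultiplicity_eq_one h1).2
  simp only [directNum, eval_neg, eval_add, hk] at h0
  have h3 : ((k : ℂ) + 1) * (derivative B).eval b = 0 := by linear_combination -h0
  exact mul_ne_zero (by exact_mod_cast k.succ_ne_zero) h2 h3

lemma exists_le_dist_of_tendsto {γ : ℝ → ℂ} {l : Filter ℝ} {b s : ℂ} (h : Tendsto γ l (𝓝 b))
    (hs : b ≠ s) : ∃ c : ℝ, 0 < c ∧ ∀ᶠ τ in l, c ≤ ‖γ τ - s‖ := by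
  have h1 : 0 < ‖b - s‖ := norm_pos_iff.2 (sub_ne_zero.2 hs)
  refine ⟨‖b - s‖ / 2, by positivity, ?_⟩
  exact (h.sub_const s).norm.eventually_const_le (by linarith)

lemma Contour.exists_le_dist_of_end (h : IsTypeBB A B) {γ : ℝ → ℂ} {l : Filter ℝ}
    (hl : IsAdmissibleEnd (directNum A B) B γ l) {s : ℂ} (hs : s ∈ v.dom) :
    ∃ c : ℝ, 0 < c ∧ ∀ᶠ τ in l, c ≤ ‖γ τ - s‖ := by
  rcases hl with hl | ⟨b, hl | hl⟩
  · refine ⟨1, one_pos, ?_⟩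
    filter_upwards [hl.1.eventually_ge_atTop (‖s‖ + 1)] with τ hτ
    linarith [norm_sub_norm_le (γ τ) s]
  · exact exists_le_dist_of_tendsto (hl.2.1.mono_right nhdsWithin_le_nhds)
      fun hb => hl.notMem_dom_dual h (v := v) (hb ▸ hs)
  · refine exists_le_dist_of_tendsto hl.2.2.1 fun hb => ?_
    exact v.notMem_dom (eval_derivative_ne_zero_of_rootMultiplicity_eq_one hl.1).1
      hl.eval_dual_ne_zero (hb ▸ hs)

lemma exists_Icc_cover {U V : Set ℝ} (hU : U ∈ 𝓝[>] (0 : ℝ)) (hV : V ∈ 𝓝[<] (1 : ℝ)) :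
    ∃ a b : ℝ, Icc a b ⊆ Ioo 0 1 ∧ Ioo (0 : ℝ) 1 ⊆ U ∪ Icc a b ∪ V := by
  obtain ⟨a, ha, hU⟩ := mem_nhdsGT_iff_exists_Ioo_subset.1 hU
  obtain ⟨b, hb, hV⟩ := mem_nhdsLT_iff_exists_Ioo_subset.1 hV
  have ha' : (0 : ℝ) < a := ha
  have hb' : b < (1 : ℝ) := hb
  refine ⟨a, b, fun t ht => ⟨ha'.trans_le ht.1, ht.2.trans_lt hb'⟩, fun t ht => ?_⟩
  rcases lt_or_ge t a with h1 | h1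
  · exact Or.inl (Or.inl (hU ⟨ht.1, h1⟩))
  rcases lt_or_ge b t with h2 | h2
  · exact Or.inr (hV ⟨h2, ht.2⟩)
  · exact Or.inl (Or.inr ⟨h1, h2⟩)

/-- A point of the dual domain that is not on a contour with admissible ends is at positive distance
from it. -/
lemma Contour.exists_le_dist (h : IsTypeBB A B) (γ : Contour w)
    (h0 : IsAdmissibleEnd (directNum A B) B γ.curve (𝓝[>] 0))
    (h1 : IsAdmissibleEnd (directNum A B) B γ.curve (𝓝[<] 1)) {s : ℂ} (hs : s ∈ v.dom)
    {I : Set ℝ} (hI : IsOpen I) (hne : ∀ τ ∈ Ioo (0 : ℝ) 1 \ I, γ.curve τ ≠ s) :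
    ∃ δ : ℝ, 0 < δ ∧ ∀ τ ∈ Ioo (0 : ℝ) 1 \ I, δ ≤ ‖γ.curve τ - s‖ := by
  obtain ⟨c₀, hc₀, H₀⟩ := Contour.exists_le_dist_of_end h h0 hs
  obtain ⟨c₁, hc₁, H₁⟩ := Contour.exists_le_dist_of_end h h1 hs
  obtain ⟨a, b, hab, hcov⟩ := exists_Icc_cover H₀ H₁
  have hK : IsCompact (Icc a b \ I) := isCompact_Icc.diff hI
  obtain ⟨c, hc, H⟩ : ∃ c : ℝ, 0 < c ∧ ∀ τ ∈ Icc a b \ I, c ≤ ‖γ.curve τ - s‖ :=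
    hK.exists_forall_le' (f := fun τ => ‖γ.curve τ - s‖)
      (((γ.piecewise.continuousOn.mono (Set.sdiff_subset.trans hab)).sub continuousOn_const).norm)
      fun τ hτ => norm_pos_iff.2 (sub_ne_zero.2 (hne τ ⟨hab hτ.1, hτ.2⟩))
  refine ⟨min c (min c₀ c₁), lt_min hc (lt_min hc₀ hc₁), fun τ hτ => ?_⟩
  rcases hcov hτ.1 with (h2 | h2) | h2
  · exact ((min_le_right _ _).trans (min_le_left _ _)).trans h2
  · exact (min_le_left _ _).trans (H τ ⟨h2, hτ.2⟩)
  · exact ((min_le_right _ _).trans (min_le_right _ _)).trans h2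

lemma Contour.notMem_closure (h : IsTypeBB A B) (γ : Contour w)
    (h0 : IsAdmissibleEnd (directNum A B) B γ.curve (𝓝[>] 0))
    (h1 : IsAdmissibleEnd (directNum A B) B γ.curve (𝓝[<] 1)) {s : ℂ} (hs : s ∈ v.dom)
    (hne : ∀ τ ∈ Ioo (0 : ℝ) 1, γ.curve τ ≠ s) : s ∉ closure (γ.curve '' Ioo 0 1) := by
  obtain ⟨δ, hδ, H⟩ := γ.exists_le_dist h h0 h1 hs isOpen_empty (by simpa using hne)
  rw [Metric.mem_closure_iff]
  push Not
  refine ⟨δ, hδ, ?_⟩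
  rintro _ ⟨τ, hτ, rfl⟩
  rw [dist_comm, dist_eq_norm]
  exact H τ (by simpa using hτ)

/-- The dual end `l'` stays away from the set `γ '' U`; near an essential singularity the
distance is comparable with the distance to the singularity. -/
def StaysAway (γ' : ℝ → ℂ) (l' : Filter ℝ) (g : ℝ → ℝ) (γ : ℝ → ℂ) (U : Set ℝ) : Prop :=
  ∃ c : ℝ, 0 < c ∧ ∀ᶠ t in l', ∀ τ ∈ U, c * g t ≤ ‖γ τ - γ' t‖

lemma StaysAway.union {γ γ' : ℝ → ℂ} {l' : Filter ℝ} {g : ℝ → ℝ} {U V : Set ℝ}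
    (hg : ∀ t, 0 ≤ g t) (hU : StaysAway γ' l' g γ U) (hV : StaysAway γ' l' g γ V) :
    StaysAway γ' l' g γ (U ∪ V) := by
  obtain ⟨c, hc, H⟩ := hU
  obtain ⟨c', hc', H'⟩ := hV
  refine ⟨min c c', lt_min hc hc', ?_⟩
  filter_upwards [H, H'] with t h1 h2 τ hτ
  rcases hτ with hτ | hτ
  · exact (mul_le_mul_of_nonneg_right (min_le_left _ _) (hg t)).trans (h1 τ hτ)
  · exact (mul_le_mul_of_nonneg_right (min_le_right _ _) (hg t)).trans (h2 τ hτ)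

lemma StaysAway.mono {γ γ' : ℝ → ℂ} {l' : Filter ℝ} {g : ℝ → ℝ} {U V : Set ℝ}
    (hU : StaysAway γ' l' g γ U) (h : V ⊆ U) : StaysAway γ' l' g γ V := by
  obtain ⟨c, hc, H⟩ := hU
  exact ⟨c, hc, H.mono fun t h1 τ hτ => h1 τ (h hτ)⟩

lemma leadingCoeff_directNum (h : IsTypeBB A B) :
    (directNum A B).leadingCoeff = -A.leadingCoeff := by
  rw [directNum, leadingCoeff_neg, leadingCoeff_add_of_degree_lt']
  refine degree_lt_degree ((natDegree_derivative_le B).trans_lt ?_)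
  have := h.degree_lt
  omega

lemma polarCoeff_directNum {b : ℂ} (hb : 1 < B.rootMultiplicity b) :
    polarCoeff (directNum A B) B b = -polarCoeff A B b := by
  simp [polarCoeff, directNum, (eval_of_one_lt_rootMultiplicity hb).2, neg_div]

lemma staysAway_infinity_end (h : IsTypeBB A B) {γ γ' : ℝ → ℂ} {l l' : Filter ℝ}
    (hl' : IsEndAtInfinity A B γ' l') (hl : IsAdmissibleEnd (directNum A B) B γ l) :
    ∃ U ∈ l, StaysAway γ' l' (fun _ => 1) γ U := by
  have key : ∀ b, Tendsto γ l (𝓝 b) → ∃ U ∈ l, StaysAway γ' l' (fun _ => 1) γ U := fun b hb => by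
    refine ⟨_, hb.norm.eventually_le_const (lt_add_one ‖b‖), 1, one_pos, ?_⟩
    filter_upwards [hl'.1.eventually_ge_atTop (‖b‖ + 2)] with t ht τ hτ
    have h1 : ‖γ τ‖ ≤ ‖b‖ + 1 := hτ
    have h2 := norm_sub_norm_le (γ' t) (γ τ)
    rw [norm_sub_rev] at h2
    linarith
  rcases hl with hl | ⟨b, hl | hl⟩
  · obtain ⟨-, ⟨ε, hε, hs⟩, -⟩ := hl
    obtain ⟨hinf, ⟨ε', hε', hs'⟩, -⟩ := hl'
    rw [leadingCoeff_directNum h, natDegree_directNum h] at hs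
    obtain ⟨c, hc, H⟩ := exists_cone_dist (A.natDegree - B.natDegree + 1)
      (-(A.leadingCoeff / B.leadingCoeff)) hε'
    refine ⟨_, hs, c, hc, ?_⟩
    filter_upwards [hs', hinf.eventually_ge_atTop 1] with t ht ht1 τ hτ
    have h1 := H (γ τ) (γ' t) ?_ ?_
    · nlinarith
    · have h2 : (-A.leadingCoeff / B.leadingCoeff *
          γ τ ^ (A.natDegree - B.natDegree + 1)).re ≤ _ := hτ
      rw [neg_div] at h2
      refine h2.trans ?_
      have : 0 ≤ ε * ‖γ τ‖ ^ (A.natDegree - B.natDegree + 1) := by positivity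
      linarith
    · rw [neg_mul, Complex.neg_re]
      linarith
  · exact key b (hl.2.1.mono_right nhdsWithin_le_nhds)
  · exact key b hl.2.2.1

lemma staysAway_of_tendsto_ne {γ γ' : ℝ → ℂ} {l l' : Filter ℝ} {b b' : ℂ}
    (h : Tendsto γ l (𝓝 b)) (h' : Tendsto γ' l' (𝓝 b')) (hne : b ≠ b') :
    ∃ U ∈ l, StaysAway γ' l' (fun _ => 1) γ U := by
  have h1 : 0 < ‖b - b'‖ := norm_pos_iff.2 (sub_ne_zero.2 hne)
  have h2 : ∀ᶠ τ in l, ‖γ τ - b‖ ≤ ‖b - b'‖ / 4 := by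
    have := (h.sub_const b).norm
    rw [sub_self, norm_zero] at this
    exact this.eventually_le_const (by linarith)
  have h3 : ∀ᶠ t in l', ‖γ' t - b'‖ ≤ ‖b - b'‖ / 4 := by
    have := (h'.sub_const b').norm
    rw [sub_self, norm_zero] at this
    exact this.eventually_le_const (by linarith)
  refine ⟨_, h2, ‖b - b'‖ / 2, by linarith, h3.mono fun t ht τ hτ => ?_⟩
  have h4 : ‖γ τ - b‖ ≤ ‖b - b'‖ / 4 := hτ
  have h5 := norm_sub_le_norm_sub_add_norm_sub b (γ τ) b'
  have h6 := norm_sub_le_norm_sub_add_norm_sub (γ τ) (γ' t) b'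
  rw [norm_sub_rev b (γ τ)] at h5
  linarith

lemma staysAway_of_infinity {γ γ' : ℝ → ℂ} {l l' : Filter ℝ} {b' : ℂ}
    (h : Tendsto (fun t => ‖γ t‖) l atTop) (h' : Tendsto γ' l' (𝓝 b')) :
    ∃ U ∈ l, StaysAway γ' l' (fun _ => 1) γ U := by
  refine ⟨_, h.eventually_ge_atTop (‖b'‖ + 2), 1, one_pos, ?_⟩
  filter_upwards [h'.norm.eventually_le_const (lt_add_one ‖b'‖)] with t ht τ hτ
  have h1 : ‖b'‖ + 2 ≤ ‖γ τ‖ := hτ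
  linarith [norm_sub_norm_le (γ τ) (γ' t)]

lemma StaysAway.of_one {γ γ' : ℝ → ℂ} {l' : Filter ℝ} {b' : ℂ} {U : Set ℝ}
    (h : StaysAway γ' l' (fun _ => 1) γ U) (h' : Tendsto γ' l' (𝓝 b')) :
    StaysAway γ' l' (fun t => ‖γ' t - b'‖) γ U := by
  obtain ⟨c, hc, H⟩ := h
  refine ⟨c, hc, ?_⟩
  have := (h'.sub_const b').norm
  rw [sub_self, norm_zero] at this
  filter_upwards [H, this.eventually_le_const one_pos] with t h1 h2 τ hτ
  exact (mul_le_mul_of_nonneg_left h2 hc.le).trans (h1 τ hτ)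

lemma re_mul_conj_pow {κ z : ℂ} {m : ℕ} (hz : z ≠ 0) :
    (conj κ * z ^ m).re = (κ / z ^ m).re * (‖z‖ ^ m) ^ 2 := by
  have h1 : conj κ * z ^ m = conj (κ / z ^ m) * ((‖z‖ ^ m) ^ 2 : ℝ) := by
    have h2 : conj (z ^ m) * z ^ m = ((‖z‖ ^ m) ^ 2 : ℝ) := by
      rw [mul_comm, Complex.mul_conj, normSq_eq_norm_sq, norm_pow]
    rw [← h2, map_div₀]
    have h3 : conj (z ^ m) ≠ 0 := by simp [hz]
    field_simp
  rw [h1, Complex.re_mul_ofReal, Complex.conj_re]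

lemma staysAway_essential_end {γ γ' : ℝ → ℂ} {l l' : Filter ℝ} {b' : ℂ}
    (hl' : IsEndAtEssential A B γ' l' b') (hl : IsAdmissibleEnd (directNum A B) B γ l) :
    ∃ U ∈ l, StaysAway γ' l' (fun t => ‖γ' t - b'‖) γ U := by
  have hlim' := hl'.2.1.mono_right nhdsWithin_le_nhds
  have key : (∃ U ∈ l, StaysAway γ' l' (fun _ => 1) γ U) →
      ∃ U ∈ l, StaysAway γ' l' (fun t => ‖γ' t - b'‖) γ U := fun ⟨U, hU, H⟩ =>
    ⟨U, hU, H.of_one hlim'⟩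
  rcases hl with hl | ⟨b, hl | hl⟩
  · exact key (staysAway_of_infinity hl.1 hlim')
  · rcases ne_or_eq b b' with hb | rfl
    · exact key (staysAway_of_tendsto_ne (hl.2.1.mono_right nhdsWithin_le_nhds) hlim' hb)
    obtain ⟨hm, hlim, ⟨ε, hε, hs⟩, -⟩ := hl
    obtain ⟨-, hlim', ⟨ε', hε', hs'⟩, -⟩ := hl'
    rw [polarCoeff_directNum hm] at hs
    set m := B.rootMultiplicity b - 1
    obtain ⟨c, hc, H⟩ := exists_cone_dist m (conj (polarCoeff A B b)) hε'
    have hne := (tendsto_nhdsWithin_iff.1 hlim).2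
    have hne' := (tendsto_nhdsWithin_iff.1 hlim').2
    refine ⟨_, hs.and hne, c, hc, ?_⟩
    filter_upwards [hs', hne'] with t ht ht0 τ hτ
    obtain ⟨hτ, hτ0⟩ := hτ
    have hτ1 : γ τ - b ≠ 0 := sub_ne_zero.2 hτ0
    have ht1 : γ' t - b ≠ 0 := sub_ne_zero.2 ht0
    have h1 := H (γ τ - b) (γ' t - b) ?_ ?_
    · rwa [sub_sub_sub_cancel_right] at h1
    · rw [re_mul_conj_pow hτ1]
      rw [neg_div, Complex.neg_re] at hτ
      have : 0 ≤ ε / ‖γ τ - b‖ ^ m := by positivity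
      exact mul_nonpos_of_nonpos_of_nonneg (by linarith) (by positivity)
    · rw [re_mul_conj_pow ht1]
      have h2 : 0 < ‖γ' t - b‖ ^ m := pow_pos (norm_pos_iff.2 ht1) _
      calc ε' * ‖γ' t - b‖ ^ m = ε' / ‖γ' t - b‖ ^ m * (‖γ' t - b‖ ^ m) ^ 2 := by field_simp
        _ ≤ _ := by gcongr
  · refine key (staysAway_of_tendsto_ne hl.2.2.1 hlim' ?_)
    rintro rfl
    have h1 := hl.1
    have h2 := hl'.1
    omega

lemma staysAway_regular_end {γ γ' : ℝ → ℂ} {l l' : Filter ℝ} {b' : ℂ}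
    (hl' : IsEndAtRegular A B γ' l' b') (hl : IsAdmissibleEnd (directNum A B) B γ l) :
    ∃ U ∈ l, StaysAway γ' l' (fun _ => 1) γ U := by
  rcases hl with hl | ⟨b, hl | hl⟩
  · exact staysAway_of_infinity hl.1 hl'.2.2.1
  · refine staysAway_of_tendsto_ne (hl.2.1.mono_right nhdsWithin_le_nhds) hl'.2.2.1 ?_
    rintro rfl
    have h1 := hl.1
    have h2 := hl'.1
    omega
  · refine staysAway_of_tendsto_ne hl.2.2.1 hl'.2.2.1 ?_
    rintro rfl
    obtain ⟨h1, ⟨k, hk⟩, -⟩ := hl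
    obtain ⟨-, ⟨k', hk'⟩, -⟩ := hl'
    have h2 := (eval_derivative_ne_zero_of_rootMultiplicity_eq_one h1).2
    simp only [directNum, eval_neg, eval_add, hk'] at hk
    have h3 : ((k : ℂ) + k' + 1) * (derivative B).eval b = 0 := by linear_combination -hk
    refine mul_ne_zero ?_ h2 h3
    exact_mod_cast (k + k').succ_ne_zero

lemma staysAway_compact (γ : Contour w) {γ' : ℝ → ℂ} {l' : Filter ℝ} {b' : ℂ}
    (h' : Tendsto γ' l' (𝓝 b')) (hb' : b' ∉ w.dom) {a b : ℝ} (hab : Icc a b ⊆ Ioo 0 1) :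
    StaysAway γ' l' (fun _ => 1) γ.curve (Icc a b) := by
  obtain ⟨c, hc, H⟩ : ∃ c : ℝ, 0 < c ∧ ∀ τ ∈ Icc a b, c ≤ ‖γ.curve τ - b'‖ :=
    isCompact_Icc.exists_forall_le' (f := fun τ => ‖γ.curve τ - b'‖)
      (((γ.piecewise.continuousOn.mono hab).sub continuousOn_const).norm)
      fun τ hτ => norm_pos_iff.2 (sub_ne_zero.2 fun h => hb' (h ▸ γ.mem_dom τ (hab hτ)))
  have h3 : ∀ᶠ t in l', ‖γ' t - b'‖ ≤ c / 2 := by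
    have := (h'.sub_const b').norm
    rw [sub_self, norm_zero] at this
    exact this.eventually_le_const (by linarith)
  refine ⟨c / 2, by linarith, h3.mono fun t ht τ hτ => ?_⟩
  have h4 := H τ hτ
  have h5 := norm_sub_le_norm_sub_add_norm_sub (γ.curve τ) (γ' t) b'
  linarith

lemma staysAway_compact_infinity (γ : Contour w) {γ' : ℝ → ℂ} {l' : Filter ℝ}
    (h' : Tendsto (fun t => ‖γ' t‖) l' atTop) {a b : ℝ} (hab : Icc a b ⊆ Ioo 0 1) :
    StaysAway γ' l' (fun _ => 1) γ.curve (Icc a b) := by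
  obtain ⟨C, hC⟩ := isCompact_Icc.exists_bound_of_continuousOn (γ.piecewise.continuousOn.mono hab)
  refine ⟨1, one_pos, ?_⟩
  filter_upwards [h'.eventually_ge_atTop (C + 1)] with t ht τ hτ
  have h1 := hC τ hτ
  have h2 := norm_sub_norm_le (γ' t) (γ.curve τ)
  rw [norm_sub_rev] at h2
  linarith

lemma StaysAway.cover {γ γ' : ℝ → ℂ} {l' : Filter ℝ} {g : ℝ → ℝ} (hg : ∀ t, 0 ≤ g t)
    (h0 : ∃ U ∈ 𝓝[>] (0 : ℝ), StaysAway γ' l' g γ U) (h1 : ∃ U ∈ 𝓝[<] (1 : ℝ), StaysAway γ' l' g γ U)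
    (hK : ∀ a b, Icc a b ⊆ Ioo 0 1 → StaysAway γ' l' g γ (Icc a b)) :
    StaysAway γ' l' g γ (Ioo 0 1) := by
  obtain ⟨U, hU, H⟩ := h0
  obtain ⟨V, hV, H'⟩ := h1
  obtain ⟨a, b, hab, hcov⟩ := exists_Icc_cover hU hV
  exact ((H.union hg (hK a b hab)).union hg H').mono hcov

end Dual

/-! ### The concomitant of a pair of contours as a sum over their crossings -/

section Crossings

variable {A B : ℂ[X]} {w : Branch (directNum A B) B} {v : Branch A B}

lemma Contour.inner_kernel_eq (h : IsTypeBB A B) (γ : Contour w) {s : ℂ}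
    (hs : s ∉ closure (γ.curve '' Ioo 0 1)) (hv : s ∈ v.dom) :
    HasDerivAt (fun s => B.eval s * v.W s * γ.stieltjes s)
      (γ.integral fun y => kernel A B 0 y s * exp (0 * (y - s)) * w.W y * v.W s) s := by
  have hB := h.ne_zero
  have hdeg := h.le_directNum
  obtain ⟨δ, hδ, hfar⟩ := γ.exists_dist_of_notMem_closure hs
  have hne : ∀ t ∈ Ioo (0 : ℝ) 1, γ.curve t ≠ s := fun t ht h0 => by
    have := hfar t ht
    rw [h0, sub_self, norm_zero] at this
    linarith
  have hI := fun {f : ℂ → ℂ} (hf : ExpGrowth f) k => γ.integrableOn_div hB hdeg hf hδ hfar k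
  have hd : ∀ z, z ≠ s → HasDerivAt (fun z => (z - s)⁻¹) (-1 / (z - s) ^ 2) z := fun z hz =>
    ((hasDerivAt_id z).sub_const s).inv (sub_ne_zero.2 hz)
  have hA1 := hI (ExpGrowth.eval B) 2
  have hA2 := hI (ExpGrowth.eval A) 1
  have hA3 := hI (ExpGrowth.const 1) 2
  have hA4 := hI (ExpGrowth.const 1) 1
  have e0 : ∀ t ∈ Ioo (0 : ℝ) 1, (B.eval (γ.curve t) * deriv (fun z => (z - s)⁻¹) (γ.curve t) +
        (directNum A B + derivative B).eval (γ.curve t) * (γ.curve t - s)⁻¹) * w.W (γ.curve t) *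
        deriv γ.curve t =
      -(B.eval (γ.curve t) / (γ.curve t - s) ^ 2 * w.W (γ.curve t) * deriv γ.curve t) -
        A.eval (γ.curve t) / (γ.curve t - s) ^ 1 * w.W (γ.curve t) * deriv γ.curve t :=
    fun t ht => by
      rw [(hd _ (hne t ht)).deriv]
      simp only [eval_add, eval_neg, pow_one]
      ring
  have hibp := γ.integral_deriv_eq_zero hB hdeg (f := fun z => (z - s)⁻¹) (C := δ⁻¹) (c := 0)
    (fun z hz => (hd z fun h0 => hs (h0 ▸ hz)).differentiableAt)
    (fun t ht => by
      rw [norm_inv, zero_mul, Real.exp_zero, mul_one]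
      exact inv_anti₀ hδ (hfar t ht))
    (IntegrableOn.congr_fun (hA1.neg.sub hA2) (fun t ht => (e0 t ht).symm) measurableSet_Ioo)
  rw [Contour.integral, setIntegral_congr_fun measurableSet_Ioo e0] at hibp
  have e1 : ∀ t ∈ Ioo (0 : ℝ) 1, kernel A B 0 (γ.curve t) s *
        exp (0 * (γ.curve t - s)) * w.W (γ.curve t) * v.W s * deriv γ.curve t =
      v.W s * (-(B.eval (γ.curve t) / (γ.curve t - s) ^ 2 * w.W (γ.curve t) * deriv γ.curve t) -
        A.eval (γ.curve t) / (γ.curve t - s) ^ 1 * w.W (γ.curve t) * deriv γ.curve t) +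
      (v.W s * B.eval s * (1 / (γ.curve t - s) ^ 2 * w.W (γ.curve t) * deriv γ.curve t) +
      v.W s * ((derivative B).eval s + A.eval s) *
        (1 / (γ.curve t - s) ^ 1 * w.W (γ.curve t) * deriv γ.curve t)) := fun t ht => by
    rw [kernel_eq _ _ _ _ _ (hne t ht), zero_mul, Complex.exp_zero]
    have := sub_ne_zero.2 (hne t ht)
    field_simp
    ring
  have e2 : (γ.integral fun y => kernel A B 0 y s * exp (0 * (y - s)) * w.W y * v.W s) =
      v.W s * B.eval s * (γ.integral fun y => w.W y / (y - s) ^ 2) +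
      v.W s * ((derivative B).eval s + A.eval s) * γ.stieltjes s := by
    have hA5 : IntegrableOn (fun t => -(B.eval (γ.curve t) / (γ.curve t - s) ^ 2 *
        w.W (γ.curve t) * deriv γ.curve t) - A.eval (γ.curve t) / (γ.curve t - s) ^ 1 *
        w.W (γ.curve t) * deriv γ.curve t) (Ioo 0 1) := hA1.neg.sub hA2
    have hA6 : IntegrableOn (fun t => v.W s * B.eval s * (1 / (γ.curve t - s) ^ 2 *
        w.W (γ.curve t) * deriv γ.curve t) + v.W s * ((derivative B).eval s + A.eval s) *
        (1 / (γ.curve t - s) ^ 1 * w.W (γ.curve t) * deriv γ.curve t)) (Ioo 0 1) :=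
      (hA3.const_mul _).add (hA4.const_mul _)
    rw [Contour.integral, setIntegral_congr_fun measurableSet_Ioo e1,
      integral_add (hA5.const_mul _) hA6, integral_add (hA3.const_mul _) (hA4.const_mul _)]
    simp only [MeasureTheory.integral_const_mul]
    rw [hibp, mul_zero, zero_add, Contour.stieltjes, Contour.integral, Contour.integral]
    congr 2
    · refine setIntegral_congr_fun measurableSet_Ioo fun t _ => ?_
      ring
    · refine setIntegral_congr_fun measurableSet_Ioo fun t _ => ?_
      ring
  rw [e2]
  have h1 := ((B.hasDerivAt s).mul (v.hasDerivAt hv)).mul (γ.hasDerivAt_stieltjes hB hdeg hs)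
  refine h1.congr_deriv ?_
  have h2 := v.ode s hv
  simp only [Pi.mul_apply]
  linear_combination γ.stieltjes s * h2

lemma Contour.tendsto_stieltjes_end (h : IsTypeBB A B) (γ : Contour w) (γ' : Contour v)
    (h0 : IsAdmissibleEnd (directNum A B) B γ.curve (𝓝[>] 0))
    (h1 : IsAdmissibleEnd (directNum A B) B γ.curve (𝓝[<] 1)) {l : Filter ℝ} (hl : IsEnd l)
    (h' : IsAdmissibleEnd A B γ'.curve l) :
    Tendsto (fun t => B.eval (γ'.curve t) * v.W (γ'.curve t) * γ.stieltjes (γ'.curve t)) l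
      (𝓝 0) := by
  have hB := h.ne_zero
  have hdeg := h.le_directNum
  set I := ∫ t in Ioo (0 : ℝ) 1, ‖w.W (γ.curve t) * deriv γ.curve t‖ with hI
  have hI0 : 0 ≤ I := integral_nonneg fun _ => norm_nonneg _
  have bdd : StaysAway γ'.curve l (fun _ => 1) γ.curve (Ioo 0 1) →
      Tendsto (fun t => B.eval (γ'.curve t) * v.W (γ'.curve t) * γ.stieltjes (γ'.curve t)) l
      (𝓝 0) := fun ⟨c, hc, H⟩ => by
    refine γ'.tendsto_boundary hB h.degree_lt hl h' (C := I / c) (c := 0) ?_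
    filter_upwards [H] with t ht
    rw [zero_mul, Real.exp_zero, mul_one]
    exact γ.norm_stieltjes_le hB hdeg hc fun τ hτ => by simpa using ht τ hτ
  rcases h' with h2 | ⟨b, h2 | h2⟩
  · exact bdd (StaysAway.cover (fun _ => zero_le_one) (staysAway_infinity_end h h2 h0)
      (staysAway_infinity_end h h2 h1) fun a b hab => staysAway_compact_infinity γ h2.1 hab)
  · have hlim := h2.2.1.mono_right nhdsWithin_le_nhds
    have hne := (tendsto_nhdsWithin_iff.1 h2.2.1).2
    obtain ⟨c, hc, H⟩ := StaysAway.cover (fun _ => norm_nonneg _) (staysAway_essential_end h2 h0)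
      (staysAway_essential_end h2 h1) fun a b' hab =>
        (staysAway_compact γ hlim (h2.notMem_dom_direct h) hab).of_one hlim
    obtain ⟨C, ε, hε, hC⟩ := γ'.norm_le_of_isEndAtEssential hB hl h2
    have hr : Tendsto (fun t => ‖γ'.curve t - b‖⁻¹) l atTop := by
      have h3 : Tendsto (fun t => ‖γ'.curve t - b‖) l (𝓝[>] 0) := by
        refine tendsto_nhdsWithin_iff.2 ⟨?_, ?_⟩
        · have := (hlim.sub_const b).norm
          rwa [sub_self, norm_zero] at this
        · filter_upwards [hne] with t ht
          exact norm_pos_iff.2 (sub_ne_zero.2 ht)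
      exact tendsto_inv_nhdsGT_zero.comp h3
    have hm : 1 ≤ B.rootMultiplicity b - 1 := by have := h2.1; omega
    have hlim2 := ((tendsto_pow_mul_exp_neg_pow hε hm 1).comp hr).const_mul
      ((‖B.eval b‖ + 1) * |C| * (I / c))
    rw [mul_zero] at hlim2
    refine squeeze_zero_norm' ?_ hlim2
    have hBb := (((B.continuous.tendsto b).comp hlim).norm).eventually_le_const
      (lt_add_one ‖B.eval b‖)
    filter_upwards [hBb, hC, H, hne] with t h3 h4 h5 h6
    have h7 : 0 < ‖γ'.curve t - b‖ := norm_pos_iff.2 (sub_ne_zero.2 h6)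
    have h8 := γ.norm_stieltjes_le hB hdeg (mul_pos hc h7) h5
    have h9 : ‖v.W (γ'.curve t)‖ ≤
        |C| * rexp (-ε * ‖γ'.curve t - b‖⁻¹ ^ (B.rootMultiplicity b - 1)) :=
      h4.trans (by gcongr; exact le_abs_self C)
    have h3' : ‖B.eval (γ'.curve t)‖ ≤ ‖B.eval b‖ + 1 := h3
    rw [norm_mul, norm_mul]
    calc _ ≤ (‖B.eval b‖ + 1) * (|C| * rexp (-ε * ‖γ'.curve t - b‖⁻¹ ^
          (B.rootMultiplicity b - 1))) * (I / (c * ‖γ'.curve t - b‖)) := by gcongr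
      _ = _ := by
        simp only [Function.comp]
        field_simp
  · have hb : b ∉ w.dom := w.notMem_dom
      (eval_derivative_ne_zero_of_rootMultiplicity_eq_one h2.1).1 h2.eval_direct_ne_zero
    exact bdd (StaysAway.cover (fun _ => zero_le_one) (staysAway_regular_end h2 h0)
      (staysAway_regular_end h2 h1) fun a b' hab => staysAway_compact γ h2.2.2.1 hb hab)

/-- The dual contour crosses the direction `d` at time `t₀` from the side of `-σ` to the side of
`σ`. -/
def CrossesAt (γ' : ℝ → ℂ) (d : ℂ) (t₀ σ : ℝ) : Prop :=
  (∀ᶠ t in 𝓝[<] t₀, σ * ((γ' t - γ' t₀) / d).im < 0) ∧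
    ∀ᶠ t in 𝓝[>] t₀, 0 < σ * ((γ' t - γ' t₀) / d).im

lemma Contour.double_eq_sum_crossings (h : IsTypeBB A B) (γ : Contour w) (γ' : Contour v)
    (h0 : IsAdmissibleEnd (directNum A B) B γ.curve (𝓝[>] 0))
    (h1 : IsAdmissibleEnd (directNum A B) B γ.curve (𝓝[<] 1))
    (h0' : IsAdmissibleEnd A B γ'.curve (𝓝[>] 0)) (h1' : IsAdmissibleEnd A B γ'.curve (𝓝[<] 1))
    (T : Finset ℝ) (σ : ℝ → ℝ) (hT : ∀ t ∈ T, t ∈ Ioo (0 : ℝ) 1)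
    (hdisj : ∀ t ∈ Ioo (0 : ℝ) 1, t ∉ T → ∀ τ ∈ Ioo (0 : ℝ) 1, γ.curve τ ≠ γ'.curve t)
    (hcross : ∀ t ∈ T, (σ t = 1 ∨ σ t = -1) ∧
      ∃ d, γ.PassesAt (γ'.curve t) d ∧ CrossesAt γ'.curve d t (σ t)) :
    γ.double γ' 0 (kernel A B 0) = -(2 * π * I) *
      ∑ t ∈ T, σ t * (B.eval (γ'.curve t) * w.W (γ'.curve t) * v.W (γ'.curve t)) := by
  have hB := h.ne_zero
  have hdeg := h.le_directNum
  obtain ⟨S, hS, hsm⟩ := γ'.exists_smooth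
  have hcl : ∀ t ∈ Ioo (0 : ℝ) 1 \ T, γ'.curve t ∉ closure (γ.curve '' Ioo 0 1) :=
    fun t ht => γ.notMem_closure h h0 h1 (γ'.mem_dom t ht.1) (hdisj t ht.1 ht.2)
  set G : ℂ → ℂ := fun s => B.eval s * v.W s * γ.stieltjes s
  have hG := fun t (ht : t ∈ Ioo (0 : ℝ) 1 \ T) =>
    γ.inner_kernel_eq h (hcl t ht) (γ'.mem_dom t ht.1)
  obtain ⟨K, hK⟩ := isPolyKernel_kernel h.degree_lt 0
  have hint : IntegrableOn (fun t => (γ.integral fun y => kernel A B 0 y (γ'.curve t) *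
      exp (0 * (y - γ'.curve t)) * w.W y * v.W (γ'.curve t)) * deriv γ'.curve t)
      (Ioo 0 1) := by
    have h2 := γ'.integrableOn_expGrowth hB h.degree_lt
      (ExpGrowth.sum (range A.natDegree) fun k _ =>
        ((ExpGrowth.eval (K k)).mul (ExpGrowth.exp (-0))).mul
          (ExpGrowth.const (γ.laplace hB hdeg 0 (X ^ k))))
    refine IntegrableOn.congr_fun h2 (fun t _ => ?_) measurableSet_Ioo
    simp only [γ.inner_eq_sum hB hdeg hK]
    ring
  have hlim : ∀ t ∈ T, ∃ Lm Lp : ℂ, Tendsto (fun t => G (γ'.curve t)) (𝓝[<] t) (𝓝 Lm) ∧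
      Tendsto (fun t => G (γ'.curve t)) (𝓝[>] t) (𝓝 Lp) ∧ Lp - Lm = 2 * π * I *
        (σ t * (B.eval (γ'.curve t) * w.W (γ'.curve t) * v.W (γ'.curve t))) := fun t ht => by
    obtain ⟨hσ, d, hpass, hl, hr⟩ := hcross t ht
    obtain ⟨a, ha1, ha2⟩ := γ.exists_tendsto_stieltjes hB hdeg hpass
    set p := γ'.curve t with hp
    have hcurve : ContinuousAt γ'.curve t := (hsm t (hT t ht)).1
    have hBW : ContinuousAt (fun s => B.eval s * v.W s) p :=
      B.continuous.continuousAt.mul (v.hasDerivAt (γ'.mem_dom t (hT t ht))).continuousAt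
    have hBW' : Tendsto (fun t => B.eval (γ'.curve t) * v.W (γ'.curve t)) (𝓝 t)
        (𝓝 (B.eval p * v.W p)) := hBW.tendsto.comp hcurve
    have hto : ∀ {l : Filter ℝ} {U : Set ℂ}, l ≤ 𝓝 t → (∀ᶠ t in l, γ'.curve t ∈ U) →
        Tendsto γ'.curve l (𝓝[U] p) := fun hl hU =>
      tendsto_nhdsWithin_iff.2 ⟨hcurve.tendsto.mono_left hl, hU⟩
    rcases hσ with hσ | hσ
    · rw [hσ] at hl hr
      refine ⟨_, _, (hBW'.mono_left nhdsWithin_le_nhds).mul (ha2.comp (hto nhdsWithin_le_nhds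
        (hl.mono fun _ h => by simpa using h))), (hBW'.mono_left nhdsWithin_le_nhds).mul
        (ha1.comp (hto nhdsWithin_le_nhds (hr.mono fun _ h => by simpa using h))), ?_⟩
      rw [hσ, Complex.ofReal_one]
      ring
    · rw [hσ] at hl hr
      refine ⟨_, _, (hBW'.mono_left nhdsWithin_le_nhds).mul (ha1.comp (hto nhdsWithin_le_nhds
        (hl.mono fun _ h => by simpa using h))), (hBW'.mono_left nhdsWithin_le_nhds).mul
        (ha2.comp (hto nhdsWithin_le_nhds (hr.mono fun _ h => by simpa using h))), ?_⟩
      rw [hσ, Complex.ofReal_neg, Complex.ofReal_one]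
      ring
  choose! Lm Lp hLm hLp hL using hlim
  have key := integral_Ioo_eq_sub_jumps (F := fun t => G (γ'.curve t)) hS.countable T one_pos hT
    (fun t ht => ((hG t ht).continuousAt.comp (f := γ'.curve) (hsm t ht.1).1).continuousWithinAt)
    (fun t ht => (hG t ht.1).comp t ((hsm t ht.1.1).2.2 ht.2).1) hint
    (γ.tendsto_stieltjes_end h γ' h0 h1 (Or.inl rfl) h0')
    (γ.tendsto_stieltjes_end h γ' h0 h1 (Or.inr rfl) h1') fun t ht => ⟨hLm t ht, hLp t ht⟩
  rw [Contour.double, Contour.integral, key, sum_congr rfl hL, ← mul_sum]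
  ring

end Crossings

/-! ### Polygonal contours -/

/-- A polygonal path with vertices `v 0, …, v n`. If `e₀ ≠ 0` it is preceded by the ray from `v 0` in
direction `e₀`, otherwise it starts at `v 0`; the same for `e₁` at the other end. -/
structure PolyPath where
  n : ℕ
  pos_n : 0 < n
  v : ℕ → ℂ
  e₀ : ℂ
  e₁ : ℂ

namespace PolyPath

variable (p : PolyPath)

/-- The truncation of a real number to the unit interval. -/
def clamp (x : ℝ) : ℝ := max 0 (min x 1)

/-- The path as a function of a parameter in `(0, n + 2)`. -/
def pos (τ : ℝ) : ℂ := p.v 0 + (1 / min τ 1 - 1 : ℝ) * p.e₀ +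
    ∑ i ∈ range p.n, (clamp (τ - 1 - i) : ℝ) * (p.v (i + 1) - p.v i) +
    (1 / min (p.n + 2 - τ) 1 - 1 : ℝ) * p.e₁

/-- The first parameter value. -/
def start : ℝ := if p.e₀ = 0 then 1 else 0

/-- The last parameter value. -/
def fin : ℝ := if p.e₁ = 0 then p.n + 1 else p.n + 2

/-- The open parameter interval. -/
abbrev dom : Set ℝ := Ioo p.start p.fin

/-- The path passes through `z` at the parameter `τ`. -/
def On (τ : ℝ) (z : ℂ) : Prop := τ ∈ p.dom ∧ p.pos τ = z

/-- The path as a function on the unit interval. -/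
def curve (t : ℝ) : ℂ := p.pos (p.start + (p.fin - p.start) * t)

lemma start_nonneg : 0 ≤ p.start := by unfold start; split_ifs <;> norm_num

lemma start_le : p.start ≤ 1 := by unfold start; split_ifs <;> norm_num

lemma le_fin : (p.n : ℝ) + 1 ≤ p.fin := by unfold fin; split_ifs <;> linarith

lemma fin_le : p.fin ≤ p.n + 2 := by unfold fin; split_ifs <;> linarith

lemma one_le_n : (1 : ℝ) ≤ p.n := by exact_mod_cast p.pos_n

lemma length_pos : 0 < p.fin - p.start := by linarith [p.start_le, p.le_fin, p.one_le_n]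

lemma clamp_of_le {x : ℝ} (h : x ≤ 0) : clamp x = 0 := max_eq_left ((min_le_left _ _).trans h)

lemma clamp_of_ge {x : ℝ} (h : 1 ≤ x) : clamp x = 1 := by
  rw [clamp, min_eq_right h, max_eq_right zero_le_one]

lemma clamp_of_mem {x : ℝ} (h0 : 0 ≤ x) (h1 : x ≤ 1) : clamp x = x := by
  rw [clamp, min_eq_left h1, max_eq_right h0]

lemma sum_clamp (v : ℕ → ℂ) {k : ℕ} {s : ℝ} (h0 : 0 ≤ s) (h1 : s ≤ 1) (m : ℕ) :
    (m ≤ k → ∑ i ∈ range m, (clamp (k + s - i) : ℝ) * (v (i + 1) - v i) = v m - v 0) ∧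
    (k < m → ∑ i ∈ range m, (clamp (k + s - i) : ℝ) * (v (i + 1) - v i) =
      v k + s * (v (k + 1) - v k) - v 0) := by
  induction m with
  | zero => simp
  | succ m ih =>
    rw [Finset.sum_range_succ]
    refine ⟨fun hm => ?_, fun hm => ?_⟩
    · have hm' : (m : ℝ) + 1 ≤ k := by exact_mod_cast hm
      rw [ih.1 (by omega), clamp_of_ge (by linarith)]
      push_cast
      ring
    · rcases Nat.lt_or_ge k m with hk | hk
      · have hk' : (k : ℝ) + 1 ≤ m := by exact_mod_cast hk
        rw [ih.2 hk, clamp_of_le (by linarith)]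
        simp
      · obtain rfl : m = k := by omega
        rw [ih.1 le_rfl, add_sub_cancel_left, clamp_of_mem h0 h1]
        ring

lemma pos_seg {k : ℕ} (hk : k < p.n) {s : ℝ} (h0 : 0 ≤ s) (h1 : s ≤ 1) :
    p.pos (1 + k + s) = p.v k + s * (p.v (k + 1) - p.v k) := by
  have hk' : (k : ℝ) + 1 ≤ p.n := by exact_mod_cast hk
  have h2 := (sum_clamp p.v h0 h1 p.n).2 hk
  have h3 : ∀ i : ℕ, 1 + (k : ℝ) + s - 1 - i = k + s - i := fun i => by ring
  simp only [pos, h3]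
  rw [h2, min_eq_right (by linarith), min_eq_right (by linarith)]
  simp

lemma pos_ray₀ {τ : ℝ} (h1 : τ ≤ 1) : p.pos τ = p.v 0 + (1 / τ - 1 : ℝ) * p.e₀ := by
  have h2 : ∑ i ∈ range p.n, (clamp (τ - 1 - i) : ℝ) * (p.v (i + 1) - p.v i) = 0 :=
    sum_eq_zero fun i _ => by
      rw [clamp_of_le (by linarith [(Nat.cast_nonneg i : (0 : ℝ) ≤ i)])]
      simp
  rw [pos, h2, min_eq_left h1, min_eq_right (by linarith [p.one_le_n])]
  simp

lemma pos_ray₁ {τ : ℝ} (h1 : p.n + 1 ≤ τ) :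
    p.pos τ = p.v p.n + (1 / (p.n + 2 - τ) - 1 : ℝ) * p.e₁ := by
  have h2 : ∑ i ∈ range p.n, (clamp (τ - 1 - i) : ℝ) * (p.v (i + 1) - p.v i) = p.v p.n - p.v 0 := by
    rw [← Finset.sum_range_sub]
    refine sum_congr rfl fun i hi => ?_
    have : (i : ℝ) + 1 ≤ p.n := by exact_mod_cast mem_range.1 hi
    rw [clamp_of_ge (by linarith)]
    simp
  rw [pos, h2, min_eq_right (by linarith [p.one_le_n]), min_eq_left (by linarith)]
  simp

variable {p} in
/-- The pieces of the path. -/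
lemma On.cases {τ : ℝ} {z : ℂ} (h : p.On τ z) :
    (∃ s : ℝ, 0 < s ∧ z = p.v 0 + s * p.e₀ ∧ p.e₀ ≠ 0) ∨
    (∃ k < p.n, ∃ s : ℝ, 0 ≤ s ∧ s ≤ 1 ∧ τ = 1 + k + s ∧ (k = 0 → p.e₀ = 0 → 0 < s) ∧
      (k + 1 = p.n → p.e₁ = 0 → s < 1) ∧ z = p.v k + s * (p.v (k + 1) - p.v k)) ∨
    ∃ s : ℝ, 0 < s ∧ z = p.v p.n + s * p.e₁ ∧ p.e₁ ≠ 0 := by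
  obtain ⟨⟨h0, h1⟩, rfl⟩ := h
  rcases lt_or_ge τ 1 with h2 | h2
  · have h4 : 0 < τ := p.start_nonneg.trans_lt h0
    exact Or.inl ⟨1 / τ - 1, by rw [sub_pos, lt_div_iff₀ h4]; linarith, p.pos_ray₀ h2.le,
      fun h => by rw [start, if_pos h] at h0; linarith⟩
  rcases lt_or_ge (p.n + 1 : ℝ) τ with h3 | h3
  · have h5 : 0 < p.n + 2 - τ := by linarith [p.fin_le]
    exact Or.inr (Or.inr ⟨1 / (p.n + 2 - τ) - 1, by rw [sub_pos, lt_div_iff₀ h5]; linarith,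
      p.pos_ray₁ h3.le, fun h => by rw [fin, if_pos h] at h1; linarith⟩)
  right; left
  rcases eq_or_lt_of_le h3 with h4 | h4
  · have hn := p.pos_n
    have e1 : τ = 1 + ((p.n - 1 : ℕ) : ℝ) + 1 := by
      rw [h4]; push_cast [Nat.cast_sub (show 1 ≤ p.n from hn)]; ring
    refine ⟨p.n - 1, by omega, 1, zero_le_one, le_rfl, e1, fun _ _ => one_pos, fun _ h => ?_, ?_⟩
    · rw [fin, if_pos h] at h1; linarith
    · rw [e1, p.pos_seg (by omega) zero_le_one le_rfl]
  · have h5 := Nat.floor_le (show 0 ≤ τ - 1 by linarith)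
    have h6 := Nat.lt_floor_add_one (τ - 1)
    set k := ⌊τ - 1⌋₊
    have hk : k < p.n := by exact_mod_cast (by linarith : (k : ℝ) < p.n)
    have e1 : τ = 1 + k + (τ - 1 - k) := by ring
    refine ⟨k, hk, τ - 1 - k, by linarith, by linarith, e1, fun hk0 h => ?_,
      fun _ _ => by linarith, ?_⟩
    · rw [start, if_pos h] at h0
      rw [hk0]
      push_cast
      linarith
    · conv_lhs => rw [e1]
      exact p.pos_seg hk (by linarith) (by linarith)

lemma on_seg {k : ℕ} (hk : k < p.n) {s : ℝ} (h0 : 0 < s) (h1 : s < 1) :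
    p.On (1 + k + s) (p.v k + s * (p.v (k + 1) - p.v k)) := by
  have hk' : (k : ℝ) + 1 ≤ p.n := by exact_mod_cast hk
  have := (Nat.cast_nonneg k : (0 : ℝ) ≤ k)
  exact ⟨⟨by linarith [p.start_le], by linarith [p.le_fin]⟩, p.pos_seg hk h0.le h1.le⟩

lemma on_vertex {i : ℕ} (h0 : 0 < i) (hi : i < p.n) : p.On (1 + i) (p.v i) := by
  have hk' : (i : ℝ) < p.n := by exact_mod_cast hi
  have : (0 : ℝ) < i := by exact_mod_cast h0
  exact ⟨⟨by linarith [p.start_le], by linarith [p.le_fin]⟩,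
    by simpa using p.pos_seg hi le_rfl zero_le_one⟩

lemma hasDerivAt_ray₀ {τ : ℝ} (h0 : 0 < τ) (h1 : τ < 1) :
    HasDerivAt p.pos ((-1 / τ ^ 2 : ℝ) * p.e₀) τ := by
  have h2 : HasDerivAt (fun τ : ℝ => 1 / τ - 1) (-1 / τ ^ 2) τ := by
    simpa using ((hasDerivAt_id τ).inv h0.ne').sub_const 1
  have h3 := (h2.ofReal_comp.mul_const p.e₀).const_add (p.v 0)
  refine h3.congr_of_eventuallyEq ?_
  filter_upwards [eventually_lt_nhds h1] with x hx using p.pos_ray₀ hx.le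

lemma hasDerivAt_ray₁ {τ : ℝ} (h0 : p.n + 1 < τ) (h1 : τ < p.n + 2) :
    HasDerivAt p.pos ((1 / (p.n + 2 - τ) ^ 2 : ℝ) * p.e₁) τ := by
  have h2 : HasDerivAt (fun τ : ℝ => 1 / (p.n + 2 - τ) - 1) (1 / (p.n + 2 - τ) ^ 2) τ := by
    simpa using (((hasDerivAt_id τ).const_sub (p.n + 2 : ℝ)).inv
      (by simp only [id]; linarith)).sub_const 1
  have h3 := (h2.ofReal_comp.mul_const p.e₁).const_add (p.v p.n)
  refine h3.congr_of_eventuallyEq ?_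
  filter_upwards [eventually_gt_nhds h0] with x hx using p.pos_ray₁ hx.le

lemma hasDerivAt_seg {τ : ℝ} {k : ℕ} (hk : k < p.n) (h0 : 1 + (k : ℝ) < τ)
    (h1 : τ < 1 + (k : ℝ) + 1) : HasDerivAt p.pos (p.v (k + 1) - p.v k) τ := by
  have h2 : HasDerivAt (fun τ : ℝ => p.v k + (τ - (1 + k) : ℝ) * (p.v (k + 1) - p.v k))
      (p.v (k + 1) - p.v k) τ := by
    simpa using ((((hasDerivAt_id τ).sub_const (1 + k : ℝ)).ofReal_comp).mul_const
      (p.v (k + 1) - p.v k)).const_add (p.v k)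
  refine h2.congr_of_eventuallyEq ?_
  filter_upwards [eventually_gt_nhds h0, eventually_lt_nhds h1] with x hx hx'
  have := p.pos_seg hk (s := x - (1 + k)) (by linarith) (by linarith)
  rwa [add_sub_cancel] at this

/-- A bound of the derivative with respect to the parameter. -/
def speed (τ : ℝ) : ℝ :=
  ‖p.e₀‖ / τ ^ 2 + (∑ i ∈ range p.n, ‖p.v (i + 1) - p.v i‖) + ‖p.e₁‖ / (p.n + 2 - τ) ^ 2

lemma exists_hasDerivAt_pos {τ : ℝ} (h0 : 0 < τ) (h1 : τ < p.n + 2)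
    (hτ : ∀ k : ℕ, k ≤ p.n → τ ≠ k + 1) : ∃ g : ℝ → ℂ, ContinuousAt g τ ∧
      (∀ᶠ x in 𝓝 τ, HasDerivAt p.pos (g x) x) ∧ ‖g τ‖ ≤ p.speed τ := by
  have hnn : 0 ≤ ∑ i ∈ range p.n, ‖p.v (i + 1) - p.v i‖ :=
    Finset.sum_nonneg fun _ _ => norm_nonneg _
  have hz := fun x : ℝ => (by positivity : 0 ≤ ‖p.e₀‖ / x ^ 2)
  have ho := fun x : ℝ => (by positivity : 0 ≤ ‖p.e₁‖ / (p.n + 2 - x) ^ 2)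
  rcases lt_or_ge τ 1 with h2 | h2
  · refine ⟨fun x => (-1 / x ^ 2 : ℝ) * p.e₀, ?_, ?_, ?_⟩
    · have : ContinuousAt (fun x : ℝ => -1 / x ^ 2) τ :=
        continuousAt_const.div (by fun_prop) (by positivity)
      exact (Complex.continuous_ofReal.continuousAt.comp this).mul continuousAt_const
    · filter_upwards [eventually_gt_nhds h0, eventually_lt_nhds h2] with x hx hx'
      exact p.hasDerivAt_ray₀ hx hx'
    · rw [norm_mul, norm_real, norm_div, norm_neg, norm_one, norm_of_nonneg
        (by positivity), speed, div_mul_eq_mul_div, one_mul]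
      linarith [ho τ]
  rcases lt_or_ge (p.n + 1 : ℝ) τ with h3 | h3
  · have h4 : 0 < p.n + 2 - τ := by linarith
    refine ⟨fun x => (1 / (p.n + 2 - x) ^ 2 : ℝ) * p.e₁, ?_, ?_, ?_⟩
    · have : ContinuousAt (fun x : ℝ => 1 / (p.n + 2 - x) ^ 2) τ :=
        continuousAt_const.div (by fun_prop) (by positivity)
      exact (Complex.continuous_ofReal.continuousAt.comp this).mul continuousAt_const
    · filter_upwards [eventually_gt_nhds h3, eventually_lt_nhds h1] with x hx hx'
      exact p.hasDerivAt_ray₁ hx hx'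
    · rw [norm_mul, norm_real, norm_div, norm_one, norm_of_nonneg
        (by positivity), speed, div_mul_eq_mul_div, one_mul]
      linarith [hz τ]
  · have h5 := Nat.floor_le (show 0 ≤ τ - 1 by linarith)
    have h6 := Nat.lt_floor_add_one (τ - 1)
    set k := ⌊τ - 1⌋₊
    have hkn : k ≤ p.n := by exact_mod_cast (by linarith : (k : ℝ) ≤ p.n)
    have hne := hτ k hkn
    have h7 : 1 + (k : ℝ) < τ := lt_of_le_of_ne (by linarith) fun h => hne (by linarith)
    have hk : k < p.n := by exact_mod_cast (by linarith : (k : ℝ) < p.n)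
    refine ⟨fun _ => p.v (k + 1) - p.v k, continuousAt_const, ?_, ?_⟩
    · filter_upwards [eventually_gt_nhds h7, eventually_lt_nhds
        (show τ < 1 + (k : ℝ) + 1 by linarith)] with x hx hx'
      exact p.hasDerivAt_seg hk hx hx'
    · have h8 := Finset.single_le_sum (f := fun i => ‖p.v (i + 1) - p.v i‖)
        (fun _ _ => norm_nonneg _) (mem_range.2 hk)
      rw [speed]
      linarith [ho τ, hz τ]

lemma mem_Ioo_param {t : ℝ} (ht : t ∈ Ioo (0 : ℝ) 1) :
    p.start + (p.fin - p.start) * t ∈ p.dom := by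
  have := p.length_pos
  constructor <;> nlinarith [ht.1, ht.2]

lemma hasDerivAt_curve {t : ℝ} {d : ℂ}
    (h : HasDerivAt p.pos d (p.start + (p.fin - p.start) * t)) :
    HasDerivAt p.curve ((p.fin - p.start : ℝ) * d) t := by
  have h1 : HasDerivAt (fun t : ℝ => p.start + (p.fin - p.start) * t) (p.fin - p.start) t := by
    simpa using ((hasDerivAt_id t).const_mul (p.fin - p.start)).const_add p.start
  have := h.scomp t h1
  rw [Complex.real_smul] at this
  exact this

lemma exists_hasDerivAt_curve : ∃ S : Set ℝ, S.Finite ∧ ∀ t ∈ Ioo (0 : ℝ) 1 \ S,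
    ∃ g : ℝ → ℂ, ContinuousAt g t ∧ (∀ᶠ x in 𝓝 t, HasDerivAt p.curve (g x) x) ∧
      ‖g t‖ ≤ (p.fin - p.start) * p.speed (p.start + (p.fin - p.start) * t) := by
  have hL := p.length_pos
  refine ⟨(fun t => p.start + (p.fin - p.start) * t) ⁻¹'
    ((fun k : ℕ => (k : ℝ) + 1) '' Set.Iic p.n), ?_, fun t ht => ?_⟩
  · refine ((Set.finite_Iic p.n).image _).preimage fun x _ y _ hxy => ?_
    have : (p.fin - p.start) * x = (p.fin - p.start) * y := by linarith [hxy]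
    exact mul_left_cancel₀ hL.ne' this
  · obtain ⟨h1, h2⟩ := p.mem_Ioo_param ht.1
    have hc : Continuous fun t : ℝ => p.start + (p.fin - p.start) * t := by fun_prop
    obtain ⟨g, hg, hd, hb⟩ := p.exists_hasDerivAt_pos (p.start_nonneg.trans_lt h1)
      (h2.trans_le p.fin_le) fun k hk h => ht.2 ⟨k, hk, h.symm⟩
    refine ⟨fun t => (p.fin - p.start : ℝ) * g (p.start + (p.fin - p.start) * t), ?_, ?_, ?_⟩
    · exact continuousAt_const.mul (ContinuousAt.comp
        (f := fun t : ℝ => p.start + (p.fin - p.start) * t) hg hc.continuousAt)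
    · filter_upwards [hc.continuousAt.eventually hd] with x hx using p.hasDerivAt_curve hx
    · rw [norm_mul, norm_real, norm_of_nonneg hL.le]
      gcongr

lemma continuousOn_pos : ContinuousOn p.pos (Ioo 0 (p.n + 2)) := by
  have h1 : ∀ {f : ℝ → ℝ}, Continuous f → (∀ τ ∈ Ioo (0 : ℝ) (p.n + 2), 0 < f τ) →
      ContinuousOn (fun τ => ((1 / min (f τ) 1 - 1 : ℝ) : ℂ)) (Ioo 0 (p.n + 2)) :=
    fun hf hp => Complex.continuous_ofReal.comp_continuousOn
      ((continuousOn_const.div (hf.min continuous_const).continuousOn fun τ hτ =>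
        (lt_min (hp τ hτ) one_pos).ne').sub continuousOn_const)
  have h2 : ∀ i : ℕ, Continuous fun τ : ℝ => ((clamp (τ - 1 - i) : ℝ) : ℂ) := fun i =>
    Complex.continuous_ofReal.comp (continuous_const.max
      (Continuous.min (by fun_prop) continuous_const))
  refine ((continuousOn_const.add ((h1 continuous_id fun τ hτ => hτ.1).mul
    continuousOn_const)).add ?_).add ((h1 (f := fun τ => p.n + 2 - τ) (by fun_prop)
      fun τ hτ => by linarith [hτ.2]).mul continuousOn_const)
  exact (continuous_finsetSum _ fun i _ => (h2 i).mul continuous_const).continuousOn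

lemma isPiecewiseC1 : IsPiecewiseC1 p.curve := by
  have hparam : Set.MapsTo (fun t : ℝ => p.start + (p.fin - p.start) * t) (Ioo 0 1)
      (Ioo 0 (p.n + 2)) := fun t ht =>
    ⟨p.start_nonneg.trans_lt (p.mem_Ioo_param ht).1, (p.mem_Ioo_param ht).2.trans_le p.fin_le⟩
  have hc : Continuous fun t : ℝ => p.start + (p.fin - p.start) * t := by fun_prop
  obtain ⟨S, hS, H⟩ := p.exists_hasDerivAt_curve
  refine ⟨p.continuousOn_pos.comp hc.continuousOn hparam, ⟨S, hS, fun t ht => ?_⟩, ?_⟩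
  · obtain ⟨g, hg, hd, -⟩ := H t ht
    refine ⟨hd.self_of_nhds.differentiableAt, hg.congr ?_⟩
    exact hd.mono fun x hx => hx.deriv.symm
  · rw [locallyIntegrableOn_iff isOpen_Ioo.isLocallyClosed]
    intro K hK hKc
    have hsp : ContinuousOn (fun t => (p.fin - p.start) *
        p.speed (p.start + (p.fin - p.start) * t)) (Ioo 0 1) := by
      refine continuousOn_const.mul (ContinuousOn.comp (t := Ioo 0 (p.n + 2)) (g := p.speed)
        (f := fun t => p.start + (p.fin - p.start) * t) ?_ hc.continuousOn hparam)
      unfold speed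
      refine ContinuousOn.add (ContinuousOn.add (ContinuousOn.div continuousOn_const (by fun_prop)
        fun τ hτ => ?_) continuousOn_const) (ContinuousOn.div continuousOn_const (by fun_prop)
        fun τ hτ => ?_)
      · exact pow_ne_zero _ hτ.1.ne'
      · exact pow_ne_zero _ (by linarith [hτ.2])
    refine Integrable.mono' ((hsp.mono hK).integrableOn_compact hKc)
      (stronglyMeasurable_deriv _).aestronglyMeasurable ?_
    rw [ae_restrict_iff' hKc.measurableSet]
    have : ∀ᵐ t : ℝ, t ∉ S := (measure_eq_zero_iff_ae_notMem).1 (hS.measure_zero _)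
    filter_upwards [this] with t htS htK
    obtain ⟨g, -, hd, hb⟩ := H t ⟨hK htK, htS⟩
    rwa [hd.self_of_nhds.deriv]

end PolyPath

/-! ### Admissible ends of polygonal contours -/

lemma integrableAtFilter_of_bounded {E : Type*} [NormedAddCommGroup E] {f : ℝ → E} {l : Filter ℝ}
    (hl : IsEnd l) (hf : AEStronglyMeasurable f (volume.restrict (Ioo 0 1))) {C : ℝ}
    (h : ∀ᶠ t in l, ‖f t‖ ≤ C) : IntegrableAtFilter f l := by
  obtain ⟨a, b, ha, hab, hb, hJ, hp⟩ := hl.exists_Ioo h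
  have hsub : Ioo a b ⊆ Ioo (0 : ℝ) 1 := Set.Ioo_subset_Ioo ha hb
  refine ⟨Ioo a b, hJ, ?_⟩
  refine Integrable.mono' (integrableOn_const (C := C) (by simp [Real.volume_Ioo]))
    (hf.mono_measure (Measure.restrict_mono hsub le_rfl)) ?_
  exact (ae_restrict_iff' measurableSet_Ioo).2 (ae_of_all _ hp)

/-- The weight decays in the direction `e` at infinity. -/
def IsDecayDirection (P B : ℂ[X]) (e : ℂ) : Prop :=
  (P.leadingCoeff / B.leadingCoeff * e ^ (P.natDegree - B.natDegree + 1)).re < 0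

/-- A contour can end at the zero `b` of `B`, coming from the direction `e`. -/
def IsEndDirection (P B : ℂ[X]) (b e : ℂ) : Prop :=
  (1 < B.rootMultiplicity b ∧ 0 < (polarCoeff P B b / e ^ (B.rootMultiplicity b - 1)).re) ∨
    (B.rootMultiplicity b = 1 ∧ ∃ k : ℕ, P.eval b = k * (derivative B).eval b)

lemma isEndAtInfinity_of_ray {P B : ℂ[X]} {γ : ℝ → ℂ} {l : Filter ℝ} (hl : IsEnd l)
    (hc : ContinuousOn γ (Ioo 0 1)) {v e : ℂ} {s : ℝ → ℝ} {K : ℝ} (hs : Tendsto s l atTop)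
    (hγ : ∀ᶠ t in l, γ t = v + s t * e ∧ ‖deriv γ t‖ ≤ K * (1 + s t) ^ 2)
    (he : IsDecayDirection P B e) : IsEndAtInfinity P B γ l := by
  unfold IsDecayDirection at he
  unfold IsEndAtInfinity
  set D := P.natDegree - B.natDegree + 1
  set ρ := P.leadingCoeff / B.leadingCoeff
  have he0 : e ≠ 0 := by rintro rfl; simp [D] at he
  have hen : 0 < ‖e‖ := norm_pos_iff.2 he0
  have hlow : ∀ᶠ t in l, s t * ‖e‖ - ‖v‖ ≤ ‖γ t‖ ∧ 0 < s t := by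
    filter_upwards [hγ, hs.eventually_gt_atTop 0] with t ht h0
    refine ⟨?_, h0⟩
    have h1 := norm_sub_le (γ t) v
    rw [ht.1, add_sub_cancel_left, norm_mul, norm_real, norm_of_nonneg h0.le] at h1
    rw [ht.1]
    linarith
  refine ⟨?_, ?_, 2, ?_⟩
  · refine tendsto_atTop_mono' l (hlow.mono fun t ht => ht.1) ?_
    exact tendsto_atTop_add_const_right _ _ (hs.atTop_mul_const hen)
  · have hdir : Tendsto (fun t => γ t / s t) l (𝓝 e) := by
      have h1 : Tendsto (fun t => v * ((s t)⁻¹ : ℝ) + e) l (𝓝 (v * ((0 : ℝ) : ℂ) + e)) :=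
        (((Complex.continuous_ofReal.tendsto 0).comp
          (tendsto_inv_atTop_zero.comp hs)).const_mul v).add_const e
      rw [Complex.ofReal_zero, mul_zero, zero_add] at h1
      refine h1.congr' ?_
      filter_upwards [hγ, hlow] with t ht h0
      have : (s t : ℂ) ≠ 0 := by exact_mod_cast h0.2.ne'
      rw [ht.1]
      push_cast
      field_simp
    set ε := -(ρ * e ^ D).re / (‖e‖ ^ D + 1) with hε
    have hε0 : 0 < ε := div_pos (by linarith) (by positivity)
    have hlim : Tendsto (fun t => (ρ * (γ t / s t) ^ D).re + ε * ‖γ t / s t‖ ^ D) l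
        (𝓝 ((ρ * e ^ D).re + ε * ‖e‖ ^ D)) :=
      ((Complex.continuous_re.tendsto _).comp ((hdir.pow D).const_mul ρ)).add
        ((hdir.norm.pow D).const_mul ε)
    have hneg : (ρ * e ^ D).re + ε * ‖e‖ ^ D < 0 := by
      have : ε * (‖e‖ ^ D + 1) = -(ρ * e ^ D).re := by rw [hε]; field_simp
      nlinarith
    refine ⟨ε, hε0, ?_⟩
    filter_upwards [hlim.eventually_le_const hneg, hlow] with t ht h0
    have h1 : (s t : ℂ) ≠ 0 := by exact_mod_cast h0.2.ne'
    have h2 : ρ * γ t ^ D = (ρ * (γ t / s t) ^ D) * ((s t ^ D : ℝ) : ℂ) := by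
      push_cast
      rw [mul_assoc, ← mul_pow, div_mul_cancel₀ _ h1]
    have h3 : ‖γ t‖ ^ D = ‖γ t / s t‖ ^ D * s t ^ D := by
      rw [norm_div, norm_real, norm_of_nonneg h0.2.le, div_pow]
      have := h0.2.ne'
      field_simp
    rw [h2, Complex.re_mul_ofReal, h3]
    have h4 : 0 < s t ^ D := pow_pos h0.2 _
    nlinarith
  · refine integrableAtFilter_of_bounded hl (C := |K| * (1 + (1 + ‖v‖) / ‖e‖) ^ 2) ?_ ?_
    · refine ((stronglyMeasurable_deriv γ).aestronglyMeasurable.norm).div₀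
        ((ContinuousOn.aestronglyMeasurable ?_ measurableSet_Ioo))
      exact (continuousOn_const.add hc.norm).pow 2
    · filter_upwards [hγ, hlow] with t ht h0
      rw [norm_of_nonneg (by positivity), div_le_iff₀ (by positivity)]
      have h1 : 1 + s t ≤ (1 + (1 + ‖v‖) / ‖e‖) * (1 + ‖γ t‖) := by
        have h2 : s t ≤ (1 + ‖v‖) / ‖e‖ * (1 + ‖γ t‖) := by
          rw [div_mul_eq_mul_div, le_div_iff₀ hen]
          nlinarith [norm_nonneg v, norm_nonneg (γ t)]
        nlinarith [norm_nonneg (γ t)]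
      calc ‖deriv γ t‖ ≤ K * (1 + s t) ^ 2 := ht.2
        _ ≤ |K| * ((1 + (1 + ‖v‖) / ‖e‖) * (1 + ‖γ t‖)) ^ 2 := by
          have : 0 ≤ 1 + s t := by linarith
          gcongr
          exact le_abs_self K
        _ = _ := by ring

lemma isAdmissibleEnd_of_seg {P B : ℂ[X]} {γ : ℝ → ℂ} {l : Filter ℝ} (hl : IsEnd l)
    {b e : ℂ} {s : ℝ → ℝ} {K : ℝ} (hs : Tendsto s l (𝓝[>] 0))
    (hγ : ∀ᶠ t in l, γ t = b + s t * e ∧ ‖deriv γ t‖ ≤ K)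
    (he : IsEndDirection P B b e) : IsAdmissibleEnd P B γ l := by
  obtain ⟨hs0, hspos⟩ := tendsto_nhdsWithin_iff.1 hs
  have hint : IntegrableAtFilter (deriv γ) l := integrableAtFilter_of_bounded hl
    (stronglyMeasurable_deriv γ).aestronglyMeasurable (hγ.mono fun t ht => ht.2)
  have hlim : Tendsto γ l (𝓝 b) := by
    have h1 : Tendsto (fun t => b + (s t : ℂ) * e) l (𝓝 (b + ((0 : ℝ) : ℂ) * e)) :=
      (((Complex.continuous_ofReal.tendsto 0).comp hs0).mul_const e).const_add b
    rw [Complex.ofReal_zero, zero_mul, add_zero] at h1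
    exact h1.congr' (hγ.mono fun t ht => ht.1.symm)
  right
  rcases he with ⟨hm, he⟩ | ⟨hm, hk⟩
  · have he0 : e ≠ 0 := by
      rintro rfl
      rw [zero_pow (by omega), div_zero] at he
      simp at he
    refine ⟨b, Or.inl ⟨hm, ?_, ⟨(polarCoeff P B b / e ^ (B.rootMultiplicity b - 1)).re *
      ‖e‖ ^ (B.rootMultiplicity b - 1), by positivity, ?_⟩, 0, ?_⟩⟩
    · refine tendsto_nhdsWithin_iff.2 ⟨hlim, ?_⟩
      filter_upwards [hγ, hspos] with t ht h0 h1
      have h2 : (s t : ℂ) * e = 0 := by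
        rw [Set.mem_singleton_iff, ht.1] at h1
        linear_combination h1
      exact mul_ne_zero (by exact_mod_cast (ne_of_gt h0)) he0 h2
    · filter_upwards [hγ, hspos] with t ht h0
      have h0' : 0 < s t := h0
      rw [ht.1, add_sub_cancel_left, mul_pow, norm_mul, mul_pow, norm_real,
        norm_of_nonneg h0'.le, ← Complex.ofReal_pow, mul_comm ((s t ^ _ : ℝ) : ℂ),
        ← div_div (polarCoeff P B b), Complex.div_ofReal_re]
      have : 0 < ‖e‖ := norm_pos_iff.2 he0
      refine le_of_eq ?_
      field_simp
    · simpa using hint.norm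
  · exact ⟨b, Or.inr ⟨hm, hk, hlim, hint⟩⟩

namespace PolyPath

/-- A contour with the end `v` can come from the direction `e` at infinity or, if `e = 0`, from the
direction `d`. -/
def EndCondition (P B : ℂ[X]) (v d e : ℂ) : Prop :=
  (e ≠ 0 → IsDecayDirection P B e) ∧ (e = 0 → IsEndDirection P B v d)

/-- Both ends of the path are admissible. -/
def Admissible (p : PolyPath) (P B : ℂ[X]) : Prop := EndCondition P B (p.v 0) (p.v 1 - p.v 0) p.e₀ ∧
    EndCondition P B (p.v p.n) (p.v (p.n - 1) - p.v p.n) p.e₁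

lemma EndCondition.ray {P B : ℂ[X]} {v d e : ℂ} (h : IsDecayDirection P B e) :
    EndCondition P B v d e := ⟨fun _ => h, fun h0 => by rw [h0, IsDecayDirection] at h; simp at h⟩

lemma EndCondition.point {P B : ℂ[X]} {v d : ℂ} (h : IsEndDirection P B v d) :
    EndCondition P B v d 0 := ⟨fun h0 => absurd rfl h0, fun _ => h⟩

variable {p : PolyPath}

lemma Admissible.atStart {P B : ℂ[X]} (h : p.Admissible P B) :
    IsAdmissibleEnd P B p.curve (𝓝[>] 0) := by
  replace h := h.1
  have hL := p.length_pos
  set c := p.fin - p.start with hc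
  have h01 : ∀ᶠ t : ℝ in 𝓝[>] 0, 0 < c * t ∧ c * t < 1 := by
    filter_upwards [Ioo_mem_nhdsGT (show (0 : ℝ) < 1 / c by positivity)] with t ht
    refine ⟨mul_pos hL ht.1, ?_⟩
    have := ht.2
    rw [lt_div_iff₀ hL] at this
    linarith
  have hct : Tendsto (fun t : ℝ => c * t) (𝓝[>] 0) (𝓝[>] 0) := by
    refine tendsto_nhdsWithin_iff.2 ⟨?_, h01.mono fun t ht => ht.1⟩
    have : Continuous fun t : ℝ => c * t := by fun_prop
    have h := this.tendsto 0
    rw [mul_zero] at h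
    exact h.mono_left nhdsWithin_le_nhds
  by_cases he : p.e₀ = 0
  · have hst : p.start = 1 := by rw [start, if_pos he]
    refine isAdmissibleEnd_of_seg (Or.inl rfl) (K := c * ‖p.v 1 - p.v 0‖) hct ?_ (h.2 he)
    filter_upwards [h01] with t ht
    constructor
    · have := p.pos_seg p.pos_n ht.1.le ht.2.le
      simpa [curve, hst, hc] using this
    · have := p.hasDerivAt_curve (t := t) (p.hasDerivAt_seg p.pos_n
        (by rw [← hc, hst]; simpa using ht.1) (by rw [← hc, hst]; simpa using ht.2))
      rw [this.deriv, norm_mul, norm_real, norm_of_nonneg hL.le]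
  · have hst : p.start = 0 := by rw [start, if_neg he]
    left
    refine isEndAtInfinity_of_ray (Or.inl rfl) p.isPiecewiseC1.continuousOn (v := p.v 0)
      (s := fun t => 1 / (c * t) - 1) (K := c * ‖p.e₀‖) ?_ ?_ (h.1 he)
    · simp only [one_div]
      exact tendsto_atTop_add_const_right _ _ (tendsto_inv_nhdsGT_zero.comp hct)
    · filter_upwards [h01] with t ht
      have e1 : p.start + c * t = c * t := by rw [hst, zero_add]
      constructor
      · have := p.pos_ray₀ ht.2.le
        rwa [curve, ← hc, e1]
      · have := p.hasDerivAt_curve (t := t) (p.hasDerivAt_ray₀ (by rw [← hc, e1]; exact ht.1)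
          (by rw [← hc, e1]; exact ht.2))
        rw [this.deriv, ← hc, e1, norm_mul, norm_mul, norm_real, norm_real,
          norm_of_nonneg hL.le, norm_div, norm_neg, norm_one, norm_pow, norm_of_nonneg ht.1.le]
        refine le_of_eq ?_
        have := ht.1.ne'
        field_simp
        ring

lemma Admissible.atFin {P B : ℂ[X]} (h : p.Admissible P B) :
    IsAdmissibleEnd P B p.curve (𝓝[<] 1) := by
  replace h := h.2
  have hL := p.length_pos
  set c := p.fin - p.start with hc
  have hct : Tendsto (fun t : ℝ => c * (1 - t)) (𝓝[<] 1) (𝓝[>] 0) := by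
    refine tendsto_nhdsWithin_iff.2 ⟨?_, ?_⟩
    · have : Continuous fun t : ℝ => c * (1 - t) := by fun_prop
      have h := this.tendsto 1
      rw [sub_self, mul_zero] at h
      exact h.mono_left nhdsWithin_le_nhds
    · filter_upwards [self_mem_nhdsWithin] with t ht
      have : t < 1 := ht
      exact mul_pos hL (by linarith)
  have h01 : ∀ᶠ t : ℝ in 𝓝[<] 1, 0 < c * (1 - t) ∧ c * (1 - t) < 1 :=
    hct.eventually (Ioo_mem_nhdsGT one_pos)
  have hn := p.pos_n
  have en : ((p.n - 1 : ℕ) : ℝ) = p.n - 1 := by push_cast [Nat.cast_sub (show 1 ≤ p.n from hn)]; ring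
  by_cases he : p.e₁ = 0
  · have hst : p.fin = p.n + 1 := by rw [fin, if_pos he]
    refine isAdmissibleEnd_of_seg (Or.inr rfl) (K := c * ‖p.v p.n - p.v (p.n - 1)‖) hct ?_ (h.2 he)
    filter_upwards [h01] with t ht
    have e1 : p.start + c * t = 1 + ((p.n - 1 : ℕ) : ℝ) + (1 - c * (1 - t)) := by rw [en]; linarith
    constructor
    · have := p.pos_seg (k := p.n - 1) (s := 1 - c * (1 - t)) (by omega) (by linarith [ht.2])
        (by linarith [ht.1])
      rw [curve, ← hc, e1, this, Nat.sub_add_cancel hn]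
      push_cast
      ring
    · have := p.hasDerivAt_curve (t := t) (p.hasDerivAt_seg (k := p.n - 1) (by omega)
        (by rw [← hc, e1]; linarith [ht.2]) (by rw [← hc, e1]; linarith [ht.1]))
      rw [this.deriv, norm_mul, norm_real, norm_of_nonneg hL.le, Nat.sub_add_cancel hn]
  · have hst : p.fin = p.n + 2 := by rw [fin, if_neg he]
    left
    refine isEndAtInfinity_of_ray (Or.inr rfl) p.isPiecewiseC1.continuousOn (v := p.v p.n)
      (s := fun t => 1 / (c * (1 - t)) - 1) (K := c * ‖p.e₁‖) ?_ ?_ (h.1 he)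
    · simp only [one_div]
      exact tendsto_atTop_add_const_right _ _ (tendsto_inv_nhdsGT_zero.comp hct)
    · filter_upwards [h01] with t ht
      have e1 : p.n + 2 - (p.start + c * t) = c * (1 - t) := by linarith
      constructor
      · have := p.pos_ray₁ (τ := p.start + c * t) (by linarith [ht.2])
        rwa [e1] at this
      · have := p.hasDerivAt_curve (t := t) (p.hasDerivAt_ray₁ (by linarith [ht.2])
          (by linarith [ht.1]))
        rw [this.deriv, ← hc, e1, norm_mul, norm_mul, norm_real, norm_real,
          norm_of_nonneg hL.le, norm_div, norm_one, norm_pow, norm_of_nonneg ht.1.le]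
        refine le_of_eq ?_
        rw [add_sub_cancel, one_div, one_div, inv_pow]
        ring

/-- The contour given by a polygonal path. -/
def toContour (p : PolyPath) {P B : ℂ[X]} {w : Branch P B} (h : p.Admissible P B)
    (hdom : ∀ τ z, p.On τ z → z ∈ w.dom) : Contour w where
  curve := p.curve
  piecewise := p.isPiecewiseC1
  mem_dom _ ht := hdom _ _ ⟨p.mem_Ioo_param ht, rfl⟩
  ends := Or.inl ⟨h.atStart, h.atFin⟩

/-- The parameter in the unit interval. -/
def time (p : PolyPath) (τ : ℝ) : ℝ := (τ - p.start) / (p.fin - p.start)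

lemma param_time (p : PolyPath) (τ : ℝ) : p.start + (p.fin - p.start) * p.time τ = τ := by
  have := p.length_pos.ne'
  rw [time]
  field_simp
  ring

lemma curve_time (p : PolyPath) (τ : ℝ) : p.curve (p.time τ) = p.pos τ := by
  rw [curve, param_time]

lemma time_mem {τ : ℝ} (h : τ ∈ p.dom) : p.time τ ∈ Ioo (0 : ℝ) 1 := by
  have hL := p.length_pos
  exact ⟨div_pos (by linarith [h.1]) hL, by rw [time, div_lt_one hL]; linarith [h.2]⟩

lemma time_injective (p : PolyPath) : Function.Injective p.time := fun x y h => by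
  rw [← p.param_time x, ← p.param_time y, h]

lemma eq_time {t τ : ℝ} (h : p.start + (p.fin - p.start) * t = τ) : t = p.time τ := by
  have := p.length_pos.ne'
  rw [time, ← h]
  field_simp
  ring

lemma im_div_eq (f d : ℂ) : (f / d).im = (conj d * f).im / Complex.normSq d := by
  have : f / d = conj d * f * ((Complex.normSq d)⁻¹ : ℝ) := by
    rw [div_eq_mul_inv, Complex.inv_def]
    push_cast
    ring
  rw [this, Complex.im_mul_ofReal, div_eq_mul_inv]

lemma crossesAt {d : ℂ} (hd : d ≠ 0) {σ : ℝ} {i : ℕ} (hi0 : 0 < i) (hi : i < p.n)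
    (h1 : 0 < σ * (conj d * (p.v i - p.v (i - 1))).im)
    (h2 : 0 < σ * (conj d * (p.v (i + 1) - p.v i)).im) :
    CrossesAt p.curve d (p.time (1 + i)) σ := by
  have hL := p.length_pos
  have hn : 0 < Complex.normSq d := Complex.normSq_pos.2 hd
  have ht : p.start + (p.fin - p.start) * p.time (1 + i) = 1 + i := p.param_time _
  have hp : p.curve (p.time (1 + i)) = p.v i := by rw [curve_time, (p.on_vertex hi0 hi).2]
  set t₀ := p.time (1 + i)
  have key : ∀ {t x : ℝ} {f : ℂ}, p.pos (1 + i + x) = p.v i + x * f →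
      (p.fin - p.start) * (t - t₀) = x →
      σ * ((p.curve t - p.curve t₀) / d).im = x * (σ * (conj d * f).im) / Complex.normSq d :=
      fun {t x f} h3 h4 => by
    rw [hp, curve, show p.start + (p.fin - p.start) * t = 1 + i + x by linarith, h3,
      add_sub_cancel_left, im_div_eq, mul_left_comm, im_ofReal_mul]
    ring
  constructor
  · filter_upwards [Ioo_mem_nhdsLT (show t₀ - 1 / (p.fin - p.start) < t₀ by simpa using hL)]
      with t ⟨h3, h4⟩
    rw [sub_lt_comm, lt_div_iff₀ hL] at h3
    rw [key ?_ rfl]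
    · exact div_neg_of_neg_of_pos (mul_neg_of_neg_of_pos (by nlinarith) h1) hn
    · have hi1 : ((i - 1 : ℕ) : ℝ) = i - 1 := by push_cast [Nat.cast_sub (show 1 ≤ i from hi0)]; ring
      have h5 := p.pos_seg (k := i - 1) (by omega) (s := 1 + (p.fin - p.start) * (t - t₀))
        (by linarith) (by nlinarith)
      rw [Nat.sub_add_cancel hi0, hi1] at h5
      rw [show 1 + (i : ℝ) + (p.fin - p.start) * (t - t₀)
        = 1 + (i - 1) + (1 + (p.fin - p.start) * (t - t₀)) by ring, h5]
      push_cast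
      ring
  · filter_upwards [Ioo_mem_nhdsGT (show t₀ < t₀ + 1 / (p.fin - p.start) by simpa using hL)]
      with t ⟨h3, h4⟩
    rw [← sub_lt_iff_lt_add', lt_div_iff₀ hL] at h4
    rw [key (p.pos_seg hi (by nlinarith) (by linarith)) rfl]
    exact div_pos (mul_pos (by nlinarith) h2) hn

lemma passesAt {A B : ℂ[X]} (h : IsTypeBB A B) {w : Branch (directNum A B) B} {v : Branch A B}
    (γ : Contour w) (hγ : γ.curve = p.curve) (hp : p.Admissible (directNum A B) B) {k : ℕ}
    (hk : k < p.n) {s : ℝ} (hs0 : 0 < s) (hs1 : s < 1) (hd : p.v (k + 1) - p.v k ≠ 0) {z : ℂ}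
    (hz : z = p.v k + s * (p.v (k + 1) - p.v k)) (hv : z ∈ v.dom)
    (hinj : ∀ τ, p.On τ z → τ = 1 + k + s) :
    γ.PassesAt z ((p.fin - p.start : ℝ) * (p.v (k + 1) - p.v k)) := by
  have hL := p.length_pos
  set c := p.fin - p.start with hc
  set t₀ := p.time (1 + k + s) with ht₀
  have ht : p.start + c * t₀ = 1 + k + s := p.param_time _
  have hmin : 0 < min s (1 - s) := lt_min hs0 (by linarith)
  set a := min s (1 - s) / c with ha
  have ha0 : 0 < a := div_pos hmin hL
  have hca : c * a = min s (1 - s) := by rw [ha]; field_simp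
  refine ⟨mul_ne_zero (by exact_mod_cast hL.ne') hd, t₀, a, ha0, fun τ hτ => ?_, ?_⟩
  · have h3 : -(c * a) < c * (τ - t₀) := by nlinarith [hτ.1]
    have h4 : c * (τ - t₀) < c * a := by nlinarith [hτ.2]
    rw [hca] at h3 h4
    have h5 : 0 < s + c * (τ - t₀) := by linarith [min_le_left s (1 - s)]
    have h6 : s + c * (τ - t₀) < 1 := by linarith [min_le_right s (1 - s)]
    have e1 : p.start + c * τ = 1 + k + (s + c * (τ - t₀)) := by linarith
    constructor
    · rw [p.eq_time e1]
      exact p.time_mem (p.on_seg hk h5 h6).1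
    · rw [hγ, curve, ← hc, e1, p.pos_seg hk h5.le h6.le, hz]
      push_cast
      ring
  · obtain ⟨δ, hδ, H⟩ := γ.exists_le_dist h (by rw [hγ]; exact hp.atStart) (by rw [hγ]; exact hp.atFin)
      hv (isOpen_Ioo (a := t₀ - a) (b := t₀ + a)) (fun τ hτ heq => hτ.2 (by
        rw [hγ] at heq
        rw [p.eq_time (hinj _ ⟨p.mem_Ioo_param hτ.1, heq⟩)]
        exact ⟨by linarith, by linarith⟩))
    refine ⟨δ, hδ, fun τ hτ habs => H τ ⟨hτ, fun hmem => ?_⟩⟩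
    have := abs_lt.2 (⟨by linarith [hmem.1], by linarith [hmem.2]⟩ : -a < τ - t₀ ∧ τ - t₀ < a)
    linarith

/-- A crossing of the segment number `k` of `p`, at its relative position `s`, by `q` at the vertex
number `i`, from the side `-σ` to the side `σ`. -/
structure Crossing (p q : PolyPath) (i k : ℕ) (s σ : ℝ) : Prop where
  pos_i : 0 < i
  i_lt : i < q.n
  k_lt : k < p.n
  pos_s : 0 < s
  s_lt : s < 1
  eq : q.v i = p.v k + s * (p.v (k + 1) - p.v k)
  sign : σ = 1 ∨ σ = -1
  left : 0 < σ * (conj (p.v (k + 1) - p.v k) * (q.v i - q.v (i - 1))).im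
  right : 0 < σ * (conj (p.v (k + 1) - p.v k) * (q.v (i + 1) - q.v i)).im

lemma double_eq_sum_crossings {A B : ℂ[X]} (h : IsTypeBB A B) {w : Branch (directNum A B) B}
    {v : Branch A B} {p q : PolyPath} (hp : p.Admissible (directNum A B) B)
    (hpw : ∀ τ z, p.On τ z → z ∈ w.dom) (hq : q.Admissible A B)
    (hqv : ∀ τ z, q.On τ z → z ∈ v.dom)
    (T : Finset ℕ) (σ s : ℕ → ℝ) (k : ℕ → ℕ) (hT : ∀ i ∈ T, Crossing p q i (k i) (s i) (σ i))
    (hX : ∀ τ τ' z, p.On τ z → q.On τ' z → ∃ i ∈ T, τ = 1 + k i + s i ∧ τ' = 1 + i) :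
    (2 * π * I)⁻¹ * (p.toContour hp hpw).double (q.toContour hq hqv) 0 (kernel A B 0) =
      -∑ i ∈ T, σ i * (B.eval (q.v i) * w.W (q.v i) * v.W (q.v i)) := by
  have hti : Function.Injective fun i : ℕ => q.time (1 + i) := fun i j hij => by
    exact_mod_cast (by linarith [q.time_injective hij] : (i : ℝ) = j)
  set σ' : ℝ → ℝ := fun t => σ (Function.invFun (fun i : ℕ => q.time (1 + i)) t) with hσ'
  have hσ : ∀ i : ℕ, σ' (q.time (1 + i)) = σ i := fun i =>
    congrArg σ (Function.leftInverse_invFun hti i)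
  have hon : ∀ i ∈ T, q.On (1 + i) (q.v i) := fun i hi => q.on_vertex (hT i hi).pos_i (hT i hi).i_lt
  have hv : ∀ i ∈ T, q.curve (q.time (1 + i)) = q.v i := fun i hi => by
    rw [curve_time, (hon i hi).2]
  have key := (p.toContour hp hpw).double_eq_sum_crossings h (q.toContour hq hqv)
    hp.atStart hp.atFin hq.atStart hq.atFin (T.map ⟨fun i : ℕ => q.time (1 + i), hti⟩) σ' ?_ ?_ ?_
  · rw [key, Finset.sum_map, mul_sum, mul_sum, ← Finset.sum_neg_distrib]
    refine sum_congr rfl fun i hi => ?_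
    simp only [Function.Embedding.coeFn_mk, hσ]
    change _ * (_ * (_ * (_ * w.W (q.curve _) * _))) = _
    rw [show (q.toContour hq hqv).curve (q.time (1 + i)) = q.v i from hv i hi, hv i hi]
    field_simp
  · intro t ht
    obtain ⟨i, hi, rfl⟩ := Finset.mem_map.1 ht
    exact q.time_mem (hon i hi).1
  · intro t ht htT τ hτ heq
    obtain ⟨i, hi, -, h2⟩ := hX _ _ _ ⟨p.mem_Ioo_param hτ, heq⟩ ⟨q.mem_Ioo_param ht, rfl⟩
    exact htT (Finset.mem_map.2 ⟨i, hi, (q.eq_time h2).symm⟩)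
  · intro t ht
    obtain ⟨i, hi, rfl⟩ := Finset.mem_map.1 ht
    have c := hT i hi
    have hΔ : p.v (k i + 1) - p.v (k i) ≠ 0 := fun h0 => by
      have := c.left
      rw [h0] at this
      simp at this
    have hL := p.length_pos
    simp only [Function.Embedding.coeFn_mk, hσ]
    refine ⟨c.sign, (p.fin - p.start : ℝ) * (p.v (k i + 1) - p.v (k i)), ?_, ?_⟩
    · change (p.toContour hp hpw).PassesAt (q.curve _) _
      rw [hv i hi]
      refine passesAt h (p.toContour hp hpw) rfl hp c.k_lt c.pos_s c.s_lt hΔ (v := v) c.eq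
        (hqv _ _ (hon i hi)) fun τ hτ => ?_
      obtain ⟨j, hj, h2, h3⟩ := hX τ _ _ hτ (hon i hi)
      obtain rfl : i = j := by exact_mod_cast (by linarith : (i : ℝ) = j)
      exact h2
    · refine q.crossesAt (mul_ne_zero (by exact_mod_cast hL.ne') hΔ) c.pos_i c.i_lt ?_ ?_
      · rw [map_mul, Complex.conj_ofReal, mul_assoc, im_ofReal_mul, mul_left_comm]
        exact mul_pos hL c.left
      · rw [map_mul, Complex.conj_ofReal, mul_assoc, im_ofReal_mul, mul_left_comm]
        exact mul_pos hL c.right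

end PolyPath

/-! ### Primitives and residues of rational functions -/

lemma exists_derivative_eq (P : ℂ[X]) : ∃ Q : ℂ[X], derivative Q = P := by
  induction P using Polynomial.induction_on' with
  | add p q hp hq =>
    obtain ⟨p', rfl⟩ := hp
    obtain ⟨q', rfl⟩ := hq
    exact ⟨p' + q', derivative_add⟩
  | monomial n a =>
    refine ⟨monomial (n + 1) (a / (n + 1)), ?_⟩
    rw [derivative_monomial, Nat.add_sub_cancel]
    congr 1
    push_cast
    have : (n : ℂ) + 1 ≠ 0 := by exact_mod_cast n.succ_ne_zero
    field_simp

lemma exists_primitive_aux (n : ℕ) : ∀ P B : ℂ[X], B ≠ 0 → B.natDegree = n →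
    ∃ G r : ℂ → ℂ, (∀ b, B.eval b ≠ 0 → r b = 0) ∧ ∀ z, B.eval z ≠ 0 →
      HasDerivAt G (P.eval z / B.eval z - ∑ b ∈ B.roots.toFinset, r b / (z - b)) z := by
  induction n with
  | zero =>
    intro P B hB hn
    obtain ⟨Q, hQ⟩ := exists_derivative_eq P
    rw [eq_C_of_natDegree_eq_zero hn] at hB ⊢
    set a := B.coeff 0
    refine ⟨fun z => Q.eval z / a, 0, fun _ _ => rfl, fun z _ => ?_⟩
    simpa [← hQ] using (Q.hasDerivAt z).div_const a
  | succ n ih =>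
    intro P B hB hn
    obtain ⟨b, hb⟩ := Complex.exists_root (f := B) (by
      rw [degree_eq_natDegree hB, hn]; exact_mod_cast n.succ_pos)
    obtain ⟨k, hk⟩ : ∃ k, B.rootMultiplicity b = k + 1 :=
      ⟨B.rootMultiplicity b - 1, by have := (rootMultiplicity_pos hB).2 hb; omega⟩
    set B₁ := B /ₘ (X - C b) ^ B.rootMultiplicity b with hB₁
    have hfac : B = (X - C b) ^ (k + 1) * B₁ := by
      rw [← hk]; exact (pow_mul_divByMonic_rootMultiplicity_eq B b).symm
    have hB₁b : B₁.eval b ≠ 0 := eval_divByMonic_pow_rootMultiplicity_ne_zero b hB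
    set c := P.eval b / B₁.eval b
    obtain ⟨P', hP'⟩ : X - C b ∣ P - C c * B₁ := by
      rw [dvd_iff_isRoot, IsRoot, eval_sub, eval_mul, eval_C, div_mul_cancel₀ _ hB₁b, sub_self]
    set B' := (X - C b) ^ k * B₁ with hB'
    have hBB' : B = (X - C b) * B' := by rw [hfac, hB']; ring
    have hB'0 : B' ≠ 0 := by rintro h; rw [hBB', h, mul_zero] at hB; exact hB rfl
    have hn' : B'.natDegree = n := by
      rw [hBB', natDegree_mul (X_sub_C_ne_zero b) hB'0, natDegree_X_sub_C] at hn
      omega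
    obtain ⟨G, r, hr, hG⟩ := ih P' B' hB'0 hn'
    have hev : ∀ z, B.eval z ≠ 0 → B'.eval z ≠ 0 ∧ z - b ≠ 0 ∧ B₁.eval z ≠ 0 ∧
        P.eval z / B.eval z = P'.eval z / B'.eval z + c / (z - b) ^ (k + 1) := fun z hz => by
      have h1 : B.eval z = (z - b) ^ (k + 1) * B₁.eval z := by
        conv_lhs => rw [hfac]
        simp
      have h2 : B'.eval z = (z - b) ^ k * B₁.eval z := by simp [hB']
      have h3 : P.eval z = c * B₁.eval z + (z - b) * P'.eval z := by
        have := congrArg (eval z) hP'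
        simp only [eval_sub, eval_mul, eval_C, eval_X] at this
        linear_combination this
      rw [h1] at hz
      have h4 : z - b ≠ 0 := fun h => hz (by rw [h, zero_pow (by omega), zero_mul])
      have h5 : B₁.eval z ≠ 0 := right_ne_zero_of_mul hz
      refine ⟨by rw [h2]; exact mul_ne_zero (pow_ne_zero _ h4) h5, h4, h5, ?_⟩
      rw [h1, h2, h3]
      field_simp
      ring
    have hroots : B.roots.toFinset = insert b B'.roots.toFinset := by
      rw [hBB', roots_mul (by rwa [hBB'] at hB), roots_X_sub_C]
      simp
    rcases Nat.eq_zero_or_pos k with rfl | hk0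
    · have hbB' : B'.eval b ≠ 0 := by rw [hB', pow_zero, one_mul]; exact hB₁b
      have hnot : b ∉ B'.roots.toFinset := by rw [Multiset.mem_toFinset, mem_roots hB'0]; exact hbB'
      refine ⟨G, Function.update r b c, fun z hz => ?_, fun z hz => ?_⟩
      · rw [Function.update_of_ne (by rintro rfl; exact hz hb), hr z (hev z hz).1]
      · obtain ⟨h1, -, -, h2⟩ := hev z hz
        refine (hG z h1).congr_deriv ?_
        rw [h2, hroots, Finset.sum_insert hnot, Function.update_self, zero_add, pow_one]
        have : ∑ x ∈ B'.roots.toFinset, Function.update r b c x / (z - x) =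
            ∑ x ∈ B'.roots.toFinset, r x / (z - x) := sum_congr rfl fun x hx => by
          rw [Function.update_of_ne (by rintro rfl; exact hnot hx)]
        rw [this]
        ring
    · have hmem : b ∈ B'.roots.toFinset := by
        rw [Multiset.mem_toFinset, mem_roots hB'0, IsRoot, hB']
        simp [hk0.ne']
      refine ⟨fun z => G z - c / (k * (z - b) ^ k), r, fun z hz => hr z (hev z hz).1,
        fun z hz => ?_⟩
      obtain ⟨h1, h3, -, h2⟩ := hev z hz
      have hk1 : (k : ℂ) ≠ 0 := by exact_mod_cast hk0.ne'
      have h4 : HasDerivAt (fun z => c / (k * (z - b) ^ k)) (-(c / (z - b) ^ (k + 1))) z := by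
        have h5 : HasDerivAt (fun z => (k : ℂ) * (z - b) ^ k) (k * (k * (z - b) ^ (k - 1) * 1)) z :=
          (((hasDerivAt_id z).sub_const b).pow k).const_mul _
        have h6 := (h5.inv (mul_ne_zero hk1 (pow_ne_zero _ h3))).const_mul c
        simp only [div_eq_mul_inv]
        refine h6.congr_deriv ?_
        obtain ⟨j, rfl⟩ : ∃ j, k = j + 1 := ⟨k - 1, by omega⟩
        rw [Nat.add_sub_cancel]
        field_simp
        ring
      refine ((hG z h1).sub h4).congr_deriv ?_
      rw [h2, hroots, Finset.insert_eq_of_mem hmem]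
      ring

lemma circleIntegral_inv_sub {b b' : ℂ} {R : ℝ} (hR : 0 < R) (h : b' ≠ b → R < ‖b' - b‖) :
    (∮ z in C(b, R), (z - b')⁻¹) = if b' = b then 2 * π * I else 0 := by
  split_ifs with hb
  · rw [hb]
    exact circleIntegral.integral_sub_inv_of_mem_ball (mem_ball_self hR)
  · have hne : ∀ z ∈ closedBall b R, z - b' ≠ 0 := fun z hz h0 => by
      rw [sub_eq_zero] at h0
      rw [h0, mem_closedBall_iff_norm] at hz
      linarith [h hb]
    refine Complex.circleIntegral_eq_zero_of_differentiable_on_off_countable hR.le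
      Set.countable_empty (ContinuousOn.inv₀ (by fun_prop) hne) fun z hz => ?_
    exact DifferentiableAt.inv (by fun_prop) (hne z (Metric.ball_subset_closedBall hz.1))

lemma exists_primitive (P : ℂ[X]) {B : ℂ[X]} (hB : B ≠ 0) : ∃ G : ℂ → ℂ, ∀ z, B.eval z ≠ 0 →
    HasDerivAt G (P.eval z / B.eval z - ∑ b ∈ B.roots.toFinset,
      residueAt (fun z => P.eval z / B.eval z) b / (z - b)) z := by
  obtain ⟨G, r, -, hG⟩ := exists_primitive_aux _ P B hB rfl
  refine ⟨G, fun z hz => ?_⟩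
  have hr : ∀ b ∈ B.roots.toFinset, residueAt (fun z => P.eval z / B.eval z) b = r b := by
    intro b hb
    obtain ⟨ρ, hρ, hρb⟩ : ∃ ρ : ℝ, 0 < ρ ∧ ∀ b' ∈ B.roots.toFinset, b' ≠ b → ρ < ‖b' - b‖ := by
      have hfin : ∀ᶠ ρ : ℝ in 𝓝[>] 0, ∀ b' ∈ B.roots.toFinset, b' ≠ b → ρ < ‖b' - b‖ := by
        rw [Filter.eventually_all_finset]
        intro b' _
        by_cases h : b' = b
        · simp [h]
        · filter_upwards [Ioo_mem_nhdsGT (norm_pos_iff.2 (sub_ne_zero.2 h))] with ρ hρ _ using hρ.2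
      obtain ⟨ρ, h1, h2⟩ := (hfin.and self_mem_nhdsWithin).exists
      exact ⟨ρ, h2, h1⟩
    refine Tendsto.limUnder_eq ((tendsto_const_nhds (x := r b)).congr' ?_)
    filter_upwards [Ioo_mem_nhdsGT hρ] with R hR
    have hne : ∀ z ∈ Metric.sphere b R, ∀ b' ∈ B.roots.toFinset, z - b' ≠ 0 := fun z hz b' hb' h0 => by
      rw [mem_sphere_iff_norm] at hz
      rw [sub_eq_zero.1 h0] at hz
      rcases eq_or_ne b' b with rfl | h
      · rw [sub_self, norm_zero] at hz; linarith [hR.1]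
      · linarith [hρb b' hb' h, hR.2]
    have hBz : ∀ z ∈ Metric.sphere b R, B.eval z ≠ 0 := fun z hz h0 =>
      hne z hz z (by rw [Multiset.mem_toFinset, mem_roots hB]; exact h0) (sub_self z)
    have hc1 : CircleIntegrable (fun z => P.eval z / B.eval z) b R :=
      (P.continuous.continuousOn.div B.continuous.continuousOn hBz).circleIntegrable hR.1.le
    have hc2 : ∀ b' ∈ B.roots.toFinset, CircleIntegrable (fun z => (z - b')⁻¹) b R := fun b' hb' =>
      (ContinuousOn.inv₀ (by fun_prop) fun z hz => hne z hz b' hb').circleIntegrable hR.1.le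
    have h0 := circleIntegral.integral_eq_zero_of_hasDerivWithinAt hR.1.le fun z hz =>
      (hG z (hBz z hz)).hasDerivWithinAt (s := Metric.sphere b R)
    have hc3 : ∀ b' ∈ B.roots.toFinset, CircleIntegrable (fun z => r b' • (z - b')⁻¹) b R :=
      fun b' hb' => (hc2 b' hb').const_smul
    have e1 : (fun z => ∑ b ∈ B.roots.toFinset, r b / (z - b)) =
        fun z => ∑ b ∈ B.roots.toFinset, r b • (z - b)⁻¹ := by
      ext z; simp only [smul_eq_mul, div_eq_mul_inv]
    rw [circleIntegral.integral_sub hc1 (by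
      rw [e1]; exact CircleIntegrable.fun_sum _ hc3), e1,
      circleIntegral.integral_fun_sum hc3, sub_eq_zero] at h0
    rw [h0]
    have e2 : ∀ b' ∈ B.roots.toFinset, (∮ z in C(b, R), r b' • (z - b')⁻¹) =
        if b' = b then r b * (2 * π * I) else 0 := fun b' hb' => by
      rw [circleIntegral.integral_smul, circleIntegral_inv_sub hR.1 fun h =>
        hR.2.trans (hρb b' hb' h)]
      split_ifs with h
      · rw [h, smul_eq_mul]
      · rw [smul_zero]
    rw [sum_congr rfl e2, Finset.sum_ite_eq' _ b, if_pos hb]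
    have := two_pi_I_ne_zero
    field_simp
  rw [sum_congr rfl fun b hb => by rw [hr b hb]]
  exact hG z hz

lemma residueAt_of_simple (P : ℂ[X]) {B : ℂ[X]} {b : ℂ} (hm : B.rootMultiplicity b = 1) :
    residueAt (fun z => P.eval z / B.eval z) b = P.eval b / (derivative B).eval b := by
  have hB : B ≠ 0 := by rintro rfl; simp at hm
  obtain ⟨R₀, hR₀, hR⟩ := exists_ball_cofactor_ne_zero hB b
  have hBe : B = (X - C b) * cofactor B b := by
    have := pow_mul_divByMonic_rootMultiplicity_eq B b
    rw [hm, pow_one] at this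
    rw [cofactor, hm, pow_one, this]
  have hder : (derivative B).eval b = (cofactor B b).eval b := by
    conv_lhs => rw [hBe]
    simp [derivative_mul]
  rw [hder]
  refine Tendsto.limUnder_eq ((tendsto_const_nhds (x := P.eval b / (cofactor B b).eval b)).congr' ?_)
  filter_upwards [Ioo_mem_nhdsGT hR₀] with ρ hρ
  have hsub : closedBall b ρ ⊆ ball b R₀ := Metric.closedBall_subset_ball hρ.2
  have h1 := Complex.circleIntegral_sub_inv_smul_of_differentiable_on_off_countable
    (f := fun z => P.eval z / (cofactor B b).eval z) Set.countable_empty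
    (mem_ball_self hρ.1 : b ∈ ball b ρ)
    (P.continuous.continuousOn.div (cofactor B b).continuous.continuousOn
      fun z hz => hR z (hsub hz))
    (fun z hz => (P.differentiableAt).div (cofactor B b).differentiableAt
      (hR z (hsub (Metric.ball_subset_closedBall hz.1))))
  have h2 : (∮ z in C(b, ρ), P.eval z / B.eval z) =
      ∮ z in C(b, ρ), (z - b)⁻¹ • (P.eval z / (cofactor B b).eval z) := by
    refine circleIntegral.integral_congr hρ.1.le fun z _ => ?_
    conv_lhs => rw [hBe]
    rw [eval_mul, eval_sub, eval_X, eval_C, smul_eq_mul, inv_mul_eq_div, div_div, mul_comm]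
  rw [h2, h1, smul_eq_mul, inv_mul_cancel_left₀ two_pi_I_ne_zero]

/-! ### Branches on plane domains with logarithms -/

/-- `L` is a branch of `log (z - b)` on the open set `U`. -/
def IsLogOn (L : ℂ → ℂ) (b : ℂ) (U : Set ℂ) : Prop :=
  ∀ z ∈ U, exp (L z) = z - b ∧ DifferentiableAt ℂ L z

lemma IsLogOn.mono {L : ℂ → ℂ} {b : ℂ} {U V : Set ℂ} (h : IsLogOn L b V) (hUV : U ⊆ V) :
    IsLogOn L b U := fun z hz => h z (hUV hz)

lemma IsLogOn.ne {L : ℂ → ℂ} {b : ℂ} {U : Set ℂ} (h : IsLogOn L b U) {z : ℂ} (hz : z ∈ U) :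
    z ≠ b := by
  rintro rfl
  have := (h z hz).1
  rw [sub_self] at this
  exact exp_ne_zero _ this

lemma IsLogOn.hasDerivAt {L : ℂ → ℂ} {b : ℂ} {U : Set ℂ} (h : IsLogOn L b U) (hU : IsOpen U)
    {z : ℂ} (hz : z ∈ U) : HasDerivAt L (1 / (z - b)) z := by
  have h1 := (h z hz).2.hasDerivAt
  have h2 := h1.cexp
  have h3 : HasDerivAt (fun z => exp (L z)) 1 z := by
    refine ((hasDerivAt_id z).sub_const b).congr_of_eventuallyEq ?_
    filter_upwards [hU.mem_nhds hz] with x hx using (h x hx).1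
  have h4 := h2.unique h3
  rw [(h z hz).1] at h4
  refine h1.congr_deriv ?_
  rw [eq_div_iff (sub_ne_zero.2 (h.ne hz)), mul_comm, h4]

section BranchPair

variable {A B : ℂ[X]}

/-- The exponent `res_b V'`. -/
def expo (A B : ℂ[X]) (b : ℂ) : ℂ := residueAt (fun z => (A + derivative B).eval z / B.eval z) b

/-- A pair of dual branches given by branches of the logarithms of `z - b`. -/
lemma exists_branches (hB : B ≠ 0) {U V : Set ℂ} (hU : IsOpen U) (hV : IsOpen V)
    {L L' : ℂ → ℂ → ℂ} (hL : ∀ b, B.eval b = 0 → IsLogOn (L b) b U)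
    (hL' : ∀ b, B.eval b = 0 → IsLogOn (L' b) b V) :
    ∃ (w : Branch (directNum A B) B) (v : Branch A B), w.dom = U ∧ v.dom = V ∧
      ∀ z ∈ U ∩ V, B.eval z * w.W z * v.W z =
        exp (∑ b ∈ B.roots.toFinset, expo A B b * (L' b z - L b z)) := by
  obtain ⟨G, hG⟩ := exists_primitive (A + derivative B) hB
  have hroot : ∀ {b}, b ∈ B.roots.toFinset → B.eval b = 0 := fun hb => by
    rw [Multiset.mem_toFinset, mem_roots hB] at hb
    exact hb
  have hBU : ∀ z ∈ U, B.eval z ≠ 0 := fun z hz h0 => (hL z h0).ne hz rfl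
  have hBV : ∀ z ∈ V, B.eval z ≠ 0 := fun z hz h0 => (hL' z h0).ne hz rfl
  have hsum : ∀ {M : ℂ → ℂ → ℂ} {D : Set ℂ}, IsOpen D → (∀ b, B.eval b = 0 → IsLogOn (M b) b D) →
      ∀ z ∈ D, HasDerivAt (fun z => ∑ b ∈ B.roots.toFinset, expo A B b * M b z)
        (∑ b ∈ B.roots.toFinset, expo A B b / (z - b)) z := fun hD hM z hz => by
    refine HasDerivAt.fun_sum fun b hb => ?_
    refine (((hM b (hroot hb)).hasDerivAt hD hz).const_mul (expo A B b)).congr_deriv ?_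
    ring
  have hW : ∀ z ∈ U, HasDerivAt (fun z => exp (-(G z + ∑ b ∈ B.roots.toFinset,
      expo A B b * L b z))) (exp (-(G z + ∑ b ∈ B.roots.toFinset,
      expo A B b * L b z)) * -((A + derivative B).eval z / B.eval z)) z := fun z hz => by
    have h1 := (((hG z (hBU z hz)).add (hsum hU hL z hz)).neg).cexp
    refine h1.congr_deriv ?_
    simp only [Pi.add_apply, Pi.neg_apply, expo]
    ring
  have hV' : ∀ z ∈ V, HasDerivAt (fun z => exp (G z + ∑ b ∈ B.roots.toFinset,
      expo A B b * L' b z) / B.eval z) (A.eval z / B.eval z * (exp (G z +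
      ∑ b ∈ B.roots.toFinset, expo A B b * L' b z) / B.eval z)) z := fun z hz => by
    have h1 := (((hG z (hBV z hz)).add (hsum hV hL' z hz)).cexp).div (B.hasDerivAt z) (hBV z hz)
    refine h1.congr_deriv ?_
    have := hBV z hz
    simp only [Pi.add_apply, expo, eval_add]
    field_simp
    ring
  refine ⟨⟨U, _, hU, fun z hz => (hW z hz).differentiableAt.differentiableWithinAt,
    fun z _ => exp_ne_zero _, fun z hz => ?_⟩, ⟨V, _, hV, fun z hz =>
    (hV' z hz).differentiableAt.differentiableWithinAt,
    fun z hz => div_ne_zero (exp_ne_zero _) (hBV z hz), fun z hz => ?_⟩, rfl, rfl, fun z hz => ?_⟩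
  · rw [(hW z hz).deriv]
    have := hBU z hz
    rw [directNum, eval_neg]
    field_simp
  · rw [(hV' z hz).deriv]
    have := hBV z hz
    field_simp
  · have h0 := hBU z hz.1
    simp only
    rw [mul_assoc, mul_div_assoc', ← exp_add, mul_div_cancel₀ _ h0]
    congr 1
    rw [← sum_congr rfl fun b _ => (mul_sub (expo A B b) (L' b z) (L b z)).symm, sum_sub_distrib]
    ring

lemma exists_int_of_exp_eq {x y : ℂ} (h : exp x = exp y) :
    ∃ n : ℤ, x - y = n * (2 * π * I) := by
  obtain ⟨n, hn⟩ := Complex.exp_eq_exp_iff_exists_int.1 h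
  exact ⟨n, by rw [hn]; ring⟩

lemma exp_sum_mem_multiplierGroup (hB : B ≠ 0) {f : ℂ → ℂ}
    (hf : ∀ b, B.eval b = 0 → ∃ n : ℤ, f b = n * (2 * π * I)) :
    ∃ u ∈ multiplierGroup A B, (u : ℂ) = exp (∑ b ∈ B.roots.toFinset, expo A B b * f b) := by
  rw [Complex.exp_sum]
  have h : ∀ b ∈ B.roots.toFinset, ∃ u ∈ multiplierGroup A B,
      (u : ℂ) = exp (expo A B b * f b) := fun b hb => by
    rw [Multiset.mem_toFinset, mem_roots hB] at hb
    obtain ⟨n, hn⟩ := hf b hb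
    set ω : ℂˣ := Units.mk0 (multiplier A B b) (exp_ne_zero _)
    have hω : ω ∈ multiplierGroup A B := Subgroup.subset_closure (Or.inr ⟨b, hb, rfl⟩)
    refine ⟨ω ^ n, Subgroup.zpow_mem _ hω n, ?_⟩
    rw [Units.val_zpow_eq_zpow_val]
    change multiplier A B b ^ n = _
    rw [multiplier, ← Complex.exp_int_mul, hn, expo]
    congr 1
    ring
  choose! u hu hu' using h
  refine ⟨∏ b ∈ B.roots.toFinset, u b, Subgroup.prod_mem _ hu, ?_⟩
  rw [Units.coe_prod, Finset.prod_congr rfl hu']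

lemma neg_mem_multiplierGroup {u : ℂˣ} (hu : u ∈ multiplierGroup A B) :
    -u ∈ multiplierGroup A B := by
  have : (-1 : ℂˣ) ∈ multiplierGroup A B := Subgroup.subset_closure (Or.inl rfl)
  simpa using Subgroup.mul_mem _ this hu

lemma multiplier_ne_one {b : ℂ} (hm : B.rootMultiplicity b = 1)
    (h1 : ¬∃ k : ℕ, (directNum A B).eval b = k * (derivative B).eval b)
    (h2 : ¬∃ k : ℕ, A.eval b = k * (derivative B).eval b) : multiplier A B b ≠ 1 := fun h => by
  rw [multiplier, residueAt_of_simple _ hm, Complex.exp_eq_one_iff] at h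
  obtain ⟨n, hn⟩ := h
  have hd := (eval_derivative_ne_zero_of_rootMultiplicity_eq_one hm).2
  rw [mul_comm, mul_left_inj' two_pi_I_ne_zero, div_eq_iff hd, eval_add] at hn
  rcases le_or_gt n 0 with h0 | h0
  · obtain ⟨k, hk⟩ := Int.exists_eq_neg_ofNat h0
    refine h1 ⟨k, ?_⟩
    rw [directNum, eval_neg, eval_add, hn, hk]
    push_cast
    ring
  · obtain ⟨k, hk⟩ := Int.eq_ofNat_of_zero_le (show 0 ≤ n - 1 by omega)
    refine h2 ⟨k, ?_⟩
    rw [show n = k + 1 by omega] at hn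
    push_cast at hn
    linear_combination hn

end BranchPair

/-! ### Logarithms along polygonal cuts -/

/-- The cut from `b` through `c₁` and `c₂` to infinity in the direction `e`. -/
def cutSet (b c₁ c₂ e : ℂ) : Set ℂ :=
  segment ℝ b c₁ ∪ segment ℝ c₁ c₂ ∪ (fun s : ℝ => c₂ + s * e) '' Set.Ici 0

lemma isClosed_cutSet (b c₁ c₂ : ℂ) {e : ℂ} (he : e ≠ 0) : IsClosed (cutSet b c₁ c₂ e) := by
  have hseg : ∀ x y : ℂ, IsClosed (segment ℝ x y) := fun x y => by
    rw [← convexHull_pair]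
    exact (((Set.finite_singleton y).insert x).isCompact_convexHull ℝ).isClosed
  refine ((hseg _ _).union (hseg _ _)).union ?_
  have h1 : Topology.IsClosedEmbedding fun s : ℝ => c₂ + s * e :=
    (Homeomorph.addLeft c₂).isClosedEmbedding.comp
      (((Homeomorph.mulRight₀ e he).isClosedEmbedding).comp Complex.isometry_ofReal.isClosedEmbedding)
  exact h1.isClosedMap _ isClosed_Ici

lemma div_mem_slitPlane {z a c : ℂ} (h : z ∉ segment ℝ a c) : (z - a) / (z - c) ∈ slitPlane := by
  have hc : z - c ≠ 0 := fun h0 => h (by rw [sub_eq_zero.1 h0]; exact right_mem_segment ℝ a c)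
  by_contra hs
  rw [Complex.mem_slitPlane_iff, not_or, not_lt, not_not] at hs
  set q := (z - a) / (z - c) with hq
  have h1 : q = ((q.re : ℝ) : ℂ) := Complex.ext (by simp) (by simp [hs.2])
  set s := q.re
  have h2 : z - a = s * (z - c) := by rw [← h1, hq, div_mul_cancel₀ _ hc]
  apply h
  have h3 : 0 < 1 - s := by linarith [hs.1]
  have h3' : (1 - s : ℂ) ≠ 0 := by exact_mod_cast h3.ne'
  refine ⟨1 / (1 - s), -s / (1 - s), by positivity, div_nonneg (by linarith [hs.1]) h3.le, by
    field_simp; ring, ?_⟩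
  simp only [Complex.real_smul]
  push_cast
  field_simp
  linear_combination -h2

/-- A logarithm of `z - b` with a polygonal cut. -/
def cutLog (b c₁ c₂ e z : ℂ) : ℂ := log (-(z - c₂) / e) + log ((z - c₁) / (z - c₂)) +
    log ((z - b) / (z - c₁)) + log (-e)

lemma isLogOn_cutLog (b c₁ c₂ : ℂ) {e : ℂ} (he : e ≠ 0) (a : ℂ) (ha : exp a = 1) :
    IsLogOn (fun z => cutLog b c₁ c₂ e z + a) b (cutSet b c₁ c₂ e)ᶜ := fun z hz => by
  simp only [cutSet, Set.mem_compl_iff, Set.mem_union, not_or] at hz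
  obtain ⟨⟨h1, h2⟩, h3⟩ := hz
  have s1 := div_mem_slitPlane h1
  have s2 := div_mem_slitPlane h2
  have hz1 : z - c₁ ≠ 0 := fun h0 => h1 (by rw [sub_eq_zero.1 h0]; exact right_mem_segment ℝ b c₁)
  have hz2 : z - c₂ ≠ 0 := fun h0 => h2 (by rw [sub_eq_zero.1 h0]; exact right_mem_segment ℝ c₁ c₂)
  have s3 : -(z - c₂) / e ∈ slitPlane := by
    by_contra hs
    rw [Complex.mem_slitPlane_iff, not_or, not_lt, not_not] at hs
    set q := -(z - c₂) / e with hq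
    have h4 : q = ((q.re : ℝ) : ℂ) := Complex.ext (by simp) (by simp [hs.2])
    refine h3 ⟨-q.re, neg_nonneg.2 hs.1, ?_⟩
    simp only [Complex.ofReal_neg]
    rw [← h4, hq]
    field_simp
    ring
  refine ⟨?_, ?_⟩
  · change exp (_ + _ + _ + _ + a) = _
    rw [exp_add, ha, exp_add, exp_add, exp_add,
      exp_log (slitPlane_ne_zero s3), exp_log (slitPlane_ne_zero s2),
      exp_log (slitPlane_ne_zero s1), exp_log (neg_ne_zero.2 he)]
    field_simp
  · unfold cutLog
    have d1 : DifferentiableAt ℂ (fun z => -(z - c₂) / e) z := by fun_prop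
    have d2 : DifferentiableAt ℂ (fun z => (z - c₁) / (z - c₂)) z :=
      DifferentiableAt.div (by fun_prop) (by fun_prop) hz2
    have d3 : DifferentiableAt ℂ (fun z => (z - b) / (z - c₁)) z :=
      DifferentiableAt.div (by fun_prop) (by fun_prop) hz1
    exact ((((d1.clog s3).add (d2.clog s2)).add (d3.clog s1)).add_const _).add_const _

/-- A branch of the logarithm on the complement of the cut with a given value at one point. -/
lemma exists_log_cut (b c₁ c₂ : ℂ) {e z₀ l : ℂ} (he : e ≠ 0) (hz₀ : z₀ ∉ cutSet b c₁ c₂ e)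
    (hl : exp l = z₀ - b) : ∃ L : ℂ → ℂ, IsLogOn L b (cutSet b c₁ c₂ e)ᶜ ∧ L z₀ = l := by
  refine ⟨fun z => cutLog b c₁ c₂ e z + (l - cutLog b c₁ c₂ e z₀),
    isLogOn_cutLog b c₁ c₂ he _ ?_, by ring⟩
  have h := (isLogOn_cutLog b c₁ c₂ he 0 Complex.exp_zero z₀ hz₀).1
  simp only [add_zero] at h
  rw [Complex.exp_sub, hl, h, div_self]
  rw [← hl]
  exact exp_ne_zero _

/-- Two logarithms of the same function differ by a constant on a preconnected set. -/
lemma IsPreconnected.sub_eq_sub {S : Set ℂ} (hS : IsPreconnected S) {f g : ℂ → ℂ} {c : ℂ}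
    (hf : ContinuousOn f S) (hg : ContinuousOn g S)
    (h : ∀ z ∈ S, exp (f z) = c * exp (g z)) {x y : ℂ} (hx : x ∈ S) (hy : y ∈ S) :
    f x - g x = f y - g y := by
  have hpi := two_pi_I_ne_zero
  have hdisc : IsDiscrete (Set.range fun n : ℤ => ((n : ℂ))) :=
    Complex.isClosedEmbedding_intCast.isInducing.isDiscrete_range
  have hc : c ≠ 0 := fun h0 => by
    have := h x hx
    rw [h0, zero_mul] at this
    exact exp_ne_zero _ this
  have := hS.constant_of_mapsTo hdisc (f := fun z => (f z - g z - log c) /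
      (2 * π * I)) (((hf.sub hg).sub continuousOn_const).div_const _) (fun z hz => by
    obtain ⟨n, hn⟩ := exists_int_of_exp_eq (x := f z) (y := log c + g z) (by
      rw [h z hz, exp_add, exp_log hc])
    refine ⟨n, ?_⟩
    rw [eq_div_iff hpi, ← hn]
    ring) hx hy
  rw [div_left_inj' hpi] at this
  linear_combination this

/-! ### Coordinates adapted to a pair of decay directions -/

/-- A frame: a unit vector `N` that determines coordinates `X`, `Y`, and two directions `em`, `ep`
with `X > 0`, pointing to the sides `Y < 0` and `Y > 0`. -/
structure Frame where
  N : ℂ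
  em : ℂ
  ep : ℂ
  M : ℝ
  norm_N : ‖N‖ = 1
  M_pos : 0 < M
  em_re : 0 < (em * conj N).re
  em_im : (em * conj N).im < 0
  ep_re : 0 < (ep * conj N).re
  ep_im : 0 < (ep * conj N).im

namespace Frame

variable (F : Frame)

/-- The first coordinate. -/
def X (z : ℂ) : ℝ := (z * conj F.N).re

/-- The second coordinate. -/
def Y (z : ℂ) : ℝ := (z * conj F.N).im

/-- The point with given coordinates. -/
def pt (x y : ℝ) : ℂ := F.N * (x + y * I)

lemma N_mul_conj : F.N * conj F.N = 1 := by
  rw [Complex.mul_conj, normSq_eq_norm_sq, F.norm_N]; simp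

lemma N_ne_zero : F.N ≠ 0 := fun h => by
  have := F.norm_N
  rw [h, norm_zero] at this
  exact zero_ne_one this

@[simp] lemma X_add (z z' : ℂ) : F.X (z + z') = F.X z + F.X z' := by simp [X, add_mul]

@[simp] lemma Y_add (z z' : ℂ) : F.Y (z + z') = F.Y z + F.Y z' := by simp [Y, add_mul]

@[simp] lemma X_sub (z z' : ℂ) : F.X (z - z') = F.X z - F.X z' := by simp [X, sub_mul]

@[simp] lemma Y_sub (z z' : ℂ) : F.Y (z - z') = F.Y z - F.Y z' := by simp [Y, sub_mul]

@[simp] lemma X_mul (s : ℝ) (z : ℂ) : F.X (s * z) = s * F.X z := by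
  rw [X, mul_assoc, Complex.re_ofReal_mul, X]

@[simp] lemma Y_mul (s : ℝ) (z : ℂ) : F.Y (s * z) = s * F.Y z := by
  rw [Y, mul_assoc, im_ofReal_mul, Y]

lemma pt_mul_conj (x y : ℝ) : F.pt x y * conj F.N = x + y * I := by
  rw [pt, mul_right_comm, F.N_mul_conj, one_mul]

@[simp] lemma X_pt (x y : ℝ) : F.X (F.pt x y) = x := by rw [X, pt_mul_conj]; simp

@[simp] lemma Y_pt (x y : ℝ) : F.Y (F.pt x y) = y := by rw [Y, pt_mul_conj]; simp

@[simp] lemma X_zero : F.X (0 : ℂ) = 0 := by simp [Frame.X]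

@[simp] lemma Y_zero : F.Y (0 : ℂ) = 0 := by simp [Frame.Y]

lemma ext {z z' : ℂ} (hX : F.X z = F.X z') (hY : F.Y z = F.Y z') : z = z' := by
  have h : z * conj F.N = z' * conj F.N := Complex.ext hX hY
  exact mul_right_cancel₀ ((_root_.map_ne_zero _).2 F.N_ne_zero) h

lemma im_conj_mul (d f : ℂ) : (conj d * f).im = F.X d * F.Y f - F.Y d * F.X f := by
  have h : conj d * f = conj (d * conj F.N) * (f * conj F.N) := by
    rw [map_mul, Complex.conj_conj]
    linear_combination -(conj d * f) * F.N_mul_conj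
  rw [h, Complex.mul_im, Complex.conj_re, Complex.conj_im]
  simp only [X, Y]
  ring

lemma continuous_X : Continuous F.X :=
  Complex.continuous_re.comp (continuous_id.mul continuous_const)

lemma continuous_Y : Continuous F.Y :=
  Complex.continuous_im.comp (continuous_id.mul continuous_const)

lemma continuous_pt : Continuous fun p : ℝ × ℝ => F.pt p.1 p.2 := by
  unfold pt
  fun_prop

lemma norm_sq (z : ℂ) : ‖z‖ ^ 2 = F.X z ^ 2 + F.Y z ^ 2 := by
  have h : ‖z‖ = ‖z * conj F.N‖ := by rw [norm_mul, RCLike.norm_conj, F.norm_N, mul_one]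
  rw [h, ← normSq_eq_norm_sq, Complex.normSq_apply, X, Y]
  ring

lemma abs_X_le (z : ℂ) : |F.X z| ≤ ‖z‖ :=
  abs_le_of_sq_le_sq (by nlinarith [F.norm_sq z, sq_nonneg (F.Y z)]) (norm_nonneg z)

lemma abs_Y_le (z : ℂ) : |F.Y z| ≤ ‖z‖ :=
  abs_le_of_sq_le_sq (by nlinarith [F.norm_sq z, sq_nonneg (F.X z)]) (norm_nonneg z)

lemma X_em : 0 < F.X F.em := F.em_re

lemma Y_em : F.Y F.em < 0 := F.em_im

lemma X_ep : 0 < F.X F.ep := F.ep_re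

lemma Y_ep : 0 < F.Y F.ep := F.ep_im

lemma em_ne_zero : F.em ≠ 0 := fun h => by
  have := F.X_em
  rw [h, X_zero] at this
  exact this.false

lemma ep_ne_zero : F.ep ≠ 0 := fun h => by
  have := F.X_ep
  rw [h, X_zero] at this
  exact this.false

/-- The displacement of the curves on which `u` is constant. -/
def shift (y : ℝ) : ℝ :=
  max 0 (max (F.X F.ep / F.Y F.ep * (y - F.M)) (F.X F.em / -F.Y F.em * (-y - F.M)))

/-- The coordinate that is constant along the broken lines which are vertical in the middle and run
in the directions `em` and `ep` outside. -/
def u (z : ℂ) : ℝ := F.X z - F.shift (F.Y z)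

lemma slope_ep : 0 < F.X F.ep / F.Y F.ep := div_pos F.X_ep F.Y_ep

lemma slope_em : 0 < F.X F.em / -F.Y F.em := div_pos F.X_em (by linarith [F.Y_em])

lemma shift_eq_zero {y : ℝ} (h1 : -F.M ≤ y) (h2 : y ≤ F.M) : F.shift y = 0 :=
  max_eq_left (max_le (mul_nonpos_of_nonneg_of_nonpos F.slope_ep.le (by linarith))
    (mul_nonpos_of_nonneg_of_nonpos F.slope_em.le (by linarith)))

lemma shift_of_ge {y : ℝ} (h : F.M ≤ y) : F.shift y = F.X F.ep / F.Y F.ep * (y - F.M) := by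
  have h1 := mul_nonneg F.slope_ep.le (sub_nonneg.2 h)
  have h2 := mul_nonpos_of_nonneg_of_nonpos F.slope_em.le (show -y - F.M ≤ 0 by linarith [F.M_pos])
  rw [shift, max_eq_left (h2.trans h1), max_eq_right h1]

lemma shift_of_le {y : ℝ} (h : y ≤ -F.M) : F.shift y = F.X F.em / -F.Y F.em * (-y - F.M) := by
  have h1 := mul_nonneg F.slope_em.le (show 0 ≤ -y - F.M by linarith)
  have h2 := mul_nonpos_of_nonneg_of_nonpos F.slope_ep.le (show y - F.M ≤ 0 by linarith [F.M_pos])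
  rw [shift, max_eq_right (h2.trans h1), max_eq_right h1]

lemma u_eq_X {z : ℂ} (h1 : -F.M ≤ F.Y z) (h2 : F.Y z ≤ F.M) : F.u z = F.X z := by
  rw [u, F.shift_eq_zero h1 h2, sub_zero]

lemma u_ray_ep {z : ℂ} {s : ℝ} (hz : F.Y z = F.M) (hs : 0 ≤ s) : F.u (z + s * F.ep) = F.X z := by
  have h := F.Y_ep
  rw [u, Y_add, Y_mul, hz, F.shift_of_ge (by nlinarith), X_add, X_mul]
  have := h.ne'
  field_simp
  ring

lemma u_ray_em {z : ℂ} {s : ℝ} (hz : F.Y z = -F.M) (hs : 0 ≤ s) : F.u (z + s * F.em) = F.X z := by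
  have h := F.Y_em
  rw [u, Y_add, Y_mul, hz, F.shift_of_le (by nlinarith), X_add, X_mul]
  have := h.ne
  field_simp
  ring

/-- The coordinates along a path whose vertices belong to the middle strip. -/
lemma on_cases {p : PolyPath} {τ : ℝ} {z : ℂ} (h : p.On τ z) (hv : ∀ k ≤ p.n, |F.Y (p.v k)| ≤ F.M) :
    (∃ s : ℝ, 0 < s ∧ z = p.v 0 + s * p.e₀ ∧ p.e₀ ≠ 0) ∨
    (∃ k < p.n, ∃ s : ℝ, 0 ≤ s ∧ s ≤ 1 ∧ τ = 1 + k + s ∧ (k = 0 → p.e₀ = 0 → 0 < s) ∧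
      z = p.v k + s * (p.v (k + 1) - p.v k) ∧
      F.u z = F.X (p.v k) + s * (F.X (p.v (k + 1)) - F.X (p.v k)) ∧
      F.Y z = F.Y (p.v k) + s * (F.Y (p.v (k + 1)) - F.Y (p.v k))) ∨
    ∃ s : ℝ, 0 < s ∧ z = p.v p.n + s * p.e₁ ∧ p.e₁ ≠ 0 := by
  rcases h.cases with h | ⟨k, hk, s, hs0, hs1, h1, h2, -, h3⟩ | h
  · exact Or.inl h
  · have hY : F.Y z = F.Y (p.v k) + s * (F.Y (p.v (k + 1)) - F.Y (p.v k)) := by rw [h3]; simp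
    obtain ⟨h4, h5⟩ := abs_le.1 (hv k hk.le)
    obtain ⟨h6, h7⟩ := abs_le.1 (hv (k + 1) hk)
    refine Or.inr (Or.inl ⟨k, hk, s, hs0, hs1, h1, h2, h3, ?_, hY⟩)
    rw [F.u_eq_X (by rw [hY]; nlinarith) (by rw [hY]; nlinarith), h3]
    simp
  · exact Or.inr (Or.inr h)

lemma ray_ep {x s : ℝ} {z : ℂ} (hs : 0 < s) (hz : z = F.pt x F.M + s * F.ep) :
    F.u z = x ∧ F.M < F.Y z := by
  rw [hz, F.u_ray_ep (by simp) hs.le, Y_add, Y_mul, X_pt, Y_pt]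
  exact ⟨rfl, by nlinarith [F.Y_ep]⟩

lemma ray_em {x s : ℝ} {z : ℂ} (hs : 0 < s) (hz : z = F.pt x (-F.M) + s * F.em) :
    F.u z = x ∧ F.Y z < -F.M := by
  rw [hz, F.u_ray_em (by simp) hs.le, Y_add, Y_mul, X_pt, Y_pt]
  exact ⟨rfl, by nlinarith [F.Y_em]⟩

/-! ### The basic contours -/

lemma _root_.eq_one_of_affine {x a c s : ℝ} (h : x = a + s * (c - a)) (hx : x = c) (hac : a ≠ c) :
    s = 1 := by
  have h1 : (s - 1) * (c - a) = 0 := by linarith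
  linarith [(mul_eq_zero.1 h1).resolve_right (sub_ne_zero.2 hac.symm)]

lemma _root_.eq_zero_of_affine {x a c s : ℝ} (h : x = a + s * (c - a)) (hx : x = a) (hac : a ≠ c) :
    s = 0 := (mul_eq_zero.1 (by linarith : s * (c - a) = 0)).resolve_right (sub_ne_zero.2 hac.symm)

/-- A stem: from `b` to `b + e`, down, and to infinity in the direction `em`. -/
def stem (b e : ℂ) : PolyPath where
  n := 2
  pos_n := two_pos
  v
    | 0 => b
    | 1 => b + e
    | _ => F.pt (F.X (b + e)) (-F.M)
  e₀ := 0
  e₁ := F.em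

lemma stem_cases {b e z : ℂ} {τ : ℝ} (h : (F.stem b e).On τ z) (hb : |F.Y b| < F.M)
    (he : |F.Y (b + e)| < F.M) :
    ∃ s : ℝ, 0 < s ∧ s ≤ 1 ∧ F.u z = F.X b + s * F.X e ∧ F.Y z ≤ F.Y b + s * F.Y e ∧
      (s < 1 → z = b + s * e ∧ τ = 1 + (0 : ℕ) + s) ∧
      (F.Y z = F.Y b + s * F.Y e ∨ s = 1 ∧ (F.Y z < -F.M ∨
        ∃ t : ℝ, τ = 2 + t ∧ F.Y z = F.Y b + F.Y e - t * (F.Y b + F.Y e + F.M))) := by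
  have hM : |-F.M| = F.M := by rw [abs_neg, abs_of_pos F.M_pos]
  rcases F.on_cases h fun k hk => by
    have hk' : k ≤ 2 := hk
    interval_cases k
    exacts [hb.le, he.le, by simp [stem, hM]] with
    ⟨s, -, -, h⟩ | ⟨k, hk, s, hs0, hs1, h1, h2, h3, h4, h5⟩ | ⟨s, hs, h3, -⟩
  · exact absurd rfl h
  · have hk' : k < 2 := hk
    rw [Y_add, abs_lt] at he
    interval_cases k <;> simp [stem] at h3 h4 h5
    · exact ⟨s, h2 rfl rfl, hs1, h4, h5.le, fun _ => ⟨h3, by simp [h1]⟩, Or.inl h5⟩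
    · exact ⟨1, one_pos, le_rfl, by linarith, by nlinarith, fun h => absurd h (lt_irrefl _),
        Or.inr ⟨rfl, Or.inr ⟨s, by rw [h1]; norm_num, by linarith⟩⟩⟩
  · obtain ⟨h4, h5⟩ := F.ray_em (x := F.X (b + e)) hs h3
    rw [Y_add, abs_lt] at he
    exact ⟨1, one_pos, le_rfl, by rw [h4, X_add, one_mul], by linarith,
      fun h => absurd h (lt_irrefl _), Or.inr ⟨rfl, Or.inl h5⟩⟩

/-- A dual stem: from `b` to `b + e`, up (through the height `y`), and to infinity in the direction
`ep`. -/
def dualStem (b e : ℂ) (y : ℝ) : PolyPath where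
  n := 3
  pos_n := three_pos
  v
    | 0 => b
    | 1 => b + e
    | 2 => F.pt (F.X (b + e)) y
    | _ => F.pt (F.X (b + e)) F.M
  e₀ := 0
  e₁ := F.ep

lemma dualStem_cases {b e z : ℂ} {y τ : ℝ} (h : (F.dualStem b e y).On τ z) (hb : |F.Y b| < F.M)
    (he : |F.Y (b + e)| < F.M) (hby : F.Y b < y) (hy : F.Y (b + e) < y) (hyM : y < F.M) :
    ∃ s : ℝ, 0 < s ∧ s ≤ 1 ∧ F.u z = F.X b + s * F.X e ∧ F.Y b + s * F.Y e ≤ F.Y z ∧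
      (s < 1 → F.Y z = F.Y b + s * F.Y e) ∧ (F.Y z = y → s = 1 ∧ τ = 1 + (2 : ℕ)) := by
  have hM := F.M_pos
  rcases F.on_cases h fun k hk => by
    have hk' : k ≤ 3 := hk
    interval_cases k
    exacts [hb.le, he.le, by simpa [dualStem, abs_le] using ⟨by linarith [abs_lt.1 hb], hyM.le⟩,
      by simp [dualStem, abs_of_pos hM]] with
    ⟨s, -, -, h⟩ | ⟨k, hk, s, hs0, hs1, h1, h2, -, h4, h5⟩ | ⟨s, hs, h3, -⟩
  · exact absurd rfl h
  · have hk' : k < 3 := hk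
    rw [Y_add] at hy
    interval_cases k <;> simp [dualStem] at h4 h5
    · exact ⟨s, h2 rfl rfl, hs1, h4, h5.ge, fun _ => h5,
        fun h => by nlinarith [mul_pos (h2 rfl rfl) (sub_pos.2 hy)]⟩
    · exact ⟨1, one_pos, le_rfl, by linarith, by nlinarith, fun h => absurd h (lt_irrefl _),
        fun h => ⟨rfl, by rw [h1, eq_one_of_affine h5 h hy.ne]; norm_num⟩⟩
    · exact ⟨1, one_pos, le_rfl, by linarith, by nlinarith, fun h => absurd h (lt_irrefl _),
        fun h => ⟨rfl, by rw [h1, eq_zero_of_affine h5 h hyM.ne]; norm_num⟩⟩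
  · obtain ⟨h4, h5⟩ := F.ray_ep (x := F.X (b + e)) hs h3
    rw [Y_add] at hy
    exact ⟨1, one_pos, le_rfl, by rw [h4, X_add, one_mul], by linarith,
      fun h => absurd h (lt_irrefl _), fun h => by linarith⟩

/-- A lasso from below around the point with coordinates `(x, y)`. -/
def lasso (x y w : ℝ) : PolyPath where
  n := 3
  pos_n := three_pos
  v
    | 0 => F.pt (x - w) (-F.M)
    | 1 => F.pt (x - w) (y + w)
    | 2 => F.pt (x + w) (y + w)
    | _ => F.pt (x + w) (-F.M)
  e₀ := F.em
  e₁ := F.em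

lemma lasso_cases {x y w τ : ℝ} {z : ℂ} (h : (F.lasso x y w).On τ z) (h0 : -F.M < y + w)
    (hM : y + w < F.M) : F.u z = x - w ∨ F.u z = x + w ∨
    ∃ s : ℝ, 0 ≤ s ∧ s ≤ 1 ∧ τ = 1 + (1 : ℕ) + s ∧ F.Y z = y + w ∧ F.u z = x - w + s * (2 * w) := by
  have h1 : |F.M| ≤ F.M ∧ |y + w| ≤ F.M := ⟨(abs_of_pos F.M_pos).le, abs_le.2 ⟨h0.le, hM.le⟩⟩
  rcases F.on_cases h fun k hk => by
    have hk' : k ≤ 3 := hk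
    interval_cases k <;> simp [lasso, h1] with
    ⟨s, hs, h2, -⟩ | ⟨k, hk, s, hs0, hs1, h1, -, -, h4, h5⟩ | ⟨s, hs, h2, -⟩
  · exact Or.inl (F.ray_em hs h2).1
  · have hk' : k < 3 := hk
    interval_cases k <;> simp only [lasso, X_pt, Y_pt, sub_self, mul_zero, add_zero] at h4 h5
    exacts [Or.inl h4, Or.inr (Or.inr ⟨s, hs0, hs1, h1, h5, by linarith⟩), Or.inr (Or.inl h4)]
  · exact Or.inr (Or.inl (F.ray_em hs h2).1)

/-- A dual lasso from above around the point with coordinates `(x, y)`. -/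
def dualLasso (x y w x₁ : ℝ) : PolyPath where
  n := 6
  pos_n := by norm_num
  v
    | 0 => F.pt (x - w / 2) F.M
    | 1 => F.pt (x - w / 2) (y + w)
    | 2 => F.pt (x - w / 2) (y - w)
    | 3 => F.pt x₁ (y - w)
    | 4 => F.pt (x + w / 2) (y - w)
    | 5 => F.pt (x + w / 2) (y + w)
    | _ => F.pt (x + w / 2) F.M
  e₀ := F.ep
  e₁ := F.ep

lemma dualLasso_cases {x y w x₁ τ : ℝ} {z : ℂ} (h : (F.dualLasso x y w x₁).On τ z) (hw : 0 < w)
    (h0 : -F.M < y - w) (hM : y + w < F.M) (hx1 : x - w / 2 < x₁) (hx2 : x₁ < x + w / 2) :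
    (y - w ≤ F.Y z ∧ ((F.u z = x - w / 2 ∧ (F.Y z = y + w → τ = 2)) ∨
       (F.u z = x + w / 2 ∧ (F.Y z = y + w → τ = 6)))) ∨
    (F.Y z = y - w ∧ x - w / 2 ≤ F.u z ∧ F.u z ≤ x + w / 2 ∧ (F.u z = x₁ → τ = 4)) := by
  have h1 : |F.M| ≤ F.M ∧ |y + w| ≤ F.M ∧ |y - w| ≤ F.M := by
    rw [abs_of_pos F.M_pos, abs_le, abs_le]
    refine ⟨le_rfl, ⟨?_, ?_⟩, ?_, ?_⟩ <;> linarith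
  have hyw : y - w ≠ y + w := by linarith
  rcases F.on_cases h fun k hk => by
    have hk' : k ≤ 6 := hk
    interval_cases k <;> simp [dualLasso, h1] with
    ⟨s, hs, h2, -⟩ | ⟨k, hk, s, hs0, hs1, h1, -, -, h4, h5⟩ | ⟨s, hs, h2, -⟩
  · have h2 := F.ray_ep (x := x - w / 2) hs h2
    exact Or.inl ⟨by linarith [h2.2], Or.inl ⟨h2.1, fun h => by linarith [h2.2]⟩⟩
  · have hk' : k < 6 := hk
    interval_cases k <;> simp only [dualLasso, X_pt, Y_pt, sub_self, mul_zero, add_zero] at h4 h5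
    · exact Or.inl ⟨by nlinarith, Or.inl ⟨h4, fun h => by
        rw [h1, eq_one_of_affine h5 h hM.ne']; norm_num⟩⟩
    · exact Or.inl ⟨by nlinarith, Or.inl ⟨h4, fun h => by
        rw [h1, eq_zero_of_affine h5 h hyw.symm]; norm_num⟩⟩
    · exact Or.inr ⟨h5, by nlinarith, by nlinarith, fun h => by
        rw [h1, eq_one_of_affine h4 h hx1.ne]; norm_num⟩
    · exact Or.inr ⟨h5, by nlinarith, by nlinarith, fun h => by
        rw [h1, eq_zero_of_affine h4 h hx2.ne]; norm_num⟩
    · exact Or.inl ⟨by nlinarith, Or.inr ⟨h4, fun h => by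
        rw [h1, eq_one_of_affine h5 h hyw]; norm_num⟩⟩
    · exact Or.inl ⟨by nlinarith, Or.inr ⟨h4, fun h => by
        rw [h1, eq_zero_of_affine h5 h hM.ne]; norm_num⟩⟩
  · have h2 := F.ray_ep (x := x + w / 2) hs h2
    exact Or.inl ⟨by linarith [h2.2], Or.inr ⟨h2.1, fun h => by linarith [h2.2]⟩⟩

end Frame

/-! ### Fans of rays -/

/-- The direction `e` turned by the angle `θ`. -/
def turn (e : ℂ) (θ : ℝ) : ℂ := e * exp (θ * Complex.I)

@[simp] lemma turn_zero (e : ℂ) : turn e 0 = e := by simp [turn]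

lemma turn_add_two_pi (e : ℂ) (θ : ℝ) : turn e (θ + 2 * π) = turn e θ := by
  rw [turn, turn]
  push_cast
  exact congrArg (e * ·) (Complex.exp_mul_I_periodic θ)

lemma norm_turn (e : ℂ) (θ : ℝ) : ‖turn e θ‖ = ‖e‖ := by
  rw [turn, norm_mul, Complex.norm_exp_ofReal_mul_I, mul_one]

lemma turn_pow (e : ℂ) (θ : ℝ) (n : ℕ) : turn e θ ^ n = turn (e ^ n) (n * θ) := by
  rw [turn, turn, mul_pow, ← Complex.exp_nat_mul]
  push_cast
  ring_nf

lemma turn_turn (e : ℂ) (θ φ : ℝ) : turn (turn e θ) φ = turn e (θ + φ) := by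
  rw [turn, turn, turn, mul_assoc, ← exp_add]
  push_cast
  ring_nf

lemma conj_turn_mul (e : ℂ) (θ φ : ℝ) :
    conj (turn e θ) * turn e φ = (‖e‖ ^ 2 : ℝ) * exp ((φ - θ : ℝ) * Complex.I) := by
  have h1 : conj (turn e θ) * turn e φ = e * conj e *
      (exp (-(θ * Complex.I)) * exp (φ * Complex.I)) := by
    rw [turn, turn, map_mul, ← Complex.exp_conj, map_mul, Complex.conj_I, Complex.conj_ofReal]
    ring_nf
  rw [h1, Complex.mul_conj, normSq_eq_norm_sq, ← exp_add]
  push_cast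
  ring_nf

lemma im_conj_turn_mul (e : ℂ) (θ φ : ℝ) :
    (conj (turn e θ) * turn e φ).im = ‖e‖ ^ 2 * sin (φ - θ) := by
  rw [conj_turn_mul, im_ofReal_mul, exp_ofReal_mul_I_im]

/-- A ray does not meet a convex cone that it does not belong to. -/
lemma cone_ne_ray {e : ℂ} (he : e ≠ 0) {a c t α β s : ℝ} (hac : a < c) (hca : c < a + π)
    (ht : (c < t ∧ t < a + 2 * π) ∨ (c < t + 2 * π ∧ t < a)) (hα : 0 ≤ α) (hβ : 0 ≤ β)
    (hαβ : 0 < α + β) (hs : 0 ≤ s) : α * turn e a + β * turn e c ≠ s * turn e t := by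
  intro h
  wlog ht' : c < t ∧ t < a + 2 * π generalizing t
  · obtain ⟨h1, h2⟩ := ht.resolve_left ht'
    have h3 : c < t + 2 * π ∧ t + 2 * π < a + 2 * π := ⟨h1, by linarith⟩
    exact this (Or.inl h3) (by rwa [turn_add_two_pi]) h3
  obtain ⟨h1, h2⟩ := ht'
  have he2 : ‖e‖ ^ 2 ≠ 0 := by simpa using he
  have hca' : 0 < sin (c - a) := sin_pos_of_pos_of_lt_pi (by linarith) (by linarith)
  have e1 := congrArg (fun z => (conj (turn e a) * z).im / ‖e‖ ^ 2) h
  have e2 := congrArg (fun z => (conj (turn e c) * z).im / ‖e‖ ^ 2) h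
  simp only [mul_add, mul_left_comm _ (_ : ℂ) (turn e _), Complex.add_im, im_ofReal_mul,
    im_conj_turn_mul, sub_self, Real.sin_zero, mul_zero, zero_add, add_zero,
    mul_left_comm _ (‖e‖ ^ 2), mul_div_cancel_left₀ _ he2] at e1 e2
  rw [← neg_sub, sin_neg] at e2
  have e3 : s * sin (t - a) ≥ 0 := by rw [← e1]; positivity
  have e4 : s * sin (t - c) ≤ 0 := by rw [← e2]; nlinarith
  rcases hs.eq_or_lt with rfl | hs
  · rw [zero_mul] at e1 e2
    nlinarith
  · have e5 : t - a ≤ π := by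
      by_contra! h3
      have := sin_pos_of_pos_of_lt_pi (x := t - a - π) (by linarith) (by linarith)
      rw [Real.sin_sub_pi] at this
      nlinarith
    have := sin_pos_of_pos_of_lt_pi (x := t - c) (by linarith) (by linarith)
    nlinarith

lemma fan_cone_ne_ray {e : ℂ} (he : e ≠ 0) {δ : ℝ} (hδ : 0 < δ) {n : ℕ} (hn : n * δ = π)
    {a c t : ℕ} (hac : a < c) (hca : c < a + n)
    (ht : (c < t ∧ t < a + 2 * n) ∨ (c < t + 2 * n ∧ t < a)) {α β s : ℝ} (hα : 0 ≤ α) (hβ : 0 ≤ β)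
    (hαβ : 0 < α + β) (hs : 0 ≤ s) :
    α * turn e (a * δ) + β * turn e (c * δ) ≠ s * turn e (t * δ) := by
  have key : ∀ {x y : ℕ}, x < y → (x : ℝ) * δ < y * δ := fun h =>
    mul_lt_mul_of_pos_right (by exact_mod_cast h) hδ
  have h1 := key hca
  have h2 : ∀ x : ℕ, (x + n : ℕ) * δ = x * δ + π := fun x => by rw [← hn]; push_cast; ring
  have h3 : ∀ x : ℕ, (x + 2 * n : ℕ) * δ = x * δ + 2 * π := fun x => by rw [← hn]; push_cast; ring
  rw [h2] at h1
  refine cone_ne_ray he (key hac) h1 (ht.imp (fun h => ⟨key h.1, ?_⟩) fun h => ⟨?_, key h.2⟩)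
    hα hβ hαβ hs <;> rw [← h3]
  exacts [key h.2, key h.1]

/-! ### Groups of contours -/

/-- Contours `P i` and dual contours `Q i`, `i < m`, in the domain `u ∈ I`, that avoid the cuts `K`
and `K'`, and such that `P i` and `Q j` cross (once or, in the case of a pair of lassoes, twice) if
and only if `i = j`. -/
structure ContourGroup (F : Frame) (A B : ℂ[X]) (b : ℂ) (m : ℕ) (I : Set ℝ) (K K' : Set ℂ)
    (P Q : ℕ → PolyPath) : Prop where
  adm : ∀ i < m, (P i).Admissible (directNum A B) B
  adm' : ∀ i < m, (Q i).Admissible A B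
  mem : ∀ i < m, ∀ τ z, (P i).On τ z → F.u z ∈ I ∧ z ∉ K
  mem' : ∀ i < m, ∀ τ z, (Q i).On τ z → F.u z ∈ I ∧ z ∉ K'
  path : ∀ i < m, ∃ S : Set ℂ, IsPreconnected S ∧ (∀ z ∈ S, F.u z ∈ I ∧ z ∉ K') ∧
    (∃ τ, ∃ z ∈ S, (Q i).On τ z) ∧ ∃ z ∈ S, F.Y z < -F.M
  disjoint : ∀ i < m, ∀ j < m, i ≠ j → ∀ τ τ' z, (P i).On τ z → ¬(Q j).On τ' z
  crossing : ∀ i < m, (∃ j k s σ, (σ = 1 ∨ σ = -1) ∧ (P i).Crossing (Q i) j k s σ ∧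
      ∀ τ τ' z, (P i).On τ z → (Q i).On τ' z → τ = 1 + k + s ∧ τ' = 1 + j) ∨
    (B.eval b = 0 ∧ multiplier A B b ≠ 1 ∧
      (∃ S : Set ℂ, IsPreconnected S ∧ (∀ z ∈ S, F.u z ∈ I) ∧ (Q i).v 1 ∈ S ∧ (Q i).v 5 ∈ S) ∧
      (∀ L L' : ℂ → ℂ, IsLogOn L b Kᶜ → IsLogOn L' b K'ᶜ → L' ((Q i).v 5) - L ((Q i).v 5)
          = L' ((Q i).v 1) - L ((Q i).v 1) + 2 * π * Complex.I) ∧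
      ∃ s t, (P i).Crossing (Q i) 1 1 s (-1) ∧ (P i).Crossing (Q i) 5 1 t 1 ∧
      ∀ τ τ' z, (P i).On τ z → (Q i).On τ' z → (τ = 2 + s ∧ τ' = 2) ∨ (τ = 2 + t ∧ τ' = 6))

/-! ### The contours that connect the sectors at infinity -/

/-- A contour from infinity in the direction `e` to `z`, and to infinity in the direction `f`. -/
def bend (z e f : ℂ) : PolyPath where
  n := 1
  pos_n := one_pos
  v
    | 0 => z
    | _ => z + 2 * f
  e₀ := e
  e₁ := f

/-- A contour from infinity in the direction `e` to `z`, and to infinity in the direction `f`. -/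
def dualBend (z e f : ℂ) : PolyPath where
  n := 2
  pos_n := two_pos
  v
    | 0 => z + e
    | 1 => z
    | _ => z + f
  e₀ := e
  e₁ := f

lemma bend_cases {z e f x : ℂ} {τ : ℝ} (h : (bend z e f).On τ x) :
    ∃ s : ℝ, 0 ≤ s ∧ (x = z + s * e ∨ x = z + s * f ∧ (s = 1 → τ = 1 + (0 : ℕ) + 1 / 2)) := by
  rcases h.cases with ⟨s, hs, h1, -⟩ | ⟨k, hk, s, hs0, hs1, h1, -, -, h4⟩ | ⟨s, hs, h1, -⟩
  · exact ⟨s, hs.le, Or.inl h1⟩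
  · have hk' : k < 1 := hk
    interval_cases k
    refine ⟨2 * s, by positivity, Or.inr ⟨?_, fun h => by rw [h1]; push_cast; linarith⟩⟩
    rw [h4]
    simp [bend]
    ring
  · refine ⟨2 + s, by positivity, Or.inr ⟨?_, fun h => by linarith⟩⟩
    rw [h1]
    simp [bend]
    ring

lemma dualBend_cases {z e f x : ℂ} {τ : ℝ} (h : (dualBend z e f).On τ x) :
    ∃ s : ℝ, 0 ≤ s ∧ (s = 0 → τ = 1 + (1 : ℕ)) ∧ (x = z + s * e ∨ x = z + s * f) := by
  rcases h.cases with ⟨s, hs, h1, -⟩ | ⟨k, hk, s, hs0, hs1, h1, -, -, h4⟩ | ⟨s, hs, h1, -⟩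
  · refine ⟨1 + s, by positivity, fun h => by linarith, Or.inl ?_⟩
    rw [h1]
    simp [dualBend]
    ring
  · have hk' : k < 2 := hk
    interval_cases k
    · refine ⟨1 - s, by linarith, fun h => by push_cast at *; linarith, Or.inl ?_⟩
      rw [h4]
      simp [dualBend]
      ring
    · exact ⟨s, hs0, fun h => by rw [h1, h, add_zero], Or.inr (by rw [h4]; simp [dualBend])⟩
  · refine ⟨1 + s, by positivity, fun h => by linarith, Or.inr ?_⟩
    rw [h1]
    simp [dualBend]
    ring

lemma Frame.u_le (F : Frame) {e z : ℂ} {s : ℝ} (hs : 0 ≤ s)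
    (he : 0 ≤ (conj F.ep * e).im ∨ (conj F.em * e).im ≤ 0) :
    F.u (z + s * e) ≤ F.X z + (F.X F.ep / F.Y F.ep + F.X F.em / -F.Y F.em) * (|F.Y z| + F.M) := by
  have h1 := F.slope_ep
  have h2 := F.slope_em
  have h3 := F.Y_ep
  have h4 := F.Y_em
  have h5 := neg_abs_le (F.Y z)
  have h6 := le_abs_self (F.Y z)
  have hM := F.M_pos
  rw [F.im_conj_mul, F.im_conj_mul] at he
  rw [Frame.u, F.X_add, F.X_mul]
  set p := F.X F.ep / F.Y F.ep with hp
  set q := F.X F.em / -F.Y F.em with hq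
  rcases he with he | he
  · have h7 : p * (F.Y (z + s * e) - F.M) ≤ F.shift (F.Y (z + s * e)) :=
      (le_max_left _ _).trans (le_max_right _ _)
    have h8 : F.X e ≤ p * F.Y e := by
      rw [hp, div_mul_eq_mul_div, le_div_iff₀ h3]
      linarith
    rw [F.Y_add, F.Y_mul] at h7 ⊢
    nlinarith [mul_le_mul_of_nonneg_left h8 hs, mul_nonneg h2.le (abs_nonneg (F.Y z)),
      mul_nonneg h2.le hM.le]
  · have h7 : q * (-F.Y (z + s * e) - F.M) ≤ F.shift (F.Y (z + s * e)) :=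
      (le_max_right _ _).trans (le_max_right _ _)
    have h8 : F.X e ≤ q * -F.Y e := by
      rw [hq, div_mul_eq_mul_div, le_div_iff₀ (by linarith)]
      linarith
    rw [F.Y_add, F.Y_mul] at h7 ⊢
    nlinarith [mul_le_mul_of_nonneg_left h8 hs, mul_nonneg h1.le (abs_nonneg (F.Y z)),
      mul_nonneg h1.le hM.le]

lemma isDecayDirection_turn {A B : ℂ[X]} (h : IsTypeBB A B) {ζ : ℂ} {r : ℝ} (hr : 0 < r)
    (hζ : A.leadingCoeff / B.leadingCoeff * ζ ^ (A.natDegree - B.natDegree + 1) = r) (n : ℕ) :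
    (Even n → IsDecayDirection (directNum A B) B
      (turn ζ (n * (π / (A.natDegree - B.natDegree + 1 : ℕ))))) ∧
    (Odd n → IsDecayDirection A B (turn ζ (n * (π / (A.natDegree - B.natDegree + 1 : ℕ))))) := by
  set D := A.natDegree - B.natDegree + 1 with hD
  have hD0 : (D : ℝ) ≠ 0 := by rw [hD]; positivity
  have h1 : A.leadingCoeff / B.leadingCoeff * turn ζ (n * (π / D)) ^ D = r * (-1) ^ n := by
    rw [turn_pow, turn, ← mul_assoc, hζ, show (D : ℝ) * (n * (π / D)) = n * π by field_simp]
    push_cast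
    rw [mul_assoc, Complex.exp_nat_mul, Complex.exp_pi_mul_I]
  refine ⟨fun hn => ?_, fun hn => ?_⟩
  · rw [IsDecayDirection, leadingCoeff_directNum h, natDegree_directNum h, ← hD, neg_div, neg_mul,
      h1, hn.neg_one_pow]
    simpa using hr
  · rw [IsDecayDirection, ← hD, h1, hn.neg_one_pow]
    simpa using hr

lemma exists_contourGroup_infinity {A B : ℂ[X]} (h : IsTypeBB A B) (F : Frame) {ζ : ℂ}
    (hζ1 : ‖ζ‖ = 1) {r : ℝ} (hr : 0 < r)
    (hζ : A.leadingCoeff / B.leadingCoeff * ζ ^ (A.natDegree - B.natDegree + 1) = r)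
    (hem : F.em = ζ) (hep : F.ep = turn ζ (π / (A.natDegree - B.natDegree + 1 : ℕ)))
    (R : ℝ) (b : ℂ) :
    ∃ P Q, ContourGroup F A B b (A.natDegree - B.natDegree) (Set.Iio R) ∅ ∅ P Q := by
  have hD2 : 1 ≤ A.natDegree - B.natDegree := by have := h.degree_lt; omega
  have hdec := isDecayDirection_turn h hr hζ
  set D := A.natDegree - B.natDegree + 1 with hD
  set δ := π / (D : ℝ) with hδ
  have hD0 : (0 : ℝ) < D := by rw [hD]; positivity
  have hδ0 : 0 < δ := div_pos pi_pos hD0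
  have hDδ : (D : ℝ) * δ = π := by rw [hδ]; field_simp
  have hδπ : δ < π := by
    rw [← hDδ]
    have : (2 : ℝ) ≤ D := by exact_mod_cast (show 2 ≤ D by omega)
    nlinarith
  set E : ℕ → ℂ := fun n => turn ζ (n * δ) with hE
  have hE0 : E 0 = F.em := by simp [hE, hem]
  have hζ0 : ζ ≠ 0 := norm_ne_zero_iff.1 (by rw [hζ1]; exact one_ne_zero)
  have hEne : ∀ n, E n ≠ 0 := fun n => mul_ne_zero hζ0 (exp_ne_zero _)
  have hside : ∀ n : ℕ, n ≤ 2 * D → 0 ≤ (conj F.ep * E n).im ∨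
      (conj F.em * E n).im ≤ 0 := fun n hn => by
    rw [hep, ← hE0, hE]
    simp only [im_conj_turn_mul, hζ1, one_pow, one_mul]
    have hn' : (n : ℝ) * δ ≤ 2 * π := by
      rw [← hDδ, ← mul_assoc]
      gcongr
      exact_mod_cast hn
    by_cases h1 : n = 0
    · right; simp [h1]
    by_cases h2 : n ≤ D
    · left
      have h3 : (1 : ℝ) ≤ n := by exact_mod_cast Nat.one_le_iff_ne_zero.2 h1
      have h4 : (n : ℝ) ≤ D := by exact_mod_cast h2
      exact sin_nonneg_of_nonneg_of_le_pi (by nlinarith) (by nlinarith)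
    · right
      have h4 : (D : ℝ) ≤ n := by exact_mod_cast (by omega : D ≤ n)
      have := sin_nonneg_of_nonneg_of_le_pi (x := n * δ - π) (by nlinarith) (by linarith)
      rw [Real.sin_sub_pi] at this
      simpa using this
  set S := F.X F.ep / F.Y F.ep + F.X F.em / -F.Y F.em
  have hS : 0 < S := add_pos F.slope_ep F.slope_em
  set Λ := |R| + 2 + S * (1 + F.M) with hΛ
  set z := F.pt (-Λ) 0 with hz
  have hSM : 0 < S * (1 + F.M) := mul_pos hS (by linarith [F.M_pos])
  have hR := neg_abs_le R
  have huz : ∀ n : ℕ, n ≤ 2 * D → ∀ s : ℝ, 0 ≤ s → F.u (z + s * E n) < R := fun n hn s hs => by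
    have h0 : F.u (z + s * E n) ≤ F.X z + S * (|F.Y z| + F.M) := F.u_le hs (hside n hn)
    rw [hz, F.X_pt, F.Y_pt, abs_zero] at h0
    nlinarith
  have huw : ∀ k n : ℕ, n ≤ 2 * D → ∀ s : ℝ, 0 ≤ s → F.u (z + E k + s * E n) < R :=
      fun k n hn s hs => by
    have h0 : F.u (z + E k + s * E n) ≤ F.X (z + E k) + S * (|F.Y (z + E k)| + F.M) :=
      F.u_le hs (hside n hn)
    have h1 : ‖E k‖ = 1 := by rw [← hζ1]; exact norm_turn _ _
    have h2 := (abs_le.1 (F.abs_X_le (E k))).2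
    have h3 := F.abs_Y_le (E k)
    rw [h1] at h2 h3
    rw [F.X_add, F.Y_add, hz, F.X_pt, F.Y_pt, zero_add] at h0
    nlinarith [mul_le_mul_of_nonneg_left h3 hS.le]
  have hne : ∀ k < D - 1, ∀ t : ℕ, (t = 0 ∨ ∃ j < D - 1, t = 2 * j + 2 ∧ j ≠ k) → ∀ s s' : ℝ,
      0 ≤ s → 0 ≤ s' → ∀ n, (n = 2 * k + 1 ∨ n = 2 * k + 3) →
      z + s * E t ≠ z + E (2 * k + 2) + s' * E n := fun k hk t ht s s' hs hs' n hn h1 => by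
    rcases hn with rfl | rfl
    · refine fan_cone_ne_ray hζ0 hδ0 hDδ (lt_add_one (2 * k + 1)) (by omega) (t := t) ?_ hs'
        zero_le_one (by linarith) hs ?_
      · rcases ht with rfl | ⟨j, hj, rfl, hjk⟩ <;> omega
      · change (s' : ℂ) * E (2 * k + 1) + (1 : ℝ) * E (2 * k + 2) = s * E t
        rw [Complex.ofReal_one]
        linear_combination -h1
    · refine fan_cone_ne_ray hζ0 hδ0 hDδ (lt_add_one (2 * k + 2)) (by omega) (t := t) ?_
        zero_le_one hs' (by linarith) hs ?_
      · rcases ht with rfl | ⟨j, hj, rfl, hjk⟩ <;> omega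
      · change ((1 : ℝ) : ℂ) * E (2 * k + 2) + s' * E (2 * k + 3) = s * E t
        rw [Complex.ofReal_one]
        linear_combination -h1
  have him : ∀ k n, (n = 2 * k + 1 ∨ n = 2 * k + 3) → (conj (E (2 * k + 2)) * E n).im =
      (n - (2 * k + 2)) * sin δ := fun k n hn => by
    simp only [hE, im_conj_turn_mul, hζ1, one_pow, one_mul]
    rcases hn with rfl | rfl
    · rw [show ((2 * k + 1 : ℕ) * δ - (2 * k + 2 : ℕ) * δ : ℝ) = -δ by push_cast; ring, sin_neg]
      push_cast
      ring
    · rw [show ((2 * k + 3 : ℕ) * δ - (2 * k + 2 : ℕ) * δ : ℝ) = δ by push_cast; ring]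
      push_cast
      ring
  have hsin : 0 < sin δ := sin_pos_of_pos_of_lt_pi hδ0 hδπ
  refine ⟨fun k => bend z (E 0) (E (2 * k + 2)),
    fun k => dualBend (z + E (2 * k + 2)) (E (2 * k + 1)) (E (2 * k + 3)), ?_⟩
  have hQ : ∀ k τ x, (dualBend (z + E (2 * k + 2)) (E (2 * k + 1)) (E (2 * k + 3))).On τ x →
      ∃ s : ℝ, 0 ≤ s ∧ (s = 0 → τ = 1 + (1 : ℕ)) ∧ ∃ n, (n = 2 * k + 1 ∨ n = 2 * k + 3) ∧
        x = z + E (2 * k + 2) + s * E n := fun k τ x hx => by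
    obtain ⟨s, hs, h2, h1 | h1⟩ := dualBend_cases hx
    exacts [⟨s, hs, h2, _, Or.inl rfl, h1⟩, ⟨s, hs, h2, _, Or.inr rfl, h1⟩]
  constructor
  · exact fun k hk => ⟨.ray ((hdec 0).1 (by decide)), .ray ((hdec (2 * k + 2)).1 ⟨k + 1, by ring⟩)⟩
  · exact fun k hk =>
      ⟨.ray ((hdec (2 * k + 1)).2 ⟨k, by ring⟩), .ray ((hdec (2 * k + 3)).2 ⟨k + 1, by ring⟩)⟩
  · intro k hk τ x hx
    obtain ⟨s, hs, rfl | ⟨rfl, -⟩⟩ := bend_cases hx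
    exacts [⟨huz _ (by omega) s hs, id⟩, ⟨huz _ (by omega) s hs, id⟩]
  · intro k hk τ x hx
    obtain ⟨s, hs, -, n, hn, rfl⟩ := hQ k τ x hx
    exact ⟨huw _ _ (by omega) s hs, id⟩
  · intro k hk
    refine ⟨(fun s : ℝ => z + s * E (2 * k + 2)) '' Set.Ici 0 ∪ (fun s : ℝ => z + s * E 0) '' Set.Ici 0,
      ?_, ?_, ⟨1 + (1 : ℕ), _, Or.inl ⟨1, by simp, rfl⟩, ?_⟩, ?_⟩
    · exact IsPreconnected.union z ⟨0, by simp, by simp⟩ ⟨0, by simp, by simp⟩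
        (isPreconnected_Ici.image _ (by fun_prop)) (isPreconnected_Ici.image _ (by fun_prop))
    · rintro _ (⟨s, hs, rfl⟩ | ⟨s, hs, rfl⟩)
      exacts [⟨huz _ (by omega) s hs, id⟩, ⟨huz _ (by omega) s hs, id⟩]
    · have := (dualBend (z + E (2 * k + 2)) (E (2 * k + 1)) (E (2 * k + 3))).on_vertex one_pos
        one_lt_two
      simpa [dualBend] using this
    · have h1 := F.Y_em
      have h2 : 0 ≤ (F.M + 1) / -F.Y F.em := div_nonneg (by linarith [F.M_pos]) (by linarith)
      refine ⟨_, Or.inr ⟨(F.M + 1) / -F.Y F.em, h2, rfl⟩, ?_⟩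
      dsimp only
      rw [hE0, F.Y_add, F.Y_mul, hz, F.Y_pt, div_neg, neg_mul, div_mul_cancel₀ _ h1.ne]
      linarith
  · intro i hi j hj hij τ τ' x hx hx'
    obtain ⟨s, hs, h2⟩ := bend_cases hx
    obtain ⟨s', hs', -, n, hn, h3⟩ := hQ j τ' x hx'
    rcases h2 with h2 | ⟨h2, -⟩
    · exact hne j hj 0 (Or.inl rfl) s s' hs hs' n hn (h2.symm.trans h3)
    · exact hne j hj _ (Or.inr ⟨i, hi, rfl, hij⟩) s s' hs hs' n hn (h2.symm.trans h3)
  · intro k hk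
    have htwo : ∀ w : ℂ, (conj 2 * w).im = 2 * w.im := fun w => by simp
    refine Or.inl ⟨1, 0, 1 / 2, 1, Or.inl rfl, ⟨one_pos, by simp [dualBend], by simp [bend],
      by norm_num, by norm_num, by simp [bend, dualBend], by simp, ?_, ?_⟩, fun τ τ' x hx hx' => ?_⟩
    · have h2 := him k _ (Or.inl rfl)
      simp [bend, dualBend, -Complex.mul_im, mul_assoc]
      rw [htwo, h2]
      push_cast
      linarith
    · have h2 := him k _ (Or.inr rfl)
      simp [bend, dualBend, -Complex.mul_im, mul_assoc]
      rw [htwo, h2]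
      push_cast
      linarith
    · obtain ⟨s, hs, h2⟩ := bend_cases hx
      obtain ⟨s', hs', h4, n, hn, h3⟩ := hQ k τ' x hx'
      rcases h2 with h2 | ⟨h2, h5⟩
      · exact absurd (h2.symm.trans h3) (hne k hk 0 (Or.inl rfl) s s' hs hs' n hn)
      · have h6 : s' * E n = (s - 1) * E (2 * k + 2) := by linear_combination h2 - h3
        have h7 := congrArg (fun w => (conj (E (2 * k + 2)) * w).im) h6
        have h9 : s' * (conj (E (2 * k + 2)) * E n).im = 0 := by
          rw [← im_ofReal_mul, mul_left_comm, h6]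
          simp
          ring
        rw [him k n hn, mul_left_comm] at h9
        have h10 : s' = 0 := by rcases hn with rfl | rfl <;> push_cast at h9 <;> nlinarith
        rw [h10, Complex.ofReal_zero, zero_mul, zero_eq_mul, sub_eq_zero] at h6
        exact ⟨h5 (by exact_mod_cast h6.resolve_right (hEne _)), h4 h10⟩

/-! ### The contours near a zero: stems and petals -/

namespace Frame

variable (F : Frame)

/-- The cut from `b` down to infinity. -/
def cut (b : ℂ) : Set ℂ := {z | F.u z = F.X b ∧ F.Y z ≤ F.Y b}

/-- The cut from `b` to `b + c` and up to infinity. -/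
def dualCut (b c : ℂ) : Set ℂ := cutSet b (b + c) (F.pt (F.X (b + c)) F.M) F.ep

/-- The part at heights at most `y` of the broken line on which `u` is equal to `x`. -/
def line (x y : ℝ) : Set ℂ := (fun t => F.pt (x + F.shift t) t) '' Set.Iic y

lemma continuous_shift : Continuous F.shift := by
  unfold shift
  fun_prop

lemma u_pt_shift (x t : ℝ) : F.u (F.pt (x + F.shift t) t) = x := by
  rw [u, X_pt, Y_pt, add_sub_cancel_right]

lemma isClosed_cut (b : ℂ) : IsClosed (F.cut b) :=
  (isClosed_eq (F.continuous_X.sub (F.continuous_shift.comp F.continuous_Y)) continuous_const).inter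
    (isClosed_le F.continuous_Y continuous_const)

lemma isPreconnected_line (x y : ℝ) : IsPreconnected (F.line x y) :=
  isPreconnected_Iic.image _ (F.continuous_pt.comp
    ((continuous_const.add F.continuous_shift).prodMk continuous_id)).continuousOn

lemma mem_line {x y : ℝ} {z : ℂ} : z ∈ F.line x y ↔ F.u z = x ∧ F.Y z ≤ y := by
  constructor
  · rintro ⟨t, ht, rfl⟩
    exact ⟨F.u_pt_shift x t, by rwa [Y_pt]⟩
  · rintro ⟨rfl, h⟩
    refine ⟨F.Y z, h, F.ext ?_ ?_⟩ <;> simp [u]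

lemma exists_mem_line (x y : ℝ) : ∃ z ∈ F.line x y, F.Y z < -F.M := by
  have h1 := min_le_left y (-F.M - 1)
  have h2 := min_le_right y (-F.M - 1)
  exact ⟨_, ⟨min y (-F.M - 1), h1, rfl⟩, by rw [Y_pt]; linarith⟩

lemma cutSet_subset_cut {b : ℂ} (hb : |F.Y b| < F.M) :
    cutSet b b (F.pt (F.X b) (-F.M)) F.em ⊆ F.cut b := by
  rw [abs_lt] at hb
  rintro z ((hz | hz) | ⟨s, hs, rfl⟩)
  · rw [segment_same, Set.mem_singleton_iff] at hz
    rw [hz]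
    exact ⟨F.u_eq_X hb.1.le hb.2.le, le_rfl⟩
  · rw [segment_eq_image'] at hz
    obtain ⟨s, ⟨hs0, hs1⟩, rfl⟩ := hz
    have hY : F.Y (b + s • (F.pt (F.X b) (-F.M) - b)) = F.Y b + s * (-F.M - F.Y b) := by simp
    refine ⟨?_, by rw [hY]; nlinarith⟩
    rw [F.u_eq_X (by rw [hY]; nlinarith) (by rw [hY]; nlinarith)]
    simp
  · refine ⟨by rw [F.u_ray_em (by simp) hs, X_pt], ?_⟩
    have := F.Y_em
    rw [Y_add, Y_mul, Y_pt]
    have : (s : ℝ) * F.Y F.em ≤ 0 := mul_nonpos_of_nonneg_of_nonpos hs this.le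
    linarith

lemma dualCut_cases {b c : ℂ} (hb : |F.Y b| < F.M) (hc : |F.Y (b + c)| < F.M) {z : ℂ}
    (hz : z ∈ F.dualCut b c) : ∃ t : ℝ, 0 ≤ t ∧ t ≤ 1 ∧ F.u z = F.X b + t * F.X c ∧
      F.Y b + t * F.Y c ≤ F.Y z ∧ (t < 1 → z = b + t * c) := by
  rw [abs_lt] at hb hc
  rw [Y_add] at hc
  have h1 : ¬(1 : ℝ) < 1 := lt_irrefl _
  rcases hz with (hz | hz) | ⟨s, hs, rfl⟩
  · rw [segment_eq_image'] at hz
    obtain ⟨s, ⟨hs0, hs1⟩, rfl⟩ := hz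
    have hY : F.Y (b + s • (b + c - b)) = F.Y b + s * F.Y c := by simp
    refine ⟨s, hs0, hs1, ?_, hY.ge, fun _ => by simp⟩
    rw [F.u_eq_X (by rw [hY]; nlinarith) (by rw [hY]; nlinarith)]
    simp
  · rw [segment_eq_image'] at hz
    obtain ⟨s, ⟨hs0, hs1⟩, rfl⟩ := hz
    have hY : F.Y (b + c + s • (F.pt (F.X (b + c)) F.M - (b + c)))
        = F.Y b + F.Y c + s * (F.M - (F.Y b + F.Y c)) := by simp
    refine ⟨1, zero_le_one, le_rfl, ?_, by rw [hY]; nlinarith, fun h => absurd h h1⟩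
    rw [F.u_eq_X (by rw [hY]; nlinarith) (by rw [hY]; nlinarith)]
    simp
  · refine ⟨1, zero_le_one, le_rfl, by rw [F.u_ray_ep (by simp) hs, X_pt, X_add, one_mul], ?_,
      fun h => absurd h h1⟩
    have := mul_nonneg hs F.Y_ep.le
    rw [Y_add, Y_mul, Y_pt]
    linarith

end Frame

/-- A loop at `b` around `b + r * e` between the directions `f` and `f'`. -/
def petal (b e f f' : ℂ) (r : ℝ) : PolyPath where
  n := 4
  pos_n := four_pos
  v
    | 0 => b
    | 1 => b + r * f
    | 2 => b + r * e
    | 3 => b + r * f'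
    | _ => b
  e₀ := 0
  e₁ := 0

lemma petal_cases {b e f f' z : ℂ} {r τ : ℝ} (hr : 0 < r) (h : (petal b e f f' r).On τ z) :
    ∃ α β : ℝ, 0 ≤ α ∧ 0 ≤ β ∧ 0 < α + β ∧ α + β ≤ r ∧ (α = 0 → τ = 1 + (2 : ℕ)) ∧
      ∃ g, (g = f ∨ g = f') ∧ z = b + (α * g + β * e) := by
  rcases h.cases with ⟨s, -, -, h⟩ | ⟨k, hk, s, hs0, hs1, h1, h2, h3, h4⟩ | ⟨s, -, -, h⟩
  · exact absurd rfl h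
  · have hk' : k < 4 := hk
    interval_cases k <;> simp [petal] at h4
    · have hs := h2 rfl rfl
      exact ⟨r * s, 0, by positivity, le_rfl, by positivity, by nlinarith,
        fun h => by nlinarith, f, Or.inl rfl, by rw [h4]; push_cast; ring⟩
    · exact ⟨r * (1 - s), r * s, by nlinarith, by positivity, by linarith, by linarith,
        fun h => by rw [h1]; push_cast; nlinarith, f, Or.inl rfl, by rw [h4]; push_cast; ring⟩
    · exact ⟨r * s, r * (1 - s), by positivity, by nlinarith, by linarith, by linarith,
        fun h => by rw [h1]; push_cast; nlinarith, f', Or.inr rfl, by rw [h4]; push_cast; ring⟩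
    · have hs := h3 rfl rfl
      exact ⟨r * (1 - s), 0, by nlinarith, le_rfl, by nlinarith, by nlinarith,
        fun h => by nlinarith, f', Or.inr rfl, by rw [h4]; push_cast; ring⟩
  · exact absurd rfl h

lemma IsEndDirection.mul {P B : ℂ[X]} {b e : ℂ} (h : IsEndDirection P B b e) {r : ℝ}
    (hr : 0 < r) : IsEndDirection P B b (r * e) := by
  refine h.imp_left fun ⟨h1, h2⟩ => ⟨h1, ?_⟩
  rw [mul_pow, mul_comm, ← div_div, ← Complex.ofReal_pow, Complex.div_ofReal_re]
  positivity

lemma IsEndDirection.sub {P B : ℂ[X]} {b e : ℂ} (h : IsEndDirection P B b e) :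
    IsEndDirection P B b (b + e - b) := by rwa [add_sub_cancel_left]

lemma not_below_of_above {s t x y x' y' : ℝ} (hs : 0 < s) (ht : 0 ≤ t) (hx : s * x = t * x')
    (hy : t * y' ≤ s * y) (h : x * x' < 0 ∨ x' * (x' * y - y' * x) < 0) : False := by
  rcases h with h | h
  · have h1 : s * (x * x') = t * x' ^ 2 := by linear_combination x' * hx
    nlinarith [mul_neg_of_pos_of_neg hs h, mul_nonneg ht (sq_nonneg x')]
  · have h1 := mul_neg_of_pos_of_neg hs h
    have h2 : s * (x' * (x' * y - y' * x)) = x' ^ 2 * (s * y - t * y') := by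
      linear_combination -(x' * y') * hx
    nlinarith [mul_nonneg (sq_nonneg x') (sub_nonneg.2 hy)]

lemma exists_half_add {e N : ℂ} (he : e ≠ 0) {δ ε : ℝ} (hδ : 0 < δ) (hε : 0 < ε) :
    ∃ η ∈ Ioo 0 ε, ∃ φ ∈ Ioo (-δ) δ, ∃ σ : ℝ, 0 ≤ σ ∧ (1 / 2 : ℝ) * e + η * N = σ * turn e φ := by
  have h1 : Tendsto (fun η : ℝ => Complex.arg (1 / 2 + η * (N / e))) (𝓝[>] 0) (𝓝 0) := by
    have h2 : ContinuousAt (fun η : ℝ => Complex.arg (1 / 2 + η * (N / e))) 0 :=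
      ContinuousAt.comp (g := Complex.arg) (Complex.continuousAt_arg (by simp [slitPlane]))
        (by fun_prop)
    have h3 := h2.tendsto
    rw [Complex.ofReal_zero, zero_mul, add_zero, show (1 / 2 : ℂ) = ((1 / 2 : ℝ) : ℂ) by simp,
      Complex.arg_ofReal_of_nonneg (by norm_num)] at h3
    simpa using h3.mono_left nhdsWithin_le_nhds
  obtain ⟨η, h2, h3⟩ :=
    ((h1.eventually (Ioo_mem_nhds (neg_lt_zero.2 hδ) hδ)).and (Ioo_mem_nhdsGT hε)).exists
  refine ⟨η, h3, _, h2, _, norm_nonneg (1 / 2 + η * (N / e)), ?_⟩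
  rw [turn, mul_left_comm, Complex.norm_mul_exp_arg_mul_I]
  push_cast
  field_simp

open SemiclassicalBOP.Frame in
set_option maxHeartbeats 4000000 in
lemma exists_contourGroup_stems {A B : ℂ[X]} (F : Frame) (hE : IsDecayDirection (directNum A B) B F.em)
    (hE' : IsDecayDirection A B F.ep) {b : ℂ} {m : ℕ} {w δ : ℝ} (hw : 0 < w)
    (hM : |F.Y b| + 2 * w < F.M) {e : ℂ} (he : ‖e‖ = w / 4) (hX : F.X e ≠ 0) (hδ : 0 < δ)
    (hm : 0 < m → (4 * m : ℕ) * δ = π) {d : ℕ → ℂ} (hd : ∀ t, d t = turn e (t * δ))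
    (hb : IsEndDirection A B b e)
    (hs : ∀ i < m, IsEndDirection (directNum A B) B b (d (8 * i + 4)))
    (hp : ∀ i < m, IsEndDirection A B b (d (8 * i + 1)) ∧ IsEndDirection A B b (d (8 * i + 7)))
    (hX' : ∀ i < m, F.X (d (8 * i + 4)) ≠ 0)
    (hpos : ∀ i < m, F.X (d (8 * i + 4)) * F.X e < 0 ∨
      F.X e * (F.X e * F.Y (d (8 * i + 4)) - F.Y e * F.X (d (8 * i + 4))) < 0) :
    ∃ c P Q, |F.X c| ≤ w ∧ |F.Y c| ≤ w ∧
      ContourGroup F A B b (m + 1) (Icc (F.X b - w) (F.X b + w)) (F.cut b) (F.dualCut b c) P Q := by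
  have he0 : e ≠ 0 := norm_pos_iff.1 (by rw [he]; positivity)
  have hd1 : ∀ t, ‖d t‖ = w / 4 := fun t => by rw [hd, norm_turn, he]
  have hd0 : ∀ t, d t ≠ 0 := fun t => norm_pos_iff.1 (by rw [hd1]; positivity)
  have hdX : ∀ t, |F.X (d t)| ≤ w / 4 := fun t => (F.abs_X_le _).trans (hd1 t).le
  have hdY : ∀ t, |F.Y (d t)| ≤ w / 4 := fun t => (F.abs_Y_le _).trans (hd1 t).le
  have heY := (F.abs_Y_le e).trans he.le
  obtain ⟨heX1, heX2⟩ := abs_le.1 ((F.abs_X_le e).trans he.le)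
  obtain ⟨heY1, heY2⟩ := abs_le.1 heY
  obtain ⟨hbY1, hbY2⟩ := abs_le.1 (le_refl |F.Y b|)
  obtain ⟨r, ⟨hrX, hrs⟩, hr0, hr1⟩ : ∃ r : ℝ, (r * (w / 4) < |F.X e| / 2 ∧
      ∀ i ∈ range m, r * (w / 4) < |F.X (d (8 * i + 4))|) ∧ r ∈ Ioo 0 1 := by
    have h0 : ∀ a : ℝ, 0 < a → ∀ᶠ r in 𝓝[>] (0 : ℝ), r * (w / 4) < a := fun a ha => by
      filter_upwards [Ioo_mem_nhdsGT (show 0 < a / (w / 4) by positivity)] with r hr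
      exact (lt_div_iff₀ (by positivity)).1 hr.2
    exact (((h0 _ (half_pos (abs_pos.2 hX))).and ((Filter.eventually_all_finset _).2 fun i hi =>
      h0 _ (abs_pos.2 (hX' i (mem_range.1 hi))))).and (Ioo_mem_nhdsGT one_pos)).exists
  have hrw : r * (w / 4) ≤ w / 4 := by nlinarith
  obtain ⟨η, ⟨hη0, hηw⟩, φ, ⟨hφ1, hφ2⟩, σ, hσ, hc⟩ :=
    exists_half_add (N := F.pt 0 1) he0 hδ (show 0 < w / 4 by positivity)
  obtain ⟨c, hcX, hcY, hc⟩ : ∃ c : ℂ, F.X c = 1 / 2 * F.X e ∧ F.Y c = 1 / 2 * F.Y e + η ∧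
      c = σ * turn e φ := ⟨_, by rw [F.X_add, F.X_mul, F.X_mul, F.X_pt]; ring,
      by rw [F.Y_add, F.Y_mul, F.Y_mul, F.Y_pt]; ring, hc⟩
  have habs : ∀ z : ℂ, |F.Y z| ≤ w → |F.Y (b + z)| < F.M := fun z hz => by
    rw [F.Y_add]
    exact (abs_add_le _ _).trans_lt (by linarith)
  have hbM : |F.Y b| < F.M := by linarith
  have hcY' : |F.Y c| ≤ w := by rw [hcY]; exact abs_le.2 ⟨by linarith, by linarith⟩
  have hcut := fun z (hz : z ∈ F.dualCut b c) => F.dualCut_cases hbM (habs c hcY') hz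
  rw [hcX, hcY] at hcut
  have hstem : ∀ i < m, ∀ z : ℂ, ∀ s : ℝ, 0 < s → s ≤ 1 → F.u z = F.X b + s * F.X (d (8 * i + 4)) →
      F.Y z ≤ F.Y b + s * F.Y (d (8 * i + 4)) →
      F.u z ∈ Icc (F.X b - w) (F.X b + w) ∧ z ∉ F.cut b ∧ z ∉ F.dualCut b c ∧
      ∀ t : ℝ, 0 ≤ t → F.u z = F.X b + t * F.X e → ¬F.Y b + t * F.Y e ≤ F.Y z :=
      fun i hi z s hs0 hs1 h1 h2 => by
    have h3 : ∀ t : ℝ, 0 ≤ t → F.u z = F.X b + t * F.X e → ¬F.Y b + t * F.Y e ≤ F.Y z :=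
      fun t ht0 h4 h5 => not_below_of_above hs0 ht0 (by linarith) (by linarith) (hpos i hi)
    refine ⟨?_, fun h => ?_, fun h => ?_, h3⟩
    · obtain ⟨h4, h5⟩ := abs_le.1 (hdX (8 * i + 4))
      rw [h1]
      constructor <;> nlinarith
    · have h4 := h.1
      rw [h1, add_eq_left] at h4
      exact mul_ne_zero hs0.ne' (hX' i hi) h4
    · obtain ⟨t, ht0, -, h4, h5, -⟩ := hcut z h
      exact h3 (t / 2) (by positivity) (by linarith) (by nlinarith)
  have hP := fun i τ z (h : (F.stem b (d (8 * i + 4))).On τ z) =>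
    F.stem_cases h hbM (habs _ ((hdY _).trans (by linarith)))
  have hyM : F.Y b + w < F.M := by linarith
  have heM := habs e (by linarith)
  have hye : F.Y (b + e) < F.Y b + w := by rw [F.Y_add]; linarith
  have hQ := fun τ z (h : (F.dualStem b e (F.Y b + w)).On τ z) =>
    F.dualStem_cases h hbM heM (by linarith) hye hyM
  have hR : ∀ i < m, ∀ τ z, (petal b (d (8 * i + 4)) (d (8 * i + 1)) (d (8 * i + 7)) r).On τ z →
      ∃ α β : ℝ, 0 ≤ α ∧ 0 ≤ β ∧ 0 < α + β ∧ (α = 0 → τ = 1 + (2 : ℕ)) ∧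
        |F.u z - F.X b| ≤ r * (w / 4) ∧ |F.Y z - F.Y b| ≤ r * (w / 4) ∧
        ∃ g, (g = d (8 * i + 1) ∨ g = d (8 * i + 7)) ∧ z = b + (α * g + β * d (8 * i + 4)) :=
      fun i hi τ z h => by
    obtain ⟨α, β, hα, hβ, h1, h2, h3, g, hg, hz⟩ := petal_cases hr0 h
    refine ⟨α, β, hα, hβ, h1, h3, ?_⟩
    have h4 : ∀ x y : ℝ, |x| ≤ w / 4 → |y| ≤ w / 4 → |α * x + β * y| ≤ r * (w / 4) :=
        fun x y hx hy => by
      refine (abs_add_le _ _).trans ?_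
      rw [abs_mul, abs_mul, abs_of_nonneg hα, abs_of_nonneg hβ]
      nlinarith
    have h5 : |F.X g| ≤ w / 4 ∧ |F.Y g| ≤ w / 4 := by
      rcases hg with rfl | rfl <;> exact ⟨hdX _, hdY _⟩
    have hY := h4 _ _ h5.2 (hdY (8 * i + 4))
    have hX := h4 _ _ h5.1 (hdX (8 * i + 4))
    rw [← F.X_mul, ← F.X_mul, ← F.X_add, ← add_sub_cancel_left b (_ + _), F.X_sub, ← hz] at hX
    rw [← F.Y_mul, ← F.Y_mul, ← F.Y_add, ← add_sub_cancel_left b (_ + _), F.Y_sub, ← hz] at hY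
    obtain ⟨h6, h7⟩ := abs_le.1 hY
    exact ⟨by rwa [F.u_eq_X (by linarith) (by linarith)], hY, g, hg, hz⟩
  have hcone : ∀ i < m, ∀ j < m, ∀ g, (g = d (8 * i + 1) ∨ g = d (8 * i + 7)) → i ≠ j →
      ∀ α β s : ℝ, 0 ≤ α → 0 ≤ β → 0 < α + β → 0 ≤ s →
      (α : ℂ) * g + β * d (8 * i + 4) ≠ s * d (8 * j + 4) :=
      fun i hi j hj g hg hij α β s hα hβ hαβ hs => by
    have hn := hm (by omega)
    rcases hg with rfl | rfl
    · rw [hd, hd, hd]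
      exact fan_cone_ne_ray he0 hδ hn (by omega) (by omega) (by omega) hα hβ hαβ hs
    · rw [add_comm, hd, hd, hd]
      exact fan_cone_ne_ray he0 hδ hn (by omega) (by omega) (by omega) hβ hα (by linarith) hs
  have hπ : ∀ i < m, 3 * δ < π ∧ (8 * i + 8) * δ ≤ 2 * π := fun i hi => by
    have h1 := hm (by omega)
    have h2 : (i : ℝ) + 1 ≤ m := by exact_mod_cast hi
    have h3 : (0 : ℝ) ≤ i := i.cast_nonneg
    push_cast at h1
    constructor <;> nlinarith
  have hsin : ∀ i < m, ∃ κ > 0, (conj (d (8 * i + 4)) * d (8 * i + 1)).im = -κ ∧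
      (conj (d (8 * i + 4)) * d (8 * i + 4)).im = 0 ∧
      (conj (d (8 * i + 4)) * d (8 * i + 7)).im = κ := fun i hi => by
    refine ⟨‖e‖ ^ 2 * sin (3 * δ), mul_pos (by rw [he]; positivity)
      (sin_pos_of_pos_of_lt_pi (by linarith) (hπ i hi).1), ?_⟩
    simp only [hd, im_conj_turn_mul, ← sub_mul, sub_self, Real.sin_zero, mul_zero, true_and]
    rw [← mul_neg, ← sin_neg]
    push_cast
    constructor <;> ring_nf
  have hRP : ∀ i < m, ∀ j < m, ∀ τ τ' z, (F.stem b (d (8 * i + 4))).On τ z →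
      (petal b (d (8 * j + 4)) (d (8 * j + 1)) (d (8 * j + 7)) r).On τ' z → ∃ s : ℝ, 0 < s ∧
      z = b + s * d (8 * i + 4) ∧ τ = 1 + (0 : ℕ) + s := fun i hi j hj τ τ' z h h' => by
    obtain ⟨s, h1, h2, h3, -, h5, -⟩ := hP i τ z h
    obtain ⟨-, -, -, -, -, -, h6, -⟩ := hR j hj τ' z h'
    refine ⟨s, h1, h5 (h2.lt_of_ne fun h7 => ?_)⟩
    rw [h3, h7, one_mul, add_sub_cancel_left] at h6
    exact (hrs i (mem_range.2 hi)).not_ge h6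
  have hL := fun τ z (h : (F.lasso (F.X b) (F.Y b) w).On τ z) => F.lasso_cases h (by linarith) hyM
  refine ⟨c, fun i => if i < m then F.stem b (d (8 * i + 4)) else F.lasso (F.X b) (F.Y b) w,
    fun i => if i < m then petal b (d (8 * i + 4)) (d (8 * i + 1)) (d (8 * i + 7)) r
      else F.dualStem b e (F.Y b + w), by rw [hcX]; exact abs_le.2 ⟨by linarith, by linarith⟩,
    hcY', ?_⟩
  constructor
  · intro i _
    split_ifs with hi
    exacts [⟨.point (hs i hi).sub, .ray hE⟩, ⟨.ray hE, .ray hE⟩]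
  · intro i _
    split_ifs with hi
    exacts [⟨.point ((hp i hi).1.mul hr0).sub, .point ((hp i hi).2.mul hr0).sub⟩,
      ⟨.point hb.sub, .ray hE'⟩]
  · intro i _ τ z hz
    split_ifs at hz with hi
    · obtain ⟨s, h1, h2, h3, h4, -⟩ := hP i τ z hz
      exact ⟨(hstem i hi z s h1 h2 h3 h4).1, (hstem i hi z s h1 h2 h3 h4).2.1⟩
    · rcases hL τ z hz with h1 | h1 | ⟨s, h1, h2, -, h3, h4⟩
      · exact ⟨⟨h1.ge, by linarith⟩, fun h => by linarith [h.1]⟩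
      · exact ⟨⟨by linarith, h1.le⟩, fun h => by linarith [h.1]⟩
      · exact ⟨by rw [h4]; constructor <;> nlinarith, fun h => by linarith [h.2]⟩
  · intro i _ τ z hz
    split_ifs at hz with hi
    · obtain ⟨α, β, hα, hβ, h1, -, h2, -, g, hg, h3⟩ := hR i hi τ z hz
      obtain ⟨h4, h5⟩ := abs_le.1 h2
      refine ⟨⟨by linarith, by linarith⟩, fun h => ?_⟩
      obtain ⟨t, ht0, ht1, h6, -, h7⟩ := hcut z h
      have h8 := h7 (ht1.lt_of_ne fun h8 => by
        rw [h6, h8, add_sub_cancel_left, one_mul, abs_mul, abs_of_pos one_half_pos] at h2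
        linarith)
      rw [h3, add_right_inj, hc, ← mul_assoc, ← Complex.ofReal_mul] at h8
      obtain ⟨h9, h10⟩ := hπ i hi
      have h11 : (0 : ℝ) ≤ i * δ := by positivity
      rcases hg with rfl | rfl
      · rw [hd, hd] at h8
        refine cone_ne_ray he0 ?_ ?_ (Or.inr ⟨?_, ?_⟩) hα hβ h1 (by positivity) h8 <;>
          push_cast <;> linarith
      · rw [hd, hd, add_comm] at h8
        refine cone_ne_ray he0 ?_ ?_ (Or.inr ⟨?_, ?_⟩) hβ hα (by linarith) (by positivity) h8 <;>
          push_cast <;> linarith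
    · obtain ⟨s, h1, h2, h3, h4, h5, -⟩ := hQ τ z hz
      refine ⟨by rw [h3]; constructor <;> nlinarith, fun h => ?_⟩
      obtain ⟨t, ht0, ht1, h8, h9, -⟩ := hcut z h
      rw [h3, add_right_inj, ← mul_assoc] at h8
      have h10 := mul_right_cancel₀ hX h8
      rw [h5 (by linarith)] at h9
      nlinarith [mul_pos h1 hη0]
  · intro i _
    split_ifs with hi
    · have hv : ∀ s : ℝ, 0 ≤ s → s ≤ 1 →
          F.u (b + s * d (8 * i + 4)) = F.X b + s * F.X (d (8 * i + 4)) := fun s hs0 hs1 => by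
        have h1 := abs_lt.1 (habs (s * d (8 * i + 4)) (by
          rw [F.Y_mul, abs_mul, abs_of_nonneg hs0]
          nlinarith [hdY (8 * i + 4), abs_nonneg (F.Y (d (8 * i + 4)))]))
        rw [F.u_eq_X h1.1.le h1.2.le, F.X_add, F.X_mul]
      have h0 := hstem i hi
      refine ⟨(fun s : ℝ => b + s * d (8 * i + 4)) '' Icc r 1 ∪
        F.line (F.X b + F.X (d (8 * i + 4))) (F.Y b + F.Y (d (8 * i + 4))), ?_, ?_,
        ⟨_, _, Or.inl ⟨r, ⟨le_rfl, hr1.le⟩, rfl⟩,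
          PolyPath.on_vertex _ (i := 2) two_pos (by simp [petal])⟩, ?_⟩
      · refine IsPreconnected.union (b + (1 : ℝ) * d (8 * i + 4)) ⟨1, ⟨hr1.le, le_rfl⟩, rfl⟩ ?_
          (isPreconnected_Icc.image _ (by fun_prop)) (F.isPreconnected_line _ _)
        rw [F.mem_line, hv 1 zero_le_one le_rfl]
        simp
      · rintro _ (⟨s, ⟨hs1, hs2⟩, rfl⟩ | hz)
        · have h3 := h0 (b + s * d (8 * i + 4)) s (by linarith) hs2 (hv s (by linarith) hs2)
            (by rw [F.Y_add, F.Y_mul])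
          exact ⟨h3.1, h3.2.2.1⟩
        · rw [F.mem_line] at hz
          have h3 := h0 _ 1 one_pos le_rfl (by rw [hz.1, one_mul]) (by rw [one_mul]; exact hz.2)
          exact ⟨h3.1, h3.2.2.1⟩
      · obtain ⟨z, hz, h1⟩ := F.exists_mem_line (F.X b + F.X (d (8 * i + 4)))
          (F.Y b + F.Y (d (8 * i + 4)))
        exact ⟨z, Or.inr hz, h1⟩
    · refine ⟨F.line (F.X b + F.X e) F.M, F.isPreconnected_line _ _, fun z hz => ?_,
        ⟨_, b + e, ?_, PolyPath.on_vertex _ (i := 1) one_pos (by simp [dualStem])⟩,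
        F.exists_mem_line _ _⟩
      · rw [F.mem_line] at hz
        refine ⟨by rw [hz.1]; constructor <;> linarith, fun h => ?_⟩
        obtain ⟨t, ht0, ht1, h8, -⟩ := hcut z h
        rw [hz.1, add_right_inj, ← mul_assoc] at h8
        linarith [mul_right_cancel₀ hX ((one_mul _).trans h8)]
      · have h1 := abs_lt.1 heM
        rw [F.mem_line, F.u_eq_X h1.1.le h1.2.le, F.X_add]
        exact ⟨rfl, h1.2.le⟩
  · intro i hi' j hj' hij τ τ' z h h'
    split_ifs at h h' with hi hj hj
    · obtain ⟨s, h1, h2, -⟩ := hRP i hi j hj τ τ' z h h'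
      obtain ⟨α, β, k1, k2, k3, -, -, -, g, hg, k6⟩ := hR j hj τ' z h'
      rw [h2, add_right_inj] at k6
      exact hcone j hj i hi g hg hij.symm α β s k1 k2 k3 h1.le k6.symm
    · obtain ⟨s, h1, h2, h3, h4, -⟩ := hP i τ z h
      obtain ⟨t, k1, k2, k3, k4, -⟩ := hQ τ' z h'
      exact (hstem i hi z s h1 h2 h3 h4).2.2.2 t k1.le k3 k4
    · obtain ⟨-, -, -, -, -, -, h1, h2, -⟩ := hR j hj τ' z h'
      rw [abs_le] at h1 h2
      rcases hL τ z h with h3 | h3 | ⟨-, -, -, -, h3, -⟩ <;> linarith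
    · omega
  · intro i hi'
    left
    split_ifs with hi
    · obtain ⟨κ, hκ, h1, h2, h3⟩ := hsin i hi
      refine ⟨2, 0, r, 1, Or.inl rfl, ⟨two_pos, by simp [petal], two_pos, hr0, hr1,
        by simp [petal, stem], Or.inl rfl, ?_, ?_⟩, fun τ τ' z h h' => ?_⟩
      · simp only [petal, stem, zero_add, add_sub_cancel_left, add_sub_add_left_eq_sub, one_mul,
          mul_sub, mul_left_comm _ (r : ℂ), Complex.sub_im, im_ofReal_mul, h1, h2]
        nlinarith
      · simp only [petal, stem, zero_add, add_sub_cancel_left, add_sub_add_left_eq_sub, one_mul,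
          mul_sub, mul_left_comm _ (r : ℂ), Complex.sub_im, im_ofReal_mul, h2, h3]
        nlinarith
      · obtain ⟨s, k1, k2, k3⟩ := hRP i hi i hi τ τ' z h h'
        obtain ⟨α, β, -, -, -, k4, -, -, g, hg, k6⟩ := hR i hi τ' z h'
        rw [k2, add_right_inj] at k6
        have h7 := congrArg (fun z => (conj (d (8 * i + 4)) * z).im) k6
        simp only [mul_add, mul_left_comm _ (_ : ℂ) (d _), mul_left_comm _ (_ : ℂ) g,
          Complex.add_im, im_ofReal_mul, h2, mul_zero, add_zero] at h7
        have hα : α = 0 := by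
          refine (mul_eq_zero.1 h7.symm).resolve_right ?_
          rcases hg with rfl | rfl
          exacts [by rw [h1]; linarith, by rw [h3]; exact hκ.ne']
        refine ⟨?_, k4 hα⟩
        have h8 := PolyPath.on_vertex
          (p := petal b (d (8 * i + 4)) (d (8 * i + 1)) (d (8 * i + 7)) r) (i := 2) two_pos
          (by simp [petal])
        have h9 := h8.2.symm.trans ((congrArg _ (k4 hα).symm).trans h'.2)
        simp only [petal, k2, add_right_inj] at h9
        rw [k3, ← Complex.ofReal_injective (mul_right_cancel₀ (hd0 _) h9)]
    · obtain ⟨s, hs⟩ : ∃ s, s = (w + F.X e) / (2 * w) := ⟨_, rfl⟩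
      have hs' : s * (2 * w) = w + F.X e := by rw [hs, div_mul_cancel₀ _ (by positivity)]
      rw [F.Y_add] at hye
      refine ⟨2, 1, s, 1, Or.inl rfl, ⟨two_pos, by simp [dualStem], by simp [lasso], by nlinarith,
        by nlinarith, F.ext ?_ ?_, Or.inl rfl, ?_, ?_⟩, fun τ τ' z h h' => ?_⟩
      · simp [dualStem, lasso]
        linarith
      · simp [dualStem, lasso]
      · rw [F.im_conj_mul]
        simp [dualStem, lasso]
        nlinarith
      · rw [F.im_conj_mul]
        simp [dualStem, lasso]
        nlinarith
      · obtain ⟨t, k1, k2, k3, -, -, k6⟩ := hQ τ' z h'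
        rcases hL τ z h with h1 | h1 | ⟨s', -, -, h2, h3, h4⟩
        · nlinarith
        · nlinarith
        · obtain ⟨h5, h8⟩ := k6 h3
          refine ⟨?_, h8⟩
          rw [k3, h5, one_mul] at h4
          rw [h2, mul_right_cancel₀ (show 2 * w ≠ 0 by positivity)
            (show s' * (2 * w) = s * (2 * w) by linarith)]


/-! ### The contours near a simple zero: a dual lasso -/

namespace Frame

variable (F : Frame)

lemma dualCut_zero {b : ℂ} (hb : |F.Y b| < F.M) {z : ℂ} (hz : z ∈ F.dualCut b 0) :
    F.u z = F.X b ∧ F.Y b ≤ F.Y z := by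
  obtain ⟨t, -, -, h1, h2, -⟩ := F.dualCut_cases hb (by rwa [add_zero]) hz
  rw [X_zero, mul_zero, add_zero] at h1
  rw [Y_zero, mul_zero, add_zero] at h2
  exact ⟨h1, h2⟩

lemma sub_div_pt (b z : ℂ) :
    (z - b) / F.pt 0 1 = ((F.Y z - F.Y b : ℝ) : ℂ) - (F.X z - F.X b : ℝ) * Complex.I := by
  have h : F.pt 0 1 ≠ 0 := by simp [pt, F.N_ne_zero]
  have h1 : z - b = F.pt (F.X z - F.X b) (F.Y z - F.Y b) := F.ext (by simp) (by simp)
  rw [div_eq_iff h, h1, pt, pt]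
  push_cast
  linear_combination F.N * (F.X z - F.X b) * Complex.I_sq

lemma isPreconnected_Y_lt (y : ℝ) : IsPreconnected {z | F.Y z < y} :=
  Convex.isPreconnected fun z hz z' hz' s t hs ht hst => by
    simp only [Set.mem_ofPred_eq, Complex.real_smul, Y_add, Y_mul] at hz hz' ⊢
    rcases hs.eq_or_lt with rfl | hs
    · rw [zero_add] at hst
      simpa [hst] using hz'
    · have : s * y + t * y = y := by rw [← add_mul, hst, one_mul]
      nlinarith

lemma isPreconnected_lt_Y (y : ℝ) : IsPreconnected {z | y < F.Y z} := by
  convert (F.isPreconnected_Y_lt (-y)).image (fun z => -z) continuous_neg.continuousOn using 1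
  ext z
  have h : ∀ z, F.Y (-z) = -F.Y z := fun z => by simp [Frame.Y]
  constructor
  · exact fun hz => ⟨-z, by simpa [h] using hz, neg_neg z⟩
  · rintro ⟨z, hz, rfl⟩
    simp only [Set.mem_ofPred_eq, h] at hz ⊢
    linarith

lemma log_sub_log {b : ℂ} {w : ℝ} (hw : 0 < w) (hM : |F.Y b| + 2 * w < F.M) {L L' : ℂ → ℂ}
    (hL : IsLogOn L b (F.cut b)ᶜ) (hL' : IsLogOn L' b (F.dualCut b 0)ᶜ) :
    L' (F.pt (F.X b + w / 2) (F.Y b + w)) - L (F.pt (F.X b + w / 2) (F.Y b + w))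
      = L' (F.pt (F.X b - w / 2) (F.Y b + w)) - L (F.pt (F.X b - w / 2) (F.Y b + w))
        + 2 * π * Complex.I := by
  obtain ⟨hb1, hb2⟩ := abs_le.1 (le_refl |F.Y b|)
  have hbM : |F.Y b| < F.M := by linarith
  have hpt : F.pt 0 1 ≠ 0 := by simp [Frame.pt, F.N_ne_zero]
  have hlog : ∀ {S : Set ℂ} {f : ℂ → ℂ} {a : ℂ}, IsPreconnected S → a ≠ 0 →
      (∀ z ∈ S, exp (f z) = z - b ∧ DifferentiableAt ℂ f z) →
      (∀ z ∈ S, (z - b) / a ∈ slitPlane) → ∀ z ∈ S, ∀ z' ∈ S,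
      f z - log ((z - b) / a) = f z' - log ((z' - b) / a) :=
      fun {S f a} hS ha hf hs z hz z' hz' => by
    refine IsPreconnected.sub_eq_sub (c := a) hS
      (fun z hz => (hf z hz).2.continuousAt.continuousWithinAt) (g := fun z => log ((z - b) / a))
      (fun z hz => ?_) (fun z hz => ?_) hz hz'
    · exact ((by fun_prop : ContinuousAt (fun z => (z - b) / a) z).clog (hs z hz)).continuousWithinAt
    · rw [(hf z hz).1, exp_log (slitPlane_ne_zero (hs z hz)), mul_div_cancel₀ _ ha]
  have h1 := hlog (f := L) (F.isPreconnected_lt_Y (F.Y b)) hpt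
    (fun z hz => hL z fun h => hz.not_ge h.2)
    (fun z hz => Or.inl (by rw [F.sub_div_pt]; simpa using hz))
    (F.pt (F.X b + w / 2) (F.Y b + w)) (by simpa using hw)
    (F.pt (F.X b - w / 2) (F.Y b + w)) (by simpa using hw)
  have hu : ∀ x, F.u (F.pt x (F.Y b + w)) = x := fun x => by
    rw [F.u_eq_X (by rw [F.Y_pt]; linarith) (by rw [F.Y_pt]; linarith), F.X_pt]
  have hmem : ∀ x, F.pt x (F.Y b + w) ∈ F.line x (F.Y b + w) := fun x =>
    F.mem_line.2 ⟨hu x, by rw [F.Y_pt]⟩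
  have hconn : ∀ x, ∃ z, z ∈ F.line x (F.Y b + w) ∧ F.Y z < F.Y b := fun x => by
    obtain ⟨z, h2, h3⟩ := F.exists_mem_line x (F.Y b + w)
    exact ⟨z, h2, by linarith⟩
  have hS : IsPreconnected (F.line (F.X b + w / 2) (F.Y b + w) ∪ {z | F.Y z < F.Y b} ∪
      F.line (F.X b - w / 2) (F.Y b + w)) := by
    obtain ⟨z, hz1, hz2⟩ := hconn (F.X b + w / 2)
    obtain ⟨z', hz1', hz2'⟩ := hconn (F.X b - w / 2)
    exact IsPreconnected.union z' (Or.inr hz2') hz1' (IsPreconnected.union z hz1 hz2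
      (F.isPreconnected_line _ _) (F.isPreconnected_Y_lt _)) (F.isPreconnected_line _ _)
  have hside : ∀ z ∈ F.line (F.X b + w / 2) (F.Y b + w) ∪ {z | F.Y z < F.Y b} ∪
      F.line (F.X b - w / 2) (F.Y b + w), F.Y z < F.Y b ∨ (F.u z ≠ F.X b ∧ F.Y z ≤ F.Y b + w) := by
    rintro z ((hz | hz) | hz)
    · rw [F.mem_line] at hz
      exact Or.inr ⟨by linarith [hz.1], hz.2⟩
    · exact Or.inl hz
    · rw [F.mem_line] at hz
      exact Or.inr ⟨by linarith [hz.1], hz.2⟩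
  have h2 := hlog (f := L') hS (neg_ne_zero.2 hpt) (fun z hz => hL' z fun h => by
      have h3 := F.dualCut_zero hbM h
      rcases hside z hz with h4 | h4
      · exact h4.not_ge h3.2
      · exact h4.1 h3.1) (fun z hz => by
      rw [div_neg, F.sub_div_pt]
      by_cases h4 : F.Y z < F.Y b
      · exact Or.inl (by simpa using h4)
      · have h5 := (hside z hz).resolve_left h4
        rw [F.u_eq_X (by linarith) (by linarith)] at h5
        exact Or.inr (by simpa [sub_eq_zero] using h5.1))
    (F.pt (F.X b + w / 2) (F.Y b + w)) (Or.inl (Or.inl (hmem _)))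
    (F.pt (F.X b - w / 2) (F.Y b + w)) (Or.inr (hmem _))
  rw [div_neg, div_neg, F.sub_div_pt, F.sub_div_pt] at h2
  rw [F.sub_div_pt, F.sub_div_pt] at h1
  simp only [F.X_pt, F.Y_pt, add_sub_cancel_left, sub_sub_cancel_left] at h1 h2
  have hneg1 : ∀ z : ℂ, z.im < 0 → log (-z) = log z + π * Complex.I := fun z hz => by
      rw [log, log, norm_neg, Complex.arg_neg_eq_arg_add_pi_of_im_neg hz]
      push_cast
      ring
  have hneg2 : ∀ z : ℂ, 0 < z.im → log (-z) = log z - π * Complex.I := fun z hz => by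
      rw [log, log, norm_neg, Complex.arg_neg_eq_arg_sub_pi_of_im_pos hz]
      push_cast
      ring
  rw [hneg1 _ (by simpa using hw), hneg2 _ (by simpa using hw)] at h2
  linear_combination h2 - h1

end Frame

lemma exists_contourGroup_dualLasso {A B : ℂ[X]} (F : Frame)
    (hE : IsDecayDirection (directNum A B) B F.em) (hE' : IsDecayDirection A B F.ep) {b : ℂ} {w : ℝ}
    (hw : 0 < w) (hM : |F.Y b| + 2 * w < F.M) (hb : IsEndDirection (directNum A B) B b F.N ∨
      (B.eval b = 0 ∧ multiplier A B b ≠ 1)) :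
    ∃ P Q, ContourGroup F A B b 1 (Icc (F.X b - w) (F.X b + w)) (F.cut b) (F.dualCut b 0) P Q := by
  obtain ⟨hb1, hb2⟩ := abs_le.1 (le_refl |F.Y b|)
  have hbM : |F.Y b| < F.M := by linarith
  have h1M : -F.M < F.Y b - w := by linarith
  have h2M : F.Y b + w < F.M := by linarith
  have hNX : F.X F.N = 1 := by rw [Frame.X, F.N_mul_conj]; rfl
  have hNY : F.Y F.N = 0 := by rw [Frame.Y, F.N_mul_conj]; rfl
  obtain ⟨x₁, hx₁⟩ : ∃ x₁, x₁ = F.X b + w / 4 := ⟨_, rfl⟩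
  have hcases := fun τ z (h : (F.dualLasso (F.X b) (F.Y b) w x₁).On τ z) =>
    F.dualLasso_cases h hw h1M h2M (by linarith) (by linarith)
  have hu : ∀ x, F.u (F.pt x (F.Y b + w)) = x := fun x => by
    rw [F.u_eq_X (by rw [F.Y_pt]; linarith) (by rw [F.Y_pt]; linarith), F.X_pt]
  have hcut := fun z => F.dualCut_zero (z := z) hbM
  have key : ∀ p : PolyPath, p.Admissible (directNum A B) B →
      (∀ τ z, p.On τ z → F.u z ∈ Icc (F.X b - w) (F.X b + w) ∧ z ∉ F.cut b) → _ →
      ContourGroup F A B b 1 (Icc (F.X b - w) (F.X b + w)) (F.cut b) (F.dualCut b 0)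
        (fun _ => p) (fun _ => F.dualLasso (F.X b) (F.Y b) w x₁) := fun p hp1 hp2 hp3 =>
    { adm := fun _ _ => hp1, adm' := fun _ _ => ⟨.ray hE', .ray hE'⟩, mem := fun _ _ => hp2
      mem' := fun _ _ τ z hz => by
        rcases hcases τ z hz with ⟨-, ⟨h2, -⟩ | ⟨h2, -⟩⟩ | ⟨h1, h2, h3, -⟩ <;>
          exact ⟨⟨by linarith, by linarith⟩, fun h => by linarith [(hcut z h).1, (hcut z h).2]⟩
      path := fun _ _ => ⟨F.line (F.X b - w / 2) (F.Y b + w), F.isPreconnected_line _ _,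
        fun z hz => by
          rw [F.mem_line] at hz
          exact ⟨⟨by linarith, by linarith⟩, fun h => by linarith [(hcut z h).1]⟩,
        ⟨_, F.pt (F.X b - w / 2) (F.Y b + w), F.mem_line.2 ⟨hu _, (F.Y_pt _ _).le⟩,
          PolyPath.on_vertex _ (i := 1) one_pos (by simp [Frame.dualLasso])⟩, F.exists_mem_line _ _⟩
      disjoint := fun i hi j hj hij => by omega
      crossing := fun _ _ => hp3 }
  rcases hb with hb | ⟨hb, hmul⟩
  · obtain ⟨e, he, hX, hN0⟩ : ∃ e, IsEndDirection (directNum A B) B b e ∧ F.X e = w / 4 ∧ F.Y e = 0 :=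
      ⟨_, hb.mul (show 0 < w / 4 by positivity), by rw [F.X_mul, hNX, mul_one],
        by rw [F.Y_mul, hNY, mul_zero]⟩
    have hstem := fun τ z (h : (F.stem b e).On τ z) =>
      F.stem_cases h hbM (by rwa [F.Y_add, hN0, add_zero])
    simp only [hX, hN0, mul_zero, add_zero] at hstem
    refine ⟨fun _ => F.stem b e, _, key _ ⟨.point he.sub, .ray hE⟩ (fun τ z hz => ?_) (Or.inl ?_)⟩
    · obtain ⟨s, h1, h2, h5, -⟩ := hstem τ z hz
      exact ⟨by rw [h5]; constructor <;> nlinarith, fun h => by nlinarith [h.1]⟩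
    · have hs : 0 < F.Y b + F.M := by linarith
      obtain ⟨s, h1⟩ : ∃ s, s = w / (F.Y b + F.M) := ⟨_, rfl⟩
      have h2 : s * (F.Y b + F.M) = w := by rw [h1, div_mul_cancel₀ _ hs.ne']
      refine ⟨3, 1, s, 1, Or.inl rfl, ⟨by norm_num, by simp [Frame.dualLasso],
        by simp [Frame.stem], by rw [h1]; positivity, by rw [h1, div_lt_one hs]; linarith,
        F.ext ?_ ?_, by simp, ?_, ?_⟩, fun τ τ' z h h' => ?_⟩
      · rw [F.X_add, F.X_mul]
        simp [Frame.dualLasso, Frame.stem, hX, hx₁]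
      · rw [F.Y_add, F.Y_mul]
        simp [Frame.dualLasso, Frame.stem, hN0]
        linarith
      iterate 2
        rw [F.im_conj_mul]
        simp [Frame.dualLasso, Frame.stem, hX, hN0, hx₁]
        nlinarith
      · obtain ⟨t, k1, k2, k3, k4, -, k5⟩ := hstem τ z h
        rcases hcases τ' z h' with ⟨k, ⟨k', -⟩ | ⟨k', -⟩⟩ | ⟨k, -, -, k'⟩
        · nlinarith
        · nlinarith
        · rcases k5 with k5 | ⟨rfl, k5 | ⟨t, h8, h9⟩⟩
          · linarith
          · linarith
          · refine ⟨?_, by rw [k' (by linarith)]; norm_num⟩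
            rw [h8, mul_right_cancel₀ hs.ne' (show t * _ = s * _ by linarith)]
            norm_num
  · have hcases' := fun τ z (h : (F.lasso (F.X b) (F.Y b) w).On τ z) =>
      F.lasso_cases h (by linarith) h2M
    refine ⟨fun _ => F.lasso (F.X b) (F.Y b) w, _, key _ ⟨.ray hE, .ray hE⟩ (fun τ z hz => ?_)
      (Or.inr ⟨hb, hmul, ?_, fun L L' hL hL' => F.log_sub_log hw hM hL hL', 1 / 4, 3 / 4, ?_, ?_,
        fun τ τ' z h h' => ?_⟩)⟩
    · rcases hcases' τ z hz with h1 | h1 | ⟨s, h1, h2, -, h3, h4⟩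
      · exact ⟨⟨by linarith, by linarith⟩, fun h => by linarith [h.1]⟩
      · exact ⟨⟨by linarith, by linarith⟩, fun h => by linarith [h.1]⟩
      · exact ⟨by rw [h4]; constructor <;> nlinarith, fun h => by linarith [h.2]⟩
    · refine ⟨(fun x => F.pt x (F.Y b + w)) '' Icc (F.X b - w / 2) (F.X b + w / 2),
        isPreconnected_Icc.image _ (F.continuous_pt.comp (by fun_prop :
          Continuous fun x : ℝ => (x, F.Y b + w))).continuousOn, ?_, ⟨_, ⟨le_rfl, by linarith⟩, rfl⟩,
        ⟨_, ⟨by linarith, le_rfl⟩, rfl⟩⟩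
      rintro _ ⟨x, ⟨h1, h2⟩, rfl⟩
      rw [hu]
      constructor <;> linarith
    iterate 2
      · refine ⟨by norm_num, by simp [Frame.dualLasso], by simp [Frame.lasso], by norm_num,
          by norm_num, F.ext ?_ ?_, by norm_num, ?_, ?_⟩
        · rw [F.X_add, F.X_mul]
          simp [Frame.dualLasso, Frame.lasso]
          ring
        · rw [F.Y_add, F.Y_mul]
          simp [Frame.dualLasso, Frame.lasso]
        all_goals
          rw [F.im_conj_mul]
          simp [Frame.dualLasso, Frame.lasso]
          nlinarith
    · rcases hcases' τ z h with h1 | h1 | ⟨s, -, -, h3, h1, h2⟩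
      iterate 2 rcases hcases τ' z h' with ⟨-, ⟨k, -⟩ | ⟨k, -⟩⟩ | ⟨-, k, k', -⟩ <;> linarith
      rcases hcases τ' z h' with ⟨-, ⟨k, k'⟩ | ⟨k, k'⟩⟩ | ⟨k, -⟩
      · have := mul_right_cancel₀ hw.ne' (show s * w = 1 / 4 * w by linarith)
        exact Or.inl ⟨by rw [h3, this]; norm_num, k' h1⟩
      · have := mul_right_cancel₀ hw.ne' (show s * w = 3 / 4 * w by linarith)
        exact Or.inr ⟨by rw [h3, this]; norm_num, k' h1⟩
      · linarith

lemma Frame.X_turn (F : Frame) (θ : ℝ) : F.X (turn F.N θ) = cos θ := by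
  rw [Frame.X, turn, mul_right_comm, F.N_mul_conj, one_mul, exp_ofReal_mul_I_re]

lemma turn_ofReal_mul (r : ℝ) (e : ℂ) (θ : ℝ) : turn (r * e) θ = r * turn e θ := mul_assoc _ _ _

/-- The square of the direction of the polar coefficient: its `2m`-th roots are the directions of
steepest descent and ascent of the weight. -/
def polarSign (A B : ℂ[X]) (b : ℂ) : ℂ := (polarCoeff A B b / ‖polarCoeff A B b‖) ^ 2

lemma exists_contourGroup_zero {A B : ℂ[X]} (h : IsTypeBB A B) (F : Frame)
    (hE : IsDecayDirection (directNum A B) B F.em) (hE' : IsDecayDirection A B F.ep) {b : ℂ}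
    (hb : B.eval b = 0) {w : ℝ} (hw : 0 < w) (hM : |F.Y b| + 2 * w < F.M)
    (hgen : ∀ e ∈ nthRoots (2 * (B.rootMultiplicity b - 1)) (polarSign A B b), e ≠ 0 → F.X e ≠ 0) :
    ∃ c P Q, |F.X c| ≤ w ∧ |F.Y c| ≤ w ∧ ContourGroup F A B b (B.rootMultiplicity b)
      (Icc (F.X b - w) (F.X b + w)) (F.cut b) (F.dualCut b c) P Q := by
  have hw4 : 0 < w / 4 := by positivity
  have hnorm : ∀ {e : ℂ}, ‖e‖ = 1 → ‖((w / 4 : ℝ) : ℂ) * e‖ = w / 4 := fun he => by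
    rw [norm_mul, norm_real, norm_of_nonneg hw4.le, he, mul_one]
  have hpos : 0 < B.rootMultiplicity b := (rootMultiplicity_pos h.ne_zero).2 hb
  rcases (Nat.one_le_iff_ne_zero.2 hpos.ne').eq_or_lt with hm | hm
  · by_cases h1 : ∃ k : ℕ, (directNum A B).eval b = k * (derivative B).eval b
    · obtain ⟨P, Q, h2⟩ := exists_contourGroup_dualLasso F hE hE' hw hM
        (Or.inl (Or.inr ⟨hm.symm, h1⟩))
      rw [← hm]
      exact ⟨0, P, Q, by simpa using hw.le, by simpa using hw.le, h2⟩
    by_cases h2 : ∃ k : ℕ, A.eval b = k * (derivative B).eval b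
    · rw [← hm]
      exact exists_contourGroup_stems F hE hE' (m := 0) hw hM (hnorm F.norm_N) (by
          rw [F.X_mul, Frame.X, F.N_mul_conj]
          simpa using hw.ne') one_pos (by simp) (fun _ => rfl) (Or.inr ⟨hm.symm, h2⟩) (by simp)
        (by simp) (by simp) (by simp)
    · obtain ⟨P, Q, h3⟩ := exists_contourGroup_dualLasso F hE hE' hw hM
        (Or.inr ⟨hb, multiplier_ne_one hm.symm h1 h2⟩)
      rw [← hm]
      exact ⟨0, P, Q, by simpa using hw.le, by simpa using hw.le, h3⟩
  · obtain ⟨m, hm'⟩ : ∃ m, B.rootMultiplicity b = m + 1 := ⟨_, (Nat.sub_add_cancel hpos).symm⟩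
    have hm0 : 0 < m := by omega
    have hmR : (0 : ℝ) < m := by exact_mod_cast hm0
    obtain ⟨p, hp⟩ : ∃ p, p = polarCoeff A B b := ⟨_, rfl⟩
    have hp' : polarCoeff (directNum A B) B b = -p := by rw [hp]; exact polarCoeff_directNum hm
    have hp0 : p ≠ 0 := by
      rw [hp]
      exact div_ne_zero (h.eval_ne_zero hm) (eval_divByMonic_pow_rootMultiplicity_ne_zero b h.ne_zero)
    have hpn : (‖p‖ : ℂ) ≠ 0 := by simpa using hp0
    -- the direction of the dual stem
    set κ := π / m with hκ
    have hκ0 : 0 < κ := div_pos pi_pos hmR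
    have hmκ : m * κ = π := by rw [hκ]; field_simp
    have hκπ : κ ≤ π := div_le_self Real.pi_pos.le (by exact_mod_cast hm0)
    set β := Complex.arg (p / ‖p‖ / F.N ^ m) with hβ
    have hpβ : turn (F.N ^ m) β = p / ‖p‖ := by
      have h1 : ‖p / ‖p‖ / F.N ^ m‖ = 1 := by
        rw [norm_div, norm_pow, F.norm_N, norm_div, norm_real, norm_norm, one_pow, div_one,
          div_self (norm_ne_zero_iff.2 hp0)]
      have h2 := Complex.norm_mul_exp_arg_mul_I (p / ‖p‖ / F.N ^ m)
      rw [h1, Complex.ofReal_one, one_mul] at h2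
      rw [turn, h2, mul_div_cancel₀ _ (pow_ne_zero _ F.N_ne_zero)]
    obtain ⟨α, hα1, hα2, hα⟩ : ∃ α : ℝ, π / 2 - κ < α ∧ α ≤ π / 2 + κ ∧
        turn F.N α ^ m = p / ‖p‖ := by
      have h2κ : 0 < 2 * κ := by positivity
      obtain ⟨h1, h2⟩ := toIocMod_mem_Ioc h2κ (π / 2 - κ) (β / m)
      refine ⟨toIocMod h2κ (π / 2 - κ) (β / m), h1, by linarith, ?_⟩
      rw [turn_pow, ← hpβ, toIocMod, turn, turn, Complex.exp_eq_exp_iff_exists_int.2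
        ⟨-toIocDiv h2κ (π / 2 - κ) (β / m), ?_⟩]
      have : (m : ℝ) * (β / m - toIocDiv h2κ (π / 2 - κ) (β / m) • (2 * κ))
          = β - toIocDiv h2κ (π / 2 - κ) (β / m) * (2 * π) := by
        rw [zsmul_eq_mul, ← hmκ]
        field_simp
      rw [this]
      push_cast
      ring
    set e := turn F.N α with he
    have he1 : ‖e‖ = 1 := (norm_turn _ _).trans F.norm_N
    set δ := κ / 4 with hδ
    have hmδ : m * δ = π / 4 := by rw [hδ, ← hmκ]; ring
    have hpow : ∀ t : ℕ, (turn e (t * δ)) ^ m = turn (p / ‖p‖) (t * (π / 4)) := fun t => by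
      rw [turn_pow, hα, ← hmδ]
      ring_nf
    have hre : ∀ t : ℕ, (p / turn e (t * δ) ^ m).re = ‖p‖ * cos (t * (π / 4)) := fun t => by
      rw [hpow, turn, show p / (p / ‖p‖ * exp ((t * (π / 4) : ℝ) * Complex.I))
        = ‖p‖ * (exp ((t * (π / 4) : ℝ) * Complex.I))⁻¹ by field_simp,
        ← Complex.exp_neg, ← neg_mul, ← Complex.ofReal_neg, Complex.re_ofReal_mul,
        exp_ofReal_mul_I_re, Real.cos_neg]
    have hcos : ∀ i s : ℕ, cos ((8 * i + s : ℕ) * (π / 4)) = cos (s * (π / 4)) := fun i s => by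
      rw [← Real.cos_add_nat_mul_two_pi (s * (π / 4)) i]
      push_cast
      ring_nf
    have hcos7 : cos ((7 : ℕ) * (π / 4)) = cos (π / 4) := by
      rw [← Real.cos_neg (π / 4), ← Real.cos_add_two_pi (-(π / 4))]
      push_cast
      ring_nf
    have hcos4 : cos ((4 : ℕ) * (π / 4)) = -1 := by
      rw [← Real.cos_pi]
      push_cast
      ring_nf
    have hp00 : 0 < ‖p‖ := norm_pos_iff.2 hp0
    have hcospos : 0 < ‖p‖ * cos (π / 4) := by
      rw [Real.cos_pi_div_four]
      positivity
    have hend : ∀ t : ℕ, 0 < cos (t * (π / 4)) → IsEndDirection A B b (turn e (t * δ)) :=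
      fun t ht => Or.inl ⟨hm, by
        rw [hm', Nat.add_sub_cancel, ← hp, hre]
        positivity⟩
    have hXe : ∀ s : ℕ, ((turn e ((4 * s : ℕ) * δ)) ^ m) ^ 2 = (p / ‖p‖) ^ 2 := fun s => by
      rw [hpow, turn, mul_pow, ← Complex.exp_nat_mul, Complex.exp_eq_one_iff.2 ⟨s, ?_⟩, mul_one]
      push_cast
      ring
    have hX : ∀ s : ℕ, F.X (turn e ((4 * s : ℕ) * δ)) ≠ 0 := fun s => by
      refine hgen _ ?_ (norm_ne_zero_iff.1 (by rw [norm_turn, he1]; exact one_ne_zero))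
      rw [hm', Nat.add_sub_cancel, mem_nthRoots (by omega), pow_mul', hXe, polarSign, hp]
    have hXe0 : F.X e ≠ 0 := by simpa using hX 0
    rw [hm']
    have hX4 : ∀ i : ℕ, F.X (turn e ((8 * i + 4 : ℕ) * δ)) ≠ 0 := fun i => by
      have := hX (2 * i + 1)
      rwa [show 4 * (2 * i + 1) = 8 * i + 4 by ring] at this
    refine exists_contourGroup_stems F hE hE' hw hM (hnorm he1) ?_ (δ := δ) (by positivity)
      (fun _ => by push_cast; linarith) (fun t => (turn_ofReal_mul _ e _).symm)
      (.mul ?_ hw4) (fun i hi => .mul ?_ hw4) (fun i hi => ⟨.mul ?_ hw4, .mul ?_ hw4⟩)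
      (fun i hi => ?_) (fun i hi => ?_)
    · rw [F.X_mul]
      exact mul_ne_zero hw4.ne' hXe0
    · simpa using hend 0 (by simp)
    · refine Or.inl ⟨hm, ?_⟩
      rw [hp', hm', Nat.add_sub_cancel, neg_div, Complex.neg_re, hre, hcos, hcos4]
      linarith
    · refine hend _ ?_
      rw [hcos, Nat.cast_one, one_mul, Real.cos_pi_div_four]
      positivity
    · refine hend _ ?_
      rw [hcos, hcos7, Real.cos_pi_div_four]
      positivity
    · rw [F.X_mul]
      exact mul_ne_zero hw4.ne' (hX4 i)
    · have hXi := hX4 i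
      set t := ((8 * i + 4 : ℕ) : ℝ) * δ with ht
      have ht1 : κ ≤ t := by
        rw [ht, hδ]
        push_cast
        nlinarith [(Nat.cast_nonneg i : (0 : ℝ) ≤ i)]
      have ht2 : t ≤ 2 * π - κ := by
        have h1 : (i + 1 : ℝ) ≤ m := by exact_mod_cast hi
        rw [ht, hδ, ← hmκ]
        push_cast
        nlinarith
      suffices F.X (turn e t) * F.X e < 0 ∨ F.X e * sin t < 0 by
        rw [← mul_one (sin t), ← one_pow 2, ← he1, mul_comm (sin t), ← sub_zero t,
          ← im_conj_turn_mul, turn_zero, sub_zero, F.im_conj_mul] at this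
        simp only [F.X_mul, F.Y_mul]
        refine this.imp (fun h => ?_) fun h => ?_
        · nlinarith [mul_neg_of_pos_of_neg (pow_pos hw4 2) h]
        · nlinarith [mul_neg_of_pos_of_neg (pow_pos hw4 3) h]
      rw [he, turn_turn, F.X_turn] at hXi
      rw [he, F.X_turn] at hXe0
      rw [he, turn_turn, F.X_turn, F.X_turn]
      rcases hXe0.lt_or_gt with h1 | h1
      · have h2 : π / 2 < α := by
          by_contra! h3
          exact h1.not_ge (Real.cos_nonneg_of_neg_pi_div_two_le_of_le (by linarith) h3)
        rcases lt_or_ge t π with h3 | h3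
        · exact Or.inr (mul_neg_of_neg_of_pos h1 (sin_pos_of_pos_of_lt_pi (by linarith) h3))
        · have h4 := Real.cos_nonneg_of_neg_pi_div_two_le_of_le (x := α + t - 2 * π)
            (by linarith) (by linarith)
          rw [Real.cos_sub_two_pi] at h4
          exact Or.inl (mul_neg_of_pos_of_neg (lt_of_le_of_ne h4 hXi.symm) h1)
      · have h2 : α < π / 2 := by
          by_contra! h3
          exact h1.not_ge (Real.cos_nonpos_of_pi_div_two_le_of_le h3 (by linarith))
        rcases le_or_gt t π with h3 | h3
        · exact Or.inl (mul_neg_of_neg_of_pos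
            (Real.cos_neg_of_pi_div_two_lt_of_lt (by linarith) (by linarith)) h1)
        · have h4 := sin_pos_of_pos_of_lt_pi (x := t - π) (by linarith) (by linarith)
          rw [Real.sin_sub_pi] at h4
          exact Or.inr (mul_neg_of_pos_of_neg h1 (by linarith))

lemma exists_generic_angle {ζ : ℂ} (hζ : ‖ζ‖ = 1) {δ : ℝ} (hδ : 0 < δ) (hδπ : δ ≤ π)
    (S : Finset ℂ) :
    ∃ θ ∈ Ioo 0 δ, ∀ c ∈ S, c ≠ 0 → (c * conj (turn ζ θ)).re ≠ 0 := by
  have h1 : ∀ c θ, (c * conj (turn ζ θ)).re = (c * conj ζ).re * cos θ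
      + (c * conj ζ).im * sin θ := fun c θ => by
    rw [turn, map_mul, ← mul_assoc, Complex.mul_re, Complex.conj_re, Complex.conj_im,
      exp_ofReal_mul_I_re, exp_ofReal_mul_I_im]
    ring
  have h2 : ∀ c : ℂ, c ≠ 0 → {θ ∈ Ioo 0 δ | (c * conj (turn ζ θ)).re = 0}.Subsingleton := by
    rintro c hc θ ⟨hθ, h3⟩ φ ⟨hφ, h4⟩
    wlog hle : θ ≤ φ generalizing θ φ
    · exact (this hφ h4 hθ h3 (le_of_not_ge hle)).symm
    by_contra hne
    have hlt := lt_of_le_of_ne hle hne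
    have hsin := sin_pos_of_pos_of_lt_pi (x := φ - θ) (by linarith) (by linarith [hφ.2, hθ.1])
    rw [h1] at h3 h4
    rw [Real.sin_sub] at hsin
    have h5 : (c * conj ζ).re * (sin φ * cos θ - cos φ * sin θ) = 0 := by
      linear_combination sin φ * h3 - sin θ * h4
    have h6 : (c * conj ζ).im * (sin φ * cos θ - cos φ * sin θ) = 0 := by
      linear_combination cos θ * h4 - cos φ * h3
    have h7 : c * conj ζ = 0 := Complex.ext
      ((mul_eq_zero.1 h5).resolve_right hsin.ne') ((mul_eq_zero.1 h6).resolve_right hsin.ne')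
    refine hc ((mul_eq_zero.1 h7).resolve_right fun h8 => ?_)
    rw [← RCLike.norm_conj ζ, h8, norm_zero] at hζ
    exact zero_ne_one hζ
  obtain ⟨θ, hθ, h3⟩ := (Set.Ioo_infinite hδ).exists_notMem_finite
    ((S.filter (· ≠ 0)).finite_toSet.biUnion fun c hc => (h2 c (Finset.mem_filter.1 hc).2).finite)
  refine ⟨θ, hθ, fun c hc hc0 h4 => h3 ?_⟩
  exact Set.mem_biUnion (Finset.mem_coe.2 (Finset.mem_filter.2 ⟨hc, hc0⟩)) ⟨hθ, h4⟩

/-- A frame adapted to the sectors at infinity, in general position with respect to the zeros of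
`B` and the steepest directions there. -/
lemma exists_frame {A B : ℂ[X]} (h : IsTypeBB A B) :
    ∃ (F : Frame) (ζ : ℂ) (r w : ℝ), ‖ζ‖ = 1 ∧ 0 < r ∧ 0 < w ∧
      A.leadingCoeff / B.leadingCoeff * ζ ^ (A.natDegree - B.natDegree + 1) = r ∧ F.em = ζ ∧
      F.ep = turn ζ (π / (A.natDegree - B.natDegree + 1 : ℕ)) ∧
      (∀ b ∈ B.roots.toFinset, |F.Y b| + 2 * w < F.M ∧
        (∀ b' ∈ B.roots.toFinset, b ≠ b' → 2 * w < |F.X b - F.X b'|) ∧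
        ∀ e ∈ nthRoots (2 * (B.rootMultiplicity b - 1)) (polarSign A B b), e ≠ 0 → F.X e ≠ 0) := by
  classical
  have hD2 : 2 ≤ A.natDegree - B.natDegree + 1 := by have := h.degree_lt; omega
  set D := A.natDegree - B.natDegree + 1 with hD
  have hA : A ≠ 0 := by
    rintro rfl
    have := h.degree_lt
    simp at this
  set a := A.leadingCoeff / B.leadingCoeff with ha
  have ha0 : a ≠ 0 := div_ne_zero (leadingCoeff_ne_zero.2 hA) (leadingCoeff_ne_zero.2 h.ne_zero)
  have han : 0 < ‖a‖ := norm_pos_iff.2 ha0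
  obtain ⟨ζ, hζ⟩ := IsAlgClosed.exists_pow_nat_eq ((‖a‖ : ℂ) / a) (show 0 < D by omega)
  have hζ1 : ‖ζ‖ = 1 := by
    have h1 := congrArg norm hζ
    rw [norm_pow, norm_div, norm_real, norm_norm, div_self han.ne'] at h1
    exact (pow_eq_one_iff_of_nonneg (norm_nonneg _) (by omega)).1 h1
  have hDR : (2 : ℝ) ≤ D := by exact_mod_cast hD2
  have hδ : 0 < π / D := div_pos pi_pos (by linarith)
  have hδ2 : π / D ≤ π / 2 := div_le_div_of_nonneg_left Real.pi_pos.le two_pos hDR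
  set R := B.roots.toFinset
  obtain ⟨θ, ⟨hθ0, hθδ⟩, hgen⟩ := exists_generic_angle hζ1 hδ (by linarith [pi_pos])
    (((R ×ˢ R).image fun q => q.1 - q.2) ∪
      R.biUnion fun b => (nthRoots (2 * (B.rootMultiplicity b - 1)) (polarSign A B b)).toFinset)
  set N := turn ζ θ with hN
  have hX : ∀ q ∈ (R ×ˢ R).filter (fun q => q.1 ≠ q.2), ∀ᶠ w in 𝓝[>] (0 : ℝ),
      2 * w < |((q.1 - q.2) * conj N).re| := fun q hq => by
    obtain ⟨h1, h2⟩ := Finset.mem_filter.1 hq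
    have h3 := abs_pos.2 (hgen (q.1 - q.2) (Finset.mem_union_left _
      (Finset.mem_image_of_mem (fun q : ℂ × ℂ => q.1 - q.2) h1)) (sub_ne_zero.2 h2))
    filter_upwards [Ioo_mem_nhdsGT (half_pos h3)] with w hw
    linarith [hw.2]
  obtain ⟨w, hw1, hw0⟩ := (((Filter.eventually_all_finset _).2 hX).and self_mem_nhdsWithin).exists
  have hturn : ∀ φ, turn ζ φ * conj N = exp ((φ - θ : ℝ) * I) :=
    fun φ => by rw [mul_comm, hN, conj_turn_mul, hζ1]; simp
  have hζN := hturn 0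
  rw [turn_zero] at hζN
  have hYsum : ∀ b ∈ R, |(b * conj N).im| ≤ ∑ b ∈ R, |(b * conj N).im| :=
    fun b hb => Finset.single_le_sum (f := fun b => |(b * conj N).im|) (fun _ _ => abs_nonneg _) hb
  have hw0' : 0 < w := hw0
  refine ⟨{
      N, em := ζ, ep := turn ζ (π / D), M := ∑ b ∈ R, |(b * conj N).im| + 2 * w + 1
      norm_N := (norm_turn _ _).trans hζ1
      M_pos := by positivity
      em_re := by
        rw [hζN, exp_ofReal_mul_I_re]
        exact Real.cos_pos_of_mem_Ioo ⟨by linarith, by linarith⟩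
      em_im := by
        rw [hζN, exp_ofReal_mul_I_im]
        exact Real.sin_neg_of_neg_of_neg_pi_lt (by linarith) (by linarith)
      ep_re := by
        rw [hturn, exp_ofReal_mul_I_re]
        exact Real.cos_pos_of_mem_Ioo ⟨by linarith, by linarith⟩
      ep_im := by
        rw [hturn, exp_ofReal_mul_I_im]
        exact sin_pos_of_pos_of_lt_pi (by linarith) (by linarith) },
    ζ, ‖a‖, w, hζ1, han, hw0, by rw [hζ, mul_div_cancel₀ _ ha0], rfl, rfl, fun b hb => ⟨?_, ?_, ?_⟩⟩
  · have := hYsum b hb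
    change |(b * conj N).im| + 2 * w < _
    linarith
  · intro b' hb' hne
    have h1 := hw1 (b, b') (Finset.mem_filter.2 ⟨Finset.mk_mem_product hb hb', hne⟩)
    rwa [sub_mul, Complex.sub_re] at h1
  · exact fun e he he0 => hgen e (Finset.mem_union_right _ (Finset.mem_biUnion.2
      ⟨b, hb, Multiset.mem_toFinset.2 he⟩)) he0

/-! ### The dual systems of contours -/

lemma PolyPath.Crossing.on {p q : PolyPath} {i k : ℕ} {s σ : ℝ} (h : p.Crossing q i k s σ) :
    p.On (1 + k + s) (q.v i) ∧ q.On (1 + i) (q.v i) :=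
  ⟨h.eq ▸ p.on_seg h.k_lt h.pos_s h.s_lt, q.on_vertex h.pos_i h.i_lt⟩

/-- The group `g` of contours and dual contours has a domain `I g`, and the cuts belong to these
domains. -/
structure IsCutSystem {G : Type*} (F : Frame) (I : G → Set ℝ) (K K' : G → Set ℂ) : Prop where
  disjoint : ∀ g g', g ≠ g' → ∀ x ∈ I g, x ∉ I g'
  cut : ∀ g, ∀ z ∈ K g, F.u z ∈ I g ∧ F.Y z ≤ F.M
  cut' : ∀ g, ∀ z ∈ K' g, F.u z ∈ I g ∧ -F.M ≤ F.Y z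
  ray : ∀ g, ∀ z z', z ∉ K g → F.u z = F.u z' → F.Y z ≤ F.Y z' → z' ∉ K g

section CutSystem

variable {G : Type*} {F : Frame} {I : G → Set ℝ} {K K' : G → Set ℂ}

lemma IsCutSystem.notMem (h : IsCutSystem F I K K') {g : G} {z : ℂ} (hz : F.u z ∈ I g)
    (hK : z ∉ K g) (g' : G) : z ∉ K g' := fun h' => by
  by_cases hg : g = g'
  · exact hK (hg ▸ h')
  · exact h.disjoint g g' hg _ hz (h.cut g' z h').1

lemma IsCutSystem.notMem' (h : IsCutSystem F I K K') {g : G} {z : ℂ} (hz : F.u z ∈ I g)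
    (hK : z ∉ K' g) (g' : G) : z ∉ K' g' := fun h' => by
  by_cases hg : g = g'
  · exact hK (hg ▸ h')
  · exact h.disjoint g g' hg _ hz (h.cut' g' z h').1

lemma IsCutSystem.isPreconnected (h : IsCutSystem F I K K') :
    IsPreconnected {z | ∀ g, z ∉ K g} := by
  refine isPreconnected_of_forall (F.pt 0 (F.M + 1)) fun z hz => ?_
  refine ⟨(fun t => F.pt (F.u z + F.shift t) t) '' Set.Ici (F.Y z) ∪ {z | F.M < F.Y z}, ?_, Or.inr
    (by simp), Or.inl ⟨F.Y z, Set.mem_Ici.2 le_rfl, F.ext (by simp [Frame.u]) (by simp)⟩, ?_⟩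
  · rintro _ (⟨t, ht, rfl⟩ | hz') g
    · exact h.ray g z _ (hz g) (F.u_pt_shift _ _).symm (by rwa [F.Y_pt])
    · exact fun h' => (h.cut g _ h').2.not_gt hz'
  · refine IsPreconnected.union (F.pt (F.u z + F.shift (max (F.Y z) (F.M + 1))) (max (F.Y z) (F.M + 1)))
      ⟨_, Set.mem_Ici.2 (le_max_left _ _), rfl⟩ ?_ (isPreconnected_Ici.image _ (F.continuous_pt.comp
        ((continuous_const.add F.continuous_shift).prodMk continuous_id)).continuousOn)
      (F.isPreconnected_lt_Y _)
    have := le_max_right (F.Y z) (F.M + 1)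
    simp only [Set.mem_ofPred_eq, F.Y_pt]
    linarith

/-- The dual contours belong to the component of the complement of the cuts that contains the
points below all cuts. -/
lemma IsCutSystem.mem_component (h : IsCutSystem F I K K') {z₀ : ℂ} (hz₀ : F.Y z₀ < -F.M)
    {A B : ℂ[X]} {b : ℂ} {m : ℕ} {g : G} {P Q : ℕ → PolyPath}
    (hG : ContourGroup F A B b m (I g) (K g) (K' g) P Q) {i : ℕ} (hi : i < m) {τ : ℝ}
    {x : ℂ} (hx : (Q i).On τ x) : x ∈ connectedComponentIn {z | ∀ g, z ∉ K' g} z₀ := by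
  obtain ⟨S, hS, hSK, ⟨τ', y, h1, hτ', rfl⟩, z, hz, hzM⟩ := hG.path i hi
  have hcont : ContinuousOn (Q i).pos ((Q i).dom) :=
    (Q i).continuousOn_pos.mono (Set.Ioo_subset_Ioo (Q i).start_nonneg (Q i).fin_le)
  have hT : IsPreconnected ((Q i).pos '' (Q i).dom ∪ S ∪ {z | F.Y z < -F.M}) :=
    IsPreconnected.union z (Or.inr hz) hzM
      (IsPreconnected.union _ ⟨τ', hτ', rfl⟩ h1 (isPreconnected_Ioo.image _ hcont) hS)
      (F.isPreconnected_Y_lt _)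
  refine hT.subset_connectedComponentIn (Or.inr hz₀) ?_ (Or.inl (Or.inl ⟨τ, hx⟩))
  rintro _ ((⟨τ, hτ, rfl⟩ | hz) | hz)
  · exact h.notMem' (hG.mem' i hi τ _ ⟨hτ, rfl⟩).1 (hG.mem' i hi τ _ ⟨hτ, rfl⟩).2
  · exact h.notMem' (hSK _ hz).1 (hSK _ hz).2
  · exact fun g h' => (h.cut' g _ h').2.not_gt hz

end CutSystem

lemma isResidueScalar_crossing {A B : ℂ[X]} (hB : B ≠ 0) {L L' : ℂ → ℂ → ℂ} {z : ℂ}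
    (h : ∀ b, B.eval b = 0 → exp (L' b z) = exp (L b z)) :
    ∃ u ∈ multiplierGroup A B,
      (u : ℂ) = exp (∑ b ∈ B.roots.toFinset, expo A B b * (L' b z - L b z)) :=
  exp_sum_mem_multiplierGroup hB fun b hb => exists_int_of_exp_eq (h b hb)

lemma exp_sum_eq_mul_multiplier {A B : ℂ[X]} (hB : B ≠ 0) {b : ℂ} (hb : B.eval b = 0) {f f' : ℂ → ℂ}
    (h : f' b = f b + 2 * π * Complex.I) (h' : ∀ c, B.eval c = 0 → c ≠ b → f' c = f c) :
    exp (∑ c ∈ B.roots.toFinset, expo A B c * f' c)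
      = exp (∑ c ∈ B.roots.toFinset, expo A B c * f c) * multiplier A B b := by
  have hmem : b ∈ B.roots.toFinset := by rwa [Multiset.mem_toFinset, mem_roots hB]
  have hs : ∑ c ∈ B.roots.toFinset.erase b, expo A B c * f' c
      = ∑ c ∈ B.roots.toFinset.erase b, expo A B c * f c := sum_congr rfl fun c hc => by
    rw [Finset.mem_erase, Multiset.mem_toFinset, mem_roots hB] at hc
    rw [h' c hc.2 hc.1]
  rw [multiplier, ← exp_add, ← Finset.add_sum_erase _ _ hmem, hs,
    ← Finset.add_sum_erase _ (fun c => expo A B c * f c) hmem, h, expo]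
  ring_nf

lemma exists_dual_contours {A B : ℂ[X]} (h : IsTypeBB A B) :
    ∃ (Y : ContourSystem (directNum A B) B A.natDegree) (Z : ContourSystem A B A.natDegree)
      (c : Fin A.natDegree → ℂ), IsConnected Y.branch.dom ∧ IsConnected Z.branch.dom ∧
      (∃ z ∈ Y.branch.dom ∩ Z.branch.dom, B.eval z * Y.branch.W z * Z.branch.W z = 1) ∧
      (∀ ν, c ν ≠ 0 ∧ IsResidueScalar A B (c ν)) ∧
      ∀ x : ℂ, concomitant A Y Z x = Matrix.diagonal c := by
  classical
  obtain ⟨F, ζ, r, w, hζ1, hr, hw, hζ, hem, hep, hgen⟩ := exists_frame h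
  obtain ⟨b₀, hb₀⟩ := Infinite.exists_notMem_finset B.roots.toFinset
  have hroot : ∀ {b}, b ∈ B.roots.toFinset ↔ B.eval b = 0 := fun {b} => by
    rw [Multiset.mem_toFinset, mem_roots h.ne_zero, IsRoot]
  have hE : IsDecayDirection (directNum A B) B F.em := by
    simpa [hem] using (isDecayDirection_turn h hr hζ 0).1 (by decide)
  have hE' : IsDecayDirection A B F.ep := by
    simpa [hep] using (isDecayDirection_turn h hr hζ 1).2 (by decide)
  choose c Pb Qb hcX hcY hGb using fun b : B.roots.toFinset =>
    exists_contourGroup_zero h F hE hE' (hroot.1 b.2) hw (hgen b b.2).1 (hgen b b.2).2.2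
  set R := ∑ b ∈ B.roots.toFinset, -|F.X b| - w with hR
  have hRle : ∀ b : B.roots.toFinset, R ≤ F.X b - w := fun b => by
    have h1 := Finset.single_le_sum (f := fun b => |F.X b|) (fun _ _ => abs_nonneg _) b.2
    have h2 := neg_abs_le (F.X b)
    rw [hR, Finset.sum_neg_distrib]
    linarith
  obtain ⟨P₀, Q₀, hG₀⟩ := exists_contourGroup_infinity h F hζ1 hr hζ hem hep R b₀
  set I : Option B.roots.toFinset → Set ℝ :=
    fun g => g.elim (Set.Iio R) fun b => Icc (F.X b - w) (F.X b + w) with hI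
  set K : Option B.roots.toFinset → Set ℂ := fun g => g.elim ∅ fun b => F.cut b with hK
  set K' : Option B.roots.toFinset → Set ℂ := fun g => g.elim ∅ fun b => F.dualCut b (c b) with hK'
  set pt : Option B.roots.toFinset → ℂ := fun g => g.elim b₀ fun b => b with hpt
  set m : Option B.roots.toFinset → ℕ :=
    fun g => g.elim (A.natDegree - B.natDegree) fun b => B.rootMultiplicity b.1 with hm
  have hG : ∀ g, ∃ P Q, ContourGroup F A B (pt g) (m g) (I g) (K g) (K' g) P Q := by
    rintro (_ | b)
    exacts [⟨P₀, Q₀, hG₀⟩, ⟨_, _, hGb b⟩]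
  choose P Q hG using hG
  have hbM : ∀ b : B.roots.toFinset, |F.Y b| < F.M := fun b => by linarith [(hgen b b.2).1]
  have hcM : ∀ b : B.roots.toFinset, |F.Y (b + c b)| < F.M := fun b => by
    rw [F.Y_add]
    exact (abs_add_le _ _).trans_lt (by linarith [(hgen b b.2).1, hcY b])
  have hsys : IsCutSystem F I K K' := by
    constructor
    · rintro (_ | b) (_ | b') hne x hx hx'
      · exact hne rfl
      · have h1 : x < R := hx
        have h2 : F.X b' - w ≤ x := hx'.1
        linarith [hRle b']
      · have h1 : x < R := hx'
        have h2 : F.X b - w ≤ x := hx.1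
        linarith [hRle b]
      · have h1 := (hgen b b.2).2.1 b' b'.2 fun h2 => hne (by rw [Subtype.ext h2])
        have h2 : F.X b - w ≤ x ∧ x ≤ F.X b + w := hx
        have h3 : F.X b' - w ≤ x ∧ x ≤ F.X b' + w := hx'
        exact h1.not_ge (abs_le.2 ⟨by linarith, by linarith⟩)
    · rintro (_ | b) z hz
      · exact absurd hz (Set.notMem_empty _)
      · have h1 := abs_lt.1 (hbM b)
        have h2 : F.u z = F.X b ∧ F.Y z ≤ F.Y b := hz
        rw [h2.1]
        exact ⟨⟨by linarith, by linarith⟩, by linarith⟩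
    · rintro (_ | b) z hz
      · exact absurd hz (Set.notMem_empty _)
      · have h1 := abs_lt.1 (hbM b)
        have h3 := abs_lt.1 (hcM b)
        have h4 := abs_le.1 (hcX b)
        rw [F.Y_add] at h3
        obtain ⟨s, hs0, hs1, h5, h6, -⟩ := F.dualCut_cases (hbM b) (hcM b) hz
        rw [h5]
        refine ⟨⟨?_, ?_⟩, ?_⟩ <;> nlinarith
    · rintro (_ | b) z z' hz h1 h2 h3
      · exact h3
      · exact hz ⟨h1.trans h3.1, h2.trans h3.2⟩
  -- the base point
  set z₀ := F.pt (R - 1 + F.shift (-F.M - 1)) (-F.M - 1) with hz₀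
  have hz₀Y : F.Y z₀ < -F.M := by rw [hz₀, F.Y_pt]; linarith
  have hz₀I : F.u z₀ ∈ I none := by
    rw [hz₀, F.u_pt_shift]
    exact sub_one_lt R
  have hz₀K : ∀ g, z₀ ∉ K g := hsys.notMem hz₀I (Set.notMem_empty _)
  have hz₀K' : ∀ g, z₀ ∉ K' g := hsys.notMem' hz₀I (Set.notMem_empty _)
  -- the logarithms and the branches
  have hlog : ∀ b : ℂ, ∃ L L' : ℂ → ℂ, ∀ hb : b ∈ B.roots.toFinset, IsLogOn L b (K (some ⟨b, hb⟩))ᶜ ∧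
      IsLogOn L' b (K' (some ⟨b, hb⟩))ᶜ ∧ L z₀ = L' z₀ := fun b => by
    by_cases hb : b ∈ B.roots.toFinset
    · have hz : z₀ - b ≠ 0 := sub_ne_zero.2 fun h0 => hz₀K (some ⟨b, hb⟩) ⟨by
          have h1 := abs_lt.1 (hbM ⟨b, hb⟩)
          rw [h0, F.u_eq_X h1.1.le h1.2.le], by rw [h0]⟩
      obtain ⟨L, hL, hL0⟩ := exists_log_cut b b (F.pt (F.X b) (-F.M)) F.em_ne_zero
        (fun h' => hz₀K (some ⟨b, hb⟩) (F.cutSet_subset_cut (hbM ⟨b, hb⟩) h')) (exp_log hz)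
      obtain ⟨L', hL', hL0'⟩ := exists_log_cut b (b + c ⟨b, hb⟩) (F.pt (F.X (b + c ⟨b, hb⟩)) F.M)
        F.ep_ne_zero (hz₀K' (some ⟨b, hb⟩)) (exp_log hz)
      exact ⟨L, L', fun _ => ⟨hL.mono (Set.compl_subset_compl.2 (F.cutSet_subset_cut (hbM ⟨b, hb⟩))),
        hL', hL0.trans hL0'.symm⟩⟩
    · exact ⟨0, 0, fun h' => absurd h' hb⟩
  choose L L' hL using hlog
  set U := {z | ∀ g, z ∉ K g} with hU
  set V := connectedComponentIn {z | ∀ g, z ∉ K' g} z₀ with hV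
  have hUo : IsOpen U := by
    have : U = ⋂ g, (K g)ᶜ := by ext; simp [hU]
    rw [this]
    refine isOpen_iInter_of_finite fun g => ?_
    rcases g with _ | b
    · exact isOpen_compl_iff.2 isClosed_empty
    · exact isOpen_compl_iff.2 (F.isClosed_cut b)
  have hVo : IsOpen V := by
    refine IsOpen.connectedComponentIn ?_
    have : {z | ∀ g, z ∉ K' g} = ⋂ g, (K' g)ᶜ := by ext; simp
    rw [this]
    refine isOpen_iInter_of_finite fun g => ?_
    rcases g with _ | b
    · exact isOpen_compl_iff.2 isClosed_empty
    · exact isOpen_compl_iff.2 (isClosed_cutSet _ _ _ F.ep_ne_zero)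
  have hVs : ∀ z ∈ V, ∀ g, z ∉ K' g := connectedComponentIn_subset _ _
  obtain ⟨W, W', hWU, hWV, hprod⟩ := exists_branches (A := A) h.ne_zero hUo hVo (L := L) (L' := L')
    (fun b hb => (hL b (hroot.2 hb)).1.mono fun z hz => hz _)
    (fun b hb => (hL b (hroot.2 hb)).2.1.mono fun z hz => hVs z hz _)
  have hPU : ∀ g, ∀ i < m g, ∀ τ z, (P g i).On τ z → z ∈ W.dom := fun g i hi τ z hz => by
    rw [hWU]
    exact hsys.notMem ((hG g).mem i hi τ z hz).1 ((hG g).mem i hi τ z hz).2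
  have hQV : ∀ g, ∀ i < m g, ∀ τ z, (Q g i).On τ z → z ∈ W'.dom := fun g i hi τ z hz => by
    rw [hWV]
    exact hsys.mem_component hz₀Y (hG g) hi hz
  have hpos : ∀ g, ∀ i < m g, ∀ {j k : ℕ} {s σ : ℝ}, (P g i).Crossing (Q g i) j k s σ →
      (Q g i).v j ∈ U ∩ V ∧ F.u ((Q g i).v j) ∈ I g := fun g i hi j k s σ hc => by
    rw [← hWU, ← hWV]
    exact ⟨⟨hPU g i hi _ _ hc.on.1, hQV g i hi _ _ hc.on.2⟩, ((hG g).mem' i hi _ _ hc.on.2).1⟩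
  have hexp : ∀ z ∈ U ∩ V, ∀ b, B.eval b = 0 → exp (L' b z) = exp (L b z) := fun z hz b hb => by
      rw [((hL b (hroot.2 hb)).1 z (hz.1 _)).1, ((hL b (hroot.2 hb)).2.1 z (hVs z hz.2 _)).1]
  have hdiag : ∀ g, ∀ i, ∀ hi : i < m g, ∃ c : ℂ, c ≠ 0 ∧ IsResidueScalar A B c ∧
      (2 * π * Complex.I)⁻¹ * (((P g i).toContour ((hG g).adm i hi)
        (hPU g i hi)).double ((Q g i).toContour ((hG g).adm' i hi) (hQV g i hi)) 0 (kernel A B 0)) = c := fun g i hi => by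
    rcases (hG g).crossing i hi with ⟨j, k, s, σ, hσ, hc, hX⟩ |
        ⟨hb, hmul, ⟨S, hS, hSI, hS1, hS5⟩, hrel, s, t, hc1, hc5, hX⟩
    · obtain ⟨u, hu, h1⟩ := isResidueScalar_crossing (A := A) h.ne_zero (hexp _ (hpos g i hi hc).1)
      refine ⟨-(σ * u), ?_, ?_, ?_⟩
      · rcases hσ with rfl | rfl <;> simp
      · rcases hσ with rfl | rfl
        · exact ⟨-u, neg_mem_multiplierGroup hu, Or.inl (by simp)⟩
        · exact ⟨u, hu, Or.inl (by simp)⟩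
      · rw [PolyPath.double_eq_sum_crossings h ((hG g).adm i hi) (hPU g i hi) ((hG g).adm' i hi)
          (hQV g i hi) {j} (fun _ => σ) (fun _ => s) (fun _ => k)
          (fun j' hj' => by rwa [Finset.mem_singleton.1 hj'])
          (fun τ τ' z h2 h3 => ⟨j, Finset.mem_singleton_self _, hX τ τ' z h2 h3⟩),
          Finset.sum_singleton, hprod _ (hpos g i hi hc).1, h1]
    · obtain ⟨b, rfl⟩ : ∃ b, g = some b := by
        rcases g with _ | b
        · exact absurd (hroot.2 hb) hb₀
        · exact ⟨b, rfl⟩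
      have h1V := hpos _ i hi hc1
      have h5V := hpos _ i hi hc5
      obtain ⟨u, hu, h1⟩ := isResidueScalar_crossing (A := A) h.ne_zero (hexp _ h1V.1)
      have h5 := exp_sum_eq_mul_multiplier (A := A) h.ne_zero hb
        (f := fun c => L' c ((Q (some b) i).v 1) - L c ((Q (some b) i).v 1))
        (f' := fun c => L' c ((Q (some b) i).v 5) - L c ((Q (some b) i).v 5))
        (hrel _ _ (hL b b.2).1 (hL b b.2).2.1) fun c hc hcb => by
          have hL1 := fun z hz => (hL c (hroot.2 hc)).1 z fun h' =>
            hsys.disjoint (some b) (some ⟨c, hroot.2 hc⟩) (fun h' => hcb (by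
              rw [Option.some.inj h']; rfl)) _ (hSI z hz) (hsys.cut _ z h').1
          have hL2 := fun z hz => (hL c (hroot.2 hc)).2.1 z fun h' =>
            hsys.disjoint (some b) (some ⟨c, hroot.2 hc⟩) (fun h' => hcb (by
              rw [Option.some.inj h']; rfl)) _ (hSI z hz) (hsys.cut' _ z h').1
          exact IsPreconnected.sub_eq_sub (c := 1) hS
            (fun z hz => (hL2 z hz).2.continuousAt.continuousWithinAt)
            (fun z hz => (hL1 z hz).2.continuousAt.continuousWithinAt)
            (fun z hz => by rw [(hL2 z hz).1, (hL1 z hz).1, one_mul]) hS5 hS1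
      refine ⟨u * (1 - multiplier A B b), mul_ne_zero u.ne_zero (sub_ne_zero.2 (Ne.symm hmul)),
        ⟨u, hu, Or.inr ⟨b, hb, hmul, rfl⟩⟩, ?_⟩
      rw [PolyPath.double_eq_sum_crossings h ((hG _).adm i hi) (hPU _ i hi) ((hG _).adm' i hi)
        (hQV _ i hi) {1, 5}
        (fun j => if j = 1 then -1 else 1) (fun j => if j = 1 then s else t) (fun _ => 1)
        (fun j' hj' => ?_) (fun τ τ' z h2 h3 => ?_), Finset.sum_pair (by norm_num),
        hprod _ h1V.1, hprod _ h5V.1, h5, h1]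
      · change _ = _ * (1 - multiplier A B (pt (some b)))
        norm_num
        ring
      · rcases Finset.mem_insert.1 hj' with rfl | hj'
        · simpa using hc1
        · rw [Finset.mem_singleton.1 hj']
          simpa using hc5
      · rcases hX τ τ' z h2 h3 with ⟨h3, h4⟩ | ⟨h3, h4⟩
        · exact ⟨1, by simp, by rw [h3]; norm_num, by rw [h4]; norm_num⟩
        · exact ⟨5, by simp, by rw [h3]; norm_num, by rw [h4]; norm_num⟩
  choose! d hd0 hdR hd using hdiag
  have hcard : Fintype.card (Σ g, Fin (m g)) = A.natDegree := by
    have h1 : ∑ b : B.roots.toFinset, B.rootMultiplicity b.1 = B.natDegree := by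
      rw [Finset.sum_coe_sort B.roots.toFinset fun b => B.rootMultiplicity b,
        ← IsAlgClosed.card_roots_eq_natDegree, ← Multiset.toFinset_sum_count_eq]
      simp
    rw [Fintype.card_sigma, Fintype.sum_option]
    simp only [Fintype.card_fin, hm, Option.elim]
    rw [h1]
    have := h.degree_lt
    omega
  set e := (Fintype.equivFinOfCardEq hcard).symm
  refine ⟨⟨W, fun ν => (P (e ν).1 (e ν).2).toContour ((hG _).adm _ (e ν).2.2) (hPU _ _ (e ν).2.2)⟩,
    ⟨W', fun ν => (Q (e ν).1 (e ν).2).toContour ((hG _).adm' _ (e ν).2.2) (hQV _ _ (e ν).2.2)⟩,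
    fun ν => d (e ν).1 (e ν).2, ?_, ?_, ?_,
    fun ν => ⟨hd0 _ _ (e ν).2.2, hdR _ _ (e ν).2.2⟩, fun x => ?_⟩
  · change IsConnected W.dom
    rw [hWU]
    exact ⟨⟨z₀, hz₀K⟩, hsys.isPreconnected⟩
  · change IsConnected W'.dom
    rw [hWV]
    exact isConnected_connectedComponentIn_iff.2 hz₀K'
  · refine ⟨z₀, ?_, ?_⟩
    · change z₀ ∈ W.dom ∩ W'.dom
      rw [hWU, hWV]
      exact ⟨hz₀K, mem_connectedComponentIn hz₀K'⟩
    · change B.eval z₀ * W.W z₀ * W'.W z₀ = 1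
      rw [hprod z₀ ⟨hz₀K, mem_connectedComponentIn hz₀K'⟩, sum_eq_zero, Complex.exp_zero]
      intro b hb
      rw [(hL b hb).2.2, sub_self, mul_zero]
  · rw [concomitant_const h _ _ x 0]
    ext ν μ
    by_cases hνμ : ν = μ
    · subst hνμ
      rw [Matrix.diagonal_apply_eq]
      exact hd _ _ (e ν).2.2
    · rw [Matrix.diagonal_apply_ne _ hνμ]
      refine (PolyPath.double_eq_sum_crossings h ((hG _).adm _ (e ν).2.2) (hPU _ _ (e ν).2.2)
        ((hG _).adm' _ (e μ).2.2) (hQV _ _ (e μ).2.2) ∅ 0 0 0 (by simp)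
        (fun τ τ' z hτ hτ' => ?_)).trans (by simp)
      exfalso
      by_cases hg : (e ν).1 = (e μ).1
      · have hne : e ν ≠ e μ := fun h' => hνμ (e.injective h')
        revert hne hg hτ hτ'
        rcases e ν with ⟨g, i, hi⟩
        rcases e μ with ⟨g', j, hj⟩
        intro hτ hτ' hg hne
        obtain rfl : g = g' := hg
        exact (hG g).disjoint i hi j hj (fun h' => hne (by subst h'; rfl)) τ τ' z hτ hτ'
      · exact hsys.disjoint _ _ hg _ ((hG _).mem _ (e ν).2.2 τ z hτ).1
          ((hG _).mem' _ (e μ).2.2 τ' z hτ').1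


end SemiclassicalBOP

end

theorem theorem5p1 (A₂ B₂ : ℂ[X]) (h₂ : IsTypeBB A₂ B₂) :
    -- the pairing, for arbitrary admissible contours and dual contours
    (∀ (A₁ B₁ : ℂ[X]), IsTypeBB A₁ B₁ →
      ∀ (X : ContourSystem (directNum A₁ B₁) B₁ A₁.natDegree)
        (Y : ContourSystem (directNum A₂ B₂) B₂ A₂.natDegree)
        (Z : ContourSystem A₂ B₂ A₂.natDegree)
        (κ : Matrix (Fin A₁.natDegree) (Fin A₂.natDegree) ℂ),
      (A₁.natDegree = B₁.natDegree + 1 → A₂.natDegree = B₂.natDegree + 1 →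
        BimomentsConverge X Y κ) →
      IsGeneric (functional X Y κ) B₂ →
      (∀ x x' : ℂ, concomitant A₂ Y Z x = concomitant A₂ Y Z x') ∧
      (∃ p s : ℕ → ℂ[X], IsBiorthonormal (functional X Y κ) p s) ∧
      ∀ p s : ℕ → ℂ[X], IsBiorthonormal (functional X Y κ) p s →
        (∃! Lh : ℕ → ℕ → ℂ, IsHatL B₂ s Lh) ∧
        ∀ Lh : ℕ → ℕ → ℂ, IsHatL B₂ s Lh →
          (∃! Ah : ℕ → ℕ → ℂ, IsHatA A₂ B₂ s Lh Ah) ∧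
          ∀ Ah : ℕ → ℕ → ℂ, IsHatA A₂ B₂ s Lh Ah →
            ∀ n : ℕ, A₂.natDegree ≤ n → ∀ x ∈ regularPoints X,
              dualSystem X Y κ s n x * cdMatrix A₂.natDegree Lh Ah n x *
                  directSystem A₂ X Y Z κ Lh p n x
                = Matrix.fromBlocks (-1) 0 0 (concomitant A₂ Y Z x)) ∧
    -- suitable contours, for which the rescaled pairing is trivial
    (∃ (Y' : ContourSystem (directNum A₂ B₂) B₂ A₂.natDegree)
        (Z' : ContourSystem A₂ B₂ A₂.natDegree) (c : Fin A₂.natDegree → ℂ),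
      IsConnected Y'.branch.dom ∧ IsConnected Z'.branch.dom ∧
      (∃ z ∈ Y'.branch.dom ∩ Z'.branch.dom, B₂.eval z * Y'.branch.W z * Z'.branch.W z = 1) ∧
      (∀ ν, c ν ≠ 0 ∧ IsResidueScalar A₂ B₂ (c ν)) ∧
      (∀ x : ℂ, concomitant A₂ Y' Z' x = Matrix.diagonal c) ∧
      ∀ (A₁ B₁ : ℂ[X]), IsTypeBB A₁ B₁ →
        ∀ (X : ContourSystem (directNum A₁ B₁) B₁ A₁.natDegree)
          (Y : ContourSystem (directNum A₂ B₂) B₂ A₂.natDegree)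
          (κ : Matrix (Fin A₁.natDegree) (Fin A₂.natDegree) ℂ),
        (A₁.natDegree = B₁.natDegree + 1 → A₂.natDegree = B₂.natDegree + 1 →
          BimomentsConverge X Y κ) →
        IsGeneric (functional X Y κ) B₂ →
        ∃ κ' : Matrix (Fin A₁.natDegree) (Fin A₂.natDegree) ℂ,
          (∀ (μ : Fin A₁.natDegree) (q : ℂ[X]) (ξ : ℂ),
            innerIntegral Y' κ' μ (fun y => q.eval y) ξ
              = innerIntegral Y κ μ (fun y => q.eval y) ξ) ∧
          ∀ p s : ℕ → ℂ[X], IsBiorthonormal (functional X Y κ) p s →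
            ∀ Lh Ah : ℕ → ℕ → ℂ, IsHatL B₂ s Lh → IsHatA A₂ B₂ s Lh Ah →
              ∀ n : ℕ, A₂.natDegree ≤ n → ∀ x ∈ regularPoints X,
                dualSystem X Y' κ' s n x * cdMatrix A₂.natDegree Lh Ah n x *
                    (directSystem A₂ X Y' Z' κ' Lh p n x * rescaling c)
                  = Matrix.fromBlocks (-1) 0 0 1) := by
  refine ⟨fun A₁ B₁ h₁ X Y Z κ hconv hgen => ?_, ?_⟩
  · have hc := bimomentsConverge h₁ h₂ X Y κ hconv
    have hfun : functional X Y κ = fun p q => bilinearFunctional Y h₂ κ hc p q := rfl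
    refine ⟨concomitant_const h₂ Y Z, ?_, fun p s h => ?_⟩
    · exact exists_isBiorthonormal (ℓ := bilinearFunctional Y h₂ κ hc) hgen.1
    · have h' : IsBiorthonormal (fun p q => bilinearFunctional Y h₂ κ hc p q) p s := h
      exact ⟨h'.existsUnique_isHatL h₂.ne_zero hgen.2, fun Lh hL =>
        ⟨h'.existsUnique_isHatA h₂.ne_zero h₂.degree_lt hL,
          fun Ah hA n hn x hx => pairing_eq h₂ X Y Z κ hc h hL hA hn hx⟩⟩
  · obtain ⟨Y', Z', c, hY, hZ, hz, hc, hdiag⟩ := exists_dual_contours h₂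
    exact ⟨Y', Z', c, hY, hZ, hz, hc, hdiag, fun A₁ B₁ h₁ X Y κ hconv _ =>
      rescaled_pairing h₁ h₂ Y' Z' (fun ν => (hc ν).1) hdiag X Y κ hconv⟩
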